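/- **Theorem.** Let $k_0>0$, let $\omega_0\in\mathbb R$ satisfy $\omega_0^2=k_0^2+1$, put $c_g=k_0/\omega_0$, and fix $s>1/2$ and $T_0>0$. Let $H^s=H^s(\mathbb R)$ have the norm $\|w\|_{H^s}=(\int(1+k^2)^s|\widehat w(k)|^2\,dk)^{1/2}$, and let $H^s_{per}$ be the space of $2\pi/k_0$-periodic functions $v(x)=\frac{k_0}{2\pi}\sum_{k\in\mathbb Z}\widehat v_k e^{ikk_0x}$ with the norm $\|v\|_{H^s_{per}}=(\sum_{k}(1+k^2)^s|\widehat v_k|^2)^{1/2}$. (a) Let $(A_v,A_w)\in C([0,T_0],\mathbb C\times H^{s+4}(\mathbb R))$ be such that $A(X,T)=A_v(T)+A_w(X,T)$ is a solution of the NLS equation $$2i\omega_0\,\partial_T A=(c_g^2-1)\,\partial_X^2A-3A|A|^2 .$$ For $q\in\{v,w\}$ put $$\varepsilon\Psi_q(x,t)=\varepsilon A_q(\varepsilon(x-c_gt),\varepsilon^2t)\,e^{i(k_0x-\omega_0t)}+\text{c.c.}$$ ($A_v$ does not depend on its first argument). Then there exist $\varepsilon_0>0$ and $C>0$ such that for all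 $\varepsilon\in(0,\varepsilon_0)$ there are real-valued $(v,w)\in C([0,T_0/\varepsilon^2],H^s_{per}\times H^s(\mathbb R))$ which solve, in the sense of distributions in $x$, $$\partial_t^2v=\partial_x^2v-v+v^3,\qquad \partial_t^2w=\partial_x^2w-w+3v^2w+3vw^2+w^3,$$ so that $u=v+w$ solves the cubic Klein–Gordon equation $\partial_t^2u=\partial_x^2u-u+u^3$, and which satisfy $$\sup_{t\in[0,T_0/\varepsilon^2]}\big(\|v(\cdot,t)-\varepsilon\Psi_v(\cdot,t)\|_{H^s_{per}}+\|w(\cdot,t)-\varepsilon\Psi_w(\cdot,t)\|_{H^s}\big)\le C\varepsilon^{3/2}.$$ (b) Part (a) applies to the following solutions. Let $\psi(\xi,\tau)$ be a solution of the normalized equation $i\partial_\tau\psi+\frac12\partial_\xi^2\psi+|\psi|^2\psi=0$ with spatially constant background $b(\tau)$. For all $\beta>0$ and $\tau_0\in\mathbb R$ put $$A_v(T)=\sqrt{\tfrac23}\,\tfrac{\beta}{|\omega_0|}\,b(\tau),\quad A_w(X,T)=\sqrt{\tfrac23}\,\tfrac{\beta}{|\omega_0|}\,\big(\psi(\beta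 X,\tau)-b(\tau)\big),\quad \tau=\tau_0+\tfrac{\beta^2}{\omega_0^3}T .$$ Then $(A_v,A_w)$ satisfies the hypotheses of (a) when $\psi$ is one of the following: 1. the Peregrine solution $\psi=\big(1-\frac{4(1+2i\tau)}{1+4\xi^2+4\tau^2}\big)e^{i\tau}$, with $b=e^{i\tau}$; 2. a Kuznetsov–Ma soliton $\psi=e^{i\tau}\Big(1+\frac{2(1-2a)\cosh(R\tau)+iR\sinh(R\tau)}{\sqrt{2a}\cos(\Omega\xi)-\cosh(R\tau)}\Big)$ with $a>1/2$, $R=i\sqrt{8a(2a-1)}$, $\Omega=2i\sqrt{2a-1}$, and $b=e^{i\tau}$; 3. a higher-order Peregrine solution, i.e. a solution of the normalized equation of the form $\psi=e^{i\tau}\big((-1)^j+\frac{G+iH}{D}\big)$, $j\in\mathbb N_0$, with $b=(-1)^je^{i\tau}$, where $G,H$ are complex polynomials and $D$ is a real polynomial in $(\xi,\tau)$, positive on $\mathbb R^2$, such that the degree of $D(\cdot,\tau)$ in $\xi$ is the same for all $\tau\in\mathbb R$ and larger than the degrees of $G$ and $H$ in $\xi$. -/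

import Mathlib

open MeasureTheory Filter Topology Set
open scoped ENNReal FourierTransform ContDiff

noncomputable section

/-! ### Function spaces -/

/-- The norm of `H^s(ℝ)`, `s ≥ 0`, with values in `[0, ∞]`:
`‖f‖ = (∫ (1 + k²)^s |f̂(k)|² dk)^(1/2)`, where `f̂` is the unitary Fourier transform of `f ∈ L²`;
the value is `∞` if `f ∉ L²`. Mathlib's Fourier transform uses the frequency `ξ = k / (2π)`.
A function belongs to `H^s(ℝ)` if and only if this norm is finite. -/
def hsNorm (s : ℝ) (f : ℝ → ℂ) : ℝ≥0∞ :=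
  open scoped Classical in
  if h : MemLp f 2 volume then
    eLpNorm (fun ξ : ℝ =>
      (((1 + (2 * Real.pi * ξ) ^ 2) ^ (s / 2) : ℝ) : ℂ) * (𝓕 (h.toLp f) : Lp ℂ 2 volume) ξ)
      2 volume
  else ⊤

/-- The coefficient `v̂ₖ = ∫_0^{2π/k₀} v(x) e^{-i k k₀ x} dx`, for which
`v(x) = (k₀ / 2π) ∑ₖ v̂ₖ e^{i k k₀ x}`. -/
def perCoeff (k₀ : ℝ) (v : ℝ → ℂ) (k : ℤ) : ℂ :=
  ∫ x in Ioc 0 (2 * Real.pi / k₀), v x * Complex.exp (-(Complex.I * k * k₀ * x))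

/-- The norm of `H^s_per` (period `2π/k₀`, `s ≥ 0`), with values in `[0, ∞]`:
`‖v‖ = (∑ₖ (1 + k²)^s |v̂ₖ|²)^(1/2)`; the value is `∞` if `v` is not `2π/k₀`-periodic
or not square integrable over a period. -/
def hsPerNorm (k₀ s : ℝ) (v : ℝ → ℂ) : ℝ≥0∞ :=
  open scoped Classical in
  if Function.Periodic v (2 * Real.pi / k₀) ∧
      MemLp v 2 (volume.restrict (Ioc 0 (2 * Real.pi / k₀))) then
    (∑' k : ℤ, ENNReal.ofReal ((1 + (k : ℝ) ^ 2) ^ s) * ‖perCoeff k₀ v k‖ₑ ^ 2) ^ (1 / 2 : ℝ)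
  else ⊤

/-- `f ∈ C([0, T], H)` for the space `H = {g : N g < ∞}` with the norm `N`; here `f t` is the
function `f(·, t)`. -/
def ContinuousCurve (N : (ℝ → ℂ) → ℝ≥0∞) (T : ℝ) (f : ℝ → ℝ → ℂ) : Prop :=
  (∀ t ∈ Icc 0 T, N (f t) < ⊤) ∧
    ∀ t₀ ∈ Icc 0 T, Tendsto (fun t => N (fun x => f t x - f t₀ x)) (𝓝[Icc 0 T] t₀) (𝓝 0)

/-! ### The nonlinear Schrödinger equation -/

/-- `A = A(T, X)` is a classical solution of `i ν₀ ∂_T A = ν₁ ∂_X² A + ν₂ A |A|²` for times `T` in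
the set `S`: it is `C²` in `X`, and the equation holds at every point (with one-sided time
derivatives at the end points of an interval `S`). -/
def SolvesNLS (ν₀ ν₁ ν₂ : ℝ) (S : Set ℝ) (A : ℝ → ℝ → ℂ) : Prop :=
  ∀ T ∈ S, ContDiff ℝ 2 (A T) ∧ ∀ X : ℝ, ∃ A' : ℂ,
    HasDerivWithinAt (fun τ => A τ X) A' S T ∧
      Complex.I * ν₀ * A' =
        ν₁ * iteratedDeriv 2 (A T) X + ν₂ * (A T X * ((‖A T X‖ ^ 2 : ℝ) : ℂ))

/-- `(A_v, A_w) ∈ C([0, T₀], ℂ × H^r(ℝ))`, and `A = A_v + A_w` solves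
`2 i ω₀ ∂_T A = (c_g² - 1) ∂_X² A - 3 A |A|²` on `[0, T₀]`, with `c_g = k₀ / ω₀`. -/
structure IsSplitNLSSolution (k₀ ω₀ r T₀ : ℝ) (Av : ℝ → ℂ) (Aw : ℝ → ℝ → ℂ) : Prop where
  continuousOn_v : ContinuousOn Av (Icc 0 T₀)
  continuous_w : ContinuousCurve (hsNorm r) T₀ Aw
  solves : SolvesNLS (2 * ω₀) ((k₀ / ω₀) ^ 2 - 1) (-3) (Icc 0 T₀) (fun T X => Av T + Aw T X)

/-- The NLS ansatz `ε A(ε (x - c_g t), ε² t) e^{i (k₀ x - ω₀ t)} + c.c.`, with `c_g = k₀ / ω₀`,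
as a function of `t` and `x`. -/
def nlsAnsatz (k₀ ω₀ ε : ℝ) (A : ℝ → ℝ → ℂ) (t x : ℝ) : ℝ :=
  2 * (ε * A (ε ^ 2 * t) (ε * (x - k₀ / ω₀ * t)) *
    Complex.exp (Complex.I * (k₀ * x - ω₀ * t))).re

/-! ### The cubic Klein-Gordon equation -/

/-- `∂_t² q = ∂_x² q + f` on `[0, T]`, in the sense of distributions in `x`: for every test
function `φ ∈ C_c^∞(ℝ)`, the function `t ↦ ∫ q(x,t) φ(x) dx` is twice differentiable on `[0, T]`
(one-sided at the end points) with second derivative `∫ (q φ'' + f φ) dx`. -/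
def SolvesWave (T : ℝ) (q f : ℝ → ℝ → ℝ) : Prop :=
  ∀ φ : ℝ → ℝ, ContDiff ℝ ∞ φ → HasCompactSupport φ → ∃ p : ℝ → ℝ, ∀ t ∈ Icc 0 T,
    HasDerivWithinAt (fun τ => ∫ x, q τ x * φ x) (p t) (Icc 0 T) t ∧
    HasDerivWithinAt p (∫ x, (q t x * iteratedDeriv 2 φ x + f t x * φ x)) (Icc 0 T) t

/-- `(v, w)` solves the split Klein-Gordon system: `∂_t² v = ∂_x² v - v + v³` and
`∂_t² w = ∂_x² w - w + 3 v² w + 3 v w² + w³`, and `u = v + w` solves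
`∂_t² u = ∂_x² u - u + u³`. -/
structure SolvesSplitKG (T : ℝ) (v w : ℝ → ℝ → ℝ) : Prop where
  solves_v : SolvesWave T v (fun t x => -v t x + v t x ^ 3)
  solves_w : SolvesWave T w (fun t x =>
    -w t x + 3 * v t x ^ 2 * w t x + 3 * v t x * w t x ^ 2 + w t x ^ 3)
  solves_u : SolvesWave T (fun t x => v t x + w t x)
    (fun t x => -(v t x + w t x) + (v t x + w t x) ^ 3)

/-- Validity of the split NLS approximation: there are `ε₀, C > 0` such that for all
`ε ∈ (0, ε₀)` there is a solution `(v, w) ∈ C([0, T₀/ε²], H^s_per × H^s(ℝ))` of the Klein-Gordon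
equation whose distance to `(ε Ψ_v, ε Ψ_w)` is at most `C ε^(3/2)` on `[0, T₀/ε²]`. -/
def NLSApproximationValid (k₀ ω₀ s T₀ : ℝ) (Av : ℝ → ℂ) (Aw : ℝ → ℝ → ℂ) : Prop :=
  ∃ ε₀ > (0 : ℝ), ∃ C > (0 : ℝ), ∀ ε ∈ Ioo 0 ε₀, ∃ v w : ℝ → ℝ → ℝ,
    ContinuousCurve (hsPerNorm k₀ s) (T₀ / ε ^ 2) (fun t x => (v t x : ℂ)) ∧
    ContinuousCurve (hsNorm s) (T₀ / ε ^ 2) (fun t x => (w t x : ℂ)) ∧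
    SolvesSplitKG (T₀ / ε ^ 2) v w ∧
    ∀ t ∈ Icc 0 (T₀ / ε ^ 2),
      hsPerNorm k₀ s (fun x => ((v t x - nlsAnsatz k₀ ω₀ ε (fun T _ => Av T) t x : ℝ) : ℂ)) +
        hsNorm s (fun x => ((w t x - nlsAnsatz k₀ ω₀ ε Aw t x : ℝ) : ℂ)) ≤
      ENNReal.ofReal (C * ε ^ (3 / 2 : ℝ))

/-! ### Explicit solutions of the normalized equation `i ∂_τ ψ + (1/2) ∂_ξ² ψ + |ψ|² ψ = 0` -/

/-- The rescaling `A(T, X) = √(2/3) (β/|ω₀|) ψ(τ₀ + (β²/ω₀³) T, β X)`, which turns solutions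
`ψ(τ, ξ)` of the normalized equation into solutions of
`2 i ω₀ ∂_T A = (c_g² - 1) ∂_X² A - 3 A |A|²` when `ω₀² = k₀² + 1` and `c_g = k₀ / ω₀`. -/
def rescale (ω₀ β τ₀ : ℝ) (ψ : ℝ → ℝ → ℂ) (T X : ℝ) : ℂ :=
  ((Real.sqrt (2 / 3) * (β / |ω₀|) : ℝ) : ℂ) * ψ (τ₀ + β ^ 2 / ω₀ ^ 3 * T) (β * X)

/-- All rescalings of the normalized solution `ψ`, split into the rescaled spatially constant
background `b(τ)` and the rescaled remainder `ψ(τ, ξ) - b(τ)`, are solutions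
`A = A_v + A_w` as in `IsSplitNLSSolution`. -/
def RescalingsAreSplitNLSSolutions (k₀ ω₀ r T₀ : ℝ) (b : ℝ → ℂ) (ψ : ℝ → ℝ → ℂ) : Prop :=
  ∀ β τ₀ : ℝ, 0 < β → IsSplitNLSSolution k₀ ω₀ r T₀
    (fun T => rescale ω₀ β τ₀ (fun τ _ => b τ) T 0)
    (rescale ω₀ β τ₀ (fun τ ξ => ψ τ ξ - b τ))

/-- The Peregrine solution. -/
def peregrine (τ ξ : ℝ) : ℂ :=
  (1 - 4 * (1 + 2 * Complex.I * τ) / (1 + 4 * ξ ^ 2 + 4 * τ ^ 2)) * Complex.exp (Complex.I * τ)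

/-- The Kuznetsov-Ma soliton with parameter `a > 1/2`, that is
`e^{iτ} (1 + (2 (1 - 2a) cosh(Rτ) + i R sinh(Rτ)) / (√(2a) cos(Ωξ) - cosh(Rτ)))`
with the imaginary numbers `R = √(8a(1-2a)) = i √(8a(2a-1))` and
`Ω = 2 √(1-2a) = 2 i √(2a-1)`. -/
def kuznetsovMa (a τ ξ : ℝ) : ℂ :=
  let R : ℂ := Complex.I * (Real.sqrt (8 * a * (2 * a - 1)) : ℝ)
  let Ω : ℂ := 2 * Complex.I * (Real.sqrt (2 * a - 1) : ℝ)
  Complex.exp (Complex.I * τ) *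
    (1 + (2 * (1 - 2 * a) * Complex.cosh (R * τ) + Complex.I * R * Complex.sinh (R * τ)) /
      ((Real.sqrt (2 * a) : ℝ) * Complex.cos (Ω * ξ) - Complex.cosh (R * τ)))

/-- The function `e^{iτ} ((-1)^j + (G + i H) / D)`, for polynomials `G`, `H`, `D` in `τ` (inner
variable) and `ξ` (outer variable), `D` real. -/
def rationalProfile (j : ℕ) (G H : Polynomial (Polynomial ℂ)) (D : Polynomial (Polynomial ℝ))
    (τ ξ : ℝ) : ℂ :=
  Complex.exp (Complex.I * τ) * ((-1) ^ j +
    (G.evalEval (τ : ℂ) (ξ : ℂ) + Complex.I * H.evalEval (τ : ℂ) (ξ : ℂ)) /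
      ((D.evalEval τ ξ : ℝ) : ℂ))

/-- Higher-order Peregrine solutions: the solutions
`e^{iτ} ((-1)^j + (G + i H) / D)` of the normalized equation, with polynomials `G`, `H` and a
positive real polynomial `D`, that are localized in space: at each time `τ` the polynomial `D` has
the same degree in `ξ`, and `G`, `H` have smaller degree in `ξ`. -/
structure IsHigherOrderPeregrine (j : ℕ) (G H : Polynomial (Polynomial ℂ))
    (D : Polynomial (Polynomial ℝ)) : Prop where
  pos : ∀ τ ξ : ℝ, 0 < D.evalEval τ ξ
  leadingCoeff_ne : ∀ τ : ℝ, D.leadingCoeff.eval τ ≠ 0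
  degree_G : G.degree < D.degree
  degree_H : H.degree < D.degree
  solves : SolvesNLS 1 (-(1 / 2)) (-1) univ (rationalProfile j G H D)

end

/-! Part (a). For the pair (v, u) with u = v + w, the split system consists of the same cubic
Klein–Gordon equation written twice. It is therefore one cubic equation in an algebra of functions
with values in ℂ × ℂ (`FunAlg`, `algE`), and no mixed terms have to be estimated separately.
Elements of the algebra are pairs in `E = V × L2` on the frequency side: `V` is a weighted Wiener
algebra, contained in H^s_per, and `L2` parametrizes H^s(ℝ) isometrically. A localized amplitude
a(εx) has H^s norm of order ε^(-1/2), whereas a constant amplitude is not affected by the dilation.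
The periodic component is therefore represented with a factor √ε, and then inserting an amplitude
(`embE`) costs ε^(-1/2) in both components.

The equation is used in its mild form, with the propagator sin(t⟨∂⟩)/⟨∂⟩, where ⟨∂⟩ = √(1 - ∂²). The
cube of the ansatz is ε³ times a sum of the modes n = 3, 1, -1, -3. After conjugation with
exp(iσ⟨∂⟩t), σ the sign of ω₀, mode n oscillates with the phase `dispD`. For n = 3, -1, -3 this
phase does not vanish at the carrier frequency (`dispD_ne_zero`), and an integration by parts in
time bounds the integral over [0, T₀/ε²] by O(1/ε) instead of O(1/ε²)
(`norm_integral_mulY_phase_le`). For n = 1 the constant and linear parts of the phase vanish by the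
dispersion relation and the choice of the group velocity. What remains is the curvature
ε²(2πζ)²/(2ω₀³) and an error O(ε³) (`abs_dispD_one_sub_le`); the NLS equation says exactly that the
slow evolution of the amplitude compensates both this curvature and the resonant cubic term
(`integral_resonant`, `resonant_cancellation`). The residual thus has size ε³ · ε^(-1) · ε^(-1/2) =
ε^(3/2) (`exists_residual_le`), with neither a corrected ansatz nor a normal form.

Multiplication by the ansatz is O(ε) on `E`: the L¹ norm of the Fourier transform does not change
under dilation, in contrast to the L² norm (`exists_norm_ansatzE_mul_le`). Hence the cubic
nonlinearity has Lipschitz constant O(ε²) for errors of norm at most ε, and the Gronwall factor over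
a time T₀/ε² is bounded. A contraction in an exponentially weighted sup norm
(`exists_volterra_solution`) yields existence on the whole interval and the error bound at once.
After four orders of smoothing, mild solutions are twice differentiable in `E`, which gives the
distributional equations (`solvesWave_mildE`).

Part (b). The NLS equation is invariant under the stated rescaling. For the Peregrine and
Kuznetsov–Ma solutions the normalized equation reduces to an algebraic identity
(`solvesNLS_one_add_div`). Membership in the Sobolev spaces follows because ψ - b is a family of
smooth functions all of whose derivatives decay at least like 1/(1+|ξ|), locally uniformly in τ;
this class is closed under the operations that build ψ (`IsSymbol`, `continuousCurve_rescale`). -/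

noncomputable section

open scoped BoundedContinuousFunction ComplexConjugate Convolution

/-! ### The Japanese bracket -/

/-- The bracket `√(1 + k²)` at the wave number `k = 2πξ`. -/
def jb (ξ : ℝ) : ℝ := Real.sqrt (1 + (2 * Real.pi * ξ) ^ 2)

lemma jb_sq (ξ : ℝ) : jb ξ ^ 2 = 1 + (2 * Real.pi * ξ) ^ 2 :=
  Real.sq_sqrt (by positivity)

lemma one_le_jb (ξ : ℝ) : 1 ≤ jb ξ :=
  Real.one_le_sqrt.2 (by nlinarith [sq_nonneg (2 * Real.pi * ξ)])

lemma jb_pos (ξ : ℝ) : 0 < jb ξ := zero_lt_one.trans_le (one_le_jb ξ)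

@[fun_prop]
lemma continuous_jb : Continuous jb := by unfold jb; fun_prop

@[simp] lemma jb_zero : jb 0 = 1 := by simp [jb]

@[simp] lemma jb_neg (ξ : ℝ) : jb (-ξ) = jb ξ := by simp [jb]

lemma abs_le_jb (ξ : ℝ) : |2 * Real.pi * ξ| ≤ jb ξ :=
  Real.abs_le_sqrt (by linarith)

lemma jb_add_le (ξ η : ℝ) : jb (ξ + η) ≤ jb ξ + jb η := by
  refine Real.sqrt_le_iff.2 ⟨by linarith [jb_pos ξ, jb_pos η], ?_⟩
  have h1 := abs_le_jb ξ
  have h2 := abs_le_jb η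
  have h3 : (2 * Real.pi * ξ) * (2 * Real.pi * η) ≤ jb ξ * jb η := by
    calc _ ≤ |2 * Real.pi * ξ| * |2 * Real.pi * η| := by rw [← abs_mul]; exact le_abs_self _
      _ ≤ _ := mul_le_mul h1 h2 (abs_nonneg _) (jb_pos ξ).le
  nlinarith [jb_sq ξ, jb_sq η]

lemma jb_add_le_mul (ξ η : ℝ) : jb (ξ + η) ≤ 2 * jb ξ * jb η := by
  nlinarith [jb_add_le ξ η, one_le_jb ξ, one_le_jb η]

lemma jb_mul_le {ε : ℝ} (hε : |ε| ≤ 1) (ξ : ℝ) : jb (ε * ξ) ≤ jb ξ := by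
  refine Real.sqrt_le_sqrt ?_
  have : ε ^ 2 ≤ 1 := (sq_le_one_iff_abs_le_one ε).2 hε
  nlinarith [mul_nonneg (sub_nonneg.2 this) (sq_nonneg (2 * Real.pi * ξ))]

/-- In a convolution this additive form puts the weight on one of the two factors, which leaves the
other one without weight; it serves the algebra property of H^s. The product form
`jb_rpow_add_le_mul` weights both factors and serves when one of them has an integrable weighted
transform. -/
lemma jb_rpow_add_le {s : ℝ} (hs : 0 ≤ s) (ξ η : ℝ) :
    jb (ξ + η) ^ s ≤ 2 ^ s * (jb ξ ^ s + jb η ^ s) := by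
  have h1 : jb (ξ + η) ≤ 2 * max (jb ξ) (jb η) := by
    linarith [jb_add_le ξ η, le_max_left (jb ξ) (jb η), le_max_right (jb ξ) (jb η)]
  have hx := Real.rpow_nonneg (jb_pos ξ).le s
  have hy := Real.rpow_nonneg (jb_pos η).le s
  calc jb (ξ + η) ^ s ≤ (2 * max (jb ξ) (jb η)) ^ s :=
        Real.rpow_le_rpow (jb_pos _).le h1 hs
    _ = 2 ^ s * max (jb ξ) (jb η) ^ s :=
        Real.mul_rpow (by norm_num) ((jb_pos ξ).le.trans (le_max_left _ _))
    _ ≤ _ := by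
        gcongr
        rcases max_cases (jb ξ) (jb η) with h | h <;> rw [h.1] <;> linarith

lemma jb_rpow_add_le_mul {s : ℝ} (hs : 0 ≤ s) (ξ η : ℝ) :
    jb (ξ + η) ^ s ≤ 2 ^ s * jb ξ ^ s * jb η ^ s := by
  rw [← Real.mul_rpow (by norm_num) (jb_pos ξ).le, ← Real.mul_rpow
    (by linarith [jb_pos ξ]) (jb_pos η).le]
  exact Real.rpow_le_rpow (jb_pos _).le (jb_add_le_mul ξ η) hs

lemma continuous_jb_rpow (s : ℝ) : Continuous fun ξ => jb ξ ^ s :=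
  continuous_jb.rpow_const fun ξ => Or.inl (jb_pos ξ).ne'

lemma integrable_jb_rpow {r : ℝ} (hr : 1 < r) : Integrable fun ξ => jb ξ ^ (-r) := by
  have h := integrable_rpow_neg_one_add_norm_sq (E := ℝ) (μ := volume) (r := r) (by simpa using hr)
  have h2 := h.comp_mul_left' (R := 2 * Real.pi) (by positivity)
  refine h2.congr (Eventually.of_forall fun ξ => ?_)
  simp only [Real.norm_eq_abs, sq_abs, jb, Real.sqrt_eq_rpow]
  rw [← Real.rpow_mul (by positivity)]
  ring_nf

/-- The threshold s > 1/2 is that of square integrability of the inverse weight; through it Fourier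
transforms of H^s functions become integrable. -/
lemma memLp_jb_rpow {s : ℝ} (hs : 1 / 2 < s) : MemLp (fun ξ => jb ξ ^ (-s)) 2 := by
  refine (memLp_two_iff_integrable_sq (continuous_jb_rpow _).aestronglyMeasurable).2 ?_
  refine (integrable_jb_rpow (r := 2 * s) (by linarith)).congr (Eventually.of_forall fun ξ => ?_)
  simp only
  rw [← Real.rpow_natCast, ← Real.rpow_mul (jb_pos ξ).le]
  norm_num; ring_nf

/-! ### Multipliers on `L²` -/

/-- `L²(ℝ)` on the frequency side. -/
abbrev L2 := Lp ℂ 2 (volume : Measure ℝ)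

lemma memLp_bcf_mul (m : ℝ →ᵇ ℂ) (f : L2) : MemLp (fun ξ => m ξ * f ξ) 2 :=
  MemLp.of_le_mul (c := ‖m‖) (Lp.memLp f)
    (m.continuous.aestronglyMeasurable.mul (Lp.aestronglyMeasurable f))
    (Eventually.of_forall fun ξ => by
      rw [norm_mul]; exact mul_le_mul_of_nonneg_right (m.norm_coe_le_norm ξ) (norm_nonneg _))

/-- Multiplication of `L²` functions by bounded continuous functions. -/
def mulL2 : (ℝ →ᵇ ℂ) →L[ℂ] L2 →L[ℂ] L2 :=
  LinearMap.mkContinuous₂ (LinearMap.mk₂ ℂ (fun m f => (memLp_bcf_mul m f).toLp _)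
    (fun m m' f => by
      rw [← MemLp.toLp_add]
      exact MemLp.toLp_congr _ _ (Eventually.of_forall fun ξ => by simp [add_mul]))
    (fun c m f => by
      rw [← MemLp.toLp_const_smul]
      exact MemLp.toLp_congr _ _ (Eventually.of_forall fun ξ => by simp [mul_assoc]))
    (fun m f f' => by
      rw [← MemLp.toLp_add]
      refine MemLp.toLp_congr _ _ ?_
      filter_upwards [Lp.coeFn_add f f'] with ξ h
      rw [h]; simp [mul_add])
    (fun c m f => by
      rw [← MemLp.toLp_const_smul]
      refine MemLp.toLp_congr _ _ ?_
      filter_upwards [Lp.coeFn_smul c f] with ξ h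
      rw [h]; simp [mul_left_comm])) 1
    (fun m f => by
      rw [one_mul]
      refine Lp.norm_le_mul_norm_of_ae_le_mul ?_
      filter_upwards [(memLp_bcf_mul m f).coeFn_toLp] with ξ h
      simp only [LinearMap.mk₂_apply, h, norm_mul]
      exact mul_le_mul_of_nonneg_right (m.norm_coe_le_norm ξ) (norm_nonneg _))

lemma coeFn_mulL2 (m : ℝ →ᵇ ℂ) (f : L2) : mulL2 m f =ᵐ[volume] fun ξ => m ξ * f ξ :=
  (memLp_bcf_mul m f).coeFn_toLp

lemma norm_mulL2_le (m : ℝ →ᵇ ℂ) (f : L2) : ‖mulL2 m f‖ ≤ ‖m‖ * ‖f‖ := by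
  refine Lp.norm_le_mul_norm_of_ae_le_mul ?_
  filter_upwards [coeFn_mulL2 m f] with ξ h
  rw [h, norm_mul]
  exact mul_le_mul_of_nonneg_right (m.norm_coe_le_norm ξ) (norm_nonneg _)

lemma mulL2_mulL2 (m m' : ℝ →ᵇ ℂ) (f : L2) : mulL2 m (mulL2 m' f) = mulL2 (m * m') f := by
  refine Lp.ext ?_
  filter_upwards [coeFn_mulL2 m (mulL2 m' f), coeFn_mulL2 m' f, coeFn_mulL2 (m * m') f]
    with ξ h1 h2 h3
  rw [h1, h2, h3]; simp [mul_assoc]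

lemma mulL2_one (f : L2) : mulL2 1 f = f := by
  refine Lp.ext ?_
  filter_upwards [coeFn_mulL2 1 f] with ξ h1
  rw [h1]; simp

/-- The multiplier `(1 + k²)^(-s/2)`. -/
def jbPow (s : ℝ) (hs : 0 ≤ s) : ℝ →ᵇ ℂ :=
  BoundedContinuousFunction.ofNormedAddCommGroup (fun ξ => ((jb ξ ^ (-s) : ℝ) : ℂ))
    (Complex.continuous_ofReal.comp (continuous_jb_rpow _)) 1 fun ξ => by
      rw [Complex.norm_real, Real.norm_of_nonneg (Real.rpow_nonneg (jb_pos ξ).le _)]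
      exact Real.rpow_le_one_of_one_le_of_nonpos (one_le_jb ξ) (by linarith)

@[simp] lemma jbPow_apply (s : ℝ) (hs : 0 ≤ s) (ξ : ℝ) :
    jbPow s hs ξ = ((jb ξ ^ (-s) : ℝ) : ℂ) := rfl

/-! ### Functions with weighted square integrable Fourier transform -/

/-- The Fourier transform `(1 + k²)^(-s/2) f` of the `H^s` function represented by `f ∈ L²`. -/
def dens (s : ℝ) (f : ℝ → ℂ) (ξ : ℝ) : ℂ := ((jb ξ ^ (-s) : ℝ) : ℂ) * f ξ

lemma norm_dens (s : ℝ) (f : ℝ → ℂ) (ξ : ℝ) : ‖dens s f ξ‖ = jb ξ ^ (-s) * ‖f ξ‖ := by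
  rw [dens, norm_mul, Complex.norm_real, Real.norm_of_nonneg (Real.rpow_nonneg (jb_pos ξ).le _)]

lemma memLp_dens {s : ℝ} (hs : 0 ≤ s) (f : L2) : MemLp (dens s f) 2 := by
  exact memLp_bcf_mul (jbPow s hs) f

lemma integrable_dens {s : ℝ} (hs : 1 / 2 < s) (f : L2) : Integrable (dens s f) := by
  have h : MemLp (fun ξ => ((jb ξ ^ (-s) : ℝ) : ℂ)) 2 := (memLp_jb_rpow hs).ofReal
  exact h.integrable_mul (Lp.memLp f)

/-- Cauchy–Schwarz with the square integrable inverse weight: the Sobolev embedding in the strong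
form that the Fourier transform is integrable. -/
lemma integral_norm_dens_le {s : ℝ} (hs : 1 / 2 < s) (f : L2) :
    ∫ ξ, ‖dens s f ξ‖ ≤ Real.sqrt (∫ ξ, jb ξ ^ (-(2 * s))) * ‖f‖ := by
  have h := integral_mul_le_Lp_mul_Lq_of_nonneg (μ := volume) (p := 2) (q := 2)
    (f := fun ξ => jb ξ ^ (-s)) (g := fun ξ => ‖f ξ‖) (by constructor <;> norm_num)
    (Eventually.of_forall fun ξ => Real.rpow_nonneg (jb_pos ξ).le _)
    (Eventually.of_forall fun ξ => norm_nonneg _)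
    (by simpa using memLp_jb_rpow hs) (by simpa using (Lp.memLp f).norm)
  simp only [norm_dens]
  refine h.trans (le_of_eq ?_)
  congr 1
  · rw [Real.sqrt_eq_rpow]
    congr 1
    refine integral_congr_ae (Eventually.of_forall fun ξ => ?_)
    simp only
    rw [← Real.rpow_mul (jb_pos ξ).le]; ring_nf
  · rw [Lp.norm_def, eLpNorm_eq_lintegral_rpow_enorm_toReal (by norm_num) (by norm_num),
      ← ENNReal.toReal_rpow, integral_eq_lintegral_of_nonneg_ae]
    · simp
    · exact Eventually.of_forall fun ξ => by positivity
    · exact ((Lp.aestronglyMeasurable f).norm.aemeasurable.pow_const _).aestronglyMeasurable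

/-- The character `e^{2πiξx}`. -/
def fchar (x ξ : ℝ) : ℂ := Complex.exp ((2 * Real.pi * ξ * x : ℝ) * Complex.I)

@[simp] lemma norm_fchar (x ξ : ℝ) : ‖fchar x ξ‖ = 1 := Complex.norm_exp_ofReal_mul_I _

@[fun_prop]
lemma continuous_fchar : Continuous fun p : ℝ × ℝ => fchar p.1 p.2 := by
  unfold fchar; fun_prop

lemma continuous_fchar_left (ξ : ℝ) : Continuous fun x => fchar x ξ := by
  unfold fchar; fun_prop

lemma continuous_fchar_right (x : ℝ) : Continuous fun ξ => fchar x ξ := by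
  unfold fchar; fun_prop

/-- The `H^s` function represented by `f ∈ L²`. -/
def synth (s : ℝ) (f : L2) : ℝ → ℂ := 𝓕⁻ (dens s f)

lemma synth_apply (s : ℝ) (f : L2) (x : ℝ) :
    synth s f x = ∫ ξ, fchar x ξ * dens s f ξ := by
  simp only [synth, Real.fourierInv_eq', smul_eq_mul, fchar]
  congr 1; ext ξ; congr 4; simp; ring

lemma integrable_exp_mul_dens {s : ℝ} (hs : 1 / 2 < s) (f : L2) (x : ℝ) :
    Integrable fun ξ : ℝ => fchar x ξ * dens s f ξ := by
  refine (integrable_dens hs f).bdd_mul (c := 1) ?_ ?_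
  · exact (continuous_fchar_right x).aestronglyMeasurable
  · exact Eventually.of_forall fun ξ => (norm_fchar x ξ).le

lemma norm_synth_le {s : ℝ} (hs : 1 / 2 < s) (f : L2) (x : ℝ) :
    ‖synth s f x‖ ≤ Real.sqrt (∫ ξ, jb ξ ^ (-(2 * s))) * ‖f‖ := by
  rw [synth_apply]
  refine (norm_integral_le_integral_norm _).trans ?_
  simp only [norm_mul, norm_fchar, one_mul]
  exact integral_norm_dens_le hs f

lemma dens_add (s : ℝ) (f g : L2) : dens s ((f + g : L2) : ℝ → ℂ) =ᵐ[volume] fun ξ => dens s f ξ + dens s g ξ := by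
  filter_upwards [Lp.coeFn_add f g] with ξ h
  rw [dens, h]; simp [dens, mul_add]

lemma dens_smul (s : ℝ) (c : ℂ) (f : L2) :
    dens s ((c • f : L2) : ℝ → ℂ) =ᵐ[volume] fun ξ => c * dens s f ξ := by
  filter_upwards [Lp.coeFn_smul c f] with ξ h
  rw [dens, h]; simp [dens, mul_left_comm]

lemma synth_add {s : ℝ} (hs : 1 / 2 < s) (f g : L2) :
    synth s (f + g) = synth s f + synth s g := by
  ext x
  simp only [synth_apply, Pi.add_apply]
  rw [← integral_add (integrable_exp_mul_dens hs f x) (integrable_exp_mul_dens hs g x)]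
  refine integral_congr_ae ?_
  filter_upwards [dens_add s f g] with ξ h
  rw [h, mul_add]

lemma synth_smul (s : ℝ) (c : ℂ) (f : L2) : synth s (c • f) = c • synth s f := by
  ext x
  simp only [synth_apply, Pi.smul_apply, smul_eq_mul]
  rw [← integral_const_mul]
  refine integral_congr_ae ?_
  filter_upwards [dens_smul s c f] with ξ h
  rw [h, mul_left_comm]

lemma continuous_synth {s : ℝ} (hs : 1 / 2 < s) (f : L2) : Continuous (synth s f) := by
  have h : synth s f = fun x =>
      ∫ ξ : ℝ, fchar x ξ * dens s f ξ :=
    funext fun x => synth_apply s f x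
  rw [h]
  refine continuous_of_dominated (bound := fun ξ => ‖dens s f ξ‖) ?_ ?_
    (integrable_dens hs f).norm ?_
  · exact fun x => (integrable_exp_mul_dens hs f x).aestronglyMeasurable
  · exact fun x => Eventually.of_forall fun ξ => by
      rw [norm_mul, norm_fchar, one_mul]
  · exact Eventually.of_forall fun ξ => (continuous_fchar_left ξ).mul continuous_const

/-- Riemann–Lebesgue. The decay at infinity makes the sum of a constant and a localized function
direct. -/
lemma tendsto_synth (s : ℝ) (f : L2) : Tendsto (synth s f) atTop (𝓝 0) := by
  have h := Real.zero_at_infty_fourier (dens s f)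
  have h2 : synth s f = fun x => 𝓕 (dens s f) (-x) :=
    funext fun x => Real.fourierInv_eq_fourier_neg _ _
  rw [h2]
  exact (h.mono_left (by rw [cocompact_eq_atBot_atTop]; exact le_sup_left)).comp
    tendsto_neg_atTop_atBot

lemma dens_mulL2 (s : ℝ) (m : ℝ →ᵇ ℂ) (f : L2) :
    dens s (mulL2 m f) =ᵐ[volume] fun ξ => m ξ * dens s f ξ := by
  filter_upwards [coeFn_mulL2 m f] with ξ h
  rw [dens, h]; simp [dens, mul_left_comm]

lemma synth_mulL2 (s : ℝ) (m : ℝ →ᵇ ℂ) (f : L2) (x : ℝ) :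
    synth s (mulL2 m f) x =
      ∫ ξ, fchar x ξ * (m ξ * dens s f ξ) := by
  rw [synth_apply]
  refine integral_congr_ae ?_
  filter_upwards [dens_mulL2 s m f] with ξ h
  rw [h]

/-- Since `f` stores the weighted transform, the inclusion of H^(s+p) in H^s is not the identity on
representatives but multiplication by ⟨ξ⟩^(-p). Throughout, `jbPow p` stands for the loss of p
orders of regularity. -/
lemma synth_mulL2_jbPow (s p : ℝ) (hp : 0 ≤ p) (f : L2) :
    synth s (mulL2 (jbPow p hp) f) = synth (s + p) f := by
  ext x
  rw [synth_mulL2, synth_apply]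
  congr 1; ext ξ
  rw [dens, dens, jbPow_apply, ← mul_assoc ((jb ξ ^ (-p) : ℝ) : ℂ), ← Complex.ofReal_mul,
    ← Real.rpow_add (jb_pos ξ)]
  congr 4; ring

/-! ### The Fourier transform on `L²` and on integrable functions -/

lemma fourierInv_eq_integral_fchar (G : ℝ → ℂ) (x : ℝ) : 𝓕⁻ G x = ∫ ξ, fchar x ξ * G ξ := by
  simp only [Real.fourierInv_eq', smul_eq_mul, fchar]
  congr 1; ext ξ; congr 4; simp; ring

lemma integral_mul_integral_fchar {φ G : ℝ → ℂ} (hφ : Integrable φ) (hG : Integrable G) :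
    ∫ x, φ x * ∫ ξ, fchar x ξ * G ξ = ∫ ξ, G ξ * ∫ x, fchar x ξ * φ x := by
  have hint : Integrable (fun p : ℝ × ℝ => fchar p.1 p.2 * (φ p.1 * G p.2))
      (volume.prod volume) :=
    (hφ.mul_prod hG).bdd_mul (c := 1) continuous_fchar.aestronglyMeasurable
      (Eventually.of_forall fun p => (norm_fchar _ _).le)
  calc ∫ x, φ x * ∫ ξ, fchar x ξ * G ξ = ∫ x, ∫ ξ, fchar x ξ * (φ x * G ξ) := by
        congr 1; ext x
        rw [← integral_const_mul]
        congr 1; ext ξ; ring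
    _ = ∫ ξ, ∫ x, fchar x ξ * (φ x * G ξ) := integral_integral_swap hint
    _ = _ := by
        congr 1; ext ξ
        rw [← integral_const_mul]
        congr 1; ext x; ring

lemma fchar_comm (x ξ : ℝ) : fchar x ξ = fchar ξ x := by
  unfold fchar; congr 3; ring

/-- The transform on L² is known through its action on Schwartz functions, the other one is an
integral. Both give the same integrals against test functions, by Fubini. -/
lemma Lp_fourierInv_ae_eq {G : ℝ → ℂ} (h1 : Integrable G) (h2 : MemLp G 2) :
    (𝓕⁻ (h2.toLp G) : L2) =ᵐ[volume] 𝓕⁻ G := by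
  have hc : Continuous (𝓕⁻ G) := by
    have : 𝓕⁻ G = fun x => 𝓕 G (-x) := funext fun x => Real.fourierInv_eq_fourier_neg _ _
    rw [this]
    exact (VectorFourier.fourierIntegral_continuous Real.continuous_fourierChar
      (by fun_prop) h1).comp continuous_neg
  refine ae_eq_of_integral_contDiff_smul_eq
    ((Lp.memLp _).locallyIntegrable (by norm_num)) hc.locallyIntegrable ?_
  intro φ hφ hφc
  let ψ : SchwartzMap ℝ ℂ := HasCompactSupport.toSchwartzMap (f := fun x => (φ x : ℂ))
    (hφc.comp_left (g := fun y : ℝ => (y : ℂ)) (by simp))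
    (Complex.ofRealCLM.contDiff.comp hφ)
  have hψ : ∀ x, ψ x = (φ x : ℂ) := fun x => rfl
  have e1 := congrArg (fun T => T ψ) (Lp.fourierInv_toTemperedDistribution_eq (h2.toLp G))
  simp only [TemperedDistribution.fourierInv_apply, Lp.toTemperedDistribution_apply] at e1
  have e2 : ∫ x, φ x • (𝓕⁻ (h2.toLp G) : L2) x = ∫ x, (𝓕⁻ ψ) x • (h2.toLp G) x := by
    rw [e1]
    congr 1
  have e3 : ∫ x, (𝓕⁻ ψ) x • (h2.toLp G) x = ∫ x, G x * ∫ ξ, fchar ξ x * ψ ξ := by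
    refine integral_congr_ae ?_
    filter_upwards [h2.coeFn_toLp] with x hx
    rw [hx, smul_eq_mul, mul_comm]
    congr 1
    rw [SchwartzMap.fourierInv_coe, fourierInv_eq_integral_fchar]
    congr 1; ext ξ; rw [fchar_comm]
  rw [e2, e3, ← integral_mul_integral_fchar ψ.integrable h1]
  congr 1; ext x
  rw [fourierInv_eq_integral_fchar, hψ, Complex.real_smul]

lemma jb_rpow_eq (s ξ : ℝ) : (1 + (2 * Real.pi * ξ) ^ 2) ^ (s / 2) = jb ξ ^ s := by
  rw [jb, Real.sqrt_eq_rpow, ← Real.rpow_mul (by positivity)]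
  ring_nf

lemma jb_rpow_mul_dens (s : ℝ) (f : ℝ → ℂ) (ξ : ℝ) :
    ((jb ξ ^ s : ℝ) : ℂ) * dens s f ξ = f ξ := by
  rw [dens, ← mul_assoc, ← Complex.ofReal_mul, ← Real.rpow_add (jb_pos ξ)]
  simp

lemma hsNorm_synth {s : ℝ} (hs : 1 / 2 < s) (f : L2) : hsNorm s (synth s f) = ‖f‖ₑ := by
  have hd := memLp_dens (by linarith) f
  have h1 : (𝓕⁻ (hd.toLp _) : L2) =ᵐ[volume] synth s f :=
    Lp_fourierInv_ae_eq (integrable_dens hs f) hd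
  have hm : MemLp (synth s f) 2 := (memLp_congr_ae h1).1 (Lp.memLp _)
  have h2 : hm.toLp (synth s f) = 𝓕⁻ (hd.toLp (dens s f)) := by
    refine Lp.ext ?_
    filter_upwards [h1, hm.coeFn_toLp] with x e1 e2
    rw [e1, e2]
  rw [hsNorm, dif_pos hm, h2, FourierTransform.fourier_fourierInv_eq, Lp.enorm_def]
  refine eLpNorm_congr_ae ?_
  filter_upwards [hd.coeFn_toLp] with ξ h
  rw [h, jb_rpow_eq, jb_rpow_mul_dens]

/-- Continuity of `g` upgrades the almost everywhere identity from Fourier inversion to equality at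
every point. -/
lemma exists_synth_eq {s : ℝ} (hs : 1 / 2 < s) {g : ℝ → ℂ} (hg : Continuous g)
    (h : hsNorm s g < ⊤) : ∃ f : L2, synth s f = g := by
  rw [hsNorm] at h
  split_ifs at h with hm
  · set F : L2 := 𝓕 (hm.toLp g) with hF
    have hw : MemLp (fun ξ : ℝ => (((1 + (2 * Real.pi * ξ) ^ 2) ^ (s / 2) : ℝ) : ℂ) * F ξ) 2 := by
      refine ⟨?_, h⟩
      refine AEStronglyMeasurable.mul (Continuous.aestronglyMeasurable ?_)
        (Lp.aestronglyMeasurable _)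
      simp only [jb_rpow_eq]
      exact Complex.continuous_ofReal.comp (continuous_jb_rpow _)
    refine ⟨hw.toLp _, ?_⟩
    have hd := memLp_dens (by linarith : (0 : ℝ) ≤ s) (hw.toLp _)
    have e1 : hd.toLp _ = F := by
      refine Lp.ext ?_
      filter_upwards [hd.coeFn_toLp, hw.coeFn_toLp] with ξ e1 e2
      rw [e1, dens, e2, jb_rpow_eq, ← mul_assoc, ← Complex.ofReal_mul,
        ← Real.rpow_add (jb_pos ξ)]
      simp
    have e2 := Lp_fourierInv_ae_eq (integrable_dens hs (hw.toLp _)) hd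
    rw [e1, show (𝓕⁻ F : L2) = hm.toLp g from FourierTransform.fourierInv_fourier_eq _] at e2
    refine Continuous.ae_eq_iff_eq volume (continuous_synth hs _) hg |>.1 ?_
    filter_upwards [e2, hm.coeFn_toLp] with x e2 e3
    rw [← e3, e2]; rfl
  · exact absurd h (lt_irrefl _)

/-- The synthesis map as a linear map. -/
def synthₗ {s : ℝ} (hs : 1 / 2 < s) : L2 →ₗ[ℂ] (ℝ → ℂ) where
  toFun := synth s
  map_add' := synth_add hs
  map_smul' := synth_smul s

lemma synth_zero {s : ℝ} (hs : 1 / 2 < s) : synth s 0 = 0 := (synthₗ hs).map_zero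

lemma synth_sub {s : ℝ} (hs : 1 / 2 < s) (f g : L2) :
    synth s (f - g) = synth s f - synth s g := (synthₗ hs).map_sub f g

lemma synth_injective {s : ℝ} (hs : 1 / 2 < s) : Function.Injective (synth s) := by
  refine (injective_iff_map_eq_zero (synthₗ hs)).2 fun f hf => ?_
  have h := hsNorm_synth hs f
  rw [show synth s f = synth s 0 from (hf : synth s f = 0).trans (synth_zero hs).symm,
    hsNorm_synth hs 0] at h
  simpa using h.symm

/-! ### Convolution estimates -/

/-- Cauchy–Schwarz after writing P Q = P^(1/2) · P^(1/2) Q. -/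
lemma sq_lintegral_mul_le {P Q : ℝ → ℝ≥0∞} (hP : Measurable P) (hQ : Measurable Q) :
    (∫⁻ η, P η * Q η) ^ 2 ≤ (∫⁻ η, P η) * ∫⁻ η, P η * Q η ^ 2 := by
  have h := ENNReal.lintegral_mul_le_Lp_mul_Lq (volume : Measure ℝ) (p := 2) (q := 2)
    (by constructor <;> norm_num) (f := fun η => P η ^ (1 / 2 : ℝ))
    (g := fun η => P η ^ (1 / 2 : ℝ) * Q η)
    (hP.pow_const _).aemeasurable ((hP.pow_const _).mul hQ).aemeasurable
  have e1 : ∀ η, ((fun η => P η ^ (1 / 2 : ℝ)) * fun η => P η ^ (1 / 2 : ℝ) * Q η) η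
      = P η * Q η := fun η => by
    simp only [Pi.mul_apply]
    rw [← mul_assoc, ← ENNReal.rpow_add_of_nonneg _ _ (by norm_num) (by norm_num)]
    norm_num
  have e2 : ∀ η, (P η ^ (1 / 2 : ℝ)) ^ (2 : ℝ) = P η := fun η => by
    rw [← ENNReal.rpow_mul]; norm_num
  simp only [e1, ENNReal.mul_rpow_of_nonneg _ _ (by norm_num : (0 : ℝ) ≤ 2), e2,
    ENNReal.rpow_two] at h
  calc _ ≤ _ := pow_le_pow_left' h 2
    _ = _ := by
      rw [mul_pow]
      simp only [← ENNReal.rpow_natCast, ← ENNReal.rpow_mul]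
      norm_num

/-- Young's inequality L¹ * L² → L²: Cauchy–Schwarz with respect to the density P, then Tonelli and
translation invariance. -/
lemma lintegral_sq_convolution_le {P Q : ℝ → ℝ≥0∞} (hP : Measurable P) (hQ : Measurable Q) :
    ∫⁻ ξ, (∫⁻ η, P η * Q (ξ - η)) ^ 2 ≤ (∫⁻ η, P η) ^ 2 * ∫⁻ η, Q η ^ 2 := by
  calc ∫⁻ ξ, (∫⁻ η, P η * Q (ξ - η)) ^ 2
      ≤ ∫⁻ ξ, (∫⁻ η, P η) * ∫⁻ η, P η * Q (ξ - η) ^ 2 :=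
        lintegral_mono fun ξ => sq_lintegral_mul_le hP (hQ.comp (measurable_const.sub measurable_id))
    _ = (∫⁻ η, P η) * ∫⁻ ξ, ∫⁻ η, P η * Q (ξ - η) ^ 2 :=
        lintegral_const_mul _ (Measurable.lintegral_prod_right (by fun_prop))
    _ = (∫⁻ η, P η) * ∫⁻ η, ∫⁻ ξ, P η * Q (ξ - η) ^ 2 := by
        rw [lintegral_lintegral_swap]
        exact Measurable.aemeasurable (by fun_prop)
    _ = (∫⁻ η, P η) * ∫⁻ η, P η * ∫⁻ ξ, Q ξ ^ 2 := by
        congr 1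
        refine lintegral_congr fun η => ?_
        rw [lintegral_const_mul _ (by fun_prop)]
        congr 1
        exact lintegral_sub_right_eq_self (fun ξ => Q ξ ^ 2) η
    _ = _ := by
        rw [lintegral_mul_const _ hP]; ring

lemma measurable_lintegral_convolution {P Q : ℝ → ℝ≥0∞} (hP : Measurable P) (hQ : Measurable Q) :
    Measurable fun ξ => ∫⁻ η, P η * Q (ξ - η) :=
  Measurable.lintegral_prod_right (by fun_prop)

lemma lintegral_convolution_comm (P Q : ℝ → ℝ≥0∞) (ξ : ℝ) :
    ∫⁻ η, P η * Q (ξ - η) = ∫⁻ η, Q η * P (ξ - η) := by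
  rw [← lintegral_sub_left_eq_self _ ξ]
  simp [mul_comm]

lemma fourierInv_convolution {G H : ℝ → ℂ} (hG : Integrable G) (hH : Integrable H) (x : ℝ) :
    𝓕⁻ (G ⋆[ContinuousLinearMap.mul ℂ ℂ] H) x = 𝓕⁻ G x * 𝓕⁻ H x := by
  simp only [Real.fourierInv_eq_fourier_neg]
  exact Real.fourier_mul_convolution_eq hG hH (-x)

lemma lintegral_sq_enorm (f : L2) : ∫⁻ ξ, ‖f ξ‖ₑ ^ 2 = ‖f‖ₑ ^ 2 := by
  rw [Lp.enorm_def, eLpNorm_eq_lintegral_rpow_enorm_toReal (by norm_num) (by norm_num),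
    ← ENNReal.rpow_natCast, ← ENNReal.rpow_mul]
  norm_num

lemma eq_of_dens_ae_eq {s : ℝ} {f g : L2} (h : dens s f =ᵐ[volume] dens s g) : f = g := by
  refine Lp.ext ?_
  filter_upwards [h] with ξ h
  rw [← jb_rpow_mul_dens s f, h, jb_rpow_mul_dens]

/-- The way in which elements of `L2` are produced below: prescribe the unweighted transform and
bound its weighted square integral. -/
lemma exists_dens_eq (s : ℝ) {G : ℝ → ℂ} (hG : AEStronglyMeasurable G) {B : ℝ} (hB : 0 ≤ B)
    (h : ∫⁻ ξ, (ENNReal.ofReal (jb ξ ^ s) * ‖G ξ‖ₑ) ^ 2 ≤ ENNReal.ofReal B ^ 2) :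
    ∃ f : L2, dens s f =ᵐ[volume] G ∧ ‖f‖ ≤ B := by
  have he : ∀ ξ, ‖((jb ξ ^ s : ℝ) : ℂ) * G ξ‖ₑ = ENNReal.ofReal (jb ξ ^ s) * ‖G ξ‖ₑ := fun ξ => by
    rw [enorm_mul, ← ofReal_norm, Complex.norm_real,
      Real.norm_of_nonneg (Real.rpow_nonneg (jb_pos ξ).le _)]
  have hle : eLpNorm (fun ξ => ((jb ξ ^ s : ℝ) : ℂ) * G ξ) 2 volume ≤ ENNReal.ofReal B := by
    rw [eLpNorm_eq_lintegral_rpow_enorm_toReal (by norm_num) (by norm_num)]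
    simp only [he, ENNReal.toReal_ofNat, ENNReal.rpow_two]
    calc _ ≤ (ENNReal.ofReal B ^ 2) ^ (1 / 2 : ℝ) := ENNReal.rpow_le_rpow h (by norm_num)
      _ = _ := by rw [← ENNReal.rpow_natCast, ← ENNReal.rpow_mul]; norm_num
  have hm : MemLp (fun ξ => ((jb ξ ^ s : ℝ) : ℂ) * G ξ) 2 volume :=
    ⟨(Complex.continuous_ofReal.comp (continuous_jb_rpow _)).aestronglyMeasurable.mul hG,
      hle.trans_lt ENNReal.ofReal_lt_top⟩
  refine ⟨hm.toLp _, ?_, ?_⟩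
  · filter_upwards [hm.coeFn_toLp] with ξ h
    rw [dens, h, ← mul_assoc, ← Complex.ofReal_mul, ← Real.rpow_add (jb_pos ξ)]
    simp
  · rw [Lp.norm_toLp]
    exact ENNReal.toReal_le_of_le_ofReal hB hle

lemma synth_eq_of_dens_ae_eq {s : ℝ} {f : L2} {G : ℝ → ℂ} (h : dens s f =ᵐ[volume] G) :
    synth s f = 𝓕⁻ G := by
  ext x
  rw [synth_apply, fourierInv_eq_integral_fchar]
  refine integral_congr_ae ?_
  filter_upwards [h] with ξ h
  rw [h]

lemma enorm_convolution_le (G H : ℝ → ℂ) (ξ : ℝ) :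
    ‖(G ⋆[ContinuousLinearMap.mul ℂ ℂ] H) ξ‖ₑ ≤ ∫⁻ η, ‖G η‖ₑ * ‖H (ξ - η)‖ₑ := by
  refine (enorm_integral_le_lintegral_enorm _).trans (le_of_eq ?_)
  simp [enorm_mul]

lemma measurable_dens (s : ℝ) (f : L2) : Measurable (dens s f) :=
  ((Complex.continuous_ofReal.comp (continuous_jb_rpow _)).measurable).mul
    (Lp.stronglyMeasurable f).measurable

lemma ofReal_jb_mul_enorm_dens (s : ℝ) (f : ℝ → ℂ) (ξ : ℝ) :
    ENNReal.ofReal (jb ξ ^ s) * ‖dens s f ξ‖ₑ = ‖f ξ‖ₑ := by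
  conv_rhs => rw [← jb_rpow_mul_dens s f ξ, enorm_mul, ← ofReal_norm (_ : ℂ),
    Complex.norm_real, Real.norm_of_nonneg (Real.rpow_nonneg (jb_pos ξ).le _)]

lemma lintegral_enorm_dens_le {s : ℝ} (hs : 1 / 2 < s) (f : L2) :
    ∫⁻ ξ, ‖dens s f ξ‖ₑ ≤ ENNReal.ofReal (Real.sqrt (∫ ξ, jb ξ ^ (-(2 * s))) * ‖f‖) := by
  rw [← ofReal_integral_norm_eq_lintegral_enorm (integrable_dens hs f)]
  exact ENNReal.ofReal_le_ofReal (integral_norm_dens_le hs f)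

lemma ennreal_add_sq_le (a b : ℝ≥0∞) : (a + b) ^ 2 ≤ 4 * (a ^ 2 + b ^ 2) := by
  calc (a + b) ^ 2 ≤ (2 * max a b) ^ 2 := by
        refine pow_le_pow_left' ?_ 2
        rw [two_mul]; exact add_le_add (le_max_left _ _) (le_max_right _ _)
    _ = 4 * max a b ^ 2 := by rw [mul_pow]; norm_num
    _ ≤ _ := by
        gcongr
        rcases max_choice a b with h | h <;> rw [h]
        · exact le_self_add
        · exact le_add_self

/-- `H^s(ℝ)` is an algebra for `s > 1/2`. -/
lemma exists_synth_mul {s : ℝ} (hs : 1 / 2 < s) : ∃ C : ℝ, 0 ≤ C ∧ ∀ f g : L2,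
    ∃ h : L2, synth s h = synth s f * synth s g ∧ ‖h‖ ≤ C * (‖f‖ * ‖g‖) := by
  set K := Real.sqrt (∫ ξ, jb ξ ^ (-(2 * s))) with hK
  have hK0 : 0 ≤ K := Real.sqrt_nonneg _
  -- The factor 2^s comes from the inequality for the weight, 2 from (a+b)² ≤ 4(a²+b²), and 2K is a
  -- crude bound for the sum of the two convolution terms, each of which is at most K‖f‖‖g‖.
  refine ⟨2 ^ s * 2 * (2 * K), by positivity, fun f g => ?_⟩
  have hG := integrable_dens hs f
  have hH := integrable_dens hs g
  obtain ⟨h, h1, h2⟩ := exists_dens_eq s (B := 2 ^ s * 2 * (2 * K) * (‖f‖ * ‖g‖))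
    (hG.integrable_convolution (ContinuousLinearMap.mul ℂ ℂ) hH).aestronglyMeasurable
    (by positivity) (by
      -- The weight at ξ = η + (ξ - η) falls on one factor at a time. In each term the weighted
      -- factor is in L² and the unweighted one in L¹, so that Young's inequality applies.
      have hpt : ∀ ξ, ENNReal.ofReal (jb ξ ^ s) *
          ‖(dens s f ⋆[ContinuousLinearMap.mul ℂ ℂ] dens s g) ξ‖ₑ ≤
          ENNReal.ofReal (2 ^ s) * ((∫⁻ η, ‖dens s g η‖ₑ * ‖f (ξ - η)‖ₑ) +
            ∫⁻ η, ‖dens s f η‖ₑ * ‖g (ξ - η)‖ₑ) := fun ξ => by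
        rw [← lintegral_convolution_comm (fun η => ‖f η‖ₑ) (fun η => ‖dens s g η‖ₑ)]
        rw [← lintegral_add_left (by
          exact ((Lp.stronglyMeasurable f).measurable.enorm).mul
            ((measurable_dens s g).comp (measurable_const.sub measurable_id)).enorm)]
        rw [← lintegral_const_mul _ (by
          exact (((Lp.stronglyMeasurable f).measurable.enorm).mul
            ((measurable_dens s g).comp (measurable_const.sub measurable_id)).enorm).add
            ((measurable_dens s f).enorm.mul (((Lp.stronglyMeasurable g).measurable.comp
              (measurable_const.sub measurable_id)).enorm)))]
        refine (mul_le_mul_right (enorm_convolution_le _ _ ξ) _).trans ?_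
        rw [← lintegral_const_mul _ (by
          exact ((measurable_dens s f).enorm).mul
            ((measurable_dens s g).comp (measurable_const.sub measurable_id)).enorm)]
        refine lintegral_mono fun η => ?_
        have hj := ENNReal.ofReal_le_ofReal
          (jb_rpow_add_le (s := s) (by linarith) η (ξ - η))
        rw [add_sub_cancel, ENNReal.ofReal_mul (by positivity), ENNReal.ofReal_add
          (Real.rpow_nonneg (jb_pos _).le _) (Real.rpow_nonneg (jb_pos _).le _)] at hj
        calc _ ≤ (ENNReal.ofReal (2 ^ s) * (ENNReal.ofReal (jb η ^ s) +
              ENNReal.ofReal (jb (ξ - η) ^ s))) * (‖dens s f η‖ₑ * ‖dens s g (ξ - η)‖ₑ) := by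
              gcongr
          _ = ENNReal.ofReal (2 ^ s) * ((ENNReal.ofReal (jb η ^ s) * ‖dens s f η‖ₑ) *
              ‖dens s g (ξ - η)‖ₑ + ‖dens s f η‖ₑ *
                (ENNReal.ofReal (jb (ξ - η) ^ s) * ‖dens s g (ξ - η)‖ₑ)) := by ring
          _ = _ := by rw [ofReal_jb_mul_enorm_dens, ofReal_jb_mul_enorm_dens]
      have hmf := (Lp.stronglyMeasurable f).measurable.enorm
      have hmg := (Lp.stronglyMeasurable g).measurable.enorm
      have hdf := (measurable_dens s f).enorm
      have hdg := (measurable_dens s g).enorm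
      calc _ ≤ ∫⁻ ξ, (ENNReal.ofReal (2 ^ s) * ((∫⁻ η, ‖dens s g η‖ₑ * ‖f (ξ - η)‖ₑ) +
            ∫⁻ η, ‖dens s f η‖ₑ * ‖g (ξ - η)‖ₑ)) ^ 2 :=
            lintegral_mono fun ξ => pow_le_pow_left' (hpt ξ) 2
        _ ≤ ∫⁻ ξ, ENNReal.ofReal (2 ^ s) ^ 2 * (4 * ((∫⁻ η, ‖dens s g η‖ₑ * ‖f (ξ - η)‖ₑ) ^ 2 +
            (∫⁻ η, ‖dens s f η‖ₑ * ‖g (ξ - η)‖ₑ) ^ 2)) := by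
            refine lintegral_mono fun ξ => ?_
            rw [mul_pow]
            gcongr
            exact ennreal_add_sq_le _ _
        _ = ENNReal.ofReal (2 ^ s) ^ 2 * (4 * ((∫⁻ ξ, (∫⁻ η, ‖dens s g η‖ₑ * ‖f (ξ - η)‖ₑ) ^ 2) +
            ∫⁻ ξ, (∫⁻ η, ‖dens s f η‖ₑ * ‖g (ξ - η)‖ₑ) ^ 2)) := by
            have m1 : Measurable fun ξ => (∫⁻ η, ‖dens s g η‖ₑ * ‖f (ξ - η)‖ₑ) ^ 2 :=
              (measurable_lintegral_convolution hdg hmf).pow_const _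
            have m2 : Measurable fun ξ => (∫⁻ η, ‖dens s f η‖ₑ * ‖g (ξ - η)‖ₑ) ^ 2 :=
              (measurable_lintegral_convolution hdf hmg).pow_const _
            have m3 : Measurable fun ξ => (∫⁻ η, ‖dens s g η‖ₑ * ‖f (ξ - η)‖ₑ) ^ 2 +
              (∫⁻ η, ‖dens s f η‖ₑ * ‖g (ξ - η)‖ₑ) ^ 2 := m1.add m2
            rw [lintegral_const_mul _ (m3.const_mul _), lintegral_const_mul _ m3,
              lintegral_add_left m1]
        _ ≤ ENNReal.ofReal (2 ^ s) ^ 2 * (4 * (ENNReal.ofReal (K * ‖g‖) ^ 2 * ‖f‖ₑ ^ 2 +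
            ENNReal.ofReal (K * ‖f‖) ^ 2 * ‖g‖ₑ ^ 2)) := by
            gcongr
            · refine (lintegral_sq_convolution_le hdg hmf).trans ?_
              rw [lintegral_sq_enorm]
              gcongr
              exact lintegral_enorm_dens_le hs g
            · refine (lintegral_sq_convolution_le hdf hmg).trans ?_
              rw [lintegral_sq_enorm]
              gcongr
              exact lintegral_enorm_dens_le hs f
        _ ≤ ENNReal.ofReal (2 ^ s * 2 * (2 * K) * (‖f‖ * ‖g‖)) ^ 2 := by
            rw [← ofReal_norm, ← ofReal_norm,
              show (4 : ℝ≥0∞) = ENNReal.ofReal 4 by norm_num]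
            simp only [← ENNReal.ofReal_pow (show (0 : ℝ) ≤ 2 ^ s by positivity),
              ← ENNReal.ofReal_pow (norm_nonneg f), ← ENNReal.ofReal_pow (norm_nonneg g),
              ← ENNReal.ofReal_pow (show 0 ≤ K * ‖f‖ by positivity),
              ← ENNReal.ofReal_pow (show 0 ≤ K * ‖g‖ by positivity),
              ← ENNReal.ofReal_pow (show 0 ≤ 2 ^ s * 2 * (2 * K) * (‖f‖ * ‖g‖) by positivity)]
            rw [← ENNReal.ofReal_mul (by positivity), ← ENNReal.ofReal_mul (by positivity),
              ← ENNReal.ofReal_add (by positivity) (by positivity),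
              ← ENNReal.ofReal_mul (by positivity), ← ENNReal.ofReal_mul (by positivity)]
            refine ENNReal.ofReal_le_ofReal ?_
            have : 0 ≤ ((2 : ℝ) ^ s * K * ‖f‖ * ‖g‖) ^ 2 := by positivity
            nlinarith)
  refine ⟨h, ?_, h2⟩
  rw [synth_eq_of_dens_ae_eq h1]
  ext x
  exact fourierInv_convolution hG hH x

/-- Functions with weighted integrable Fourier transform are multipliers of `H^s(ℝ)`. -/
lemma exists_synth_mul_of_integrable {s : ℝ} (hs : 1 / 2 < s) {f : L2} {B : ℝ} (hB : 0 ≤ B)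
    (hf : ∫⁻ ξ, ENNReal.ofReal (jb ξ ^ s) * ‖dens s f ξ‖ₑ ≤ ENNReal.ofReal B) (g : L2) :
    ∃ h : L2, synth s h = synth s f * synth s g ∧ ‖h‖ ≤ 2 ^ s * B * ‖g‖ := by
  have hG := integrable_dens hs f
  have hH := integrable_dens hs g
  have hmf := (Lp.stronglyMeasurable f).measurable.enorm
  have hmg := (Lp.stronglyMeasurable g).measurable.enorm
  have hdf := (measurable_dens s f).enorm
  have hdg := (measurable_dens s g).enorm
  obtain ⟨h, h1, h2⟩ := exists_dens_eq s (B := 2 ^ s * B * ‖g‖)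
    (hG.integrable_convolution (ContinuousLinearMap.mul ℂ ℂ) hH).aestronglyMeasurable
    (by positivity) (by
      have hpt : ∀ ξ, ENNReal.ofReal (jb ξ ^ s) *
          ‖(dens s f ⋆[ContinuousLinearMap.mul ℂ ℂ] dens s g) ξ‖ₑ ≤
          ENNReal.ofReal (2 ^ s) * (∫⁻ η, ‖f η‖ₑ * ‖g (ξ - η)‖ₑ) := fun ξ => by
        rw [← lintegral_const_mul _ (by
          exact hmf.mul (hmg.comp (measurable_const.sub measurable_id)))]
        refine (mul_le_mul_right (enorm_convolution_le _ _ ξ) _).trans ?_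
        rw [← lintegral_const_mul _ (by
          exact hdf.mul (hdg.comp (measurable_const.sub measurable_id)))]
        refine lintegral_mono fun η => ?_
        have hj := ENNReal.ofReal_le_ofReal
          (jb_rpow_add_le_mul (s := s) (by linarith) η (ξ - η))
        rw [add_sub_cancel, ENNReal.ofReal_mul (mul_nonneg (by positivity)
          (Real.rpow_nonneg (jb_pos _).le _)), ENNReal.ofReal_mul (by positivity)] at hj
        calc _ ≤ (ENNReal.ofReal (2 ^ s) * ENNReal.ofReal (jb η ^ s) *
              ENNReal.ofReal (jb (ξ - η) ^ s)) * (‖dens s f η‖ₑ * ‖dens s g (ξ - η)‖ₑ) := by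
              gcongr
          _ = ENNReal.ofReal (2 ^ s) * ((ENNReal.ofReal (jb η ^ s) * ‖dens s f η‖ₑ) *
                (ENNReal.ofReal (jb (ξ - η) ^ s) * ‖dens s g (ξ - η)‖ₑ)) := by ring
          _ = _ := by rw [ofReal_jb_mul_enorm_dens, ofReal_jb_mul_enorm_dens]
      simp only [ofReal_jb_mul_enorm_dens] at hf
      calc _ ≤ ∫⁻ ξ, (ENNReal.ofReal (2 ^ s) * (∫⁻ η, ‖f η‖ₑ * ‖g (ξ - η)‖ₑ)) ^ 2 :=
            lintegral_mono fun ξ => pow_le_pow_left' (hpt ξ) 2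
        _ = ENNReal.ofReal (2 ^ s) ^ 2 * ∫⁻ ξ, (∫⁻ η, ‖f η‖ₑ * ‖g (ξ - η)‖ₑ) ^ 2 := by
            simp only [mul_pow]
            refine lintegral_const_mul _ ?_
            exact (measurable_lintegral_convolution hmf hmg).pow_const _
        _ ≤ ENNReal.ofReal (2 ^ s) ^ 2 * (ENNReal.ofReal B ^ 2 * ‖g‖ₑ ^ 2) := by
            gcongr
            refine (lintegral_sq_convolution_le hmf hmg).trans ?_
            rw [lintegral_sq_enorm]
            gcongr
        _ = _ := by
            rw [← ofReal_norm, ← mul_pow, ← mul_pow,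
              ← ENNReal.ofReal_mul hB, ← ENNReal.ofReal_mul (by positivity), mul_assoc])
  refine ⟨h, ?_, h2⟩
  rw [synth_eq_of_dens_ae_eq h1]
  ext x
  exact fourierInv_convolution hG hH x

/-! ### Dilations and modulations -/

lemma map_affine_volume {ε : ℝ} (hε : 0 < ε) (c : ℝ) :
    Measure.map (fun ζ : ℝ => c + ε * ζ) volume = ENNReal.ofReal ε⁻¹ • volume := by
  have h : (fun ζ : ℝ => c + ε * ζ) = (fun y => c + y) ∘ fun ζ => ε * ζ := rfl
  rw [h, ← Measure.map_map (measurable_const_add c) (measurable_const_mul ε),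
    Real.map_volume_mul_left hε.ne', Measure.map_smul, map_add_left_eq_self, abs_of_pos (by positivity)]

lemma quasiMeasurePreserving_affine_inv {ε : ℝ} (hε : 0 < ε) (c : ℝ) :
    Measure.QuasiMeasurePreserving (fun ξ : ℝ => (ξ - c) / ε) volume volume := by
  have h := map_affine_volume (inv_pos.2 hε) (-(c / ε))
  refine ⟨by fun_prop, ?_⟩
  have e : (fun ξ : ℝ => (ξ - c) / ε) = fun ζ : ℝ => -(c / ε) + ε⁻¹ * ζ := by
    ext ξ; field_simp; ring
  rw [e, h]
  exact Measure.smul_absolutelyContinuous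

/-- The Fourier transform of `f(εx) e^{2πicx}` in terms of the Fourier transform `G` of `f`. -/
def dilate (ε c : ℝ) (G : ℝ → ℂ) (ξ : ℝ) : ℂ := (ε⁻¹ : ℝ) * G ((ξ - c) / ε)

lemma dilate_affine {ε : ℝ} (hε : 0 < ε) (c : ℝ) (G : ℝ → ℂ) (ζ : ℝ) :
    dilate ε c G (c + ε * ζ) = (ε⁻¹ : ℝ) * G ζ := by
  rw [dilate]; congr 2; field_simp; ring

lemma fourierInv_dilate {ε : ℝ} (hε : 0 < ε) (c : ℝ) (G : ℝ → ℂ) (x : ℝ) :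
    𝓕⁻ (dilate ε c G) x = fchar x c * 𝓕⁻ G (ε * x) := by
  simp only [fourierInv_eq_integral_fchar]
  have h1 := integral_add_left_eq_self (μ := (volume : Measure ℝ))
    (fun ξ => fchar x ξ * dilate ε c G ξ) c
  have h2 := Measure.integral_comp_mul_left (fun ξ => fchar x (c + ξ) * dilate ε c G (c + ξ)) ε
  rw [← h1, ← inv_smul_smul₀ hε.ne' (∫ ξ, fchar x (c + ξ) * dilate ε c G (c + ξ)),
    ← abs_of_pos (inv_pos.2 hε), abs_inv, smul_comm, ← abs_inv, ← h2, ← integral_const_mul,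
    ← integral_smul]
  congr 1; ext ζ
  rw [dilate_affine hε, show fchar x (c + ε * ζ) = fchar x c * fchar (ε * x) ζ by
    rw [fchar, fchar, fchar, ← Complex.exp_add]; congr 1; push_cast; ring]
  rw [Complex.real_smul]
  have : (ε : ℂ) ≠ 0 := by exact_mod_cast hε.ne'
  push_cast
  field_simp

lemma lintegral_comp_affine {ε : ℝ} (hε : 0 < ε) (c : ℝ) {P : ℝ → ℝ≥0∞} (hP : Measurable P) :
    ∫⁻ ξ, P ξ = ENNReal.ofReal ε * ∫⁻ ζ, P (c + ε * ζ) := by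
  rw [← lintegral_map hP (by fun_prop : Measurable fun ζ : ℝ => c + ε * ζ), map_affine_volume hε,
    lintegral_smul_measure, smul_eq_mul, ← mul_assoc, ← ENNReal.ofReal_mul hε.le,
    mul_inv_cancel₀ hε.ne', ENNReal.ofReal_one, one_mul]

/-- For ε ≤ 1 the weight at c + εζ is controlled by the weight at ζ, with a constant that depends on
the carrier frequency c but not on ε. -/
lemma jb_affine_rpow_le {s ε : ℝ} (hs : 0 ≤ s) (hε : 0 < ε) (hε1 : ε ≤ 1) (c ζ : ℝ) :
    jb (c + ε * ζ) ^ s ≤ 2 ^ s * jb c ^ s * jb ζ ^ s := by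
  refine (jb_rpow_add_le_mul hs c (ε * ζ)).trans ?_
  refine mul_le_mul_of_nonneg_left (Real.rpow_le_rpow (jb_pos _).le
    (jb_mul_le (by rwa [abs_of_pos hε]) ζ) hs)
    (mul_nonneg (by positivity) (Real.rpow_nonneg (jb_pos _).le _))

lemma measurable_dilate {ε c : ℝ} {G : ℝ → ℂ} (hG : Measurable G) : Measurable (dilate ε c G) :=
  measurable_const.mul (hG.comp (by fun_prop))

lemma ofReal_jb_mul_dilate_le {s ε : ℝ} (hs : 0 ≤ s) (hε : 0 < ε) (hε1 : ε ≤ 1) (c : ℝ)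
    (f : ℝ → ℂ) (ζ : ℝ) :
    ENNReal.ofReal (jb (c + ε * ζ) ^ s) * ‖dilate ε c (dens s f) (c + ε * ζ)‖ₑ ≤
      ENNReal.ofReal (2 ^ s * jb c ^ s * ε⁻¹) * ‖f ζ‖ₑ := by
  have hc := Real.rpow_nonneg (jb_pos c).le s
  rw [dilate_affine hε, enorm_mul, ← ofReal_norm (_ : ℂ), Complex.norm_real,
    Real.norm_of_nonneg (by positivity)]
  calc _ ≤ ENNReal.ofReal (2 ^ s * jb c ^ s * jb ζ ^ s) *
        (ENNReal.ofReal ε⁻¹ * ‖dens s f ζ‖ₑ) := by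
        gcongr; exact jb_affine_rpow_le hs hε hε1 c ζ
    _ = ENNReal.ofReal (2 ^ s * jb c ^ s) * ENNReal.ofReal ε⁻¹ *
        (ENNReal.ofReal (jb ζ ^ s) * ‖dens s f ζ‖ₑ) := by
        rw [ENNReal.ofReal_mul (by positivity)]; ring
    _ = _ := by
        rw [ofReal_jb_mul_enorm_dens, ← ENNReal.ofReal_mul (by positivity)]

/-- The substitution ξ = c + εζ turns the amplitude factor ε⁻¹ of the dilated transform into ε⁻² · ε
= ε⁻¹ under the squared integral; its root is the factor ε^(-1/2). -/
lemma exists_dens_eq_dilate {s ε : ℝ} (hs : 0 ≤ s) (hε : 0 < ε) (hε1 : ε ≤ 1) (c : ℝ) (f : L2) :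
    ∃ h : L2, dens s h =ᵐ[volume] dilate ε c (dens s f) ∧
      ‖h‖ ≤ 2 ^ s * jb c ^ s * ε ^ (-(1 / 2) : ℝ) * ‖f‖ := by
  have hc := Real.rpow_nonneg (jb_pos c).le s
  have hm := measurable_dilate (ε := ε) (c := c) (measurable_dens s f)
  refine exists_dens_eq s hm.aestronglyMeasurable (by positivity) ?_
  have hmj : Measurable fun ξ => ENNReal.ofReal (jb ξ ^ s) :=
    (continuous_jb_rpow s).measurable.ennreal_ofReal
  have hmm : Measurable fun ξ =>
      (ENNReal.ofReal (jb ξ ^ s) * ‖dilate ε c (dens s f) ξ‖ₑ) ^ 2 :=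
    (hmj.mul hm.enorm).pow_const 2
  rw [lintegral_comp_affine hε c hmm]
  calc _ ≤ ENNReal.ofReal ε * ∫⁻ ζ, (ENNReal.ofReal (2 ^ s * jb c ^ s * ε⁻¹) * ‖f ζ‖ₑ) ^ 2 := by
        refine mul_le_mul_right (lintegral_mono fun ζ => pow_le_pow_left' ?_ 2) _
        exact ofReal_jb_mul_dilate_le hs hε hε1 c f ζ
    _ = ENNReal.ofReal ε * (ENNReal.ofReal (2 ^ s * jb c ^ s * ε⁻¹) ^ 2 * ‖f‖ₑ ^ 2) := by
        simp only [mul_pow]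
        rw [lintegral_const_mul _ ((Lp.stronglyMeasurable f).measurable.enorm.pow_const 2),
          lintegral_sq_enorm]
    _ = _ := by
        rw [← ofReal_norm, ← ENNReal.ofReal_pow (by positivity),
          ← ENNReal.ofReal_pow (by positivity), ← ENNReal.ofReal_mul (by positivity),
          ← ENNReal.ofReal_mul (by positivity), ← ENNReal.ofReal_pow (by positivity)]
        congr 1
        have e : (ε ^ (-(1 / 2) : ℝ)) ^ 2 = ε⁻¹ := by
          rw [← Real.rpow_natCast, ← Real.rpow_mul hε.le, ← Real.rpow_neg_one]; norm_num
        have e' : (2 ^ s * jb c ^ s * ε ^ (-(1 / 2) : ℝ) * ‖f‖) ^ 2 =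
            (2 ^ s * jb c ^ s) ^ 2 * ε⁻¹ * ‖f‖ ^ 2 := by rw [← e]; ring
        rw [e']
        field_simp

/-- The map representing `f ↦ f(εx) e^{2πicx}` on `H^s(ℝ)`. -/
def dil {s ε : ℝ} (hs : 1 / 2 < s) (hε : 0 < ε) (hε1 : ε ≤ 1) (c : ℝ) : L2 →L[ℂ] L2 :=
  have H := fun f => exists_dens_eq_dilate (s := s) (by linarith) hε hε1 c f
  LinearMap.mkContinuous
    { toFun := fun f => (H f).choose
      map_add' := fun f g => by
        apply synth_injective hs
        ext x
        rw [synth_add hs]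
        simp only [synth_eq_of_dens_ae_eq (H _).choose_spec.1, Pi.add_apply,
          fourierInv_dilate hε, ← mul_add]
        congr 1
        exact congrFun (synth_add hs f g) _
      map_smul' := fun a f => by
        apply synth_injective hs
        ext x
        rw [synth_smul]
        simp only [synth_eq_of_dens_ae_eq (H _).choose_spec.1, Pi.smul_apply,
          fourierInv_dilate hε, RingHom.id_apply, smul_eq_mul]
        rw [mul_left_comm]
        congr 1
        exact congrFun (synth_smul s a f) _ }
    (2 ^ s * jb c ^ s * ε ^ (-(1 / 2) : ℝ)) fun f => (H f).choose_spec.2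

section dil

variable {s ε : ℝ} (hs : 1 / 2 < s) (hε : 0 < ε) (hε1 : ε ≤ 1) (c : ℝ)

lemma dens_dil (f : L2) : dens s (dil hs hε hε1 c f) =ᵐ[volume] dilate ε c (dens s f) :=
  (exists_dens_eq_dilate (s := s) (by linarith) hε hε1 c f).choose_spec.1

lemma norm_dil_le (f : L2) :
    ‖dil hs hε hε1 c f‖ ≤ 2 ^ s * jb c ^ s * ε ^ (-(1 / 2) : ℝ) * ‖f‖ :=
  (exists_dens_eq_dilate (s := s) (by linarith) hε hε1 c f).choose_spec.2

lemma synth_dil (f : L2) (x : ℝ) :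
    synth s (dil hs hε hε1 c f) x = fchar x c * synth s f (ε * x) := by
  rw [synth_eq_of_dens_ae_eq (dens_dil hs hε hε1 c f), fourierInv_dilate hε]
  rfl

lemma mulL2_dil {m m' : ℝ →ᵇ ℂ} (hm : ∀ ζ, m (c + ε * ζ) = m' ζ) (f : L2) :
    mulL2 m (dil hs hε hε1 c f) = dil hs hε hε1 c (mulL2 m' f) := by
  apply eq_of_dens_ae_eq (s := s)
  have h := (quasiMeasurePreserving_affine_inv hε c).ae (dens_mulL2 s m' f)
  filter_upwards [dens_mulL2 s m (dil hs hε hε1 c f), dens_dil hs hε hε1 c f,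
    dens_dil hs hε hε1 c (mulL2 m' f), h] with ξ h1 h2 h3 h4
  rw [h1, h2, h3, dilate, dilate, h4, ← hm, mul_left_comm]
  congr 3
  field_simp; ring_nf

/-- Dilated functions multiply `H^s(ℝ)` with a bound that does not depend on the dilation. -/
lemma exists_synth_dil_mul (f g : L2) :
    ∃ h : L2, synth s h = synth s (dil hs hε hε1 c (mulL2 (jbPow 1 zero_le_one) f)) * synth s g ∧
      ‖h‖ ≤ 2 ^ s * (2 ^ s * jb c ^ s * Real.sqrt (∫ ξ, jb ξ ^ (-(2 * 1 : ℝ)))) * ‖f‖ * ‖g‖ := by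
  have hc := Real.rpow_nonneg (jb_pos c).le s
  set K := Real.sqrt (∫ ξ, jb ξ ^ (-(2 * 1 : ℝ)))
  set f' := mulL2 (jbPow 1 zero_le_one) f
  obtain ⟨h, h1, h2⟩ := exists_synth_mul_of_integrable hs (f := dil hs hε hε1 c f')
    (B := 2 ^ s * jb c ^ s * (K * ‖f‖)) (by positivity) (by
      have e1 : ∫⁻ ξ, ENNReal.ofReal (jb ξ ^ s) * ‖dens s (dil hs hε hε1 c f') ξ‖ₑ =
          ∫⁻ ξ, ENNReal.ofReal (jb ξ ^ s) * ‖dilate ε c (dens s f') ξ‖ₑ := by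
        refine lintegral_congr_ae ?_
        filter_upwards [dens_dil hs hε hε1 c f'] with ξ h
        rw [h]
      have hmj : Measurable fun ξ => ENNReal.ofReal (jb ξ ^ s) :=
        (continuous_jb_rpow s).measurable.ennreal_ofReal
      have hmm : Measurable fun ξ => ENNReal.ofReal (jb ξ ^ s) * ‖dilate ε c (dens s f') ξ‖ₑ :=
        hmj.mul (measurable_dilate (measurable_dens s f')).enorm
      rw [e1, lintegral_comp_affine hε c hmm]
      -- In L¹ the Jacobian ε cancels the amplitude ε⁻¹, so the bound does not depend on ε. The one
      -- order of smoothing makes the weighted transform equal to ⟨ζ⟩⁻¹ f, which is integrable.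
      calc _ ≤ ENNReal.ofReal ε * ∫⁻ ζ, ENNReal.ofReal (2 ^ s * jb c ^ s * ε⁻¹) * ‖f' ζ‖ₑ := by
            refine mul_le_mul_right (lintegral_mono fun ζ => ?_) _
            exact ofReal_jb_mul_dilate_le (s := s) (by linarith) hε hε1 c f' ζ
        _ = ENNReal.ofReal ε * (ENNReal.ofReal (2 ^ s * jb c ^ s * ε⁻¹) *
              ∫⁻ ζ, ‖dens 1 f ζ‖ₑ) := by
            rw [lintegral_const_mul _ (Lp.stronglyMeasurable f').measurable.enorm]
            congr 2
            refine lintegral_congr_ae ?_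
            filter_upwards [coeFn_mulL2 (jbPow 1 zero_le_one) f] with ξ h
            rw [h]; rfl
        _ ≤ ENNReal.ofReal ε * (ENNReal.ofReal (2 ^ s * jb c ^ s * ε⁻¹) *
              ENNReal.ofReal (K * ‖f‖)) := by
            gcongr
            exact lintegral_enorm_dens_le (by norm_num) f
        _ = _ := by
            rw [← ENNReal.ofReal_mul (by positivity), ← ENNReal.ofReal_mul (by positivity)]
            congr 1
            field_simp) g
  exact ⟨h, h1, h2.trans (le_of_eq (by ring))⟩

end dil

/-! ### The Wiener algebra of periodic functions -/

/-- Absolutely summable sequences of Fourier coefficients. -/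
abbrev V := lp (fun _ : ℤ => ℂ) 1

lemma summable_norm_V (v : V) : Summable fun k => ‖v k‖ := by
  simpa using (memℓp_gen_iff (p := 1) (by norm_num)).1 (lp.memℓp v)

lemma norm_V_eq (v : V) : ‖v‖ = ∑' k, ‖v k‖ := by
  have := lp.norm_eq_tsum_rpow (p := 1) (by norm_num) v
  simpa using this

/-- The element of `V` with given coefficients. -/
def mkV (a : ℤ → ℂ) (ha : Summable fun k => ‖a k‖) : V :=
  ⟨a, (memℓp_gen_iff (p := 1) (by norm_num)).2 (by simpa using ha)⟩

@[simp] lemma mkV_apply (a : ℤ → ℂ) (ha : Summable fun k => ‖a k‖) (k : ℤ) : mkV a ha k = a k := rfl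

lemma norm_mkV_le_of_le {a : ℤ → ℂ} {ha : Summable fun k => ‖a k‖} {v : V} {c : ℝ}
    (h : ∀ k, ‖a k‖ ≤ c * ‖v k‖) : ‖mkV a ha‖ ≤ c * ‖v‖ := by
  rw [norm_V_eq, norm_V_eq, ← tsum_mul_left]
  exact ha.tsum_le_tsum h ((summable_norm_V v).mul_left c)

lemma norm_bcf_mul_le (m : ℝ →ᵇ ℂ) (ξ : ℝ) (z : ℂ) : ‖m ξ * z‖ ≤ ‖m‖ * ‖z‖ := by
  rw [norm_mul]; exact mul_le_mul_of_nonneg_right (m.norm_coe_le_norm _) (norm_nonneg _)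

lemma summable_bcf_mul (κ : ℝ) (m : ℝ →ᵇ ℂ) (v : V) :
    Summable fun k : ℤ => ‖m (k * κ) * v k‖ :=
  ((summable_norm_V v).mul_left ‖m‖).of_nonneg_of_le (fun _ => norm_nonneg _)
    fun _ => norm_bcf_mul_le m _ _

/-- Multipliers on the Wiener algebra with frequencies in `κℤ`. -/
def mulV (κ : ℝ) : (ℝ →ᵇ ℂ) →L[ℂ] V →L[ℂ] V :=
  LinearMap.mkContinuous₂ (LinearMap.mk₂ ℂ (fun m v => mkV _ (summable_bcf_mul κ m v))
    (fun m m' v => by ext k; simp [add_mul])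
    (fun c m v => by ext k; simp [mul_assoc])
    (fun m v v' => by ext k; simp [mul_add])
    (fun c m v => by ext k; simp [mul_left_comm])) 1
    (fun m v => by
      rw [one_mul]
      exact norm_mkV_le_of_le (ha := summable_bcf_mul κ m v) fun _ => norm_bcf_mul_le m _ _)

@[simp] lemma mulV_apply (κ : ℝ) (m : ℝ →ᵇ ℂ) (v : V) (k : ℤ) :
    mulV κ m v k = m (k * κ) * v k := rfl

lemma norm_mulV_le (κ : ℝ) (m : ℝ →ᵇ ℂ) (v : V) : ‖mulV κ m v‖ ≤ ‖m‖ * ‖v‖ :=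
  norm_mkV_le_of_le (ha := summable_bcf_mul κ m v) fun _ => norm_bcf_mul_le m _ _

/-- The Fourier coefficients of the periodic function represented by `v`. -/
def coefV (s κ : ℝ) (v : V) (k : ℤ) : ℂ := ((jb (k * κ) ^ (-s) : ℝ) : ℂ) * v k

lemma norm_coefV (s κ : ℝ) (v : V) (k : ℤ) : ‖coefV s κ v k‖ = jb (k * κ) ^ (-s) * ‖v k‖ := by
  rw [coefV, norm_mul, Complex.norm_real, Real.norm_of_nonneg (Real.rpow_nonneg (jb_pos _).le _)]

lemma norm_coefV_le {s : ℝ} (hs : 0 ≤ s) (κ : ℝ) (v : V) (k : ℤ) : ‖coefV s κ v k‖ ≤ ‖v k‖ := by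
  rw [norm_coefV]
  exact mul_le_of_le_one_left (norm_nonneg _)
    (Real.rpow_le_one_of_one_le_of_nonpos (one_le_jb _) (by linarith))

/-- The periodic function represented by `v`. -/
def synthV (s κ : ℝ) (v : V) (x : ℝ) : ℂ := ∑' k : ℤ, coefV s κ v k * fchar x (k * κ)

section

variable {s : ℝ} (hs : 0 ≤ s) (κ : ℝ)
include hs

lemma summable_norm_coefV (v : V) : Summable fun k => ‖coefV s κ v k‖ :=
  (summable_norm_V v).of_nonneg_of_le (fun _ => norm_nonneg _) (norm_coefV_le hs κ v)

lemma summable_norm_synthV (v : V) (x : ℝ) :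
    Summable fun k : ℤ => ‖coefV s κ v k * fchar x (k * κ)‖ := by
  simpa using summable_norm_coefV hs κ v

lemma synthV_add (u v : V) : synthV s κ (u + v) = synthV s κ u + synthV s κ v := by
  ext x
  rw [Pi.add_apply, synthV, synthV, synthV, ← (summable_norm_synthV hs κ u x).of_norm.tsum_add
    (summable_norm_synthV hs κ v x).of_norm]
  congr 1; ext k
  simp only [coefV, lp.coeFn_add, Pi.add_apply]; ring

lemma continuous_synthV (v : V) : Continuous (synthV s κ v) := by
  refine continuous_tsum (fun k => continuous_const.mul (continuous_fchar_left _))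
    (summable_norm_coefV hs κ v) fun k x => ?_
  simp

lemma norm_synthV_le (v : V) (x : ℝ) : ‖synthV s κ v x‖ ≤ ‖v‖ := by
  refine (norm_tsum_le_tsum_norm (summable_norm_synthV hs κ v x)).trans ?_
  rw [norm_V_eq]
  refine (summable_norm_synthV hs κ v x).tsum_le_tsum (fun k => ?_) (summable_norm_V v)
  simpa using norm_coefV_le hs κ v k

end

lemma synthV_smul (s κ : ℝ) (c : ℂ) (v : V) : synthV s κ (c • v) = c • synthV s κ v := by
  ext x
  rw [Pi.smul_apply, synthV, synthV, smul_eq_mul, ← tsum_mul_left]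
  congr 1; ext k
  simp only [coefV, lp.coeFn_smul, Pi.smul_apply, smul_eq_mul]; ring

lemma fchar_periodic {k₀ : ℝ} (hk₀ : 0 < k₀) (k : ℤ) (x : ℝ) :
    fchar (x + 2 * Real.pi / k₀) (k * (k₀ / (2 * Real.pi))) =
      fchar x (k * (k₀ / (2 * Real.pi))) := by
  have hk : (k₀ : ℂ) ≠ 0 := by exact_mod_cast hk₀.ne'
  have hp : (Real.pi : ℂ) ≠ 0 := by exact_mod_cast Real.pi_ne_zero
  rw [fchar, fchar, Complex.exp_eq_exp_iff_exists_int]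
  refine ⟨k, ?_⟩
  push_cast
  field_simp

lemma synthV_periodic {k₀ : ℝ} (hk₀ : 0 < k₀) (s : ℝ) (v : V) :
    Function.Periodic (synthV s (k₀ / (2 * Real.pi)) v) (2 * Real.pi / k₀) := fun x => by
  simp only [synthV, fchar_periodic hk₀]

lemma integral_fchar_mul_exp {k₀ : ℝ} (hk₀ : 0 < k₀) (j k : ℤ) :
    ∫ x in Ioc 0 (2 * Real.pi / k₀),
      fchar x (j * (k₀ / (2 * Real.pi))) * Complex.exp (-(Complex.I * k * k₀ * x)) =
      if j = k then ((2 * Real.pi / k₀ : ℝ) : ℂ) else 0 := by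
  have hk : (k₀ : ℂ) ≠ 0 := by exact_mod_cast hk₀.ne'
  have hp : (Real.pi : ℂ) ≠ 0 := by exact_mod_cast Real.pi_ne_zero
  have hP : 0 ≤ 2 * Real.pi / k₀ := by positivity
  have e : ∀ x : ℝ, fchar x (j * (k₀ / (2 * Real.pi))) * Complex.exp (-(Complex.I * k * k₀ * x)) =
      Complex.exp ((((j - k : ℤ) : ℂ) * k₀ * Complex.I) * x) := fun x => by
    rw [fchar, ← Complex.exp_add]
    congr 1; push_cast; field_simp; ring
  simp only [e]
  rw [← intervalIntegral.integral_of_le hP]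
  split_ifs with h
  · subst h; simp
  · have hc : (((j - k : ℤ) : ℂ) * k₀ * Complex.I) ≠ 0 :=
      mul_ne_zero (mul_ne_zero (by exact_mod_cast sub_ne_zero.2 h) hk) Complex.I_ne_zero
    rw [integral_exp_mul_complex hc, div_eq_zero_iff]
    left
    rw [sub_eq_zero, Complex.exp_eq_exp_iff_exists_int]
    refine ⟨j - k, ?_⟩
    push_cast
    field_simp
    ring

lemma perCoeff_synthV {k₀ s : ℝ} (hk₀ : 0 < k₀) (hs : 0 ≤ s) (v : V) (k : ℤ) :
    perCoeff k₀ (synthV s (k₀ / (2 * Real.pi)) v) k =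
      ((2 * Real.pi / k₀ : ℝ) : ℂ) * coefV s (k₀ / (2 * Real.pi)) v k := by
  have hP : 0 ≤ 2 * Real.pi / k₀ := by positivity
  set κ := k₀ / (2 * Real.pi) with hκ
  have hexp : ∀ x : ℝ, ‖Complex.exp (-(Complex.I * k * k₀ * x))‖ = 1 := fun x => by
    rw [show -(Complex.I * k * k₀ * x) = ((-(k * k₀ * x) : ℝ) : ℂ) * Complex.I by push_cast; ring,
      Complex.norm_exp_ofReal_mul_I]
  have h := hasSum_integral_of_summable_integral_norm
    (μ := volume.restrict (Ioc 0 (2 * Real.pi / k₀)))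
    (F := fun (j : ℤ) (x : ℝ) => coefV s κ v j * fchar x (j * κ) *
      Complex.exp (-(Complex.I * k * k₀ * x)))
    (fun j => by
      have hc : Continuous fun x : ℝ => coefV s κ v j * fchar x (j * κ) *
          Complex.exp (-(Complex.I * k * k₀ * x)) := by
        have := continuous_fchar_left (j * κ)
        fun_prop
      exact (hc.integrableOn_Icc (a := 0) (b := 2 * Real.pi / k₀)).mono_set Ioc_subset_Icc_self)
    (by
      simp only [norm_mul, norm_fchar, hexp, mul_one]
      simpa [hP] using (summable_norm_coefV hs κ v).mul_left (2 * Real.pi / k₀))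
  have e1 : ∀ j : ℤ, ∫ x in Ioc 0 (2 * Real.pi / k₀), coefV s κ v j * fchar x (j * κ) *
      Complex.exp (-(Complex.I * k * k₀ * x)) =
      if j = k then ((2 * Real.pi / k₀ : ℝ) : ℂ) * coefV s κ v k else 0 := fun j => by
    simp only [mul_assoc (coefV s κ v j)]
    rw [integral_const_mul, hκ, integral_fchar_mul_exp hk₀]
    split_ifs with h
    · rw [h, mul_comm]
    · simp
  have e2 := h.tsum_eq
  simp only [e1, tsum_ite_eq] at e2
  rw [e2, perCoeff]
  congr 1; ext x
  rw [synthV, tsum_mul_right]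

lemma synthV_injective {k₀ s : ℝ} (hk₀ : 0 < k₀) (hs : 0 ≤ s) {v : V}
    (h : synthV s (k₀ / (2 * Real.pi)) v = 0) : v = 0 := by
  ext k
  have h1 := perCoeff_synthV hk₀ hs v k
  rw [h] at h1
  have h2 : perCoeff k₀ 0 k = 0 := by simp [perCoeff]
  rw [h2, coefV] at h1
  have h3 : ((2 * Real.pi / k₀ : ℝ) : ℂ) ≠ 0 := by
    exact_mod_cast (by positivity : 2 * Real.pi / k₀ ≠ 0)
  have h4 : ((jb (k * (k₀ / (2 * Real.pi))) ^ (-s) : ℝ) : ℂ) ≠ 0 := by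
    exact_mod_cast (Real.rpow_pos_of_pos (jb_pos _) _).ne'
  simpa [h3, h4, hk₀.ne'] using h1.symm

/-- The Wiener algebra is contained in `H^s_per`. -/
lemma exists_hsPerNorm_synthV_le {k₀ s : ℝ} (hk₀ : 0 < k₀) (hs : 0 ≤ s) :
    ∃ C : ℝ, 0 ≤ C ∧ ∀ v : V, hsPerNorm k₀ s (synthV s (k₀ / (2 * Real.pi)) v) ≤
      ENNReal.ofReal (C * ‖v‖) := by
  set κ := k₀ / (2 * Real.pi) with hκ
  have hP : 0 < 2 * Real.pi / k₀ := by positivity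
  -- H^s_per is weighted with the index k, the Wiener algebra with the wave number k k₀; the factor
  -- b compares the two.
  set b : ℝ := max 1 k₀⁻¹ with hb
  have hb1 : 1 ≤ b := le_max_left _ _
  have hjb : ∀ k : ℤ, (1 + (k : ℝ) ^ 2) ≤ (b * jb (k * κ)) ^ 2 := fun k => by
    have e : 2 * Real.pi * (k * κ) = k * k₀ := by rw [hκ]; field_simp
    rw [mul_pow, jb_sq, e]
    have h1 : 1 ≤ b * k₀ := by
      calc (1 : ℝ) = k₀⁻¹ * k₀ := by field_simp
        _ ≤ _ := mul_le_mul_of_nonneg_right (le_max_right _ _) hk₀.le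
    nlinarith [mul_le_mul_of_nonneg_right (one_le_pow₀ h1 : 1 ≤ (b * k₀) ^ 2) (sq_nonneg (k : ℝ)),
      one_le_pow₀ hb1 (n := 2)]
  refine ⟨b ^ s * (2 * Real.pi / k₀), by positivity, fun v => ?_⟩
  have hmem : MemLp (synthV s κ v) 2 (volume.restrict (Ioc 0 (2 * Real.pi / k₀))) :=
    MemLp.of_bound (continuous_synthV hs κ v).aestronglyMeasurable ‖v‖
      (Eventually.of_forall fun x => norm_synthV_le hs κ v x)
  rw [hsPerNorm, if_pos ⟨synthV_periodic hk₀ s v, hmem⟩]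
  set C := b ^ s * (2 * Real.pi / k₀)
  have hC : 0 ≤ C := by positivity
  have hterm : ∀ k : ℤ, ENNReal.ofReal ((1 + (k : ℝ) ^ 2) ^ s) * ‖perCoeff k₀ (synthV s κ v) k‖ₑ ^ 2
      ≤ ENNReal.ofReal ((C * ‖v k‖) ^ 2) := fun k => by
    rw [perCoeff_synthV hk₀ hs, ← ofReal_norm, norm_mul, Complex.norm_real,
      Real.norm_of_nonneg hP.le, norm_coefV, ← ENNReal.ofReal_pow (by
        have := Real.rpow_nonneg (jb_pos (k * κ)).le (-s); positivity),
      ← ENNReal.ofReal_mul (by positivity)]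
    refine ENNReal.ofReal_le_ofReal ?_
    have h1 : (1 + (k : ℝ) ^ 2) ^ s ≤ (b ^ s * jb (k * κ) ^ s) ^ 2 := by
      calc _ ≤ ((b * jb (k * κ)) ^ 2) ^ s := Real.rpow_le_rpow (by positivity) (hjb k) hs
        _ = _ := by
          rw [← Real.mul_rpow (by positivity) (jb_pos _).le, ← Real.rpow_natCast,
            ← Real.rpow_natCast, ← Real.rpow_mul (mul_nonneg (by positivity) (jb_pos _).le),
            ← Real.rpow_mul (mul_nonneg (by positivity) (jb_pos _).le), mul_comm s]
    have h2 : jb (k * κ) ^ s * jb (k * κ) ^ (-s) = 1 := by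
      rw [← Real.rpow_add (jb_pos _)]; simp
    calc _ ≤ (b ^ s * jb (k * κ) ^ s) ^ 2 *
          (2 * Real.pi / k₀ * (jb (k * κ) ^ (-s) * ‖v k‖)) ^ 2 := by gcongr
      _ = (b ^ s * (2 * Real.pi / k₀) * ‖v k‖ * (jb (k * κ) ^ s * jb (k * κ) ^ (-s))) ^ 2 := by
          ring
      _ = _ := by rw [h2, mul_one]
  have hsum : Summable fun k => C * ‖v k‖ := (summable_norm_V v).mul_left C
  -- The inclusion ℓ¹ ⊂ ℓ²: one of the two factors is bounded by the sum.
  have hsq : ∑' k, ENNReal.ofReal ((C * ‖v k‖) ^ 2) ≤ ENNReal.ofReal (C * ‖v‖) ^ 2 := by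
    have hle : ∀ k, C * ‖v k‖ ≤ C * ‖v‖ := fun k =>
      mul_le_mul_of_nonneg_left (lp.norm_apply_le_norm (by norm_num) v k) hC
    calc _ ≤ ∑' k, ENNReal.ofReal (C * ‖v‖) * ENNReal.ofReal (C * ‖v k‖) := by
          refine ENNReal.tsum_le_tsum fun k => ?_
          rw [← ENNReal.ofReal_mul (by positivity)]
          refine ENNReal.ofReal_le_ofReal ?_
          rw [sq]
          exact mul_le_mul_of_nonneg_right (hle k) (by positivity)
      _ = _ := by
          rw [ENNReal.tsum_mul_left, ← ENNReal.ofReal_tsum_of_nonneg (fun k => by positivity) hsum,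
            tsum_mul_left, ← norm_V_eq, sq]
  calc _ ≤ (ENNReal.ofReal (C * ‖v‖) ^ 2) ^ (1 / 2 : ℝ) :=
        ENNReal.rpow_le_rpow ((ENNReal.tsum_le_tsum hterm).trans hsq) (by norm_num)
    _ = _ := by rw [← ENNReal.rpow_natCast, ← ENNReal.rpow_mul]; norm_num

/-- The Wiener algebra is an algebra. -/
lemma exists_synthV_mul {s : ℝ} (hs : 0 ≤ s) (κ : ℝ) (u v : V) :
    ∃ h : V, synthV s κ h = synthV s κ u * synthV s κ v ∧ ‖h‖ ≤ 2 ^ s * (‖u‖ * ‖v‖) := by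
  let T : ℤ × ℤ → ℂ := fun p => ((jb ((p.1 + p.2 : ℤ) * κ) ^ s : ℝ) : ℂ) *
    (coefV s κ u p.1 * coefV s κ v p.2)
  have hT : ∀ p, ‖T p‖ ≤ 2 ^ s * (‖u p.1‖ * ‖v p.2‖) := fun p => by
    have h1 := jb_rpow_add_le_mul hs (p.1 * κ) (p.2 * κ)
    have hx := Real.rpow_pos_of_pos (jb_pos (p.1 * κ)) s
    have hy := Real.rpow_pos_of_pos (jb_pos (p.2 * κ)) s
    simp only [T, norm_mul, Complex.norm_real, norm_coefV]
    rw [Real.norm_of_nonneg (Real.rpow_nonneg (jb_pos _).le _), Int.cast_add, add_mul,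
      Real.rpow_neg (jb_pos _).le, Real.rpow_neg (jb_pos _).le]
    calc _ ≤ (2 ^ s * jb (p.1 * κ) ^ s * jb (p.2 * κ) ^ s) *
          ((jb (p.1 * κ) ^ s)⁻¹ * ‖u p.1‖ * ((jb (p.2 * κ) ^ s)⁻¹ * ‖v p.2‖)) := by gcongr
      _ = _ := by
        generalize jb (p.1 * κ) ^ s = X at hx
        generalize jb (p.2 * κ) ^ s = Y at hy
        field_simp
  have hsum0 : Summable fun p : ℤ × ℤ => ‖u p.1‖ * ‖v p.2‖ :=
    (summable_norm_V u).mul_of_nonneg (summable_norm_V v) (fun _ => norm_nonneg _)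
      fun _ => norm_nonneg _
  have hsum : Summable fun p => ‖T p‖ :=
    (hsum0.mul_left (2 ^ s)).of_nonneg_of_le (fun _ => norm_nonneg _) hT
  -- The reindexing (n, k) ↦ (k, n - k) sorts the double series by total frequency n, so that the
  -- inner sums are the coefficients of the product.
  let e : ℤ × ℤ ≃ ℤ × ℤ :=
    { toFun := fun q => (q.2, q.1 - q.2), invFun := fun p => (p.1 + p.2, p.1)
      left_inv := fun q => by simp, right_inv := fun p => by simp }
  have hsum' : Summable fun q => ‖T (e q)‖ := (e.summable_iff (f := fun p => ‖T p‖)).2 hsum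
  have hrow : ∀ n, Summable fun k => ‖T (e (n, k))‖ := fun n => hsum'.prod_factor n
  have hcol : Summable fun n => ∑' k, ‖T (e (n, k))‖ := hsum'.prod
  have ha : Summable fun n => ‖∑' k, T (e (n, k))‖ :=
    hcol.of_nonneg_of_le (fun _ => norm_nonneg _) fun n => norm_tsum_le_tsum_norm (hrow n)
  refine ⟨mkV _ ha, ?_, ?_⟩
  · ext x
    have hu := summable_norm_synthV hs κ u x
    have hv := summable_norm_synthV hs κ v x
    rw [Pi.mul_apply, synthV, synthV, synthV, tsum_mul_tsum_of_summable_norm hu hv]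
    have hF : Summable fun p : ℤ × ℤ => ‖coefV s κ u p.1 * fchar x (p.1 * κ) *
        (coefV s κ v p.2 * fchar x (p.2 * κ))‖ := by
      have := hu.mul_of_nonneg hv (fun _ => norm_nonneg _) fun _ => norm_nonneg _
      simpa only [norm_mul] using this
    rw [← e.tsum_eq]
    have hF' := (e.summable_iff (f := fun p : ℤ × ℤ => coefV s κ u p.1 * fchar x (p.1 * κ) *
        (coefV s κ v p.2 * fchar x (p.2 * κ)))).2 hF.of_norm
    simp only [Function.comp_def] at hF'
    rw [Summable.tsum_prod hF']
    congr 1; ext n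
    rw [coefV, mkV_apply, ← tsum_mul_left, ← tsum_mul_right]
    congr 1; ext k
    have h1 : fchar x (n * κ) = fchar x (k * κ) * fchar x ((n - k : ℤ) * κ) := by
      rw [fchar, fchar, fchar, ← Complex.exp_add]; congr 1; push_cast; ring
    have h2 : ((jb (n * κ) ^ (-s) : ℝ) : ℂ) * ((jb (n * κ) ^ s : ℝ) : ℂ) = 1 := by
      rw [← Complex.ofReal_mul, ← Real.rpow_add (jb_pos _)]; simp
    simp only [T, e, Equiv.coe_fn_mk, add_sub_cancel]
    rw [h1]
    linear_combination (coefV s κ u k * coefV s κ v (n - k) *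
      (fchar x (k * κ) * fchar x ((n - k : ℤ) * κ))) * h2
  · rw [norm_V_eq]
    simp only [mkV_apply]
    calc _ ≤ ∑' n, ∑' k, ‖T (e (n, k))‖ :=
          ha.tsum_le_tsum (fun n => norm_tsum_le_tsum_norm (hrow n)) hcol
      _ = ∑' p, ‖T p‖ := by
          rw [← e.tsum_eq (fun p => ‖T p‖), ← hsum'.tsum_prod]
      _ ≤ ∑' p : ℤ × ℤ, 2 ^ s * (‖u p.1‖ * ‖v p.2‖) := hsum.tsum_le_tsum hT (hsum0.mul_left _)
      _ = _ := by
          rw [tsum_mul_left, norm_V_eq, norm_V_eq,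
            (summable_norm_V u).tsum_mul_tsum (summable_norm_V v) hsum0]

/-- Evaluation of `H^s` functions at a point. -/
def evL2 {s : ℝ} (hs : 1 / 2 < s) (x : ℝ) : L2 →L[ℂ] ℂ :=
  LinearMap.mkContinuous ((LinearMap.proj x).comp (synthₗ hs))
    (Real.sqrt (∫ ξ, jb ξ ^ (-(2 * s)))) fun f => norm_synth_le hs f x

@[simp] lemma evL2_apply {s : ℝ} (hs : 1 / 2 < s) (x : ℝ) (f : L2) : evL2 hs x f = synth s f x := rfl

/-- The Wiener algebra acts on `H^s(ℝ)` by multiplication. -/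
lemma exists_synthV_mul_synth {s : ℝ} (hs : 1 / 2 < s) (κ : ℝ) (v : V) (f : L2) :
    ∃ h : L2, synth s h = synthV s κ v * synth s f ∧ ‖h‖ ≤ 2 ^ s * (‖v‖ * ‖f‖) := by
  have hs0 : 0 ≤ s := by linarith
  -- Multiplication by a single character is a frequency shift, that is `dil` without dilation. Its
  -- norm ⟨kκ⟩^s cancels against the weight in the coefficient, and the series converges absolutely.
  let T : ℤ → L2 := fun k => coefV s κ v k • dil hs one_pos le_rfl (k * κ) f
  have hT : ∀ k, ‖T k‖ ≤ 2 ^ s * (‖v k‖ * ‖f‖) := fun k => by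
    have h := norm_dil_le hs one_pos le_rfl (k * κ) f
    have hx := Real.rpow_pos_of_pos (jb_pos (k * κ)) s
    simp only [T, norm_smul, norm_coefV]
    rw [Real.rpow_neg (jb_pos _).le]
    calc _ ≤ (jb (k * κ) ^ s)⁻¹ * ‖v k‖ *
          (2 ^ s * jb (k * κ) ^ s * 1 ^ (-(1 / 2) : ℝ) * ‖f‖) := by gcongr
      _ = _ := by rw [Real.one_rpow]; field_simp
  have hsum0 : Summable fun k => 2 ^ s * (‖v k‖ * ‖f‖) :=
    ((summable_norm_V v).mul_right _).mul_left _
  have hsum : Summable fun k => ‖T k‖ := hsum0.of_nonneg_of_le (fun _ => norm_nonneg _) hT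
  refine ⟨∑' k, T k, ?_, ?_⟩
  · ext x
    rw [← evL2_apply hs, ContinuousLinearMap.map_tsum _ hsum.of_norm, Pi.mul_apply, synthV,
      ← tsum_mul_right]
    congr 1; ext k
    simp [T, synth_dil, mul_assoc]
  · calc _ ≤ ∑' k, ‖T k‖ := norm_tsum_le_tsum_norm hsum
      _ ≤ ∑' k, 2 ^ s * (‖v k‖ * ‖f‖) := hsum.tsum_le_tsum hT hsum0
      _ = _ := by rw [tsum_mul_left, tsum_mul_right, ← norm_V_eq]

/-! ### Banach spaces which are algebras of functions -/

/-- A continuous product on a normed space `X`, which is the pointwise product for an embedding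
of `X` into the functions `ℝ → ℂ × ℂ`. -/
structure FunAlg (X : Type*) [NormedAddCommGroup X] [NormedSpace ℂ X] where
  /-- the embedding -/
  σ : X →ₗ[ℂ] (ℝ → ℂ × ℂ)
  inj : Function.Injective σ
  /-- the product -/
  mul : X →L[ℂ] X →L[ℂ] X
  σ_mul : ∀ a b, σ (mul a b) = σ a * σ b

namespace FunAlg

variable {X : Type*} [NormedAddCommGroup X] [NormedSpace ℂ X]

/-- The algebra obtained from a bound for the products of functions. -/
def ofExists (σ : X →ₗ[ℂ] (ℝ → ℂ × ℂ)) (inj : Function.Injective σ) (K : ℝ)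
    (H : ∀ a b, ∃ h, σ h = σ a * σ b ∧ ‖h‖ ≤ K * (‖a‖ * ‖b‖)) : FunAlg X where
  σ := σ
  inj := inj
  mul := LinearMap.mkContinuous₂ (LinearMap.mk₂ ℂ (fun a b => (H a b).choose)
    (fun a a' b => inj (by
      rw [(H (a + a') b).choose_spec.1, map_add σ (H a b).choose, (H a b).choose_spec.1,
        (H a' b).choose_spec.1, map_add, add_mul]))
    (fun c a b => inj (by
      rw [(H (c • a) b).choose_spec.1, map_smul σ c (H a b).choose, (H a b).choose_spec.1,
        map_smul, smul_mul_assoc]))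
    (fun a b b' => inj (by
      rw [(H a (b + b')).choose_spec.1, map_add σ (H a b).choose, (H a b).choose_spec.1,
        (H a b').choose_spec.1, map_add, mul_add]))
    (fun c a b => inj (by
      rw [(H a (c • b)).choose_spec.1, map_smul σ c (H a b).choose, (H a b).choose_spec.1,
        map_smul, mul_smul_comm]))) K
    (fun a b => (H a b).choose_spec.2.trans_eq (mul_assoc _ _ _).symm)
  σ_mul := fun a b => (H a b).choose_spec.1

lemma norm_ofExists_mul_le (σ : X →ₗ[ℂ] (ℝ → ℂ × ℂ)) (inj : Function.Injective σ) (K : ℝ)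
    (H : ∀ a b, ∃ h, σ h = σ a * σ b ∧ ‖h‖ ≤ K * (‖a‖ * ‖b‖)) (a b : X) :
    ‖(ofExists σ inj K H).mul a b‖ ≤ K * (‖a‖ * ‖b‖) := (H a b).choose_spec.2

/-- Commutativity, associativity and all other identities of the product are verified pointwise
through this injectivity; no ring structure is needed on `X`. -/
lemma ext (A : FunAlg X) {a b : X} (h : ∀ x, A.σ a x = A.σ b x) : a = b := A.inj (funext h)

lemma σ_mul_apply (A : FunAlg X) (a b : X) (x : ℝ) : A.σ (A.mul a b) x = A.σ a x * A.σ b x :=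
  congrFun (A.σ_mul a b) x

end FunAlg

/-! ### Complex conjugation -/

lemma measurePreserving_neg_real : MeasurePreserving (Neg.neg : ℝ → ℝ) volume volume :=
  Measure.measurePreserving_neg volume

/-- Complex conjugation on `L²(ℝ)`, on the frequency side. -/
def conjL2 : L2 →L[ℝ] L2 :=
  ((Complex.conjCLE : ℂ →L[ℝ] ℂ).compLpL 2 volume).comp
    (Lp.compMeasurePreservingₗᵢ ℝ Neg.neg measurePreserving_neg_real).toContinuousLinearMap

lemma coeFn_conjL2 (f : L2) : conjL2 f =ᵐ[volume] fun ξ => conj (f (-ξ)) := by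
  have h1 := ContinuousLinearMap.coeFn_compLp (Complex.conjCLE : ℂ →L[ℝ] ℂ)
    (Lp.compMeasurePreserving Neg.neg measurePreserving_neg_real f)
  have h2 := Lp.coeFn_compMeasurePreserving f measurePreserving_neg_real
  filter_upwards [h1, h2] with ξ h1 h2
  refine h1.trans ?_
  rw [h2]; rfl

lemma dens_conjL2 (s : ℝ) (f : L2) :
    dens s (conjL2 f) =ᵐ[volume] fun ξ => conj (dens s f (-ξ)) := by
  filter_upwards [coeFn_conjL2 f] with ξ h
  rw [dens, h, dens, map_mul, Complex.conj_ofReal, jb_neg]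

@[simp] lemma conj_fchar (x ξ : ℝ) : conj (fchar x ξ) = fchar x (-ξ) := by
  rw [fchar, fchar, ← Complex.exp_conj]; congr 1
  rw [map_mul, Complex.conj_ofReal, Complex.conj_I]; push_cast; ring

lemma synth_conjL2 (s : ℝ) (f : L2) (x : ℝ) : synth s (conjL2 f) x = conj (synth s f x) := by
  rw [synth_eq_of_dens_ae_eq (dens_conjL2 s f), fourierInv_eq_integral_fchar, synth_apply,
    ← integral_conj, ← integral_neg_eq_self]
  congr 1; ext ξ
  rw [map_mul, conj_fchar, neg_neg]

/-- The multiplier `ξ ↦ conj m(-ξ)`. -/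
def starNeg (m : ℝ →ᵇ ℂ) : ℝ →ᵇ ℂ :=
  star (m.compContinuous ⟨Neg.neg, continuous_neg⟩)

@[simp] lemma starNeg_apply (m : ℝ →ᵇ ℂ) (ξ : ℝ) : starNeg m ξ = conj (m (-ξ)) := rfl

lemma conjL2_mulL2 (m : ℝ →ᵇ ℂ) (f : L2) : conjL2 (mulL2 m f) = mulL2 (starNeg m) (conjL2 f) := by
  refine Lp.ext ?_
  have h := (measurePreserving_neg_real.quasiMeasurePreserving).ae (coeFn_mulL2 m f)
  filter_upwards [coeFn_conjL2 (mulL2 m f), coeFn_mulL2 (starNeg m) (conjL2 f), coeFn_conjL2 f, h]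
    with ξ h1 h2 h3 h4
  rw [h1, h2, h3, h4, map_mul]; rfl

lemma summable_conjV (v : V) : Summable fun k => ‖conj (v (-k))‖ := by
  simp only [RCLike.norm_conj]
  exact ((Equiv.neg ℤ).summable_iff (f := fun k => ‖v k‖)).2 (summable_norm_V v)

/-- Complex conjugation on the Wiener algebra, on the frequency side. -/
def conjV : V →L[ℝ] V :=
  LinearMap.mkContinuous
    { toFun := fun v => mkV _ (summable_conjV v)
      map_add' := fun u v => by ext k; simp
      map_smul' := fun c v => by ext k; simp } 1 fun v => by
    rw [one_mul, norm_V_eq, norm_V_eq, ← (Equiv.neg ℤ).tsum_eq (fun k => ‖v k‖)]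
    simp

@[simp] lemma conjV_apply (v : V) (k : ℤ) : conjV v k = conj (v (-k)) := rfl

lemma synthV_conjV (s κ : ℝ) (v : V) (x : ℝ) : synthV s κ (conjV v) x = conj (synthV s κ v x) := by
  rw [synthV, synthV, Complex.conj_tsum, ← (Equiv.neg ℤ).tsum_eq]
  congr 1; ext k
  simp [coefV]

lemma conjV_mulV (κ : ℝ) (m : ℝ →ᵇ ℂ) (v : V) : conjV (mulV κ m v) = mulV κ (starNeg m) (conjV v) := by
  ext k; simp

/-! ### Sums of periodic and localized functions -/

/-- Pairs of a periodic and a localized function. -/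
abbrev E := V × L2

/-- Pairs of a constant and a localized function. -/
abbrev Y := ℂ × L2

/-- Multipliers on pairs of a periodic and a localized function. -/
def mulE (κ : ℝ) : (ℝ →ᵇ ℂ) →L[ℂ] E →L[ℂ] E :=
  (ContinuousLinearMap.prodMapL ℂ V V L2 L2).comp ((mulV κ).prod mulL2)

@[simp] lemma mulE_apply (κ : ℝ) (m : ℝ →ᵇ ℂ) (e : E) :
    mulE κ m e = (mulV κ m e.1, mulL2 m e.2) := rfl

lemma norm_mulE_le (κ : ℝ) (m : ℝ →ᵇ ℂ) (e : E) : ‖mulE κ m e‖ ≤ ‖m‖ * ‖e‖ := by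
  refine (Prod.norm_def _).trans_le (max_le ?_ ?_)
  · exact (norm_mulV_le κ m e.1).trans (mul_le_mul_of_nonneg_left (norm_fst_le e) (norm_nonneg _))
  · exact (norm_mulL2_le m e.2).trans (mul_le_mul_of_nonneg_left (norm_snd_le e) (norm_nonneg _))

lemma mulE_mulE (κ : ℝ) (m m' : ℝ →ᵇ ℂ) (e : E) :
    mulE κ m (mulE κ m' e) = mulE κ (m * m') e := by
  ext1
  · ext k; simp [mul_assoc]
  · simp [mulL2_mulL2]

lemma mulE_one (κ : ℝ) (e : E) : mulE κ 1 e = e := by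
  ext1
  · ext k; simp
  · simp [mulL2_one]

/-- Multipliers on pairs of a constant and a localized function. -/
def mulY : (ℝ →ᵇ ℂ) →L[ℂ] Y →L[ℂ] Y :=
  (ContinuousLinearMap.prodMapL ℂ ℂ ℂ L2 L2).comp
    (((ContinuousLinearMap.mul ℂ ℂ).comp (BoundedContinuousFunction.evalCLM ℂ 0)).prod mulL2)

@[simp] lemma mulY_apply (m : ℝ →ᵇ ℂ) (b : Y) : mulY m b = (m 0 * b.1, mulL2 m b.2) := rfl

lemma norm_mulY_le (m : ℝ →ᵇ ℂ) (b : Y) : ‖mulY m b‖ ≤ ‖m‖ * ‖b‖ := by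
  refine (Prod.norm_def _).trans_le (max_le ?_ ?_)
  · exact (norm_bcf_mul_le m 0 b.1).trans
      (mul_le_mul_of_nonneg_left (norm_fst_le b) (norm_nonneg _))
  · exact (norm_mulL2_le m b.2).trans (mul_le_mul_of_nonneg_left (norm_snd_le b) (norm_nonneg _))

lemma mulY_mulY (m m' : ℝ →ᵇ ℂ) (b : Y) : mulY m (mulY m' b) = mulY (m * m') b := by
  ext1
  · simp [mul_assoc]
  · simp [mulL2_mulL2]

lemma mulY_one (b : Y) : mulY 1 b = b := by
  ext1
  · simp
  · simp [mulL2_one]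

/-- Complex conjugation on `E`. -/
def conjE : E →L[ℝ] E := conjV.prodMap conjL2

@[simp] lemma conjE_apply (e : E) : conjE e = (conjV e.1, conjL2 e.2) := rfl

/-- Complex conjugation on `Y`. -/
def conjY : Y →L[ℝ] Y := (Complex.conjCLE : ℂ →L[ℝ] ℂ).prodMap conjL2

@[simp] lemma conjY_apply (b : Y) : conjY b = (conj b.1, conjL2 b.2) := rfl

lemma conjE_mulE (κ : ℝ) (m : ℝ →ᵇ ℂ) (e : E) :
    conjE (mulE κ m e) = mulE κ (starNeg m) (conjE e) := by
  simp [conjV_mulV, conjL2_mulL2]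

lemma conjY_mulY (m : ℝ →ᵇ ℂ) (b : Y) : conjY (mulY m b) = mulY (starNeg m) (conjY b) := by
  simp [conjL2_mulL2]

section Y

variable {r : ℝ} (hr : 1 / 2 < r)

/-- The functions represented by the elements of `Y`. -/
def sigmaY : Y →ₗ[ℂ] (ℝ → ℂ × ℂ) where
  toFun b x := (b.1, b.1 + synth r b.2 x)
  map_add' b b' := by
    ext x <;> simp [synth_add hr]
    ring
  map_smul' c b := by ext x <;> simp [synth_smul, mul_add]

lemma sigmaY_apply (b : Y) (x : ℝ) : sigmaY hr b x = (b.1, b.1 + synth r b.2 x) := rfl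

/-- The limit at infinity recovers the constant, since the localized part vanishes there; hence the
second component alone determines the element. -/
lemma eq_zero_of_sigmaY_snd {b : Y} (h : ∀ x, (sigmaY hr b x).2 = 0) : b = 0 := by
  have h0 : b.1 = 0 := by
    have h1 : Tendsto (fun x => (sigmaY hr b x).2) atTop (𝓝 (b.1 + 0)) :=
      tendsto_const_nhds.add (tendsto_synth r b.2)
    simp only [h, add_zero] at h1
    exact tendsto_nhds_unique h1 tendsto_const_nhds
  ext1
  · exact h0
  · refine synth_injective hr ?_
    rw [Prod.snd_zero, synth_zero hr]
    ext x
    simpa [sigmaY_apply, h0] using h x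

lemma sigmaY_injective : Function.Injective (sigmaY hr) :=
  (injective_iff_map_eq_zero _).2 fun b hb =>
    eq_zero_of_sigmaY_snd hr fun x => by rw [hb]; rfl

lemma exists_sigmaY_mul : ∃ K : ℝ, ∀ a b : Y, ∃ h : Y, sigmaY hr h = sigmaY hr a * sigmaY hr b ∧
    ‖h‖ ≤ K * (‖a‖ * ‖b‖) := by
  obtain ⟨C, hC, H⟩ := exists_synth_mul hr
  refine ⟨2 + C, fun a b => ?_⟩
  obtain ⟨h, h1, h2⟩ := H a.2 b.2
  refine ⟨(a.1 * b.1, a.1 • b.2 + b.1 • a.2 + h), ?_, ?_⟩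
  · ext x
    · simp [sigmaY_apply]
    · simp only [sigmaY_apply, synth_add hr, synth_smul, h1, Pi.add_apply, Pi.smul_apply,
        Pi.mul_apply, smul_eq_mul, Prod.snd_mul]
      ring
  · have ha1 := norm_fst_le a
    have ha2 := norm_snd_le a
    have hb1 := norm_fst_le b
    have hb2 := norm_snd_le b
    have e11 : ‖a.1‖ * ‖b.1‖ ≤ ‖a‖ * ‖b‖ := by gcongr
    have e12 : ‖a.1‖ * ‖b.2‖ ≤ ‖a‖ * ‖b‖ := by gcongr
    have e21 : ‖b.1‖ * ‖a.2‖ ≤ ‖a‖ * ‖b‖ := by rw [mul_comm]; gcongr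
    have e22 : C * (‖a.2‖ * ‖b.2‖) ≤ C * (‖a‖ * ‖b‖) := by gcongr
    have hp : 0 ≤ ‖a‖ * ‖b‖ := by positivity
    refine (Prod.norm_def _).trans_le (max_le ?_ ?_)
    · simp only [norm_mul]
      nlinarith [mul_nonneg hC hp]
    · refine (norm_add₃_le).trans ?_
      rw [norm_smul, norm_smul]
      linarith

/-- The algebra `ℂ ⊕ H^r(ℝ)`. -/
def algY : FunAlg Y :=
  FunAlg.ofExists (sigmaY hr) (sigmaY_injective hr) (exists_sigmaY_mul hr).choose
    (exists_sigmaY_mul hr).choose_spec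

lemma algY_σ (b : Y) (x : ℝ) : (algY hr).σ b x = (b.1, b.1 + synth r b.2 x) := rfl

lemma algY_σ_jbPow {p : ℝ} (hp : 0 ≤ p) (hrp : 1 / 2 < r + p) (b : Y) (x : ℝ) :
    (algY hr).σ (mulY (jbPow p hp) b) x = (algY hrp).σ b x := by
  rw [algY_σ, algY_σ, mulY_apply, synth_mulL2_jbPow]
  simp

/-- Both sides represent the same pointwise product, once multiplied in H^r and once in the smaller
algebra H^(r+p). This is how regularity is carried through the cubic terms. -/
lemma algY_mul_jbPow {p : ℝ} (hp : 0 ≤ p) (hrp : 1 / 2 < r + p) (a b : Y) :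
    (algY hr).mul (mulY (jbPow p hp) a) (mulY (jbPow p hp) b) =
      mulY (jbPow p hp) ((algY hrp).mul a b) := by
  refine (algY hr).ext fun x => ?_
  rw [FunAlg.σ_mul_apply, algY_σ_jbPow hr hp hrp, algY_σ_jbPow hr hp hrp,
    algY_σ_jbPow hr hp hrp, FunAlg.σ_mul_apply]

lemma algY_σ_conj (b : Y) (x : ℝ) : (algY hr).σ (conjY b) x = star ((algY hr).σ b x) := by
  rw [algY_σ, algY_σ, conjY_apply, synth_conjL2]
  ext <;> simp

end Y

/-- The functions represented by the elements of `E`. The periodic part is scaled by `δ`. -/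
def sigmaE (k₀ δ : ℝ) {s : ℝ} (hs : 1 / 2 < s) : E →ₗ[ℂ] (ℝ → ℂ × ℂ) where
  toFun e x := (δ * synthV s (k₀ / (2 * Real.pi)) e.1 x,
    δ * synthV s (k₀ / (2 * Real.pi)) e.1 x + synth s e.2 x)
  map_add' b b' := by
    ext x <;> simp [synth_add hs, synthV_add (by linarith : 0 ≤ s)] <;> ring
  map_smul' c b := by
    ext x <;> simp [synth_smul, synthV_smul] <;> ring

section E

variable {k₀ s δ : ℝ} (hk₀ : 0 < k₀) (hs : 1 / 2 < s) (hδ : 0 < δ) (hδ1 : δ ≤ 1)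

include hk₀ hδ in
lemma sigmaE_injective : Function.Injective (sigmaE k₀ δ hs) := by
  refine (injective_iff_map_eq_zero _).2 fun e he => ?_
  have hδ' : (δ : ℂ) ≠ 0 := by exact_mod_cast hδ.ne'
  have h1 : ∀ x, (δ : ℂ) * synthV s (k₀ / (2 * Real.pi)) e.1 x = 0 := fun x =>
    congrArg Prod.fst (congrFun he x)
  have h2 : ∀ x, (δ : ℂ) * synthV s (k₀ / (2 * Real.pi)) e.1 x + synth s e.2 x = 0 := fun x =>
    congrArg Prod.snd (congrFun he x)
  ext1
  · refine synthV_injective hk₀ (by linarith : 0 ≤ s) (funext fun x => ?_)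
    simpa [hδ'] using h1 x
  · refine synth_injective hs ?_
    rw [Prod.snd_zero, synth_zero hs]
    ext x
    simpa [h1] using h2 x

/-- The bound for the products in `E`. -/
def boundE {s : ℝ} (hs : 1 / 2 < s) : ℝ := 2 * 2 ^ s + (exists_synth_mul hs).choose

include hδ hδ1 in
-- Products of two periodic parts carry δ², and the representation removes only one factor δ. Every
-- term that involves a periodic part thus keeps a factor δ ≤ 1, and the bound is uniform in δ.
lemma exists_sigmaE_mul (k₀ : ℝ) (a b : E) : ∃ h : E,
    sigmaE k₀ δ hs h = sigmaE k₀ δ hs a * sigmaE k₀ δ hs b ∧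
      ‖h‖ ≤ boundE hs * (‖a‖ * ‖b‖) := by
  obtain ⟨hC, H⟩ := (exists_synth_mul hs).choose_spec
  rw [boundE]
  set C := (exists_synth_mul hs).choose
  set κ := k₀ / (2 * Real.pi)
  have hs0 : 0 ≤ s := by linarith
  obtain ⟨h, h1, h2⟩ := H a.2 b.2
  obtain ⟨v, v1, v2⟩ := exists_synthV_mul hs0 κ a.1 b.1
  obtain ⟨f, f1, f2⟩ := exists_synthV_mul_synth hs κ a.1 b.2
  obtain ⟨g, g1, g2⟩ := exists_synthV_mul_synth hs κ b.1 a.2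
  refine ⟨((δ : ℂ) • v, (δ : ℂ) • f + (δ : ℂ) • g + h), ?_, ?_⟩
  · ext x
    · simp only [sigmaE, LinearMap.coe_mk, AddHom.coe_mk, synthV_smul, Pi.smul_apply,
        Pi.mul_apply, smul_eq_mul, Prod.fst_mul]
      rw [show k₀ / (2 * Real.pi) = κ from rfl, v1, Pi.mul_apply]
      ring
    · simp only [sigmaE, LinearMap.coe_mk, AddHom.coe_mk, synthV_smul, synth_add hs, synth_smul,
        Pi.smul_apply, Pi.add_apply, Pi.mul_apply, smul_eq_mul, Prod.snd_mul, h1, f1, g1]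
      rw [show k₀ / (2 * Real.pi) = κ from rfl, v1, Pi.mul_apply]
      ring
  · have ha1 := norm_fst_le a
    have ha2 := norm_snd_le a
    have hb1 := norm_fst_le b
    have hb2 := norm_snd_le b
    have e11 : ‖v‖ ≤ 2 ^ s * (‖a‖ * ‖b‖) := v2.trans (by gcongr)
    have e12 : ‖f‖ ≤ 2 ^ s * (‖a‖ * ‖b‖) := f2.trans (by gcongr)
    have e21 : ‖g‖ ≤ 2 ^ s * (‖a‖ * ‖b‖) := g2.trans (by rw [mul_comm ‖b.1‖]; gcongr)
    have e22 : ‖h‖ ≤ C * (‖a‖ * ‖b‖) := h2.trans (by gcongr)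
    have hδn : ‖(δ : ℂ)‖ ≤ 1 := by rwa [Complex.norm_real, Real.norm_of_nonneg hδ.le]
    have hsc : ∀ {X : Type} [NormedAddCommGroup X] [NormedSpace ℂ X] (x : X), ‖(δ : ℂ) • x‖ ≤ ‖x‖ :=
      fun x => by
        rw [norm_smul]; exact mul_le_of_le_one_left (norm_nonneg _) hδn
    have hp : 0 ≤ ‖a‖ * ‖b‖ := by positivity
    have h2s : 0 ≤ (2 : ℝ) ^ s * (‖a‖ * ‖b‖) := by positivity
    have hCp := mul_nonneg hC hp
    refine (Prod.norm_def _).trans_le (max_le ?_ ?_)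
    · exact (hsc v).trans (by linarith)
    · refine (norm_add₃_le).trans ?_
      linarith [hsc f, hsc g]

/-- The algebra of sums of periodic and localized functions. -/
def algE : FunAlg E :=
  FunAlg.ofExists (sigmaE k₀ δ hs) (sigmaE_injective hk₀ hs hδ) (boundE hs)
    (exists_sigmaE_mul hs hδ hδ1 k₀)

lemma algE_σ (e : E) (x : ℝ) : (algE hk₀ hs hδ hδ1).σ e x =
    (δ * synthV s (k₀ / (2 * Real.pi)) e.1 x,
      δ * synthV s (k₀ / (2 * Real.pi)) e.1 x + synth s e.2 x) := rfl

lemma norm_algE_mul_le (a b : E) :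
    ‖(algE hk₀ hs hδ hδ1).mul a b‖ ≤ boundE hs * (‖a‖ * ‖b‖) :=
  FunAlg.norm_ofExists_mul_le _ _ _ _ a b

lemma boundE_nonneg : 0 ≤ boundE hs := by
  have := (exists_synth_mul hs).choose_spec.1
  rw [boundE]; positivity

lemma algE_σ_conj (e : E) (x : ℝ) :
    (algE hk₀ hs hδ hδ1).σ (conjE e) x = star ((algE hk₀ hs hδ hδ1).σ e x) := by
  rw [algE_σ, algE_σ, conjE_apply, synth_conjL2, synthV_conjV]
  ext <;> simp

lemma algE_mul_conj (a b : E) : (algE hk₀ hs hδ hδ1).mul (conjE a) (conjE b) =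
    conjE ((algE hk₀ hs hδ hδ1).mul a b) := by
  refine (algE hk₀ hs hδ hδ1).ext fun x => ?_
  rw [FunAlg.σ_mul_apply, algE_σ_conj, algE_σ_conj, algE_σ_conj, FunAlg.σ_mul_apply, star_mul']

lemma conjE_smul (c : ℂ) (e : E) : conjE (c • e) = conj c • conjE e := by
  -- The parameters are irrelevant: any of the algebras serves as a faithful pointwise
  -- representation of `E`.
  refine (algE one_pos (by norm_num : (1 / 2 : ℝ) < 1) one_pos le_rfl).ext fun x => ?_
  rw [algE_σ_conj, map_smul, map_smul, Pi.smul_apply, Pi.smul_apply, algE_σ_conj, star_smul]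
  rfl

end E

/-! ### The embedding of modulated amplitudes -/

lemma summable_modeV (s κ : ℝ) (n : ℤ) :
    Summable fun k : ℤ => ‖if k = n then ((jb (n * κ) ^ s : ℝ) : ℂ) else 0‖ :=
  summable_of_ne_finset_zero (s := {n}) fun k hk => by
    rw [Finset.mem_singleton] at hk; simp [hk]

/-- The element of the Wiener algebra representing the character with frequency `nκ`. -/
def modeV (s κ : ℝ) (n : ℤ) : V := mkV _ (summable_modeV s κ n)

lemma modeV_apply (s κ : ℝ) (n k : ℤ) :
    modeV s κ n k = if k = n then ((jb (n * κ) ^ s : ℝ) : ℂ) else 0 := rfl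

lemma norm_modeV (s κ : ℝ) (n : ℤ) : ‖modeV s κ n‖ = jb (n * κ) ^ s := by
  rw [norm_V_eq, tsum_eq_single n fun k hk => by simp [modeV_apply, hk], modeV_apply, if_pos rfl,
    Complex.norm_real, Real.norm_of_nonneg (Real.rpow_nonneg (jb_pos _).le _)]

lemma synthV_modeV (s κ : ℝ) (n : ℤ) (x : ℝ) : synthV s κ (modeV s κ n) x = fchar x (n * κ) := by
  rw [synthV, tsum_eq_single n fun k hk => by simp [coefV, modeV_apply, hk], coefV, modeV_apply,
    if_pos rfl, ← Complex.ofReal_mul, ← Real.rpow_add (jb_pos _)]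
  simp

lemma mulV_modeV (s κ : ℝ) (n : ℤ) (m : ℝ →ᵇ ℂ) :
    mulV κ m (modeV s κ n) = m (n * κ) • modeV s κ n := by
  ext k
  by_cases h : k = n <;> simp [modeV_apply, h]

lemma rpow_half_pos {ε : ℝ} (hε : 0 < ε) : 0 < ε ^ (1 / 2 : ℝ) := Real.rpow_pos_of_pos hε _

lemma rpow_half_le_one {ε : ℝ} (hε : 0 < ε) (hε1 : ε ≤ 1) : ε ^ (1 / 2 : ℝ) ≤ 1 :=
  Real.rpow_le_one hε.le hε1 (by norm_num)

section embE

variable {k₀ s ε : ℝ} (hk₀ : 0 < k₀) (hs : 1 / 2 < s) (hε : 0 < ε) (hε1 : ε ≤ 1)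

/-- The algebra `E` with periodic parts scaled by `√ε`. -/
def algEε : FunAlg E := algE hk₀ hs (rpow_half_pos hε) (rpow_half_le_one hε hε1)

/-- The map representing `a ↦ a(εx) e^{ink₀x}`. -/
def embE (k₀ : ℝ) (n : ℤ) : Y →L[ℂ] E :=
  ((ContinuousLinearMap.fst ℂ ℂ L2).smulRight
    (((ε ^ (-(1 / 2) : ℝ) : ℝ) : ℂ) • modeV s (k₀ / (2 * Real.pi)) n)).prod
    ((dil hs hε hε1 (n * (k₀ / (2 * Real.pi)))).comp (ContinuousLinearMap.snd ℂ ℂ L2))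

lemma embE_apply (n : ℤ) (b : Y) : embE hs hε hε1 k₀ n b =
    (b.1 • ((ε ^ (-(1 / 2) : ℝ) : ℝ) : ℂ) • modeV s (k₀ / (2 * Real.pi)) n,
      dil hs hε hε1 (n * (k₀ / (2 * Real.pi))) b.2) := rfl

lemma algEε_σ_embE (n : ℤ) (b : Y) (x : ℝ) :
    (algEε hk₀ hs hε hε1).σ (embE hs hε hε1 k₀ n b) x =
      fchar x (n * (k₀ / (2 * Real.pi))) • (algY hs).σ b (ε * x) := by
  have h : ((ε ^ (1 / 2 : ℝ) : ℝ) : ℂ) * ((ε ^ (-(1 / 2) : ℝ) : ℝ) : ℂ) = 1 := by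
    rw [← Complex.ofReal_mul, ← Real.rpow_add hε]; simp
  rw [algEε, algE_σ, algY_σ, embE_apply, synth_dil, synthV_smul, synthV_smul, Pi.smul_apply,
    Pi.smul_apply, synthV_modeV]
  ext
  · simp only [smul_eq_mul, Prod.smul_fst]
    linear_combination (b.1 * fchar x (n * (k₀ / (2 * Real.pi)))) * h
  · simp only [smul_eq_mul, Prod.smul_snd]
    linear_combination (b.1 * fchar x (n * (k₀ / (2 * Real.pi)))) * h

/-- The choice of √ε as scale of the periodic part is made for this bound: the constant amplitude
then costs ε^(-1/2), as the dilated localized amplitude does. -/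
lemma norm_embE_le (n : ℤ) (b : Y) : ‖embE hs hε hε1 k₀ n b‖ ≤
    2 ^ s * jb (n * (k₀ / (2 * Real.pi))) ^ s * ε ^ (-(1 / 2) : ℝ) * ‖b‖ := by
  set κ := k₀ / (2 * Real.pi)
  have h2 : (1 : ℝ) ≤ 2 ^ s := Real.one_le_rpow (by norm_num) (by linarith)
  have hj := Real.rpow_nonneg (jb_pos (n * κ)).le s
  have he := Real.rpow_nonneg hε.le (-(1 / 2))
  rw [embE_apply]
  refine (Prod.norm_def _).trans_le (max_le ?_ ?_)
  · rw [norm_smul, norm_smul, norm_modeV, Complex.norm_real, Real.norm_of_nonneg he]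
    calc _ ≤ ‖b‖ * (ε ^ (-(1 / 2) : ℝ) * jb (n * κ) ^ s) := by
          gcongr; exact norm_fst_le b
      _ = 1 * (jb (n * κ) ^ s * ε ^ (-(1 / 2) : ℝ) * ‖b‖) := by ring
      _ ≤ 2 ^ s * (jb (n * κ) ^ s * ε ^ (-(1 / 2) : ℝ) * ‖b‖) := by gcongr
      _ = _ := by ring
  · refine (norm_dil_le hs hε hε1 _ b.2).trans ?_
    gcongr
    exact norm_snd_le b

/-- A Fourier multiplier acts on a modulated amplitude through its values near the carrier
frequency. The constant part of the amplitude sits at ζ = 0 and sees only `m' 0`. -/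
lemma mulE_embE {m m' : ℝ →ᵇ ℂ} {n : ℤ} (hm : ∀ ζ, m (n * (k₀ / (2 * Real.pi)) + ε * ζ) = m' ζ)
    (b : Y) : mulE (k₀ / (2 * Real.pi)) m (embE hs hε hε1 k₀ n b) =
      embE hs hε hε1 k₀ n (mulY m' b) := by
  rw [embE_apply, embE_apply, mulE_apply]
  ext1
  · simp only [map_smul, mulV_modeV, mulY_apply, ← hm 0, mul_zero, add_zero, smul_smul]
    congr 1; ring
  · simp only [mulY_apply]
    exact mulL2_dil hs hε hε1 _ hm b.2

lemma algEε_σ_conj (e : E) (x : ℝ) :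
    (algEε hk₀ hs hε hε1).σ (conjE e) x = star ((algEε hk₀ hs hε hε1).σ e x) :=
  algE_σ_conj _ _ _ _ e x

include hk₀ in
lemma conjE_embE (n : ℤ) (b : Y) : conjE (embE hs hε hε1 k₀ n b) =
    embE hs hε hε1 k₀ (-n) (conjY b) := by
  refine (algEε hk₀ hs hε hε1).ext fun x => ?_
  rw [algEε_σ_embE, algEε_σ_conj, algEε_σ_embE, algY_σ_conj, star_smul, Complex.star_def,
    conj_fchar]
  simp

lemma embE_mul (n m : ℤ) (a b : Y) :
    (algEε hk₀ hs hε hε1).mul (embE hs hε hε1 k₀ n a) (embE hs hε hε1 k₀ m b) =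
      embE hs hε hε1 k₀ (n + m) ((algY hs).mul a b) := by
  refine (algEε hk₀ hs hε hε1).ext fun x => ?_
  rw [FunAlg.σ_mul_apply, algEε_σ_embE, algEε_σ_embE, algEε_σ_embE, FunAlg.σ_mul_apply,
    smul_mul_smul_comm]
  congr 1
  rw [fchar, fchar, fchar, ← Complex.exp_add]; congr 1; push_cast; ring

/-- Modulated amplitudes multiply `E` with a bound that does not depend on `ε`. -/
lemma exists_norm_embE_mul_le (k₀ : ℝ) {s : ℝ} (hs : 1 / 2 < s) (n : ℤ) :
    ∃ C : ℝ, 0 ≤ C ∧ ∀ (ε : ℝ) (hε : 0 < ε) (hε1 : ε ≤ 1) (hk₀ : 0 < k₀) (b : Y) (e : E),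
      ‖(algEε hk₀ hs hε hε1).mul (embE hs hε hε1 k₀ n (mulY (jbPow 1 zero_le_one) b)) e‖ ≤
        C * ‖b‖ * ‖e‖ := by
  set κ := k₀ / (2 * Real.pi)
  set K := Real.sqrt (∫ ξ, jb ξ ^ (-(2 * 1 : ℝ)))
  have hj := Real.rpow_nonneg (jb_pos (n * κ)).le s
  have hs0 : 0 ≤ s := by linarith
  set A := (2 : ℝ) ^ s * jb (n * κ) ^ s
  set B := (2 : ℝ) ^ s * (2 ^ s * jb (n * κ) ^ s)
  set D := (2 : ℝ) ^ s * (2 ^ s * jb (n * κ) ^ s * K)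
  have hA : 0 ≤ A := by positivity
  have hB : 0 ≤ B := by positivity
  have hD : 0 ≤ D := by positivity
  refine ⟨A + B + D, by positivity, fun ε hε hε1 hk₀ b e => ?_⟩
  have hb1 := norm_fst_le b
  have hb2 := norm_snd_le b
  have he1 := norm_fst_le e
  have he2 := norm_snd_le e
  have hp : 0 ≤ ‖b‖ * ‖e‖ := by positivity
  have heps := Real.rpow_nonneg hε.le (-(1 / 2))
  have hδ : ε ^ (1 / 2 : ℝ) * ε ^ (-(1 / 2) : ℝ) = 1 := by rw [← Real.rpow_add hε]; simp
  have hδ' : ((ε ^ (1 / 2 : ℝ) : ℝ) : ℂ) * ((ε ^ (-(1 / 2) : ℝ) : ℝ) : ℂ) = 1 := by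
    exact_mod_cast hδ
  set f' := mulL2 (jbPow 1 zero_le_one) b.2
  have hf' : ‖f'‖ ≤ ‖b.2‖ := by
    refine (norm_mulL2_le _ _).trans (mul_le_of_le_one_left (norm_nonneg _) ?_)
    refine BoundedContinuousFunction.norm_ofNormedAddCommGroup_le _ zero_le_one _
  obtain ⟨v, v1, v2⟩ := exists_synthV_mul hs0 κ (b.1 • modeV s κ n) e.1
  obtain ⟨f, f1, f2⟩ := exists_synthV_mul_synth hs κ (b.1 • modeV s κ n) e.2
  obtain ⟨g, g1, g2⟩ := exists_synthV_mul_synth hs κ e.1 (dil hs hε hε1 (n * κ) f')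
  obtain ⟨h, h1, h2⟩ := exists_synth_dil_mul hs hε hε1 (n * κ) b.2 e.2
  have hm : ‖b.1 • modeV s κ n‖ ≤ jb (n * κ) ^ s * ‖b‖ := by
    rw [norm_smul, norm_modeV, mul_comm]; gcongr
  -- Four products arise. The constant amplitude acts with its full size, as √ε · ε^(-1/2) = 1. The
  -- localized amplitude meets the periodic part of `e` with a factor √ε, which compensates the norm
  -- ε^(-1/2) of the dilation, and meets the localized part of `e` through the dilation invariant
  -- bound.
  have key : (algEε hk₀ hs hε hε1).mul
      (embE hs hε hε1 k₀ n (mulY (jbPow 1 zero_le_one) b)) e =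
      (v, f + ((ε ^ (1 / 2 : ℝ) : ℝ) : ℂ) • g + h) := by
    refine (algEε hk₀ hs hε hε1).ext fun x => ?_
    rw [FunAlg.σ_mul_apply, algEε_σ_embE, algEε, algE_σ, algE_σ, algY_σ, mulY_apply]
    rw [show k₀ / (2 * Real.pi) = κ from rfl]
    have hsd : synth s f' (ε * x) * fchar x (n * κ) = synth s (dil hs hε hε1 (n * κ) f') x := by
      rw [synth_dil, mul_comm]
    simp only [synth_add hs, synth_smul, v1, f1, g1, h1, Pi.add_apply, Pi.smul_apply, Pi.mul_apply,
      synthV_smul, synthV_modeV, jbPow_apply, smul_eq_mul, jb_zero, Real.one_rpow, Complex.ofReal_one,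
      one_mul, ← hsd, f']
    ext
    · simp only [Prod.fst_mul, Prod.smul_fst, smul_eq_mul]; ring
    · simp only [Prod.snd_mul, Prod.smul_snd, smul_eq_mul]
      ring
  rw [key]
  have n1 : ‖v‖ ≤ A * (‖b‖ * ‖e‖) := by
    calc _ ≤ 2 ^ s * ((jb (n * κ) ^ s * ‖b‖) * ‖e‖) := v2.trans (by gcongr)
      _ = _ := by simp only [A]; ring
  have n2 : ‖f‖ ≤ A * (‖b‖ * ‖e‖) := by
    calc _ ≤ 2 ^ s * ((jb (n * κ) ^ s * ‖b‖) * ‖e‖) := f2.trans (by gcongr)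
      _ = _ := by simp only [A]; ring
  have n3 : ‖((ε ^ (1 / 2 : ℝ) : ℝ) : ℂ) • g‖ ≤ B * (‖b‖ * ‖e‖) := by
    rw [norm_smul, Complex.norm_real, Real.norm_of_nonneg (rpow_half_pos hε).le]
    have hd := (norm_dil_le hs hε hε1 (n * κ) f').trans
      (mul_le_mul_of_nonneg_left (hf'.trans hb2) (by positivity))
    calc _ ≤ ε ^ (1 / 2 : ℝ) * (2 ^ s * (‖e‖ *
          (2 ^ s * jb (n * κ) ^ s * ε ^ (-(1 / 2) : ℝ) * ‖b‖))) := by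
          gcongr; exact g2.trans (by gcongr)
      _ = (ε ^ (1 / 2 : ℝ) * ε ^ (-(1 / 2) : ℝ)) * (B * (‖b‖ * ‖e‖)) := by simp only [B]; ring
      _ = _ := by rw [hδ, one_mul]
  have n4 : ‖h‖ ≤ D * (‖b‖ * ‖e‖) := by
    calc _ ≤ D * ‖b‖ * ‖e‖ := h2.trans (by gcongr)
      _ = _ := by ring
  have hAp := mul_nonneg hA hp
  have hBp := mul_nonneg hB hp
  have hDp := mul_nonneg hD hp
  rw [mul_assoc]
  refine (Prod.norm_def _).trans_le (max_le ?_ ?_)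
  · exact n1.trans (by linarith)
  · exact (norm_add₃_le).trans (by linarith)

end embE

/-! ### Volterra equations -/

lemma continuous_volterra {X : Type*} [NormedAddCommGroup X] [NormedSpace ℝ X]
    {S : ℝ → X →L[ℝ] X} (hS : Continuous S) {f : ℝ → X} (hf : Continuous f) :
    Continuous fun t => ∫ τ in (0 : ℝ)..t, S (t - τ) (f τ) := by
  refine intervalIntegral.continuous_parametric_intervalIntegral_of_continuous
    (f := fun t τ => S (t - τ) (f τ)) ?_ continuous_id
  have h1 : Continuous fun p : ℝ × ℝ => S (p.1 - p.2) :=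
    hS.comp (continuous_fst.sub continuous_snd)
  exact h1.clm_apply (hf.comp continuous_snd)

/-- The exponent 2ℓ is twice the Lipschitz constant, so that the integral is at most half the weight
at time t; this half is the contraction factor below. -/
lemma integral_exp_weight {ℓ : ℝ} (hℓ : 0 < ℓ) (t c : ℝ) :
    ∫ τ in (0 : ℝ)..t, ℓ * (Real.exp (2 * ℓ * τ) * c) = c * (Real.exp (2 * ℓ * t) - 1) / 2 := by
  have h : ∀ τ ∈ uIcc 0 t, HasDerivAt (fun τ => c * Real.exp (2 * ℓ * τ) / 2)
      (ℓ * (Real.exp (2 * ℓ * τ) * c)) τ := fun τ _ => by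
    have := (((hasDerivAt_id τ).const_mul (2 * ℓ)).exp.const_mul c).div_const 2
    refine this.congr_deriv ?_
    simp; ring
  rw [intervalIntegral.integral_eq_sub_of_hasDerivAt h
    (Continuous.intervalIntegrable (by fun_prop) _ _)]
  simp; ring

/-- A Volterra equation with a Lipschitz nonlinearity has a solution on a given time interval, if
the inhomogeneity is small enough. The solution inherits a linear symmetry of the equation. -/
theorem exists_volterra_solution {X : Type*} [NormedAddCommGroup X] [NormedSpace ℝ X]
    [CompleteSpace X] {T ℓ B R : ℝ} (hT : 0 ≤ T) (hℓ : 0 < ℓ) {S : ℝ → X →L[ℝ] X}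
    (hS : Continuous S) (hS1 : ∀ t x, ‖S t x‖ ≤ ‖x‖) {F : ℝ → X → X}
    (hFc : Continuous (Function.uncurry F)) (hF0 : ∀ t, F t 0 = 0)
    (hFL : ∀ t ∈ Icc 0 T, ∀ x y, ‖x‖ ≤ B → ‖y‖ ≤ B → ‖F t x - F t y‖ ≤ ℓ * ‖x - y‖)
    {ρ : ℝ → X} (hρ : Continuous ρ) (hρR : ∀ t ∈ Icc 0 T, ‖ρ t‖ ≤ R)
    (hRB : 2 * Real.exp (2 * ℓ * T) * R ≤ B)
    {J : X →L[ℝ] X} (hJS : ∀ t x, J (S t x) = S t (J x)) (hJF : ∀ t x, J (F t x) = F t (J x))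
    (hJρ : ∀ t, J (ρ t) = ρ t) :
    ∃ e : ℝ → X, Continuous e ∧ (∀ t ∈ Icc 0 T, ‖e t‖ ≤ 2 * Real.exp (2 * ℓ * T) * R) ∧
      (∀ t, J (e t) = e t) ∧
      ∀ t ∈ Icc 0 T, e t = (∫ τ in (0 : ℝ)..t, S (t - τ) (F τ (e τ))) + ρ t := by
  have hR : 0 ≤ R := (norm_nonneg _).trans (hρR 0 ⟨le_rfl, hT⟩)
  -- The unknown is sought as e = w g with g bounded. The exponential weight makes the integral
  -- operator a contraction on the whole interval, without continuation in time.
  let w : ℝ → ℝ := fun τ => Real.exp (2 * ℓ * τ)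
  have hw : Continuous w := by fun_prop
  have hw0 : ∀ τ, 0 < w τ := fun τ => Real.exp_pos _
  -- Clamping to [0, T] extends the curves to continuous functions on the real line.
  let p : ℝ → Icc 0 T := projIcc 0 T hT
  have hp : Continuous p := continuous_projIcc
  have hpt : ∀ t ∈ Icc 0 T, ((p t : Icc 0 T) : ℝ) = t := fun t ht => by
    simp only [p]; rw [projIcc_of_mem hT ht]
  have hw1 : ∀ τ, w (p τ) ≤ w T := fun τ =>
    Real.exp_le_exp.2 (mul_le_mul_of_nonneg_left (p τ).2.2 (by positivity))
  let ext : C(Icc 0 T, X) → ℝ → X := fun g τ => w (p τ) • g (p τ)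
  have hext : ∀ g, Continuous (ext g) := fun g =>
    (hw.comp (continuous_subtype_val.comp hp)).smul (g.continuous.comp hp)
  have hFext : ∀ g, Continuous fun τ => F τ (ext g τ) := fun g =>
    hFc.comp (continuous_id.prodMk (hext g))
  have hint : ∀ g (t : ℝ) (a b : ℝ),
      IntervalIntegrable (fun τ => S (t - τ) (F τ (ext g τ))) volume a b := fun g t a b =>
    Continuous.intervalIntegrable
      ((hS.comp (continuous_const.sub continuous_id)).clm_apply (hFext g)) a b
  let Γ : C(Icc 0 T, X) → C(Icc 0 T, X) := fun g =>
    ⟨fun t => (w t)⁻¹ • ((∫ τ in (0 : ℝ)..t, S (t - τ) (F τ (ext g τ))) + ρ t), by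
      refine ((hw.inv₀ fun τ => (hw0 τ).ne').comp continuous_subtype_val).smul ?_
      exact ((continuous_volterra hS (hFext g)).add hρ).comp continuous_subtype_val⟩
  have hΓ : ∀ g t, Γ g t =
      (w t)⁻¹ • ((∫ τ in (0 : ℝ)..t, S (t - τ) (F τ (ext g τ))) + ρ t) := fun g t => rfl
  -- The radius 2R is preserved because R + (1/2)(2R) = 2R. Back in terms of e the radius is at most
  -- B by the smallness hypothesis, so the Lipschitz bound is available. The symmetry is a closed
  -- condition and is built into the set.
  let s : Set C(Icc 0 T, X) := {g | ‖g‖ ≤ 2 * R ∧ ∀ t, J (g t) = g t}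
  have hextB : ∀ g ∈ s, ∀ τ, ‖ext g τ‖ ≤ B := fun g hg τ => by
    rw [norm_smul, Real.norm_of_nonneg (hw0 _).le]
    calc _ ≤ w T * (2 * R) := mul_le_mul (hw1 τ) ((g.norm_coe_le_norm _).trans hg.1)
          (norm_nonneg _) (hw0 _).le
      _ = 2 * Real.exp (2 * ℓ * T) * R := by ring
      _ ≤ B := hRB
  have hB : 0 ≤ B := le_trans (by positivity) hRB
  have hkey : ∀ g ∈ s, ∀ g' ∈ s, ∀ t : Icc 0 T,
      ‖∫ τ in (0 : ℝ)..t, (S (t - τ) (F τ (ext g τ)) - S (t - τ) (F τ (ext g' τ)))‖ ≤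
        w t * (1 / 2 * ‖g - g'‖) := fun g hg g' hg' t => by
    have h1 : ∀ τ ∈ Icc (0 : ℝ) t,
        ‖S (t - τ) (F τ (ext g τ)) - S (t - τ) (F τ (ext g' τ))‖ ≤
        ℓ * (w τ * ‖g - g'‖) := fun τ hτ => by
      have hτT : τ ∈ Icc 0 T := ⟨hτ.1, hτ.2.trans t.2.2⟩
      rw [← map_sub]
      refine (hS1 _ _).trans ((hFL τ hτT _ _ (hextB g hg τ) (hextB g' hg' τ)).trans ?_)
      refine mul_le_mul_of_nonneg_left ?_ hℓ.le
      rw [← smul_sub, norm_smul, Real.norm_of_nonneg (hw0 _).le, hpt τ hτT]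
      exact mul_le_mul_of_nonneg_left ((g - g').norm_coe_le_norm _) (hw0 _).le
    refine (intervalIntegral.norm_integral_le_of_norm_le t.2.1
      (Eventually.of_forall fun τ hτ => h1 τ ⟨hτ.1.le, hτ.2⟩)
      (Continuous.intervalIntegrable (by fun_prop) _ _)).trans ?_
    rw [integral_exp_weight hℓ]
    have : 0 ≤ ‖g - g'‖ := norm_nonneg _
    simp only [w]
    nlinarith
  have h0s : (0 : C(Icc 0 T, X)) ∈ s := ⟨by simpa using hR, fun t => by simp⟩
  have hlip : ∀ g ∈ s, ∀ g' ∈ s, ‖Γ g - Γ g'‖ ≤ 1 / 2 * ‖g - g'‖ := fun g hg g' hg' => by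
    refine (ContinuousMap.norm_le _ (by positivity)).2 fun t => ?_
    rw [ContinuousMap.sub_apply, hΓ, hΓ, ← smul_sub, add_sub_add_right_eq_sub,
      ← intervalIntegral.integral_sub (hint g t _ _) (hint g' t _ _), norm_smul, norm_inv,
      Real.norm_of_nonneg (hw0 _).le, inv_mul_le_iff₀ (hw0 _)]
    exact hkey g hg g' hg' t
  have hmaps : MapsTo Γ s s := fun g hg => by
    refine ⟨(ContinuousMap.norm_le _ (by positivity)).2 fun t => ?_, fun t => ?_⟩
    · have h1 := hkey g hg 0 h0s t
      have e0 : ∀ τ, ext 0 τ = 0 := fun τ => by simp [ext]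
      simp only [e0, hF0, map_zero, sub_zero] at h1
      rw [hΓ, norm_smul, norm_inv, Real.norm_of_nonneg (hw0 _).le, inv_mul_le_iff₀ (hw0 _)]
      have hwt : 1 ≤ w t := Real.one_le_exp (by have := t.2.1; positivity)
      calc _ ≤ w t * (1 / 2 * ‖g‖) + R := (norm_add_le _ _).trans (add_le_add h1 (hρR t t.2))
        _ ≤ w t * (1 / 2 * (2 * R)) + w t * R := by
            gcongr
            · exact hg.1
            · nlinarith
        _ = _ := by ring
    · rw [hΓ, map_smul, map_add, hJρ, ← ContinuousLinearMap.intervalIntegral_comp_comm _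
        (hint g t _ _)]
      congr 3
      ext τ
      rw [hJS, hJF]
      simp only [ext, map_smul, hg.2]
  have hcl : IsClosed s := by
    have : s = {g | ‖g‖ ≤ 2 * R} ∩ ⋂ t, {g | J (g t) = g t} := by
      ext g; simp [s]
    rw [this]
    refine (isClosed_le continuous_norm continuous_const).inter (isClosed_iInter fun t => ?_)
    exact isClosed_eq (J.continuous.comp (continuous_eval_const t))
      (continuous_eval_const t)
  have hcontr : ContractingWith (1 / 2) (hmaps.restrict Γ s s) := by
    refine ⟨by rw [← NNReal.coe_lt_coe]; norm_num, LipschitzWith.of_dist_le_mul fun g g' => ?_⟩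
    rw [Subtype.dist_eq, Subtype.dist_eq, dist_eq_norm, dist_eq_norm]
    simpa using hlip g g.2 g' g'.2
  obtain ⟨g, hg, hfix, -⟩ := hcontr.exists_fixedPoint' hcl.isComplete hmaps h0s (edist_ne_top _ _)
  refine ⟨ext g, hext g, fun t ht => ?_, fun t => ?_, fun t ht => ?_⟩
  · rw [norm_smul, Real.norm_of_nonneg (hw0 _).le]
    calc _ ≤ w T * (2 * R) := mul_le_mul (hw1 t) ((g.norm_coe_le_norm _).trans hg.1)
          (norm_nonneg _) (hw0 _).le
      _ = _ := by ring
  · simp only [ext, map_smul, hg.2]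
  · have h1 : Γ g (p t) = g (p t) := by rw [hfix.eq]
    rw [hΓ, hpt t ht] at h1
    change w (p t) • g (p t) = _
    rw [hpt t ht, ← h1, smul_inv_smul₀ (hw0 t).ne']

/-! ### Unitary multipliers -/

lemma norm_exp_I_mul_sub_one_sub_le (x : ℝ) :
    ‖Complex.exp (Complex.I * x) - 1 - Complex.I * x‖ ≤ 3 * x ^ 2 := by
  have hx : ‖Complex.I * (x : ℂ)‖ = |x| := by simp
  rcases le_or_gt |x| 1 with h | h
  · refine (Complex.norm_exp_sub_one_sub_id_le (hx.trans_le h)).trans ?_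
    rw [hx, sq_abs]; nlinarith [sq_nonneg x]
  · have h1 : ‖Complex.exp (Complex.I * x) - 1‖ ≤ |x| := Real.norm_exp_I_mul_ofReal_sub_one_le
    calc _ ≤ ‖Complex.exp (Complex.I * x) - 1‖ + ‖Complex.I * (x : ℂ)‖ := norm_sub_le _ _
      _ ≤ |x| + |x| := add_le_add h1 hx.le
      _ ≤ 3 * x ^ 2 := by rw [← sq_abs]; nlinarith

/-- The multiplier `exp(i D(ξ) t)`. -/
def phase (D : C(ℝ, ℝ)) (t : ℝ) : ℝ →ᵇ ℂ :=
  BoundedContinuousFunction.ofNormedAddCommGroup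
    (fun ξ => Complex.exp (Complex.I * ((D ξ * t : ℝ) : ℂ))) (by fun_prop) 1 fun ξ => by
      rw [mul_comm, Complex.norm_exp_ofReal_mul_I]

lemma phase_apply (D : C(ℝ, ℝ)) (t ξ : ℝ) :
    phase D t ξ = Complex.exp (Complex.I * ((D ξ * t : ℝ) : ℂ)) := rfl

lemma norm_phase_apply (D : C(ℝ, ℝ)) (t ξ : ℝ) : ‖phase D t ξ‖ = 1 := by
  rw [phase_apply, mul_comm, Complex.norm_exp_ofReal_mul_I]

lemma norm_phase_le (D : C(ℝ, ℝ)) (t : ℝ) : ‖phase D t‖ ≤ 1 :=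
  (BoundedContinuousFunction.norm_le zero_le_one).2 fun ξ => (norm_phase_apply D t ξ).le

lemma phase_zero (D : C(ℝ, ℝ)) : phase D 0 = 1 := by
  ext ξ; simp [phase_apply]

lemma phase_mul (D D' : C(ℝ, ℝ)) (t t' : ℝ) {D'' : C(ℝ, ℝ)} {t'' : ℝ}
    (h : ∀ ξ, D ξ * t + D' ξ * t' = D'' ξ * t'') : phase D t * phase D' t' = phase D'' t'' := by
  ext ξ
  rw [BoundedContinuousFunction.mul_apply, phase_apply, phase_apply, phase_apply, ← Complex.exp_add,
    ← h ξ]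
  congr 1; push_cast; ring

lemma starNeg_phase {D D' : C(ℝ, ℝ)} {t t' : ℝ} (h : ∀ ξ, -(D (-ξ) * t) = D' ξ * t') :
    starNeg (phase D t) = phase D' t' := by
  ext ξ
  rw [starNeg_apply, phase_apply, phase_apply, ← Complex.exp_conj, ← h ξ]
  congr 1; simp

/-- The phases alone need not be norm continuous in t when `D` is unbounded; a multiplier `m` that
absorbs one power of `D` makes them Lipschitz. -/
lemma norm_phase_mul_sub_le {D : C(ℝ, ℝ)} {m : ℝ →ᵇ ℂ} {K : ℝ} (hK : ∀ ξ, |D ξ| * ‖m ξ‖ ≤ K)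
    (t t' : ℝ) : ‖phase D t * m - phase D t' * m‖ ≤ K * |t - t'| := by
  have hK0 : 0 ≤ K := le_trans (by positivity) (hK 0)
  refine (BoundedContinuousFunction.norm_le (by positivity)).2 fun ξ => ?_
  have h : (phase D t * m - phase D t' * m) ξ =
      phase D t' ξ * (Complex.exp (Complex.I * ((D ξ * (t - t') : ℝ) : ℂ)) - 1) * m ξ := by
    simp only [BoundedContinuousFunction.sub_apply, BoundedContinuousFunction.mul_apply,
      phase_apply, mul_sub, ← Complex.exp_add, mul_one, sub_mul]
    congr 3; push_cast; ring
  rw [h, norm_mul, norm_mul, norm_phase_apply, one_mul]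
  calc _ ≤ ‖D ξ * (t - t')‖ * ‖m ξ‖ := by
        gcongr; exact Real.norm_exp_I_mul_ofReal_sub_one_le
    _ = (|D ξ| * ‖m ξ‖) * |t - t'| := by rw [Real.norm_eq_abs, abs_mul]; ring
    _ ≤ _ := by gcongr; exact hK ξ

lemma continuous_phase_mul {D : C(ℝ, ℝ)} {m : ℝ →ᵇ ℂ} {K : ℝ} (hK : ∀ ξ, |D ξ| * ‖m ξ‖ ≤ K) :
    Continuous fun t => phase D t * m := by
  have hK0 : 0 ≤ K := le_trans (by positivity) (hK 0)
  refine (LipschitzWith.of_dist_le_mul (K := ⟨K, hK0⟩) fun t t' => ?_).continuous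
  rw [dist_eq_norm, Real.dist_eq]
  exact norm_phase_mul_sub_le hK t t'

/-- Two powers of `D` have to be absorbed: the remainder of the exponential is quadratic in D(ξ)(t'
- t), uniformly in ξ. -/
lemma hasDerivAt_phase_mul {D : C(ℝ, ℝ)} {m n : ℝ →ᵇ ℂ} {K : ℝ}
    (hn : ∀ ξ, n ξ = Complex.I * D ξ * m ξ) (hK : ∀ ξ, D ξ ^ 2 * ‖m ξ‖ ≤ K) (t : ℝ) :
    HasDerivAt (fun t => phase D t * m) (phase D t * n) t := by
  have hK0 : 0 ≤ K := le_trans (by positivity) (hK 0)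
  rw [hasDerivAt_iff_isLittleO]
  refine Asymptotics.IsBigO.trans_isLittleO (g := fun t' => (t' - t) ^ 2) ?_ ?_
  · refine Asymptotics.IsBigO.of_bound (3 * K) (Eventually.of_forall fun t' => ?_)
    refine (BoundedContinuousFunction.norm_le (by positivity)).2 fun ξ => ?_
    have h : (phase D t' * m - phase D t * m - (t' - t) • (phase D t * n)) ξ =
        phase D t ξ * (Complex.exp (Complex.I * ((D ξ * (t' - t) : ℝ) : ℂ)) - 1 -
          Complex.I * ((D ξ * (t' - t) : ℝ) : ℂ)) * m ξ := by
      have e : phase D t' ξ = phase D t ξ * Complex.exp (Complex.I * ((D ξ * (t' - t) : ℝ) : ℂ)) := by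
        rw [phase_apply, phase_apply, ← Complex.exp_add]; congr 1; push_cast; ring
      simp only [BoundedContinuousFunction.sub_apply, BoundedContinuousFunction.mul_apply,
        BoundedContinuousFunction.smul_apply, e, hn, Complex.real_smul]
      push_cast; ring
    rw [h, norm_mul, norm_mul, norm_phase_apply, one_mul]
    calc _ ≤ 3 * (D ξ * (t' - t)) ^ 2 * ‖m ξ‖ := by
          gcongr; exact norm_exp_I_mul_sub_one_sub_le _
      _ = 3 * (D ξ ^ 2 * ‖m ξ‖) * (t' - t) ^ 2 := by ring
      _ ≤ 3 * K * (t' - t) ^ 2 := by gcongr; exact hK ξ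
      _ = _ := by rw [Real.norm_of_nonneg (sq_nonneg _)]
  · have := (Asymptotics.isLittleO_pow_id (𝕜 := ℝ) one_lt_two).comp_tendsto
      (show Tendsto (fun t' => t' - t) (𝓝 t) (𝓝 0) from
        (continuous_id.sub continuous_const).tendsto' _ _ (sub_self t))
    exact this

/-- A product rule for a curve `g` that is merely continuous, while the smoothed curve `m g` is
differentiable. This fits amplitudes whose time derivative exists only in a weaker space. -/
lemma hasDerivAt_mulY_phase {D : C(ℝ, ℝ)} {m n : ℝ →ᵇ ℂ} {K : ℝ}
    (hn : ∀ ξ, n ξ = Complex.I * D ξ * m ξ) (hK : ∀ ξ, D ξ ^ 2 * ‖m ξ‖ ≤ K) {t : ℝ}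
    {g : ℝ → Y} {g' : Y} (hc : ContinuousAt g t) (hg : HasDerivAt (fun τ => mulY m (g τ)) g' t) :
    HasDerivAt (fun τ => mulY (phase D τ) (mulY m (g τ)))
      (mulY (phase D t) (mulY n (g t) + g')) t := by
  have h1 := hasDerivAt_phase_mul hn hK t
  -- The multiplier vanishes at τ = t, hence its difference quotients converge in norm and
  -- continuity of `g` is enough.
  have h2 : HasDerivAt (fun τ => mulY (phase D τ * m - phase D t * m) (g τ))
      (mulY (phase D t * n) (g t)) t := by
    rw [hasDerivAt_iff_tendsto_slope] at h1 ⊢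
    have h3 : Tendsto (fun τ => mulY (slope (fun t => phase D t * m) t τ) (g τ)) (𝓝[≠] t)
        (𝓝 (mulY (phase D t * n) (g t))) :=
      ((isBoundedBilinearMap_apply (𝕜 := ℂ) (E := Y) (F := Y)).continuous.tendsto
        (mulY (phase D t * n), g t)).comp
        (((mulY.continuous.tendsto _).comp h1).prodMk_nhds (hc.mono_left nhdsWithin_le_nhds))
    refine h3.congr fun τ => ?_
    simp only [slope_def_module, sub_self, map_zero, zero_apply, sub_zero]
    have : ∀ (r : ℝ) (m : ℝ →ᵇ ℂ), r • m = (r : ℂ) • m := fun r m => by ext; simp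
    rw [this, map_smul, smul_apply]; rfl
  have h3 := h2.add ((((mulY (phase D t)).hasFDerivAt.restrictScalars ℝ).comp_hasDerivAt t hg))
  refine (h3.congr_deriv ?_).congr_of_eventuallyEq (Eventually.of_forall fun τ => ?_)
  · rw [map_add, mulY_mulY]; rfl
  · simp only [Pi.add_apply, Function.comp, mulY_mulY, map_sub, sub_apply]
    abel

/-! ### The wave propagator -/

/-- The symbol of `√(1 - ∂_x²)`. -/
def jbC : C(ℝ, ℝ) := ⟨jb, continuous_jb⟩

@[simp] lemma jbC_apply (ξ : ℝ) : jbC ξ = jb ξ := rfl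

lemma norm_jbPow_le (p : ℝ) (hp : 0 ≤ p) : ‖jbPow p hp‖ ≤ 1 :=
  BoundedContinuousFunction.norm_ofNormedAddCommGroup_le _ zero_le_one _

lemma norm_jbPow_apply (p : ℝ) (hp : 0 ≤ p) (ξ : ℝ) : ‖jbPow p hp ξ‖ = jb ξ ^ (-p) := by
  rw [jbPow_apply, Complex.norm_real, Real.norm_of_nonneg (Real.rpow_nonneg (jb_pos ξ).le _)]

lemma jb_pow_mul_rpow_le (k : ℕ) {p : ℝ} (hp : k ≤ p) (ξ : ℝ) : jb ξ ^ k * jb ξ ^ (-p) ≤ 1 := by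
  rw [← Real.rpow_natCast, ← Real.rpow_add (jb_pos ξ)]
  exact Real.rpow_le_one_of_one_le_of_nonpos (one_le_jb ξ) (by linarith)

lemma abs_mul_norm_jbPow_le {D : C(ℝ, ℝ)} {C : ℝ} (hD : ∀ ξ, |D ξ| ≤ C * jb ξ) {p : ℝ}
    (hp : 1 ≤ p) (ξ : ℝ) : |D ξ| * ‖jbPow p (by linarith) ξ‖ ≤ C := by
  have hC : 0 ≤ C := by
    have := (abs_nonneg _).trans (hD 0); rwa [jb_zero, mul_one] at this
  rw [norm_jbPow_apply]
  have h0 := Real.rpow_nonneg (jb_pos ξ).le (-p)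
  calc _ ≤ C * jb ξ * jb ξ ^ (-p) := by gcongr; exact hD ξ
    _ = C * (jb ξ ^ 1 * jb ξ ^ (-p)) := by ring
    _ ≤ C * 1 := by gcongr; exact jb_pow_mul_rpow_le 1 (by simpa using hp) ξ
    _ = C := mul_one C

lemma sq_mul_norm_jbPow_le {D : C(ℝ, ℝ)} {C : ℝ} (hD : ∀ ξ, |D ξ| ≤ C * jb ξ) {p : ℝ}
    (hp : 2 ≤ p) (ξ : ℝ) : D ξ ^ 2 * ‖jbPow p (by linarith) ξ‖ ≤ C ^ 2 := by
  rw [norm_jbPow_apply, ← sq_abs]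
  have h0 := Real.rpow_nonneg (jb_pos ξ).le (-p)
  calc _ ≤ (C * jb ξ) ^ 2 * jb ξ ^ (-p) := by gcongr; exact hD ξ
    _ = C ^ 2 * (jb ξ ^ 2 * jb ξ ^ (-p)) := by ring
    _ ≤ C ^ 2 * 1 := by gcongr; exact jb_pow_mul_rpow_le 2 (by simpa using hp) ξ
    _ = _ := mul_one _

lemma continuous_phase_jbPow {D : C(ℝ, ℝ)} {C : ℝ} (hD : ∀ ξ, |D ξ| ≤ C * jb ξ) {p : ℝ}
    (hp : 1 ≤ p) : Continuous fun t => phase D t * jbPow p (by linarith) :=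
  continuous_phase_mul (abs_mul_norm_jbPow_le hD hp)

lemma abs_jbC_le (ξ : ℝ) : |jbC ξ| ≤ 1 * jb ξ := by
  rw [jbC_apply, one_mul, abs_of_pos (jb_pos ξ)]

lemma jbPow_mul_jbPow {p q r : ℝ} (hp : 0 ≤ p) (hq : 0 ≤ q) (hr : 0 ≤ r) (h : p + q = r) :
    jbPow p hp * jbPow q hq = jbPow r hr := by
  ext ξ
  rw [BoundedContinuousFunction.mul_apply, jbPow_apply, jbPow_apply, jbPow_apply,
    ← Complex.ofReal_mul, ← Real.rpow_add (jb_pos ξ), ← h, neg_add]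

lemma starNeg_jbPow (p : ℝ) (hp : 0 ≤ p) : starNeg (jbPow p hp) = jbPow p hp := by
  ext ξ
  rw [starNeg_apply, jbPow_apply, jbPow_apply, Complex.conj_ofReal, jb_neg]

/-- The symbol `sin(⟨ξ⟩t)/⟨ξ⟩`. -/
def waveSymbol (t : ℝ) : ℝ →ᵇ ℂ :=
  (Complex.I / 2) • (phase jbC (-t) * jbPow 1 zero_le_one - phase jbC t * jbPow 1 zero_le_one)

lemma continuous_waveSymbol : Continuous waveSymbol := by
  have h : Continuous fun t => phase jbC t * jbPow 1 zero_le_one :=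
    continuous_phase_jbPow abs_jbC_le le_rfl
  have h' : Continuous fun t => phase jbC (-t) * jbPow 1 zero_le_one - phase jbC t * jbPow 1 zero_le_one :=
    (h.comp continuous_neg).sub h
  exact h'.const_smul (Complex.I / 2)

lemma waveSymbol_apply (t ξ : ℝ) :
    waveSymbol t ξ = ((Real.sin (jb ξ * t) * jb ξ ^ (-1 : ℝ) : ℝ) : ℂ) := by
  simp only [waveSymbol, BoundedContinuousFunction.smul_apply, BoundedContinuousFunction.sub_apply,
    BoundedContinuousFunction.mul_apply, phase_apply, jbPow_apply, smul_eq_mul, jbC_apply]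
  rw [Complex.ofReal_mul (Real.sin _), Complex.ofReal_sin, Complex.sin]
  push_cast
  rw [mul_comm Complex.I, mul_comm Complex.I]
  simp only [mul_neg, neg_mul]
  ring

lemma norm_waveSymbol_le (t : ℝ) : ‖waveSymbol t‖ ≤ 1 := by
  refine (BoundedContinuousFunction.norm_le zero_le_one).2 fun ξ => ?_
  rw [waveSymbol_apply, Complex.norm_real, Real.norm_eq_abs, abs_mul,
    abs_of_nonneg (Real.rpow_nonneg (jb_pos ξ).le _)]
  exact mul_le_one₀ (Real.abs_sin_le_one _) (Real.rpow_nonneg (jb_pos ξ).le _)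
    (Real.rpow_le_one_of_one_le_of_nonpos (one_le_jb ξ) (by norm_num))

lemma starNeg_waveSymbol (t : ℝ) : starNeg (waveSymbol t) = waveSymbol t := by
  ext ξ
  rw [starNeg_apply, waveSymbol_apply, waveSymbol_apply, Complex.conj_ofReal, jb_neg]

/-- The wave propagator `sin(t√(1 - ∂_x²))/√(1 - ∂_x²)`. -/
def waveE (κ t : ℝ) : E →L[ℝ] E := (mulE κ (waveSymbol t)).restrictScalars ℝ

lemma waveE_apply (κ t : ℝ) (e : E) : waveE κ t e = mulE κ (waveSymbol t) e := rfl

lemma continuous_waveE (κ : ℝ) : Continuous (waveE κ) :=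
  ((ContinuousLinearMap.restrictScalarsL ℂ E E ℝ ℝ).continuous).comp
    ((mulE κ).continuous.comp continuous_waveSymbol)

lemma norm_waveE_le (κ t : ℝ) (e : E) : ‖waveE κ t e‖ ≤ ‖e‖ :=
  (norm_mulE_le κ _ e).trans (mul_le_of_le_one_left (norm_nonneg _) (norm_waveSymbol_le t))

lemma conjE_waveE (κ t : ℝ) (e : E) : conjE (waveE κ t e) = waveE κ t (conjE e) := by
  rw [waveE_apply, conjE_mulE, starNeg_waveSymbol, waveE_apply]

/-! ### Derivatives in space -/

/-- The symbol of `∂_x/√(1 - ∂_x²)`. -/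
def symX : ℝ →ᵇ ℂ :=
  BoundedContinuousFunction.ofNormedAddCommGroup
    (fun ξ => ((2 * Real.pi * ξ * jb ξ ^ (-1 : ℝ) : ℝ) : ℂ) * Complex.I)
    (by have := continuous_jb_rpow (-1); fun_prop) 1 fun ξ => by
      have h := Real.rpow_nonneg (jb_pos ξ).le (-1)
      rw [norm_mul, Complex.norm_I, mul_one, Complex.norm_real, Real.norm_eq_abs, abs_mul,
        abs_of_nonneg h]
      calc _ ≤ jb ξ * jb ξ ^ (-1 : ℝ) := by gcongr; exact abs_le_jb ξ
        _ = 1 := by rw [Real.rpow_neg_one, mul_inv_cancel₀ (jb_pos ξ).ne']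

lemma symX_apply (ξ : ℝ) :
    symX ξ = ((2 * Real.pi * ξ * jb ξ ^ (-1 : ℝ) : ℝ) : ℂ) * Complex.I := rfl

lemma hasDerivAt_fourierInv {g : ℝ → ℂ} (hg : Integrable g) (hg' : Integrable fun ξ => ξ • g ξ)
    (x : ℝ) : HasDerivAt (𝓕⁻ g) (𝓕⁻ (fun ξ => (2 * Real.pi * Complex.I * ξ) * g ξ) x) x := by
  have h := (Real.hasDerivAt_fourier hg hg' (-x)).scomp x (hasDerivAt_neg x)
  rw [Real.fourierInv_eq_fourier_neg]
  refine (h.congr_deriv ?_).congr_of_eventuallyEq (Eventually.of_forall fun y => ?_)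
  · rw [Real.fourier_eq', Real.fourier_eq', ← integral_smul]
    congr 1; ext ξ
    simp only [smul_eq_mul, neg_smul, one_smul]
    ring
  · rw [Real.fourierInv_eq_fourier_neg]; rfl

lemma hasDerivAt_synth {s : ℝ} (hs : 1 / 2 < s) (f : L2) (x : ℝ) :
    HasDerivAt (synth (s + 1) f) (synth s (mulL2 symX f) x) x := by
  have hmul : (fun ξ : ℝ => (2 * Real.pi * Complex.I * (ξ : ℂ)) * dens (s + 1) f ξ) =ᵐ[volume]
      dens s (mulL2 symX f) := by
    filter_upwards [coeFn_mulL2 symX f] with ξ h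
    rw [dens, dens, h, symX_apply, neg_add, Real.rpow_add (jb_pos ξ)]
    push_cast; ring
  have hint := integrable_dens hs (mulL2 symX f)
  have h := hasDerivAt_fourierInv (integrable_dens (by linarith : 1 / 2 < s + 1) f) ?_ x
  · rwa [← synth_eq_of_dens_ae_eq hmul.symm] at h
  · refine ((hint.congr hmul.symm).const_mul (2 * Real.pi * Complex.I)⁻¹).congr
      (Eventually.of_forall fun ξ => ?_)
    have : (2 * Real.pi * Complex.I : ℂ) ≠ 0 := Complex.two_pi_I_ne_zero
    simp only [Complex.real_smul]
    field_simp

lemma iteratedDeriv_two_synth {s : ℝ} (hs : 1 / 2 < s) (f : L2) (x : ℝ) :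
    iteratedDeriv 2 (synth (s + 1 + 1) f) x = synth s (mulL2 (symX * symX) f) x := by
  have h1 : deriv (synth (s + 1 + 1) f) = synth (s + 1) (mulL2 symX f) :=
    funext fun x => (hasDerivAt_synth (by linarith) f x).deriv
  rw [iteratedDeriv_succ, iteratedDeriv_one, h1, (hasDerivAt_synth hs _ x).deriv, mulL2_mulL2]

/-! ### The amplitude as a curve in a Hilbert space -/

/-- Continuity is transported by the isometry between `L2` and H^r. The curve is extended by its end
values, so that it is continuous on ℝ and integrals over time need no restriction. -/
lemma exists_curveY {r T₀ : ℝ} (hr : 1 / 2 < r) (hT : 0 ≤ T₀) {Av : ℝ → ℂ} {Aw : ℝ → ℝ → ℂ}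
    (hv : ContinuousOn Av (Icc 0 T₀)) (hw : ContinuousCurve (hsNorm r) T₀ Aw)
    (hc : ∀ T ∈ Icc 0 T₀, Continuous (Aw T)) :
    ∃ b : ℝ → Y, Continuous b ∧ ∀ T ∈ Icc 0 T₀, (b T).1 = Av T ∧ synth r (b T).2 = Aw T := by
  choose f hf using fun T : Icc 0 T₀ => exists_synth_eq hr (hc T T.2) (hw.1 T T.2)
  have hfc : Continuous f := by
    refine continuous_iff_continuousAt.2 fun t₀ => ?_
    rw [ContinuousAt, tendsto_iff_edist_tendsto_0]
    have h1 := (hw.2 t₀ t₀.2).comp (tendsto_nhdsWithin_iff.2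
      ⟨continuous_subtype_val.continuousAt.tendsto (x := t₀), Eventually.of_forall fun t => t.2⟩)
    refine h1.congr fun t => ?_
    rw [Function.comp, edist_eq_enorm_sub, ← hsNorm_synth hr, synth_sub hr, hf, hf]
    rfl
  refine ⟨fun T => (IccExtend hT (fun t => Av t) T, IccExtend hT f T), ?_, fun T hT' => ?_⟩
  · exact (continuous_IccExtend_iff.2 (continuousOn_iff_continuous_domRestrict.1 hv)).prodMk
      (continuous_IccExtend_iff.2 hfc)
  · simp [IccExtend_of_mem hT _ hT', hf]

/-- The evaluation of the sum of a constant and a localized function. -/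
def evY {r : ℝ} (hr : 1 / 2 < r) (x : ℝ) : Y →L[ℂ] ℂ :=
  ContinuousLinearMap.fst ℂ ℂ L2 + (evL2 hr x).comp (ContinuousLinearMap.snd ℂ ℂ L2)

lemma evY_apply {r : ℝ} (hr : 1 / 2 < r) (x : ℝ) (b : Y) : evY hr x b = b.1 + synth r b.2 x := rfl

lemma evY_mul {r : ℝ} (hr : 1 / 2 < r) (x : ℝ) (a b : Y) :
    evY hr x ((algY hr).mul a b) = evY hr x a * evY hr x b :=
  congrArg Prod.snd ((algY hr).σ_mul_apply a b x)

lemma evY_conj {r : ℝ} (hr : 1 / 2 < r) (x : ℝ) (b : Y) :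
    evY hr x (conjY b) = conj (evY hr x b) := congrArg Prod.snd (algY_σ_conj hr b x)

lemma evY_jbPow {r p : ℝ} (hr : 1 / 2 < r) (hp : 0 ≤ p) (hrp : 1 / 2 < r + p) (x : ℝ) (b : Y) :
    evY hr x (mulY (jbPow p hp) b) = evY hrp x b := congrArg Prod.snd (algY_σ_jbPow hr hp hrp b x)

/-- The cubic nonlinearity `|a|²a` of the NLS equation. -/
def cubicY {r : ℝ} (hr : 1 / 2 < r) (a : Y) : Y := (algY hr).mul ((algY hr).mul a a) (conjY a)

lemma continuous_cubicY {r : ℝ} (hr : 1 / 2 < r) : Continuous (cubicY hr) :=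
  ((algY hr).mul.continuous.comp
    (((algY hr).mul.continuous.clm_apply continuous_id))).clm_apply conjY.continuous

/-- The multiplier of the linear part of the NLS equation, applied after `⟨ξ⟩⁴`. -/
def nlsSymbol (ω₀ : ℝ) : ℝ →ᵇ ℂ :=
  (Complex.I / (2 * ω₀ ^ 3)) • (jbPow 2 zero_le_two * (symX * symX))

lemma iteratedDeriv_two_evY {s : ℝ} (hs : 1 / 2 < s) (hs4 : 1 / 2 < s + 4) (b : Y) (x : ℝ) :
    iteratedDeriv 2 (fun x => evY hs4 x b) x =
      evY hs x (mulY (jbPow 2 zero_le_two * (symX * symX)) b) := by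
  have h1 : s + 4 = (s + 2) + 1 + 1 := by ring
  have h2 : (fun x => evY hs4 x b) = (fun _ => b.1) + synth (s + 2 + 1 + 1) b.2 := by
    ext y; rw [evY_apply, ← h1]; rfl
  have hs2 : 1 / 2 < s + 2 := by linarith
  have hc : deriv ((fun _ => b.1) + synth (s + 2 + 1 + 1) b.2) = deriv (synth (s + 2 + 1 + 1) b.2) := by
    ext y
    have hd := hasDerivAt_synth (by linarith : 1 / 2 < s + 2 + 1) b.2 y
    rw [((hasDerivAt_const y b.1).add hd).deriv, hd.deriv, zero_add]
  have h3 := iteratedDeriv_two_synth hs2 b.2 x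
  rw [iteratedDeriv_succ, iteratedDeriv_one] at h3
  rw [h2, iteratedDeriv_succ, iteratedDeriv_one, hc, h3, evY_apply, mulY_apply,
    ← mulL2_mulL2 (jbPow 2 zero_le_two), synth_mulL2_jbPow]
  simp [symX_apply]

/-- A solution of the NLS equation is a differentiable curve. -/
theorem IsSplitNLSSolution.exists_curve {k₀ ω₀ s T₀ : ℝ} (hω₀ : ω₀ ^ 2 = k₀ ^ 2 + 1)
    (hs : 1 / 2 < s) (hT₀ : 0 < T₀) {Av : ℝ → ℂ} {Aw : ℝ → ℝ → ℂ}
    (h : IsSplitNLSSolution k₀ ω₀ (s + 4) T₀ Av Aw) :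
    ∃ b : ℝ → Y, Continuous b ∧
      (∀ T ∈ Icc 0 T₀, (b T).1 = Av T ∧ synth (s + 4) (b T).2 = Aw T) ∧
      ∀ T ∈ Ioo 0 T₀, HasDerivAt (fun T => mulY (jbPow 4 zero_le_four) (b T))
        (mulY (nlsSymbol ω₀) (b T) +
          (3 * Complex.I / (2 * ω₀)) • cubicY hs (mulY (jbPow 4 zero_le_four) (b T))) T := by
  have hs4 : 1 / 2 < s + 4 := by linarith
  have hω : ω₀ ≠ 0 := by rintro rfl; nlinarith [sq_nonneg k₀]
  have hωc : (ω₀ : ℂ) ≠ 0 := by exact_mod_cast hω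
  obtain ⟨b, hb, hbA⟩ := exists_curveY hs4 hT₀.le h.continuousOn_v h.continuous_w fun T hT => by
    have := (h.solves T hT).1.continuous.sub (continuous_const (y := Av T))
    refine this.congr fun x => ?_
    simp
  refine ⟨b, hb, hbA, ?_⟩
  set a : ℝ → Y := fun T => mulY (jbPow 4 zero_le_four) (b T)
  have ha : Continuous a := (mulY _).continuous.comp hb
  set G : ℝ → Y := fun T => mulY (nlsSymbol ω₀) (b T) + (3 * Complex.I / (2 * ω₀)) • cubicY hs (a T)
  have hG : Continuous G := by
    have h1 : Continuous fun T => mulY (nlsSymbol ω₀) (b T) := (mulY _).continuous.comp hb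
    have h2 : Continuous fun T => cubicY hs (a T) := (continuous_cubicY hs).comp ha
    exact h1.add (h2.const_smul (3 * Complex.I / (2 * ω₀)))
  have hev : ∀ T ∈ Icc 0 T₀, ∀ x, evY hs x (a T) = Av T + Aw T x := fun T hT x => by
    rw [evY_jbPow hs _ hs4, evY_apply, (hbA T hT).1, (hbA T hT).2]
  -- The NLS equation holds pointwise in X only. The candidate `B` is differentiable in the norm by
  -- construction, and it remains to identify it with `a`.
  let B : ℝ → Y := fun T => a 0 + ∫ τ in (0 : ℝ)..T, G τ
  have hB : ∀ T, HasDerivAt B (G T) T := fun T =>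
    (hG.integral_hasStrictDerivAt 0 T).hasDerivAt.const_add _
  have hder : ∀ T ∈ Icc 0 T₀, ∀ x,
      HasDerivWithinAt (fun T => evY hs x (a T)) (evY hs x (G T)) (Icc 0 T₀) T := fun T hT x => by
    obtain ⟨A', hA', heq⟩ := (h.solves T hT).2 x
    have h1 := hA'.congr (f₁ := fun T => evY hs x (a T)) (fun T hT => hev T hT x) (hev T hT x)
    refine h1.congr_deriv ?_
    have hA : (fun X => Av T + Aw T X) = fun x => evY hs4 x (b T) := by
      ext x; rw [evY_apply, (hbA T hT).1, (hbA T hT).2]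
    have hk : ((k₀ : ℂ) / ω₀) ^ 2 - 1 = -1 / (ω₀ : ℂ) ^ 2 := by
      field_simp
      have : (ω₀ : ℂ) ^ 2 = k₀ ^ 2 + 1 := by exact_mod_cast hω₀
      rw [this]; ring
    beta_reduce at heq
    rw [show (Av T + Aw T x) = evY hs x (a T) from (hev T hT x).symm, hA,
      iteratedDeriv_two_evY hs hs4] at heq
    have hn : ((‖evY hs x (a T)‖ ^ 2 : ℝ) : ℂ) = evY hs x (a T) * conj (evY hs x (a T)) := by
      rw [Complex.mul_conj, Complex.normSq_eq_norm_sq]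
    rw [hn] at heq
    push_cast at heq
    rw [hk] at heq
    simp only [G, nlsSymbol, map_add, map_smul, smul_apply, cubicY, evY_mul,
      evY_conj, smul_eq_mul]
    have h2 : (2 * ω₀ : ℂ) * Complex.I ≠ 0 := by simp [hωc]
    refine mul_left_cancel₀ h2 ?_
    have hI : Complex.I ^ 2 = -1 := Complex.I_sq
    have e : (2 * ω₀ : ℂ) * Complex.I * A' = Complex.I * (2 * ω₀) * A' := by ring
    rw [e, heq]
    field_simp
    rw [hI]; ring
  -- At each fixed point x the difference has zero derivative in time and vanishes initially;
  -- evaluation at all points determines the element.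
  have hzero : ∀ T ∈ Icc 0 T₀, a T = B T := fun T hT => by
    rw [← sub_eq_zero]
    refine eq_zero_of_sigmaY_snd hs fun x => ?_
    have hc : ContinuousOn (fun T => evY hs x (a T - B T)) (Icc 0 T₀) :=
      ((evY hs x).continuous.comp
        (ha.sub (continuous_iff_continuousAt.2 fun T => (hB T).continuousAt))).continuousOn
    have h1 := constant_of_has_deriv_right_zero hc (fun T hT => ?_) T hT
    · have : evY hs x (a T - B T) = 0 := by rw [h1]; simp [B]
      exact this
    · have e1 := (hder T ⟨hT.1, hT.2.le⟩ x).mono_of_mem_nhdsWithin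
        (Icc_mem_nhdsGE_of_mem hT)
      have e2 := (((evY hs x).hasFDerivAt.restrictScalars ℝ).comp_hasDerivAt T
        (hB T)).hasDerivWithinAt (s := Ici T)
      refine ((e1.sub e2).congr_deriv (sub_self _)).congr (fun y _ => ?_) ?_ <;> simp [Function.comp]
  intro T hT
  refine (hB T).congr_of_eventuallyEq ?_
  filter_upwards [Icc_mem_nhds hT.1 hT.2] with y hy using hzero y hy

/-! ### The dispersion relation -/

/-- Difference of squares together with |k| ≤ ⟨k⟩: the slope of the dispersion relation, as a
function of the wave number, is at most one. -/
lemma abs_jb_add_sub_le (ξ η : ℝ) : |jb (ξ + η) - jb ξ| ≤ |2 * Real.pi * η| := by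
  have h1 := jb_sq (ξ + η)
  have h2 := jb_sq ξ
  have p1 := jb_pos (ξ + η)
  have p2 := jb_pos ξ
  have a1 := abs_le_jb (ξ + η)
  have a2 := abs_le_jb ξ
  have h3 : (jb (ξ + η) - jb ξ) * (jb (ξ + η) + jb ξ) =
      (2 * Real.pi * η) * (2 * Real.pi * (ξ + η) + 2 * Real.pi * ξ) := by linear_combination h1 - h2
  have h4 := congrArg abs h3
  rw [abs_mul, abs_mul, abs_of_pos (add_pos p1 p2)] at h4
  have h5 := abs_add_le (2 * Real.pi * (ξ + η)) (2 * Real.pi * ξ)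
  refine le_of_mul_le_mul_right (h4.trans_le ?_) (add_pos p1 p2)
  exact mul_le_mul_of_nonneg_left (h5.trans (add_le_add a1 a2)) (abs_nonneg _)

lemma abs_inv_jb_sub_le (ξ η : ℝ) : |(jb (ξ + η))⁻¹ - (jb ξ)⁻¹| ≤ |2 * Real.pi * η| := by
  have p1 := jb_pos (ξ + η)
  have p2 := jb_pos ξ
  rw [inv_sub_inv p1.ne' p2.ne', abs_div, abs_of_pos (mul_pos p1 p2), abs_sub_comm]
  refine (div_le_self (abs_nonneg _) ?_).trans (abs_jb_add_sub_le ξ η)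
  exact one_le_mul_of_one_le_of_one_le (one_le_jb _) (one_le_jb _)

/-- The second order Taylor expansion of the dispersion relation. -/
lemma abs_jb_add_sub_taylor_le (ξ η : ℝ) :
    |jb (ξ + η) - (jb ξ + 2 * Real.pi * ξ / jb ξ * (2 * Real.pi * η) +
      (2 * Real.pi * η) ^ 2 / (2 * jb ξ ^ 3))| ≤ 5 * |2 * Real.pi * η| ^ 3 := by
  have h1 := jb_sq (ξ + η)
  have h2 := jb_sq ξ
  have p1 := one_le_jb (ξ + η)
  have p2 := one_le_jb ξ
  have a2 := abs_le_jb ξ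
  have hadd := jb_add_le ξ η
  have hη := jb_sq η
  have hd := abs_jb_add_sub_le ξ η
  rw [mul_add] at h1
  set k := 2 * Real.pi * ξ
  set h := 2 * Real.pi * η
  set w := jb ξ
  set Ω := jb (ξ + η)
  set P := w + k / w * h + h ^ 2 / (2 * w ^ 3) with hP
  have w0 : 0 < w := by linarith
  have hkw : |k / w| ≤ 1 := by rw [abs_div, abs_of_pos w0]; exact div_le_one_of_le₀ a2 w0.le
  have hkwh : |k / w * h| ≤ |h| := by
    rw [abs_mul]; exact mul_le_of_le_one_left (abs_nonneg _) hkw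
  have hq0 : 0 ≤ h ^ 2 / (2 * w ^ 3) := by positivity
  have hq : h ^ 2 / (2 * w ^ 3) ≤ |h| ^ 2 := by
    rw [sq_abs]
    refine div_le_self (sq_nonneg h) ?_
    have : 1 ≤ w ^ 3 := one_le_pow₀ p2
    linarith
  have h0 := abs_nonneg h
  rcases le_or_gt |h| w with hw | hw
  · have hP0 : 0 ≤ P := by
      have := neg_abs_le (k / w * h)
      linarith
    -- The square of the Taylor polynomial agrees with Ω² = 1 + (k + h)² up to terms of order h³,
    -- because k² = w² - 1. Division by Ω + P is harmless, as Ω ≥ 1 and P ≥ 0 in this range.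
    have e : (Ω - P) * (Ω + P) = -(k / w * h ^ 3 / w ^ 3) - h * h ^ 3 / (4 * w ^ 6) := by
      have hk2 : k ^ 2 = w ^ 2 - 1 := by linarith
      have e1 : Ω ^ 2 = 1 + (k + h) ^ 2 := h1
      have e2 : (Ω - P) * (Ω + P) = Ω ^ 2 - P ^ 2 := by ring
      rw [e2, e1, hP]
      field_simp
      linear_combination (16 * w ^ 6 - 16 * h ^ 2 * w ^ 4) * hk2
    have e1 : |Ω - P| ≤ |(Ω - P) * (Ω + P)| := by
      rw [abs_mul]
      refine le_mul_of_one_le_right (abs_nonneg _) ?_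
      rw [abs_of_nonneg (by linarith)]; linarith
    refine e1.trans ?_
    rw [e]
    have b1 : |k / w * h ^ 3 / w ^ 3| ≤ |h| ^ 3 := by
      rw [abs_div, abs_mul, abs_pow, abs_of_pos (pow_pos w0 3)]
      refine (div_le_self (by positivity) (one_le_pow₀ p2)).trans ?_
      exact mul_le_of_le_one_left (by positivity) hkw
    have b2 : |h * h ^ 3 / (4 * w ^ 6)| ≤ |h| ^ 3 := by
      rw [abs_div, abs_mul, abs_pow, abs_of_pos (by positivity : 0 < 4 * w ^ 6),
        div_le_iff₀ (by positivity)]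
      have : w ≤ 4 * w ^ 6 := by
        have : w ≤ w ^ 6 := le_self_pow₀ p2 (by norm_num)
        linarith
      calc |h| * |h| ^ 3 ≤ (4 * w ^ 6) * |h| ^ 3 := by gcongr; exact hw.trans this
        _ = _ := by ring
    calc _ ≤ |-(k / w * h ^ 3 / w ^ 3)| + |h * h ^ 3 / (4 * w ^ 6)| := abs_sub _ _
      _ ≤ |h| ^ 3 + |h| ^ 3 := by rw [abs_neg]; exact add_le_add b1 b2
      _ ≤ _ := by have := pow_nonneg h0 3; linarith
  -- Beyond |h| > w ≥ 1 no cancellation is needed: Ω - w and both Taylor terms are each bounded by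
  -- |h|³.
  · have hh1 : 1 ≤ |h| := by linarith
    have c1 : |h| ≤ |h| ^ 3 := le_self_pow₀ hh1 (by norm_num)
    have c2 : |h| ^ 2 ≤ |h| ^ 3 := pow_le_pow_right₀ hh1 (by norm_num)
    have e : Ω - P = (Ω - w) - k / w * h - h ^ 2 / (2 * w ^ 3) := by rw [hP]; ring
    rw [e]
    calc _ ≤ |Ω - w| + |k / w * h| + |h ^ 2 / (2 * w ^ 3)| :=
          (abs_sub _ _).trans (add_le_add_left (abs_sub _ _) _)
      _ ≤ |h| + |h| + |h| ^ 2 := by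
          rw [abs_of_nonneg hq0]; gcongr
      _ ≤ _ := by linarith

/-! ### Oscillatory integrals -/

/-- The symbol `D(ξ)⟨ξ⟩⁻³` for a symbol `D` of order one. -/
def symD (D : C(ℝ, ℝ)) {C : ℝ} (hD : ∀ ξ, |D ξ| ≤ C * jb ξ) : ℝ →ᵇ ℂ :=
  BoundedContinuousFunction.ofNormedAddCommGroup (fun ξ => (D ξ : ℂ) * jbPow 3 zero_le_three ξ)
    (by fun_prop) C fun ξ => by
      rw [norm_mul, Complex.norm_real]
      exact abs_mul_norm_jbPow_le hD (by norm_num) ξ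

lemma symD_apply (D : C(ℝ, ℝ)) {C : ℝ} (hD : ∀ ξ, |D ξ| ≤ C * jb ξ) (ξ : ℝ) :
    symD D hD ξ = (D ξ : ℂ) * jbPow 3 zero_le_three ξ := rfl

lemma norm_symD_le (D : C(ℝ, ℝ)) {C : ℝ} (hD : ∀ ξ, |D ξ| ≤ C * jb ξ) : ‖symD D hD‖ ≤ C := by
  refine BoundedContinuousFunction.norm_ofNormedAddCommGroup_le _ ?_ _
  have := (abs_nonneg _).trans (hD 0); rwa [jb_zero, mul_one] at this

/-- The curve `⟨∂_x⟩⁻⁴ β` is differentiable with derivative `⟨∂_x⟩⁻¹ γ`. -/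
structure IsC1 (T₀ : ℝ) (β γ : ℝ → Y) : Prop where
  cont : Continuous β
  cont' : Continuous γ
  hasDerivAt : ∀ T ∈ Ioo 0 T₀, HasDerivAt (fun T => mulY (jbPow 4 zero_le_four) (β T))
    (mulY (jbPow 1 zero_le_one) (γ T)) T

lemma IsC1.conj {T₀ : ℝ} {β γ : ℝ → Y} (h : IsC1 T₀ β γ) :
    IsC1 T₀ (fun T => conjY (β T)) (fun T => conjY (γ T)) where
  cont := conjY.continuous.comp h.cont
  cont' := conjY.continuous.comp h.cont'
  hasDerivAt T hT := by
    have := conjY.hasFDerivAt.comp_hasDerivAt T (h.hasDerivAt T hT)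
    refine (this.congr_deriv ?_).congr_of_eventuallyEq (Eventually.of_forall fun T => ?_)
    · rw [conjY_mulY, starNeg_jbPow]
    · simp only [Function.comp, conjY_mulY, starNeg_jbPow]

lemma mulY_jbPow_split {p q r : ℝ} (hp : 0 ≤ p) (hq : 0 ≤ q) (hr : 0 ≤ r) (h : p + q = r) (b : Y) :
    mulY (jbPow r hr) b = mulY (jbPow p hp) (mulY (jbPow q hq) b) := by
  rw [mulY_mulY, jbPow_mul_jbPow hp hq hr h]

/-- Leibniz rule across the scale of spaces: amplitudes live in H^(s+4), their time derivatives in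
H^(s+1). The factor that is not differentiated is lowered by three orders and multiplied in H^(s+1).
-/
lemma IsC1.mul {s T₀ : ℝ} (hs : 1 / 2 < s) (hs1 : 1 / 2 < s + 1) (hs4 : 1 / 2 < s + 4)
    {β β' γ γ' : ℝ → Y} (h : IsC1 T₀ β β') (h' : IsC1 T₀ γ γ') :
    IsC1 T₀ (fun T => (algY hs4).mul (β T) (γ T))
      (fun T => (algY hs1).mul (mulY (jbPow 3 zero_le_three) (β T)) (γ' T) +
        (algY hs1).mul (β' T) (mulY (jbPow 3 zero_le_three) (γ T))) where
  cont := ((algY hs4).mul.continuous.comp h.cont).clm_apply h'.cont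
  cont' := (((algY hs1).mul.continuous.comp ((mulY _).continuous.comp h.cont)).clm_apply
    h'.cont').add (((algY hs1).mul.continuous.comp h.cont').clm_apply
    ((mulY _).continuous.comp h'.cont))
  hasDerivAt T hT := by
    have B := ((algY hs).mul.isBoundedBilinearMap.hasFDerivAt
      (mulY (jbPow 4 zero_le_four) (β T), mulY (jbPow 4 zero_le_four) (γ T))).restrictScalars ℝ
    have e3 := B.comp_hasDerivAt T ((h.hasDerivAt T hT).prodMk (h'.hasDerivAt T hT))
    have hsp := mulY_jbPow_split zero_le_one zero_le_three zero_le_four (by norm_num)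
    refine (e3.congr_deriv ?_).congr_of_eventuallyEq (Eventually.of_forall fun T => ?_)
    · rw [map_add, ← algY_mul_jbPow hs zero_le_one hs1, ← algY_mul_jbPow hs zero_le_one hs1,
        ← hsp, ← hsp]
      rfl
    · exact (algY_mul_jbPow hs zero_le_four hs4 (β T) (γ T)).symm

lemma continuous_mulY_phase {D : C(ℝ, ℝ)} {C : ℝ} (hD : ∀ ξ, |D ξ| ≤ C * jb ξ) {p : ℝ}
    (hp : 1 ≤ p) {β : ℝ → Y} (hβ : Continuous β) :
    Continuous fun τ => mulY (phase D τ) (mulY (jbPow p (zero_le_one.trans hp)) (β τ)) := by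
  have h : Continuous fun t => phase D t * jbPow p (zero_le_one.trans hp) :=
    continuous_phase_jbPow hD hp
  simp only [mulY_mulY]
  exact (mulY.continuous.comp h).clm_apply hβ

lemma norm_mulY_phase_le (D : C(ℝ, ℝ)) (t : ℝ) (b : Y) : ‖mulY (phase D t) b‖ ≤ ‖b‖ :=
  (norm_mulY_le _ _).trans (mul_le_of_le_one_left (norm_nonneg _) (norm_phase_le D t))

lemma norm_mulY_jbPow_le (p : ℝ) (hp : 0 ≤ p) (b : Y) : ‖mulY (jbPow p hp) b‖ ≤ ‖b‖ :=
  (norm_mulY_le _ _).trans (mul_le_of_le_one_left (norm_nonneg _) (norm_jbPow_le p hp))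

lemma Continuous.smul_add_smul {X : Type*} [NormedAddCommGroup X] [NormedSpace ℂ X]
    {f g : ℝ → X} (hf : Continuous f) (hg : Continuous g) (c c' : ℂ) :
    Continuous fun τ => c • f τ + c' • g τ := (hf.const_smul c).add (hg.const_smul c')

/-- Integration of the derivative of a modulated curve. -/
lemma integral_deriv_mulY_phase {T₀ ε C : ℝ} (hε : 0 < ε) {β γ : ℝ → Y} (h : IsC1 T₀ β γ)
    {D : C(ℝ, ℝ)} (hD : ∀ ξ, |D ξ| ≤ C * jb ξ) {t : ℝ} (ht : t ∈ Icc 0 (T₀ / ε ^ 2)) :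
    mulY (phase D t) (mulY (jbPow 4 zero_le_four) (β (ε ^ 2 * t))) -
        mulY (jbPow 4 zero_le_four) (β 0) =
      ∫ τ in (0 : ℝ)..t, mulY (phase D τ) (mulY (jbPow 1 zero_le_one)
        (Complex.I • mulY (symD D hD) (β (ε ^ 2 * τ)) + ((ε ^ 2 : ℝ) : ℂ) • γ (ε ^ 2 * τ))) := by
  have hβ : Continuous fun τ => β (ε ^ 2 * τ) := h.cont.comp (by fun_prop)
  have hγ : Continuous fun τ => γ (ε ^ 2 * τ) := h.cont'.comp (by fun_prop)
  have hε2 : 0 < ε ^ 2 := by positivity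
  have hder : ∀ τ ∈ Ioo 0 t, HasDerivAt
      (fun τ => mulY (phase D τ) (mulY (jbPow 4 zero_le_four) (β (ε ^ 2 * τ))))
      (mulY (phase D τ) (mulY (jbPow 1 zero_le_one)
        (Complex.I • mulY (symD D hD) (β (ε ^ 2 * τ)) + ((ε ^ 2 : ℝ) : ℂ) • γ (ε ^ 2 * τ)))) τ :=
      fun τ hτ => by
    have hT : ε ^ 2 * τ ∈ Ioo 0 T₀ := by
      refine ⟨mul_pos hε2 hτ.1, ?_⟩
      have := hτ.2.trans_le ht.2
      rw [lt_div_iff₀ hε2] at this; linarith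
    have h1 := (h.hasDerivAt _ hT).scomp τ ((hasDerivAt_id τ).const_mul (ε ^ 2))
    have h2 := hasDerivAt_mulY_phase (D := D) (m := jbPow 4 zero_le_four)
      (n := jbPow 1 zero_le_one * (Complex.I • symD D hD)) (t := τ) (g := fun τ => β (ε ^ 2 * τ))
      (g' := (ε ^ 2 * 1) • mulY (jbPow 1 zero_le_one) (γ (ε ^ 2 * τ))) (fun ξ => by
        rw [← jbPow_mul_jbPow zero_le_one zero_le_three zero_le_four (by norm_num)]
        simp only [BoundedContinuousFunction.mul_apply, BoundedContinuousFunction.smul_apply,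
          symD_apply, smul_eq_mul]
        ring)
      (sq_mul_norm_jbPow_le hD (by norm_num)) hβ.continuousAt h1
    refine h2.congr_deriv ?_
    rw [mul_one, ← mulY_mulY, map_smul mulY, smul_apply, map_add (mulY (jbPow 1 _)),
      map_smul (mulY (jbPow 1 _)) ((ε ^ 2 : ℝ) : ℂ)]
    rfl
  rw [intervalIntegral.integral_eq_sub_of_hasDerivAt_of_le ht.1
    (continuous_mulY_phase hD (by norm_num) hβ).continuousOn hder]
  · simp only [mul_zero, phase_zero, mulY_one]
  · refine (continuous_mulY_phase hD le_rfl ?_).intervalIntegrable _ _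
    exact ((mulY _).continuous.comp hβ).smul_add_smul hγ _ _

/-- Integrals of oscillating curves without stationary phase. -/
lemma norm_integral_mulY_phase_le {T₀ ε d L M M' : ℝ} (hε : 0 < ε) (hε1 : ε ≤ 1) (hd : d ≠ 0)
    (hT₀ : 0 ≤ T₀) {β γ : ℝ → Y} (h : IsC1 T₀ β γ) (hM : ∀ T ∈ Icc 0 T₀, ‖β T‖ ≤ M)
    (hM' : ∀ T ∈ Icc 0 T₀, ‖γ T‖ ≤ M') {D : C(ℝ, ℝ)}
    (hD : ∀ ξ, |D ξ - d| ≤ L * ε * jb ξ) {t : ℝ} (ht : t ∈ Icc 0 (T₀ / ε ^ 2)) :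
    ‖∫ τ in (0 : ℝ)..t, mulY (phase D τ) (mulY (jbPow 4 zero_le_four) (β (ε ^ 2 * τ)))‖ ≤
      (2 * M + T₀ * (L * M + M')) / |d| / ε := by
  have hε2 : 0 < ε ^ 2 := by positivity
  have hmem : ∀ τ ∈ Icc 0 t, ε ^ 2 * τ ∈ Icc 0 T₀ := fun τ hτ => by
    refine ⟨mul_nonneg hε2.le hτ.1, ?_⟩
    have := hτ.2.trans ht.2
    rw [le_div_iff₀ hε2] at this; linarith
  have hL : 0 ≤ L := by
    have := (abs_nonneg _).trans (hD 0)
    rw [jb_zero, mul_one] at this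
    exact nonneg_of_mul_nonneg_left this hε
  have hM0 : 0 ≤ M := (norm_nonneg _).trans (hM 0 ⟨le_rfl, hT₀⟩)
  have hM0' : 0 ≤ M' := (norm_nonneg _).trans (hM' 0 ⟨le_rfl, hT₀⟩)
  -- The constant part d of the phase drives the oscillation. The rest has size ε as an operator of
  -- order one and joins the error.
  let D₁ : C(ℝ, ℝ) := D - ContinuousMap.const ℝ d
  have hD₁ : ∀ ξ, |D₁ ξ| ≤ L * ε * jb ξ := hD
  have hDb : ∀ ξ, |D ξ| ≤ (L * ε + |d|) * jb ξ := fun ξ => by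
    have h1 := abs_add_le (D ξ - d) d
    rw [sub_add_cancel] at h1
    have h2 := hD ξ
    have h3 : |d| ≤ |d| * jb ξ := le_mul_of_one_le_right (abs_nonneg _) (one_le_jb ξ)
    linarith
  have hβ : Continuous fun τ => β (ε ^ 2 * τ) := h.cont.comp (by fun_prop)
  have hγ : Continuous fun τ => γ (ε ^ 2 * τ) := h.cont'.comp (by fun_prop)
  let R : ℝ → Y := fun τ => mulY (phase D τ) (mulY (jbPow 1 zero_le_one)
    (Complex.I • mulY (symD D₁ hD₁) (β (ε ^ 2 * τ)) + ((ε ^ 2 : ℝ) : ℂ) • γ (ε ^ 2 * τ)))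
  have hR : Continuous R := continuous_mulY_phase hDb le_rfl
    (((mulY _).continuous.comp hβ).smul_add_smul hγ _ _)
  have hG := continuous_mulY_phase hDb (p := 4) (by norm_num) hβ
  have hkey := integral_deriv_mulY_phase hε h hDb ht
  have hsplit : ∀ τ, mulY (phase D τ) (mulY (jbPow 1 zero_le_one)
        (Complex.I • mulY (symD D hDb) (β (ε ^ 2 * τ)) + ((ε ^ 2 : ℝ) : ℂ) • γ (ε ^ 2 * τ))) =
      (Complex.I * d) • mulY (phase D τ) (mulY (jbPow 4 zero_le_four) (β (ε ^ 2 * τ))) + R τ := by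
    intro τ
    have e : symD D hDb = (d : ℂ) • jbPow 3 zero_le_three + symD D₁ hD₁ := by
      ext ξ
      simp only [BoundedContinuousFunction.add_apply, BoundedContinuousFunction.smul_apply,
        symD_apply, smul_eq_mul, D₁, ContinuousMap.sub_apply, ContinuousMap.const_apply]
      push_cast; ring
    rw [mulY_jbPow_split zero_le_one zero_le_three zero_le_four (by norm_num)]
    simp only [R, e, map_add, map_smul, add_apply,
      smul_apply, smul_add, smul_smul]
    abel
  simp only [hsplit] at hkey
  have hG' : Continuous fun τ => (Complex.I * (d : ℂ)) •
      mulY (phase D τ) (mulY (jbPow 4 zero_le_four) (β (ε ^ 2 * τ))) :=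
    hG.const_smul (Complex.I * (d : ℂ))
  rw [intervalIntegral.integral_add (hG'.intervalIntegrable _ _) (hR.intervalIntegrable _ _),
    intervalIntegral.integral_smul] at hkey
  set I := ∫ τ in (0 : ℝ)..t, mulY (phase D τ) (mulY (jbPow 4 zero_le_four) (β (ε ^ 2 * τ)))
  have hRn : ‖∫ τ in (0 : ℝ)..t, R τ‖ ≤ (L * ε * M + ε ^ 2 * M') * |t - 0| := by
    refine intervalIntegral.norm_integral_le_of_norm_le_const fun τ hτ => ?_
    rw [uIoc_of_le ht.1] at hτ
    have hm := hmem τ ⟨hτ.1.le, hτ.2⟩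
    refine (norm_mulY_phase_le _ _ _).trans ((norm_mulY_jbPow_le _ _ _).trans
      ((norm_add_le _ _).trans (add_le_add ?_ ?_)))
    · rw [norm_smul, Complex.norm_I, one_mul]
      exact (norm_mulY_le _ _).trans (mul_le_mul (norm_symD_le D₁ hD₁) (hM _ hm) (norm_nonneg _)
        (by positivity))
    · rw [norm_smul, Complex.norm_real, Real.norm_of_nonneg hε2.le]
      exact mul_le_mul_of_nonneg_left (hM' _ hm) hε2.le
  -- Integration by parts: id times the integral equals the boundary terms, which are O(1), minus an
  -- integral of size O(ε) over a time O(1/ε²).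
  have hn : |d| * ‖I‖ ≤ M + M + (L * ε * M + ε ^ 2 * M') * |t - 0| := by
    have e : (Complex.I * d) • I = mulY (phase D t) (mulY (jbPow 4 zero_le_four) (β (ε ^ 2 * t))) -
        mulY (jbPow 4 zero_le_four) (β 0) - ∫ τ in (0 : ℝ)..t, R τ := by rw [hkey]; abel
    have e2 := congrArg norm e
    rw [norm_smul, norm_mul, Complex.norm_I, one_mul, Complex.norm_real, Real.norm_eq_abs] at e2
    rw [e2]
    refine (norm_sub_le _ _).trans (add_le_add ((norm_sub_le _ _).trans (add_le_add ?_ ?_)) hRn)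
    · exact (norm_mulY_phase_le _ _ _).trans ((norm_mulY_jbPow_le _ _ _).trans
        (hM _ (hmem t ⟨ht.1, le_rfl⟩)))
    · exact (norm_mulY_jbPow_le _ _ _).trans (hM 0 ⟨le_rfl, hT₀⟩)
  have hd' : 0 < |d| := abs_pos.2 hd
  rw [div_div, le_div_iff₀ (by positivity), sub_zero, abs_of_nonneg ht.1] at *
  have ht2 : ε ^ 2 * t ≤ T₀ := (hmem t ⟨ht.1, le_rfl⟩).2
  calc ‖I‖ * (|d| * ε) = ε * (|d| * ‖I‖) := by ring
    _ ≤ ε * (M + M + (L * ε * M + ε ^ 2 * M') * t) := by gcongr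
    _ = ε * (2 * M) + (L * M + ε * M') * (ε ^ 2 * t) := by ring
    _ ≤ 1 * (2 * M) + (L * M + 1 * M') * T₀ := by
        gcongr
        exact mul_nonneg hε2.le ht.1
    _ = _ := by ring

/-! ### Modulated amplitudes -/

/-- The symbol `-(nω₀ + c·2πζ)`. -/
def carrier (ω₀ c : ℝ) (n : ℤ) : C(ℝ, ℝ) := ⟨fun ζ => -(n * ω₀ + c * (2 * Real.pi * ζ)), by fun_prop⟩

lemma carrier_apply (ω₀ c : ℝ) (n : ℤ) (ζ : ℝ) :
    carrier ω₀ c n ζ = -(n * ω₀ + c * (2 * Real.pi * ζ)) := rfl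

/-- A phase that is affine in the frequency is a translation with velocity c together with a global
oscillation. -/
lemma algY_σ_phase_carrier {r : ℝ} (hr : 1 / 2 < r) (ω₀ c : ℝ) (n : ℤ) (t : ℝ) (b : Y) (x : ℝ) :
    (algY hr).σ (mulY (phase (carrier ω₀ c n) t) b) x =
      Complex.exp (-(Complex.I * n * ω₀ * t)) • (algY hr).σ b (x - c * t) := by
  have h : synth r (mulL2 (phase (carrier ω₀ c n) t) b.2) x =
      Complex.exp (-(Complex.I * n * ω₀ * t)) * synth r b.2 (x - c * t) := by
    rw [synth_mulL2, synth_apply, ← integral_const_mul]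
    congr 1; ext ξ
    rw [phase_apply, ← mul_assoc, ← mul_assoc, fchar, ← Complex.exp_add, fchar, ← Complex.exp_add]
    congr 2
    rw [carrier_apply]; push_cast; ring
  rw [algY_σ, algY_σ, mulY_apply, h, phase_apply, carrier_apply]
  have e : Complex.exp (Complex.I * ((-(n * ω₀ + c * (2 * Real.pi * 0)) * t : ℝ) : ℂ)) =
      Complex.exp (-(Complex.I * n * ω₀ * t)) := by
    congr 1; push_cast; ring
  rw [e]
  ext <;> simp [mul_add]

lemma algY_mul_phase_carrier {r : ℝ} (hr : 1 / 2 < r) (ω₀ c : ℝ) (n m : ℤ) (t : ℝ) (a b : Y) :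
    (algY hr).mul (mulY (phase (carrier ω₀ c n) t) a) (mulY (phase (carrier ω₀ c m) t) b) =
      mulY (phase (carrier ω₀ c (n + m)) t) ((algY hr).mul a b) := by
  refine (algY hr).ext fun x => ?_
  rw [FunAlg.σ_mul_apply, algY_σ_phase_carrier, algY_σ_phase_carrier, algY_σ_phase_carrier,
    FunAlg.σ_mul_apply, smul_mul_smul_comm, ← Complex.exp_add]
  congr 2; push_cast; ring

lemma conjY_phase_carrier (ω₀ c : ℝ) (n : ℤ) (t : ℝ) (b : Y) :
    conjY (mulY (phase (carrier ω₀ c n) t) b) = mulY (phase (carrier ω₀ c (-n)) t) (conjY b) := by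
  rw [conjY_mulY, starNeg_phase (D' := carrier ω₀ c (-n)) (t' := t) fun ξ => ?_]
  rw [carrier_apply, carrier_apply]; push_cast; ring

section modE

variable {s ε : ℝ} (hs : 1 / 2 < s) (hε : 0 < ε) (hε1 : ε ≤ 1) (k₀ ω₀ : ℝ)

/-- The map representing `a ↦ a(ε(x - c_g t)) e^{in(k₀x - ω₀t)}`. -/
def modE (n : ℤ) (t : ℝ) (b : Y) : E :=
  embE hs hε hε1 k₀ n (mulY (phase (carrier ω₀ (ε * (k₀ / ω₀)) n) t) b)

variable {k₀} in
lemma modE_mul (hk₀ : 0 < k₀) (n m : ℤ) (t : ℝ) (a b : Y) :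
    (algEε hk₀ hs hε hε1).mul (modE hs hε hε1 k₀ ω₀ n t a) (modE hs hε hε1 k₀ ω₀ m t b) =
      modE hs hε hε1 k₀ ω₀ (n + m) t ((algY hs).mul a b) := by
  rw [modE, modE, modE, embE_mul, algY_mul_phase_carrier]

variable {k₀} in
lemma conjE_modE (hk₀ : 0 < k₀) (n : ℤ) (t : ℝ) (b : Y) :
    conjE (modE hs hε hε1 k₀ ω₀ n t b) = modE hs hε hε1 k₀ ω₀ (-n) t (conjY b) := by
  rw [modE, modE, conjE_embE hk₀, conjY_phase_carrier]

variable {k₀} in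
lemma algEε_σ_modE (hk₀ : 0 < k₀) (n : ℤ) (t : ℝ) (b : Y) (x : ℝ) :
    (algEε hk₀ hs hε hε1).σ (modE hs hε hε1 k₀ ω₀ n t b) x =
      (fchar x (n * (k₀ / (2 * Real.pi))) * Complex.exp (-(Complex.I * n * ω₀ * t))) •
        (algY hs).σ b (ε * (x - k₀ / ω₀ * t)) := by
  rw [modE, algEε_σ_embE, algY_σ_phase_carrier, smul_smul,
    show ε * x - ε * (k₀ / ω₀) * t = ε * (x - k₀ / ω₀ * t) by ring]

/-- The symbol of `exp(iσt√(1 - ∂_x²))` in modulated coordinates. -/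
def dispD (σ c : ℝ) (n : ℤ) (κ ε : ℝ) : C(ℝ, ℝ) :=
  ⟨fun ζ => σ * jb (n * κ + ε * ζ) + carrier ω₀ (ε * c) n ζ, by
    have := continuous_jb; fun_prop⟩

lemma dispD_apply (σ c : ℝ) (n : ℤ) (κ ε ζ : ℝ) : dispD ω₀ σ c n κ ε ζ =
    σ * jb (n * κ + ε * ζ) - (n * ω₀ + ε * c * (2 * Real.pi * ζ)) := rfl

/-- The phase varies slowly near the carrier, because it depends on ζ through εζ and the dispersion
relation is Lipschitz. Thus its value at ζ = 0 decides whether a mode is resonant. -/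
lemma abs_dispD_sub_le {σ : ℝ} (hσ : |σ| = 1) (c : ℝ) (n : ℤ) (κ : ℝ) {ε : ℝ} (hε : 0 < ε) (ζ : ℝ) :
    |dispD ω₀ σ c n κ ε ζ - dispD ω₀ σ c n κ ε 0| ≤ (1 + |c|) * ε * jb ζ := by
  have e : dispD ω₀ σ c n κ ε ζ - dispD ω₀ σ c n κ ε 0 =
      σ * (jb (n * κ + ε * ζ) - jb (n * κ)) - c * (ε * (2 * Real.pi * ζ)) := by
    rw [dispD_apply, dispD_apply, mul_zero, add_zero]; ring
  have h1 := abs_jb_add_sub_le (n * κ) (ε * ζ)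
  have h2 : |2 * Real.pi * (ε * ζ)| ≤ ε * jb ζ := by
    rw [show 2 * Real.pi * (ε * ζ) = ε * (2 * Real.pi * ζ) by ring, abs_mul, abs_of_pos hε]
    exact mul_le_mul_of_nonneg_left (abs_le_jb ζ) hε.le
  have h3 : |ε * (2 * Real.pi * ζ)| ≤ ε * jb ζ := by
    rw [show ε * (2 * Real.pi * ζ) = 2 * Real.pi * (ε * ζ) by ring]; exact h2
  rw [e]
  refine (abs_sub _ _).trans ?_
  rw [abs_mul, abs_mul, hσ, one_mul]
  calc _ ≤ ε * jb ζ + |c| * (ε * jb ζ) := by gcongr; exact h1.trans h2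
    _ = _ := by ring

lemma abs_dispD_le {σ : ℝ} (hσ : |σ| = 1) (c : ℝ) (n : ℤ) (κ : ℝ) {ε : ℝ} (hε : 0 < ε) (ζ : ℝ) :
    |dispD ω₀ σ c n κ ε ζ| ≤ ((1 + |c|) * ε + |dispD ω₀ σ c n κ ε 0|) * jb ζ := by
  have h1 := abs_add_le (dispD ω₀ σ c n κ ε ζ - dispD ω₀ σ c n κ ε 0) (dispD ω₀ σ c n κ ε 0)
  rw [sub_add_cancel] at h1
  have h2 := abs_dispD_sub_le ω₀ hσ c n κ hε ζ
  have h3 := le_mul_of_one_le_right (abs_nonneg (dispD ω₀ σ c n κ ε 0)) (one_le_jb ζ)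
  linarith

/-- Undoing the linear evolution leaves a modulated amplitude whose phase is the mismatch between
the dispersion relation and the carrier oscillation. -/
lemma mulE_phase_modE (σ : ℝ) (n : ℤ) (t : ℝ) (b : Y) :
    mulE (k₀ / (2 * Real.pi)) (phase (σ • jbC) t) (modE hs hε hε1 k₀ ω₀ n t b) =
      embE hs hε hε1 k₀ n
        (mulY (phase (dispD ω₀ σ (k₀ / ω₀) n (k₀ / (2 * Real.pi)) ε) t) b) := by
  let J : C(ℝ, ℝ) := ⟨fun ζ => σ * jb (n * (k₀ / (2 * Real.pi)) + ε * ζ), by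
    have := continuous_jb; fun_prop⟩
  rw [modE, mulE_embE (m' := phase J t) hs hε hε1 (fun ζ => rfl), mulY_mulY,
    phase_mul J _ t t (D'' := dispD ω₀ σ (k₀ / ω₀) n (k₀ / (2 * Real.pi)) ε) (t'' := t)]
  intro ξ
  rw [dispD]
  simp only [ContinuousMap.coe_mk, J]; ring

end modE

/-- The frequency `n k₀` is not resonant with `n ω₀` unless `n = ±1`. -/
lemma dispD_ne_zero {k₀ ω₀ σ : ℝ} (hk₀ : 0 < k₀) (hω₀ : ω₀ ^ 2 = k₀ ^ 2 + 1) (hσ : |σ| = 1)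
    (hσω : 0 < σ * ω₀) {n : ℤ} (hn : n = 3 ∨ n = -1 ∨ n = -3) (c ε : ℝ) :
    dispD ω₀ σ c n (k₀ / (2 * Real.pi)) ε 0 ≠ 0 := by
  have hj := jb_sq (n * (k₀ / (2 * Real.pi)))
  have hp := jb_pos (n * (k₀ / (2 * Real.pi)))
  rw [show 2 * Real.pi * (n * (k₀ / (2 * Real.pi))) = n * k₀ by field_simp] at hj
  have hs2 : σ ^ 2 = 1 := by rw [← sq_abs, hσ]; norm_num
  rw [dispD_apply, mul_zero, add_zero, mul_zero, mul_zero, add_zero]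
  intro h
  have h2 : jb (n * (k₀ / (2 * Real.pi))) = n * (σ * ω₀) := by
    linear_combination σ * h - jb (n * (k₀ / (2 * Real.pi))) * hs2
  rcases hn with rfl | rfl | rfl
  -- For n = 3, resonance would require 9k₀² + 1 = 9(k₀² + 1). For n = -1 and n = -3 it would make
  -- the positive bracket negative.
  · have h3 : (σ * ω₀) ^ 2 = k₀ ^ 2 + 1 := by rw [mul_pow, hs2, one_mul, hω₀]
    rw [h2] at hj
    push_cast at hj
    nlinarith
  · rw [h2] at hp; push_cast at hp; linarith
  · rw [h2] at hp; push_cast at hp; linarith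

/-! ### The residual of the NLS approximation -/

/-- The cube in a function algebra. -/
def FunAlg.cube {X : Type*} [NormedAddCommGroup X] [NormedSpace ℂ X] (A : FunAlg X) (x : X) : X :=
  A.mul (A.mul x x) x

lemma FunAlg.cube_add {X : Type*} [NormedAddCommGroup X] [NormedSpace ℂ X] (A : FunAlg X)
    (p q : X) : A.cube (p + q) = A.cube p + (3 : ℂ) • A.mul (A.mul p p) q +
      (3 : ℂ) • A.mul (A.mul p q) q + A.cube q := by
  refine A.ext fun x => ?_
  simp only [FunAlg.cube, FunAlg.σ_mul_apply, map_add, map_smul, Pi.add_apply, Pi.smul_apply,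
    add_apply]
  ext
  · simp only [Prod.fst_mul, Prod.fst_add, Prod.smul_fst, smul_eq_mul]; ring
  · simp only [Prod.snd_mul, Prod.snd_add, Prod.smul_snd, smul_eq_mul]; ring

lemma FunAlg.continuous_cube {X : Type*} [NormedAddCommGroup X] [NormedSpace ℂ X] (A : FunAlg X) :
    Continuous A.cube :=
  (A.mul.continuous.comp (A.mul.continuous.clm_apply continuous_id)).clm_apply continuous_id

lemma jb_carrier_frequency {k₀ ω₀ σ : ℝ} (hω₀ : ω₀ ^ 2 = k₀ ^ 2 + 1) (hσ : |σ| = 1)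
    (hσω : 0 < σ * ω₀) : jb (k₀ / (2 * Real.pi)) = σ * ω₀ := by
  have hj := jb_sq (k₀ / (2 * Real.pi))
  rw [show 2 * Real.pi * (k₀ / (2 * Real.pi)) = k₀ by field_simp] at hj
  have hs2 : σ ^ 2 = 1 := by rw [← sq_abs, hσ]; norm_num
  refine (pow_left_inj₀ (jb_pos _).le hσω.le two_ne_zero).1 ?_
  rw [hj, mul_pow, hs2, hω₀]; ring

/-- The constant Taylor term cancels since ⟨k₀⟩ = σω₀, the linear one since k₀/ω₀ is the group
velocity. The curvature that remains is the dispersion coefficient of the NLS equation. The factor σ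
reduces negative ω₀ to the positive branch. -/
lemma abs_dispD_one_sub_le {k₀ ω₀ σ : ℝ} (hω₀ : ω₀ ^ 2 = k₀ ^ 2 + 1) (hσ : |σ| = 1)
    (hσω : 0 < σ * ω₀) {ε : ℝ} (hε : 0 < ε) (ζ : ℝ) :
    |dispD ω₀ σ (k₀ / ω₀) 1 (k₀ / (2 * Real.pi)) ε ζ -
      ε ^ 2 * ((2 * Real.pi * ζ) ^ 2 / (2 * ω₀ ^ 3))| ≤ 5 * ε ^ 3 * |2 * Real.pi * ζ| ^ 3 := by
  have h := abs_jb_add_sub_taylor_le (k₀ / (2 * Real.pi)) (ε * ζ)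
  rw [jb_carrier_frequency hω₀ hσ hσω,
    show 2 * Real.pi * (k₀ / (2 * Real.pi)) = k₀ by field_simp,
    show 2 * Real.pi * (ε * ζ) = ε * (2 * Real.pi * ζ) by ring] at h
  have e : dispD ω₀ σ (k₀ / ω₀) 1 (k₀ / (2 * Real.pi)) ε ζ -
      ε ^ 2 * ((2 * Real.pi * ζ) ^ 2 / (2 * ω₀ ^ 3)) =
      σ * (jb (k₀ / (2 * Real.pi) + ε * ζ) - (σ * ω₀ + k₀ / (σ * ω₀) * (ε * (2 * Real.pi * ζ)) +
        (ε * (2 * Real.pi * ζ)) ^ 2 / (2 * (σ * ω₀) ^ 3))) := by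
    have hω : ω₀ ≠ 0 := by rintro rfl; simp at hσω
    rw [dispD_apply, Int.cast_one, one_mul, one_mul]
    rcases (abs_eq zero_le_one).1 hσ with rfl | rfl
    · field_simp; ring
    · field_simp; ring
  rw [e, abs_mul, hσ, one_mul]
  refine h.trans_eq ?_
  rw [abs_mul, abs_of_pos hε]; ring

section residual

variable {s ε : ℝ} (hs : 1 / 2 < s) (hε : 0 < ε) (hε1 : ε ≤ 1) (k₀ ω₀ : ℝ)

/-- The positive frequency part of the NLS ansatz. -/
def ansE (b : ℝ → Y) (t : ℝ) : E :=
  (ε : ℂ) • modE hs hε hε1 k₀ ω₀ 1 t (mulY (jbPow 4 zero_le_four) (b (ε ^ 2 * t)))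

/-- The NLS ansatz. -/
def ansatzE (b : ℝ → Y) (t : ℝ) : E :=
  ansE hs hε hε1 k₀ ω₀ b t + conjE (ansE hs hε hε1 k₀ ω₀ b t)

variable {k₀}

lemma conjE_conjE (e : E) : conjE (conjE e) = e := by
  refine (algE one_pos (by norm_num : (1 / 2 : ℝ) < 1) one_pos le_rfl).ext fun x => ?_
  rw [algE_σ_conj, algE_σ_conj, star_star]

lemma conjE_ansatzE (b : ℝ → Y) (t : ℝ) :
    conjE (ansatzE hs hε hε1 k₀ ω₀ b t) = ansatzE hs hε hε1 k₀ ω₀ b t := by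
  rw [ansatzE, map_add, conjE_conjE, add_comm]

lemma conjY_mulY_jbPow (p : ℝ) (hp : 0 ≤ p) (b : Y) :
    conjY (mulY (jbPow p hp) b) = mulY (jbPow p hp) (conjY b) := by
  rw [conjY_mulY, starNeg_jbPow]

lemma conjE_ansE (hk₀ : 0 < k₀) (b : ℝ → Y) (t : ℝ) : conjE (ansE hs hε hε1 k₀ ω₀ b t) =
    (ε : ℂ) • modE hs hε hε1 k₀ ω₀ (-1) t
      (mulY (jbPow 4 zero_le_four) (conjY (b (ε ^ 2 * t)))) := by
  rw [ansE, conjE_smul, conjE_modE hs hε hε1 ω₀ hk₀, Complex.conj_ofReal, conjY_mulY_jbPow]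

lemma modE_mul_jbPow (hk₀ : 0 < k₀) (hs4 : 1 / 2 < s + 4) {n m k : ℤ} (h : n + m = k) (t : ℝ)
    (a b : Y) : (algEε hk₀ hs hε hε1).mul
      (modE hs hε hε1 k₀ ω₀ n t (mulY (jbPow 4 zero_le_four) a))
      (modE hs hε hε1 k₀ ω₀ m t (mulY (jbPow 4 zero_le_four) b)) =
      modE hs hε hε1 k₀ ω₀ k t (mulY (jbPow 4 zero_le_four) ((algY hs4).mul a b)) := by
  rw [modE_mul, algY_mul_jbPow hs zero_le_four hs4, h]

/-- The cubic nonlinearity for the NLS ansatz. -/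
lemma cube_ansatzE (hk₀ : 0 < k₀) (hs4 : 1 / 2 < s + 4) (β : ℝ → Y) (t : ℝ) :
    (algEε hk₀ hs hε hε1).cube (ansatzE hs hε hε1 k₀ ω₀ β t) =
      ((ε ^ 3 : ℝ) : ℂ) •
      (modE hs hε hε1 k₀ ω₀ 3 t (mulY (jbPow 4 zero_le_four)
          ((algY hs4).mul ((algY hs4).mul (β (ε ^ 2 * t)) (β (ε ^ 2 * t))) (β (ε ^ 2 * t)))) +
        (3 : ℂ) • modE hs hε hε1 k₀ ω₀ 1 t (mulY (jbPow 4 zero_le_four)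
          ((algY hs4).mul ((algY hs4).mul (β (ε ^ 2 * t)) (β (ε ^ 2 * t)))
            (conjY (β (ε ^ 2 * t))))) +
        (3 : ℂ) • modE hs hε hε1 k₀ ω₀ (-1) t (mulY (jbPow 4 zero_le_four)
          ((algY hs4).mul ((algY hs4).mul (β (ε ^ 2 * t)) (conjY (β (ε ^ 2 * t))))
            (conjY (β (ε ^ 2 * t))))) +
        modE hs hε hε1 k₀ ω₀ (-3) t (mulY (jbPow 4 zero_le_four)
          ((algY hs4).mul ((algY hs4).mul (conjY (β (ε ^ 2 * t))) (conjY (β (ε ^ 2 * t))))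
            (conjY (β (ε ^ 2 * t)))))) := by
  rw [ansatzE, conjE_ansE hs hε hε1 ω₀ hk₀, ansE, FunAlg.cube_add]
  have m2 := modE_mul_jbPow hs hε hε1 ω₀ hk₀ hs4 (show (1 : ℤ) + 1 = 2 by norm_num) t
  have m3 := modE_mul_jbPow hs hε hε1 ω₀ hk₀ hs4 (show (2 : ℤ) + 1 = 3 by norm_num) t
  have m1 := modE_mul_jbPow hs hε hε1 ω₀ hk₀ hs4 (show (2 : ℤ) + -1 = 1 by norm_num) t
  have m0 := modE_mul_jbPow hs hε hε1 ω₀ hk₀ hs4 (show (1 : ℤ) + -1 = 0 by norm_num) t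
  have n1 := modE_mul_jbPow hs hε hε1 ω₀ hk₀ hs4 (show (0 : ℤ) + -1 = -1 by norm_num) t
  have n2 := modE_mul_jbPow hs hε hε1 ω₀ hk₀ hs4 (show (-1 : ℤ) + -1 = -2 by norm_num) t
  have n3 := modE_mul_jbPow hs hε hε1 ω₀ hk₀ hs4 (show (-2 : ℤ) + -1 = -3 by norm_num) t
  simp only [FunAlg.cube, map_smul, smul_apply, m2, m3, m1, m0, n1, n2, n3,
    smul_add, smul_smul]
  push_cast
  ring_nf

end residual

/-- The Duhamel integral with a real inhomogeneity splits into conjugate parts. -/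
lemma integral_waveE_eq {κ σ : ℝ} (hσ : |σ| = 1) {Ψ : ℝ → E} (hΨ : ∀ t, conjE (Ψ t) = Ψ t)
    (hc : Continuous fun τ => mulE κ (phase (σ • jbC) τ) (Ψ τ)) (t : ℝ) {Z : E}
    (hZ : Z = mulE κ ((σ * Complex.I / 2) • (phase (σ • jbC) (-t) * jbPow 1 zero_le_one))
      (∫ τ in (0 : ℝ)..t, mulE κ (phase (σ • jbC) τ) (Ψ τ))) :
    ∫ τ in (0 : ℝ)..t, waveE κ (t - τ) (Ψ τ) = Z + conjE Z := by
  have hi := hc.intervalIntegrable (μ := volume) 0 t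
  -- The sine is a difference of two exponentials. `m` carries the one with sign σ; conjugation
  -- reflects ξ, fixes the even bracket and supplies the other.
  set m := (σ * Complex.I / 2 : ℂ) • (phase (σ • jbC) (-t) * jbPow 1 zero_le_one)
  have hc2 : Continuous fun τ => mulE κ m (mulE κ (phase (σ • jbC) τ) (Ψ τ)) :=
    (mulE κ m).continuous.comp hc
  have hc3 : Continuous fun τ => conjE (mulE κ m (mulE κ (phase (σ • jbC) τ) (Ψ τ))) :=
    conjE.continuous.comp hc2
  rw [hZ, ← ContinuousLinearMap.intervalIntegral_comp_comm _ hi,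
    ← ContinuousLinearMap.intervalIntegral_comp_comm _ (hc2.intervalIntegrable _ _),
    ← intervalIntegral.integral_add (hc2.intervalIntegrable _ _)
      (hc3.intervalIntegrable _ _)]
  congr 1; ext1 τ
  rw [conjE_mulE, conjE_mulE, hΨ, mulE_mulE, mulE_mulE, waveE_apply, ← add_apply,
    ← map_add]
  congr 2
  ext ξ
  simp only [waveSymbol, m, BoundedContinuousFunction.add_apply, BoundedContinuousFunction.mul_apply,
    BoundedContinuousFunction.smul_apply, BoundedContinuousFunction.sub_apply, starNeg_apply,
    smul_eq_mul, map_mul, map_div₀, phase_apply, jbPow_apply, Complex.conj_ofReal, Complex.conj_I,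
    ← Complex.exp_conj, ContinuousMap.smul_apply, jbC_apply, jb_neg, map_ofNat]
  rcases (abs_eq zero_le_one).1 hσ with rfl | rfl
  · have e1 : Complex.exp (Complex.I * ((jb ξ * -(t - τ) : ℝ) : ℂ)) =
        Complex.exp (Complex.I * ((1 * jb ξ * -t : ℝ) : ℂ)) *
          Complex.exp (Complex.I * ((1 * jb ξ * τ : ℝ) : ℂ)) := by
      rw [← Complex.exp_add]; congr 1; push_cast; ring
    have e2 : Complex.exp (Complex.I * ((jb ξ * (t - τ) : ℝ) : ℂ)) =
        Complex.exp (-Complex.I * ((1 * jb ξ * -t : ℝ) : ℂ)) *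
          Complex.exp (-Complex.I * ((1 * jb ξ * τ : ℝ) : ℂ)) := by
      rw [← Complex.exp_add]; congr 1; push_cast; ring
    rw [e1, e2]; push_cast; ring
  · have e1 : Complex.exp (Complex.I * ((jb ξ * (t - τ) : ℝ) : ℂ)) =
        Complex.exp (Complex.I * ((-1 * jb ξ * -t : ℝ) : ℂ)) *
          Complex.exp (Complex.I * ((-1 * jb ξ * τ : ℝ) : ℂ)) := by
      rw [← Complex.exp_add]; congr 1; push_cast; ring
    have e2 : Complex.exp (Complex.I * ((jb ξ * -(t - τ) : ℝ) : ℂ)) =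
        Complex.exp (-Complex.I * ((-1 * jb ξ * -t : ℝ) : ℂ)) *
          Complex.exp (-Complex.I * ((-1 * jb ξ * τ : ℝ) : ℂ)) := by
      rw [← Complex.exp_add]; congr 1; push_cast; ring
    rw [e1, e2]; push_cast; ring

/-! ### The bound for the residual -/

/-- The right-hand side of the NLS equation, after extraction of a smoothing operator of order
one. -/
def nlsRhs {s : ℝ} (hs4 : 1 / 2 < s + 4) (ω₀ : ℝ) (b : Y) : Y :=
  mulY ((Complex.I / (2 * ω₀ ^ 3)) • (jbPow 1 zero_le_one * (symX * symX))) b +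
    (3 * Complex.I / (2 * ω₀)) • mulY (jbPow 3 zero_le_three) (cubicY hs4 b)

lemma continuous_nlsRhs {s : ℝ} (hs4 : 1 / 2 < s + 4) (ω₀ : ℝ) : Continuous (nlsRhs hs4 ω₀) := by
  have h1 : Continuous fun b => mulY (jbPow 3 zero_le_three) (cubicY hs4 b) :=
    (mulY _).continuous.comp (continuous_cubicY hs4)
  exact ((mulY _).continuous).add (h1.const_smul (3 * Complex.I / (2 * ω₀)))

lemma cubicY_jbPow {s : ℝ} (hs : 1 / 2 < s) (hs4 : 1 / 2 < s + 4) (b : Y) :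
    cubicY hs (mulY (jbPow 4 zero_le_four) b) = mulY (jbPow 4 zero_le_four) (cubicY hs4 b) := by
  rw [cubicY, conjY_mulY_jbPow, algY_mul_jbPow hs zero_le_four hs4,
    algY_mul_jbPow hs zero_le_four hs4, cubicY]

lemma mulY_nlsRhs {s : ℝ} (hs : 1 / 2 < s) (hs4 : 1 / 2 < s + 4) (ω₀ : ℝ) (b : Y) :
    mulY (jbPow 1 zero_le_one) (nlsRhs hs4 ω₀ b) = mulY (nlsSymbol ω₀) b +
      (3 * Complex.I / (2 * ω₀)) • cubicY hs (mulY (jbPow 4 zero_le_four) b) := by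
  rw [nlsRhs, map_add, mulY_mulY, map_smul, cubicY_jbPow hs hs4,
    ← mulY_jbPow_split zero_le_one zero_le_three zero_le_four (by norm_num), nlsSymbol,
    mul_smul_comm, ← mul_assoc, jbPow_mul_jbPow zero_le_one zero_le_one zero_le_two (by norm_num)]

lemma norm_embE_le_mul {s ε : ℝ} (hs : 1 / 2 < s) (hε : 0 < ε) (hε1 : ε ≤ 1) (k₀ : ℝ) (n : ℤ)
    {b : Y} {B : ℝ} (h : ‖b‖ ≤ B) : ‖embE hs hε hε1 k₀ n b‖ ≤
    2 ^ s * jb (n * (k₀ / (2 * Real.pi))) ^ s * B * ε ^ (-(1 / 2) : ℝ) := by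
  have h1 := Real.rpow_nonneg (jb_pos (n * (k₀ / (2 * Real.pi)))).le s
  have h2 := Real.rpow_nonneg hε.le (-(1 / 2))
  calc _ ≤ 2 ^ s * jb (n * (k₀ / (2 * Real.pi))) ^ s * ε ^ (-(1 / 2) : ℝ) * ‖b‖ :=
        norm_embE_le hs hε hε1 n b
    _ ≤ 2 ^ s * jb (n * (k₀ / (2 * Real.pi))) ^ s * ε ^ (-(1 / 2) : ℝ) * B := by gcongr
    _ = _ := by ring

lemma exists_bound_Icc {β : ℝ → Y} (hβ : Continuous β) (T₀ : ℝ) :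
    ∃ M : ℝ, 0 ≤ M ∧ ∀ T ∈ Icc 0 T₀, ‖β T‖ ≤ M := by
  obtain ⟨M, hM⟩ := isCompact_Icc.exists_bound_of_continuousOn (hβ.continuousOn (s := Icc 0 T₀))
  exact ⟨max M 0, le_max_right _ _, fun T hT => (hM T hT).trans (le_max_left _ _)⟩

/-- A nonresonant mode contributes an oscillatory integral. -/
lemma exists_norm_integral_dispD_le {k₀ ω₀ σ s T₀ : ℝ} (hk₀ : 0 < k₀) (hω₀ : ω₀ ^ 2 = k₀ ^ 2 + 1)
    (hσ : |σ| = 1) (hσω : 0 < σ * ω₀) (hs : 1 / 2 < s) (hT₀ : 0 < T₀) {β γ : ℝ → Y}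
    (h : IsC1 T₀ β γ) {n : ℤ} (hn : n = 3 ∨ n = -1 ∨ n = -3) :
    ∃ C : ℝ, 0 ≤ C ∧ ∀ (ε : ℝ) (hε : 0 < ε) (hε1 : ε ≤ 1), ∀ t ∈ Icc 0 (T₀ / ε ^ 2),
      ‖embE hs hε hε1 k₀ n (∫ τ in (0 : ℝ)..t,
        mulY (phase (dispD ω₀ σ (k₀ / ω₀) n (k₀ / (2 * Real.pi)) ε) τ)
          (mulY (jbPow 4 zero_le_four) (β (ε ^ 2 * τ))))‖ ≤ C / ε * ε ^ (-(1 / 2) : ℝ) := by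
  obtain ⟨M, hM0, hM⟩ := exists_bound_Icc h.cont T₀
  obtain ⟨M', hM0', hM'⟩ := exists_bound_Icc h.cont' T₀
  have hj := Real.rpow_nonneg (jb_pos (n * (k₀ / (2 * Real.pi)))).le s
  -- The phase at ζ = 0 does not depend on ε, so the value at ε = 1 serves in a constant that is
  -- uniform in ε.
  have hd : ∀ ε, dispD ω₀ σ (k₀ / ω₀) n (k₀ / (2 * Real.pi)) ε 0 =
      σ * jb (n * (k₀ / (2 * Real.pi))) - n * ω₀ := fun ε => by
    rw [dispD_apply, mul_zero, add_zero, mul_zero, mul_zero, add_zero]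
  have hd0 := dispD_ne_zero hk₀ hω₀ hσ hσω hn (k₀ / ω₀) 1
  refine ⟨2 ^ s * jb (n * (k₀ / (2 * Real.pi))) ^ s *
    ((2 * M + T₀ * ((1 + |k₀ / ω₀|) * M + M')) /
      |dispD ω₀ σ (k₀ / ω₀) n (k₀ / (2 * Real.pi)) 1 0|), by positivity, fun ε hε hε1 t ht => ?_⟩
  rw [mul_div_assoc]
  refine norm_embE_le_mul hs hε hε1 k₀ n ?_
  refine norm_integral_mulY_phase_le hε hε1 hd0 hT₀.le h hM hM' (fun ξ => ?_) ht
  rw [hd 1, ← hd ε]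
  exact abs_dispD_sub_le ω₀ hσ _ n _ hε ξ

lemma norm_integral_le_of_le {X : Type*} [NormedAddCommGroup X] [NormedSpace ℝ X] {f : ℝ → X}
    {t C : ℝ} (ht : 0 ≤ t) (h : ∀ τ ∈ Icc 0 t, ‖f τ‖ ≤ C) : ‖∫ τ in (0 : ℝ)..t, f τ‖ ≤ C * t := by
  have h1 := intervalIntegral.norm_integral_le_of_norm_le_const (a := 0) (b := t) (f := f) (C := C)
    fun τ hτ => h τ (by rw [uIoc_of_le ht] at hτ; exact ⟨hτ.1.le, hτ.2⟩)
  rwa [sub_zero, abs_of_nonneg ht] at h1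

/-! ### Slow evolution and coefficient of the resonant mode -/

section

variable {k₀ ω₀ σ s T₀ : ℝ} (hk₀ : 0 < k₀) (hω₀ : ω₀ ^ 2 = k₀ ^ 2 + 1)
  (hσ : |σ| = 1) (hσω : 0 < σ * ω₀) (hs : 1 / 2 < s) (hs4 : 1 / 2 < s + 4) (hT₀ : 0 < T₀)

lemma sq_mul_mem {ε t τ : ℝ} (hε : 0 < ε) (ht : t ∈ Icc 0 (T₀ / ε ^ 2)) (hτ : τ ∈ Icc 0 t) :
    ε ^ 2 * τ ∈ Icc 0 T₀ := by
  have hε2 : 0 < ε ^ 2 := by positivity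
  refine ⟨mul_nonneg hε2.le hτ.1, ?_⟩
  have := hτ.2.trans ht.2
  rw [le_div_iff₀ hε2] at this; linarith

include hω₀ hσ hσω hT₀ in
/-- The slow evolution of the resonant mode. -/
lemma integral_resonant {b : ℝ → Y} (hb : IsC1 T₀ b fun T => nlsRhs hs4 ω₀ (b T)) {M : ℝ}
    (hM : ∀ T ∈ Icc 0 T₀, ‖b T‖ ≤ M) {ε : ℝ} (hε : 0 < ε) {t : ℝ} (ht : t ∈ Icc 0 (T₀ / ε ^ 2)) :
    ∃ R : Y, ‖R‖ ≤ 5 * T₀ * M * ε ∧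
      mulY (phase (dispD ω₀ σ (k₀ / ω₀) 1 (k₀ / (2 * Real.pi)) ε) t)
        (mulY (jbPow 4 zero_le_four) (b (ε ^ 2 * t))) =
      mulY (jbPow 4 zero_le_four) (b 0) + R + ((ε ^ 2 : ℝ) : ℂ) • (3 * Complex.I / (2 * ω₀)) •
        ∫ τ in (0 : ℝ)..t, mulY (phase (dispD ω₀ σ (k₀ / ω₀) 1 (k₀ / (2 * Real.pi)) ε) τ)
          (mulY (jbPow 4 zero_le_four) (cubicY hs4 (b (ε ^ 2 * τ)))) := by
  have hM0 : 0 ≤ M := (norm_nonneg _).trans (hM 0 ⟨le_rfl, hT₀.le⟩)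
  set D := dispD ω₀ σ (k₀ / ω₀) 1 (k₀ / (2 * Real.pi)) ε
  have hD := abs_dispD_le ω₀ hσ (k₀ / ω₀) 1 (k₀ / (2 * Real.pi)) hε
  have hbc : Continuous fun τ => b (ε ^ 2 * τ) := hb.cont.comp (by fun_prop)
  have hcc : Continuous fun τ => cubicY hs4 (b (ε ^ 2 * τ)) := (continuous_cubicY hs4).comp hbc
  -- The derivative of the phase plus the linear part of the NLS evolution. As `symX * symX` has the
  -- symbol -(2πξ)²⟨ξ⟩⁻², the two cancel up to the third order Taylor remainder, which three of the
  -- four available orders of smoothing make bounded by 5ε³.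
  set μ : ℝ →ᵇ ℂ := Complex.I • symD D hD + ((ε ^ 2 : ℝ) : ℂ) •
    (Complex.I / (2 * ω₀ ^ 3)) • (jbPow 1 zero_le_one * (symX * symX))
  have hμ : ‖μ‖ ≤ 5 * ε ^ 3 := by
    refine (BoundedContinuousFunction.norm_le (by positivity)).2 fun ξ => ?_
    have e : μ ξ = Complex.I * (((D ξ - ε ^ 2 * ((2 * Real.pi * ξ) ^ 2 / (2 * ω₀ ^ 3))) *
        jb ξ ^ (-3 : ℝ) : ℝ) : ℂ) := by
      have h : jb ξ ^ (-1 : ℝ) * jb ξ ^ (-1 : ℝ) * jb ξ ^ (-1 : ℝ) = jb ξ ^ (-3 : ℝ) := by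
        rw [← Real.rpow_add (jb_pos ξ), ← Real.rpow_add (jb_pos ξ)]; norm_num
      simp only [μ, BoundedContinuousFunction.add_apply, BoundedContinuousFunction.smul_apply,
        BoundedContinuousFunction.mul_apply, symD_apply, symX_apply, jbPow_apply, smul_eq_mul, ← h]
      push_cast
      linear_combination ((ε : ℂ) ^ 2 * (Complex.I / (2 * ω₀ ^ 3)) * ((jb ξ ^ (-1 : ℝ) : ℝ) : ℂ) *
        (2 * Real.pi * ξ * ((jb ξ ^ (-1 : ℝ) : ℝ) : ℂ)) ^ 2) * Complex.I_sq
    have hp := Real.rpow_nonneg (jb_pos ξ).le (-3)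
    rw [e, norm_mul, Complex.norm_I, one_mul, Complex.norm_real, Real.norm_eq_abs, abs_mul,
      abs_of_nonneg hp]
    calc _ ≤ 5 * ε ^ 3 * |2 * Real.pi * ξ| ^ 3 * jb ξ ^ (-3 : ℝ) := by
          gcongr; exact abs_dispD_one_sub_le hω₀ hσ hσω hε ξ
      _ ≤ 5 * ε ^ 3 * jb ξ ^ 3 * jb ξ ^ (-3 : ℝ) := by gcongr; exact abs_le_jb ξ
      _ = 5 * ε ^ 3 * (jb ξ ^ 3 * jb ξ ^ (-3 : ℝ)) := by ring
      _ ≤ 5 * ε ^ 3 * 1 := by gcongr; exact jb_pow_mul_rpow_le 3 (by norm_num) ξ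
      _ = _ := mul_one _
  -- The linear part of the NLS equation is absorbed in `μ`; the cubic part is kept, to be matched
  -- with the Duhamel integral. The remaining order of smoothing makes the phase continuous in time.
  have hsplit : ∀ τ, mulY (phase D τ) (mulY (jbPow 1 zero_le_one)
        (Complex.I • mulY (symD D hD) (b (ε ^ 2 * τ)) +
          ((ε ^ 2 : ℝ) : ℂ) • nlsRhs hs4 ω₀ (b (ε ^ 2 * τ)))) =
      mulY (phase D τ) (mulY (jbPow 1 zero_le_one) (mulY μ (b (ε ^ 2 * τ)))) +
      (((ε ^ 2 : ℝ) : ℂ) * (3 * Complex.I / (2 * ω₀))) •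
        mulY (phase D τ) (mulY (jbPow 4 zero_le_four) (cubicY hs4 (b (ε ^ 2 * τ)))) := fun τ => by
    rw [mulY_jbPow_split zero_le_one zero_le_three zero_le_four (by norm_num)]
    simp only [μ, nlsRhs, map_add, map_smul, add_apply,
      smul_apply, smul_add, smul_smul]
    abel
  have c1 : Continuous fun τ =>
      mulY (phase D τ) (mulY (jbPow 1 zero_le_one) (mulY μ (b (ε ^ 2 * τ)))) :=
    continuous_mulY_phase hD le_rfl ((mulY μ).continuous.comp hbc)
  have c2 : Continuous fun τ => (((ε ^ 2 : ℝ) : ℂ) * (3 * Complex.I / (2 * ω₀))) •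
        mulY (phase D τ) (mulY (jbPow 4 zero_le_four) (cubicY hs4 (b (ε ^ 2 * τ)))) :=
    (continuous_mulY_phase hD (by norm_num) hcc).const_smul
      (((ε ^ 2 : ℝ) : ℂ) * (3 * Complex.I / (2 * ω₀)))
  have hkey := integral_deriv_mulY_phase hε hb hD ht
  rw [intervalIntegral.integral_congr fun τ _ => hsplit τ] at hkey
  rw [intervalIntegral.integral_add (c1.intervalIntegrable _ _) (c2.intervalIntegrable _ _),
    intervalIntegral.integral_smul, mul_smul, sub_eq_iff_eq_add'] at hkey
  refine ⟨_, ?_, hkey.trans (add_assoc _ _ _).symm⟩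
  refine (norm_integral_le_of_le ht.1 (C := 5 * ε ^ 3 * M) fun τ hτ => ?_).trans ?_
  · refine (norm_mulY_phase_le _ _ _).trans ((norm_mulY_jbPow_le _ _ _).trans
      ((norm_mulY_le _ _).trans ?_))
    exact mul_le_mul hμ (hM _ (sq_mul_mem hε ht hτ)) (norm_nonneg _) (by positivity)
  · calc 5 * ε ^ 3 * M * t = 5 * M * ε * (ε ^ 2 * t) := by ring
      _ ≤ 5 * M * ε * T₀ := by
          gcongr; exact (sq_mul_mem hε ht ⟨ht.1, le_rfl⟩).2
      _ = _ := by ring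

include hω₀ hσ hσω in
/-- The coefficient of the resonant mode. -/
lemma exists_resonant_coefficient {ε : ℝ} (hε : 0 < ε) :
    ∃ m : ℝ →ᵇ ℂ, (∀ ξ, m ξ = (σ * Complex.I / 2) *
      jbPow 1 zero_le_one ((1 : ℤ) * (k₀ / (2 * Real.pi)) + ε * ξ) - Complex.I / (2 * ω₀)) ∧
      ‖m * jbPow 1 zero_le_one‖ ≤ ε := by
  let φ : C(ℝ, ℝ) := ⟨fun ξ => (1 : ℤ) * (k₀ / (2 * Real.pi)) + ε * ξ, by fun_prop⟩
  let m : ℝ →ᵇ ℂ := (σ * Complex.I / 2 : ℂ) • (jbPow 1 zero_le_one).compContinuous φ -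
    BoundedContinuousFunction.const ℝ (Complex.I / (2 * ω₀))
  have hm : ∀ ξ, m ξ = (σ * Complex.I / 2) *
      jbPow 1 zero_le_one ((1 : ℤ) * (k₀ / (2 * Real.pi)) + ε * ξ) - Complex.I / (2 * ω₀) :=
    fun ξ => rfl
  refine ⟨m, hm, (BoundedContinuousFunction.norm_le hε.le).2 fun ξ => ?_⟩
  have hω : ω₀ ≠ 0 := by rintro rfl; simp at hσω
  have hκ := jb_carrier_frequency hω₀ hσ hσω
  have hσ0 : σ ≠ 0 := by rintro rfl; simp at hσ
  have h := abs_inv_jb_sub_le (k₀ / (2 * Real.pi)) (ε * ξ)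
  -- The bracket equals σω₀ at the carrier, hence (σi/2)/(σω₀) = i/(2ω₀) is the value subtracted.
  have e : m ξ = (σ * Complex.I / 2) *
      (((jb (k₀ / (2 * Real.pi) + ε * ξ))⁻¹ - (jb (k₀ / (2 * Real.pi)))⁻¹ : ℝ) : ℂ) := by
    have hc : (ω₀ : ℂ) ≠ 0 := by exact_mod_cast hω
    have hcσ : (σ : ℂ) ≠ 0 := by exact_mod_cast hσ0
    rw [hm, jbPow_apply, Int.cast_one, one_mul, Real.rpow_neg_one, hκ]
    push_cast
    rw [mul_sub]
    congr 1
    field_simp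
  have hp := Real.rpow_nonneg (jb_pos ξ).le (-1)
  have h1 : |2 * Real.pi * (ε * ξ)| ≤ ε * jb ξ := by
    rw [show 2 * Real.pi * (ε * ξ) = ε * (2 * Real.pi * ξ) by ring, abs_mul, abs_of_pos hε]
    exact mul_le_mul_of_nonneg_left (abs_le_jb ξ) hε.le
  have hn : ‖(σ * Complex.I / 2 : ℂ)‖ ≤ 1 := by
    rw [norm_div, norm_mul, Complex.norm_real, Real.norm_eq_abs, hσ, Complex.norm_I]; norm_num
  rw [BoundedContinuousFunction.mul_apply, norm_mul, norm_jbPow_apply, e, norm_mul,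
    Complex.norm_real, Real.norm_eq_abs]
  calc _ ≤ 1 * (ε * jb ξ) * jb ξ ^ (-1 : ℝ) := by gcongr; exact h.trans h1
    _ = ε * (jb ξ ^ 1 * jb ξ ^ (-1 : ℝ)) := by ring
    _ ≤ ε * 1 := by gcongr; exact jb_pow_mul_rpow_le 1 (by norm_num) ξ
    _ = ε := mul_one ε

end

/-! ### The Duhamel integral of the cubic nonlinearity, mode by mode -/

section

variable {k₀ ω₀ σ s T₀ : ℝ} (hk₀ : 0 < k₀) (hω₀ : ω₀ ^ 2 = k₀ ^ 2 + 1)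
  (hσ : |σ| = 1) (hσω : 0 < σ * ω₀) (hs : 1 / 2 < s) (hs4 : 1 / 2 < s + 4) (hT₀ : 0 < T₀)

/-- The integrated modulated curve. -/
def modInt (k₀ ω₀ σ ε : ℝ) (n : ℤ) (β : ℝ → Y) (t : ℝ) : Y :=
  ∫ τ in (0 : ℝ)..t, mulY (phase (dispD ω₀ σ (k₀ / ω₀) n (k₀ / (2 * Real.pi)) ε) τ)
    (mulY (jbPow 4 zero_le_four) (β (ε ^ 2 * τ)))

include hσ in
lemma continuous_mulY_dispD {ε : ℝ} (hε : 0 < ε) (n : ℤ) {β : ℝ → Y} (hβ : Continuous β) :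
    Continuous fun τ => mulY (phase (dispD ω₀ σ (k₀ / ω₀) n (k₀ / (2 * Real.pi)) ε) τ)
      (mulY (jbPow 4 zero_le_four) (β (ε ^ 2 * τ))) :=
  continuous_mulY_phase (abs_dispD_le ω₀ hσ (k₀ / ω₀) n (k₀ / (2 * Real.pi)) hε) (by norm_num)
    (hβ.comp (by fun_prop))

lemma continuous_modE {ε : ℝ} (hε : 0 < ε) (hε1 : ε ≤ 1) (k₀ ω₀ : ℝ) (n : ℤ) {β : ℝ → Y}
    (hβ : Continuous β) :
    Continuous fun t => modE hs hε hε1 k₀ ω₀ n t (mulY (jbPow 4 zero_le_four) (β t)) := by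
  refine (embE hs hε hε1 k₀ n).continuous.comp
    (continuous_mulY_phase (C := |n * ω₀| + |ε * (k₀ / ω₀)|) (fun ξ => ?_) (by norm_num) hβ)
  rw [carrier_apply, abs_neg]
  refine (abs_add_le _ _).trans ?_
  rw [add_mul, abs_mul (ε * (k₀ / ω₀))]
  exact add_le_add (le_mul_of_one_le_right (abs_nonneg _) (one_le_jb ξ))
    (mul_le_mul_of_nonneg_left (abs_le_jb ξ) (abs_nonneg _))

lemma continuous_ansE {ε : ℝ} (hε : 0 < ε) (hε1 : ε ≤ 1) (k₀ ω₀ : ℝ) {b : ℝ → Y}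
    (hb : Continuous b) : Continuous (ansE hs hε hε1 k₀ ω₀ b) :=
  (continuous_modE hs hε hε1 k₀ ω₀ 1 (hb.comp (by fun_prop : Continuous fun t => ε ^ 2 * t))).const_smul
    (ε : ℂ)

lemma continuous_ansatzE {ε : ℝ} (hε : 0 < ε) (hε1 : ε ≤ 1) (k₀ ω₀ : ℝ) {b : ℝ → Y}
    (hb : Continuous b) : Continuous (ansatzE hs hε hε1 k₀ ω₀ b) :=
  (continuous_ansE hs hε hε1 k₀ ω₀ hb).add
    (conjE.continuous.comp (continuous_ansE hs hε hε1 k₀ ω₀ hb))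

/-- The linear evolution of the positive frequency part of the initial data. -/
def freeE (σ : ℝ) {ε : ℝ} (hε : 0 < ε) (hε1 : ε ≤ 1) (k₀ ω₀ : ℝ) (b : ℝ → Y) (t : ℝ) : E :=
  mulE (k₀ / (2 * Real.pi)) (phase (σ • jbC) (-t)) (ansE hs hε hε1 k₀ ω₀ b 0)

/-- The ansatz in the interaction picture: the free evolution is factored out, so that it can be
compared with the initial data and the Duhamel integral under the same unitary group. -/
lemma mulE_ansE {ε : ℝ} (hε : 0 < ε) (hε1 : ε ≤ 1) (b : ℝ → Y) (t : ℝ) :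
    ansE hs hε hε1 k₀ ω₀ b t = mulE (k₀ / (2 * Real.pi)) (phase (σ • jbC) (-t))
      ((ε : ℂ) • embE hs hε hε1 k₀ 1
        (mulY (phase (dispD ω₀ σ (k₀ / ω₀) 1 (k₀ / (2 * Real.pi)) ε) t)
          (mulY (jbPow 4 zero_le_four) (b (ε ^ 2 * t))))) := by
  rw [ansE, ← mulE_phase_modE, map_smul, mulE_mulE, phase_mul (σ • jbC) (σ • jbC) (-t) t
    (D'' := jbC) (t'' := 0) (fun ξ => by ring), phase_zero, mulE_one]

lemma ansE_zero {ε : ℝ} (hε : 0 < ε) (hε1 : ε ≤ 1) (b : ℝ → Y) :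
    ansE hs hε hε1 k₀ ω₀ b 0 = (ε : ℂ) • embE hs hε hε1 k₀ 1
      (mulY (jbPow 4 zero_le_four) (b 0)) := by
  rw [ansE, modE, phase_zero, mulY_one, mul_zero]

lemma integral_smul_add₄ {f₁ f₂ f₃ f₄ : ℝ → E} (h₁ : Continuous f₁) (h₂ : Continuous f₂) (h₃ : Continuous f₃)
    (h₄ : Continuous f₄) (c : ℂ) :
    (Continuous fun τ => c • (f₁ τ + (3 : ℂ) • f₂ τ + (3 : ℂ) • f₃ τ + f₄ τ)) ∧
    ∀ t, ∫ τ in (0 : ℝ)..t, c • (f₁ τ + (3 : ℂ) • f₂ τ + (3 : ℂ) • f₃ τ + f₄ τ) =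
      c • ((∫ τ in (0 : ℝ)..t, f₁ τ) + (3 : ℂ) • (∫ τ in (0 : ℝ)..t, f₂ τ) +
        (3 : ℂ) • (∫ τ in (0 : ℝ)..t, f₃ τ) + ∫ τ in (0 : ℝ)..t, f₄ τ) := by
  have g₂ : Continuous fun τ => (3 : ℂ) • f₂ τ := h₂.const_smul (3 : ℂ)
  have g₃ : Continuous fun τ => (3 : ℂ) • f₃ τ := h₃.const_smul (3 : ℂ)
  have e₂ : Continuous fun τ => f₁ τ + (3 : ℂ) • f₂ τ := h₁.add g₂
  have e₃ : Continuous fun τ => f₁ τ + (3 : ℂ) • f₂ τ + (3 : ℂ) • f₃ τ := e₂.add g₃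
  have e₄ : Continuous fun τ => f₁ τ + (3 : ℂ) • f₂ τ + (3 : ℂ) • f₃ τ + f₄ τ := e₃.add h₄
  refine ⟨e₄.const_smul c, fun t => ?_⟩
  rw [intervalIntegral.integral_smul,
    intervalIntegral.integral_add (e₃.intervalIntegrable _ _) (h₄.intervalIntegrable _ _),
    intervalIntegral.integral_add (e₂.intervalIntegrable _ _) (g₃.intervalIntegrable _ _),
    intervalIntegral.integral_add (h₁.intervalIntegrable _ _) (g₂.intervalIntegrable _ _),
    intervalIntegral.integral_smul, intervalIntegral.integral_smul]

include hσ in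
/-- The Duhamel integral of the cubic nonlinearity, sorted by modes. -/
lemma integral_cube_ansatzE {ε : ℝ} (hε : 0 < ε) (hε1 : ε ≤ 1) {b : ℝ → Y} (hb : Continuous b) :
    (Continuous fun τ => mulE (k₀ / (2 * Real.pi)) (phase (σ • jbC) τ)
      ((algEε hk₀ hs hε hε1).cube (ansatzE hs hε hε1 k₀ ω₀ b τ))) ∧
    ∀ t, ∫ τ in (0 : ℝ)..t, mulE (k₀ / (2 * Real.pi)) (phase (σ • jbC) τ)
      ((algEε hk₀ hs hε hε1).cube (ansatzE hs hε hε1 k₀ ω₀ b τ)) =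
    ((ε ^ 3 : ℝ) : ℂ) •
      (embE hs hε hε1 k₀ 3 (modInt k₀ ω₀ σ ε 3
          (fun T => (algY hs4).mul ((algY hs4).mul (b T) (b T)) (b T)) t) +
        (3 : ℂ) • embE hs hε hε1 k₀ 1 (modInt k₀ ω₀ σ ε 1
          (fun T => (algY hs4).mul ((algY hs4).mul (b T) (b T)) (conjY (b T))) t) +
        (3 : ℂ) • embE hs hε hε1 k₀ (-1) (modInt k₀ ω₀ σ ε (-1)
          (fun T => (algY hs4).mul ((algY hs4).mul (b T) (conjY (b T))) (conjY (b T))) t) +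
        embE hs hε hε1 k₀ (-3) (modInt k₀ ω₀ σ ε (-3)
          (fun T => (algY hs4).mul ((algY hs4).mul (conjY (b T)) (conjY (b T))) (conjY (b T))) t)) := by
  have hbc : Continuous fun T => conjY (b T) := conjY.continuous.comp hb
  have hm : ∀ {f g : ℝ → Y}, Continuous f → Continuous g →
      Continuous fun T => (algY hs4).mul (f T) (g T) := fun hf hg =>
    ((algY hs4).mul.continuous.comp hf).clm_apply hg
  have hcont : ∀ (n : ℤ) {β : ℝ → Y}, Continuous β → Continuous fun τ =>
      embE hs hε hε1 k₀ n (mulY (phase (dispD ω₀ σ (k₀ / ω₀) n (k₀ / (2 * Real.pi)) ε) τ)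
        (mulY (jbPow 4 zero_le_four) (β (ε ^ 2 * τ)))) := fun n β hβ =>
    (embE hs hε hε1 k₀ n).continuous.comp (continuous_mulY_dispD hσ hε n hβ)
  have hint : ∀ (n : ℤ) {β : ℝ → Y}, Continuous β → ∀ t, ∫ τ in (0 : ℝ)..t,
      embE hs hε hε1 k₀ n (mulY (phase (dispD ω₀ σ (k₀ / ω₀) n (k₀ / (2 * Real.pi)) ε) τ)
        (mulY (jbPow 4 zero_le_four) (β (ε ^ 2 * τ)))) =
      embE hs hε hε1 k₀ n (modInt k₀ ω₀ σ ε n β t) := fun n β hβ t =>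
    ContinuousLinearMap.intervalIntegral_comp_comm _
      ((continuous_mulY_dispD hσ hε n hβ).intervalIntegrable _ _)
  have key := integral_smul_add₄ (hcont 3 (hm (hm hb hb) hb)) (hcont 1 (hm (hm hb hb) hbc))
    (hcont (-1) (hm (hm hb hbc) hbc)) (hcont (-3) (hm (hm hbc hbc) hbc)) ((ε ^ 3 : ℝ) : ℂ)
  have heq : ∀ τ, mulE (k₀ / (2 * Real.pi)) (phase (σ • jbC) τ)
      ((algEε hk₀ hs hε hε1).cube (ansatzE hs hε hε1 k₀ ω₀ b τ)) = ((ε ^ 3 : ℝ) : ℂ) • _ := fun τ => by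
    rw [cube_ansatzE hs hε hε1 ω₀ hk₀ hs4]
    simp only [map_smul, map_add, mulE_phase_modE]
    rfl
  simp only [heq]
  refine ⟨key.1, fun t => (key.2 t).trans ?_⟩
  rw [hint 3 (hm (hm hb hb) hb), hint 1 (hm (hm hb hb) hbc),
    hint (-1) (hm (hm hb hbc) hbc), hint (-3) (hm (hm hbc hbc) hbc)]

end

/-! ### Cancellation of the resonant mode and the size of the residual -/

section

variable {k₀ ω₀ σ s T₀ : ℝ} (hk₀ : 0 < k₀) (hω₀ : ω₀ ^ 2 = k₀ ^ 2 + 1)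
  (hσ : |σ| = 1) (hσω : 0 < σ * ω₀) (hs : 1 / 2 < s) (hs4 : 1 / 2 < s + 4) (hT₀ : 0 < T₀)

include hω₀ hσ hσω in
-- Near the carrier the symbol 1/⟨k⟩ of the propagator may be replaced by its value there; the
-- difference costs one order of smoothing and gains a factor ε.
lemma exists_mulE_embE_resonant {ε : ℝ} (hε : 0 < ε) (hε1 : ε ≤ 1) {β : ℝ → Y}
    (hβ : Continuous β) {M : ℝ} (hM : ∀ T ∈ Icc 0 T₀, ‖β T‖ ≤ M) {t : ℝ}
    (ht : t ∈ Icc 0 (T₀ / ε ^ 2)) :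
    ∃ R : Y, ‖R‖ ≤ ε * M * t ∧
      (σ * Complex.I / 2 : ℂ) • mulE (k₀ / (2 * Real.pi)) (jbPow 1 zero_le_one)
        (embE hs hε hε1 k₀ 1 (modInt k₀ ω₀ σ ε 1 β t)) =
      (Complex.I / (2 * ω₀)) • embE hs hε hε1 k₀ 1 (modInt k₀ ω₀ σ ε 1 β t) +
        embE hs hε hε1 k₀ 1 R := by
  obtain ⟨m, hm, hmn⟩ := exists_resonant_coefficient hω₀ hσ hσω hε
  refine ⟨mulY m (modInt k₀ ω₀ σ ε 1 β t), ?_, ?_⟩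
  · rw [modInt, ← ContinuousLinearMap.intervalIntegral_comp_comm _
      ((continuous_mulY_dispD hσ hε 1 hβ).intervalIntegrable _ _)]
    refine norm_integral_le_of_le ht.1 fun τ hτ => ?_
    rw [mulY_jbPow_split zero_le_one zero_le_three zero_le_four (by norm_num), mulY_mulY,
      mul_comm m, ← mulY_mulY, mulY_mulY m]
    refine (norm_mulY_phase_le _ _ _).trans ((norm_mulY_le _ _).trans ?_)
    exact mul_le_mul hmn ((norm_mulY_jbPow_le _ _ _).trans (hM _ (sq_mul_mem hε ht hτ)))
      (norm_nonneg _) hε.le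
  · have h := mulE_embE (m := (σ * Complex.I / 2 : ℂ) • jbPow 1 zero_le_one -
      (Complex.I / (2 * ω₀)) • 1) (m' := m) hs hε hε1 (n := 1) (k₀ := k₀)
      (fun ζ => by rw [hm]; simp) (modInt k₀ ω₀ σ ε 1 β t)
    rw [map_sub, map_smul, map_smul, sub_apply,
      smul_apply, smul_apply, mulE_one] at h
    rw [← h]; abel

lemma norm_mulE_phase_le (κ : ℝ) (D : C(ℝ, ℝ)) (t : ℝ) (e : E) : ‖mulE κ (phase D t) e‖ ≤ ‖e‖ :=
  (norm_mulE_le _ _ _).trans (mul_le_of_le_one_left (norm_nonneg _) (norm_phase_le D t))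

lemma norm_mulE_jbPow_le (κ p : ℝ) (hp : 0 ≤ p) (e : E) : ‖mulE κ (jbPow p hp) e‖ ≤ ‖e‖ :=
  (norm_mulE_le _ _ _).trans (mul_le_of_le_one_left (norm_nonneg _) (norm_jbPow_le p hp))

/-- The place where the NLS coefficient matters: the resonant Duhamel term 3ε³ d I and the growth ε
· ε² · 3d I of the ansatz cancel, leaving only the remainders R and R' and the modes without
resonance. -/
lemma resonant_cancellation {A B : Type*} [AddCommGroup A] [Module ℂ A] [AddCommGroup B]
    [Module ℂ B] (W : B →ₗ[ℂ] B) (J : A →ₗ[ℂ] B) {c d ε : ℂ} {I R' : A}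
    (h : c • W (J I) = d • J I + J R') {J₁ J₂ J₃ : B} {b R : A} :
    c • W (ε ^ 3 • (J₁ + (3 : ℂ) • J I + (3 : ℂ) • J₂ + J₃)) -
      (ε • J (b + R + ε ^ 2 • (3 * d) • I) - ε • J b) =
    ε ^ 3 • (c • W (J₁ + (3 : ℂ) • J₂ + J₃) + (3 : ℂ) • J R') - ε • J R := by
  simp only [map_add, map_smul]
  linear_combination (norm := module) (3 * ε ^ 3) • h

include hω₀ hσ hσω hT₀ in
/-- The cubic nonlinearity along the ansatz, decomposed into the resonant mode and modes without
resonances. -/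
lemma exists_cube_decomposition {b : ℝ → Y} (hb : IsC1 T₀ b fun T => nlsRhs hs4 ω₀ (b T)) :
    ∃ C M M' : ℝ, 0 ≤ C ∧ 0 ≤ M ∧ 0 ≤ M' ∧ ∀ (ε : ℝ) (hε : 0 < ε) (hε1 : ε ≤ 1),
      ∀ t ∈ Icc 0 (T₀ / ε ^ 2), ∃ (J₁ J₂ J₃ : E) (I R R' : Y),
      ‖J₁‖ ≤ C / ε * ε ^ (-(1 / 2) : ℝ) ∧ ‖J₂‖ ≤ C / ε * ε ^ (-(1 / 2) : ℝ) ∧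
      ‖J₃‖ ≤ C / ε * ε ^ (-(1 / 2) : ℝ) ∧ ‖R‖ ≤ 5 * T₀ * M * ε ∧ ‖R'‖ ≤ ε * M' * t ∧
      mulY (phase (dispD ω₀ σ (k₀ / ω₀) 1 (k₀ / (2 * Real.pi)) ε) t)
        (mulY (jbPow 4 zero_le_four) (b (ε ^ 2 * t))) =
          mulY (jbPow 4 zero_le_four) (b 0) + R +
          ((ε ^ 2 : ℝ) : ℂ) • (3 * Complex.I / (2 * ω₀)) • I ∧
      (σ * Complex.I / 2 : ℂ) • mulE (k₀ / (2 * Real.pi)) (jbPow 1 zero_le_one)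
        (embE hs hε hε1 k₀ 1 I) =
          (Complex.I / (2 * ω₀)) • embE hs hε hε1 k₀ 1 I + embE hs hε hε1 k₀ 1 R' ∧
      ∫ τ in (0 : ℝ)..t, mulE (k₀ / (2 * Real.pi)) (phase (σ • jbC) τ)
        ((algEε hk₀ hs hε hε1).cube (ansatzE hs hε hε1 k₀ ω₀ b τ)) =
          ((ε ^ 3 : ℝ) : ℂ) • (J₁ + (3 : ℂ) • embE hs hε hε1 k₀ 1 I + (3 : ℂ) • J₂ + J₃) := by
  have hs1 : 1 / 2 < s + 1 := by linarith
  have h3 := (hb.mul hs hs1 hs4 hb).mul hs hs1 hs4 hb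
  have h1 := (hb.mul hs hs1 hs4 hb.conj).mul hs hs1 hs4 hb.conj
  have h3' := (hb.conj.mul hs hs1 hs4 hb.conj).mul hs hs1 hs4 hb.conj
  have hres := (hb.mul hs hs1 hs4 hb).mul hs hs1 hs4 hb.conj
  obtain ⟨C₁, hC₁, H₁⟩ := exists_norm_integral_dispD_le hk₀ hω₀ hσ hσω hs hT₀ h3 (n := 3) (by simp)
  obtain ⟨C₂, hC₂, H₂⟩ := exists_norm_integral_dispD_le hk₀ hω₀ hσ hσω hs hT₀ h1 (n := -1) (by simp)
  obtain ⟨C₃, hC₃, H₃⟩ := exists_norm_integral_dispD_le hk₀ hω₀ hσ hσω hs hT₀ h3' (n := -3) (by simp)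
  obtain ⟨M, hM0, hM⟩ := exists_bound_Icc hb.cont T₀
  obtain ⟨M', hM0', hM'⟩ := exists_bound_Icc hres.cont T₀
  refine ⟨C₁ + C₂ + C₃, M, M', by positivity, hM0, hM0', fun ε hε hε1 t ht => ?_⟩
  have hint := (integral_cube_ansatzE hk₀ hσ hs hs4 hε hε1 (ω₀ := ω₀) hb.cont).2 t
  obtain ⟨R, hR, hRe⟩ := integral_resonant hω₀ hσ hσω hs4 hT₀ hb hM hε ht
  obtain ⟨R', hR', hRe'⟩ := exists_mulE_embE_resonant hω₀ hσ hσω hs hε hε1 hres.cont hM' ht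
  have hq : 0 ≤ ε ^ (-(1 / 2) : ℝ) := Real.rpow_nonneg hε.le _
  refine ⟨_, _, _, _, R, R', (H₁ ε hε hε1 t ht).trans ?_, (H₂ ε hε hε1 t ht).trans ?_,
    (H₃ ε hε hε1 t ht).trans ?_, hR, hR', hRe, hRe', hint⟩
  all_goals gcongr; linarith

include hω₀ hσ hσω hT₀ in
/-- The NLS ansatz solves the Klein-Gordon equation up to an error of order `ε^{3/2}`. -/
theorem exists_residual_le {b : ℝ → Y} (hb : IsC1 T₀ b fun T => nlsRhs hs4 ω₀ (b T)) :
    ∃ C : ℝ, 0 ≤ C ∧ ∀ (ε : ℝ) (hε : 0 < ε) (hε1 : ε ≤ 1), ∀ t ∈ Icc 0 (T₀ / ε ^ 2),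
      ‖freeE hs σ hε hε1 k₀ ω₀ b t + conjE (freeE hs σ hε hε1 k₀ ω₀ b t) +
        (∫ τ in (0 : ℝ)..t, waveE (k₀ / (2 * Real.pi)) (t - τ)
          ((algEε hk₀ hs hε hε1).cube (ansatzE hs hε hε1 k₀ ω₀ b τ))) -
        ansatzE hs hε hε1 k₀ ω₀ b t‖ ≤ C * ε ^ (3 / 2 : ℝ) := by
  set κ := k₀ / (2 * Real.pi)
  obtain ⟨C, M, M', hC, hM0, hM0', H⟩ := exists_cube_decomposition hk₀ hω₀ hσ hσω hs hs4 hT₀ hb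
  set K := (2 : ℝ) ^ s * jb ((1 : ℤ) * κ) ^ s
  have hK : 0 ≤ K := mul_nonneg (by positivity) (Real.rpow_nonneg (jb_pos _).le _)
  -- The five terms belong to J₁, J₂, J₃, R' and R; the leading factor accounts for the conjugate
  -- half.
  refine ⟨(1 + ‖conjE‖) * (C + 3 * C + C + 3 * (K * (M' * T₀)) + K * (5 * T₀ * M)), by positivity,
    fun ε hε hε1 t ht => ?_⟩
  have ht2 : ε ^ 2 * t ≤ T₀ := (sq_mul_mem hε ht ⟨ht.1, le_rfl⟩).2
  have hcont := (integral_cube_ansatzE hk₀ hσ hs hs4 hε hε1 (ω₀ := ω₀) hb.cont).1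
  obtain ⟨J₁, J₂, J₃, I, R, R', n₁, n₂, n₃, hR, hR', hRe2, hRe', hint⟩ := H ε hε hε1 t ht
  have hreal : ∀ t, conjE ((algEε hk₀ hs hε hε1).cube (ansatzE hs hε hε1 k₀ ω₀ b t)) =
      (algEε hk₀ hs hε hε1).cube (ansatzE hs hε hε1 k₀ ω₀ b t) := fun t => by
    rw [FunAlg.cube, algEε, ← algE_mul_conj, ← algE_mul_conj, conjE_ansatzE]
  rw [integral_waveE_eq hσ hreal hcont t rfl, hint]
  obtain ⟨Z, hZ⟩ : ∃ Z, Z = mulE κ ((σ * Complex.I / 2) • (phase (σ • jbC) (-t) * jbPow 1 zero_le_one))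
    (((ε ^ 3 : ℝ) : ℂ) • (J₁ + (3 : ℂ) • embE hs hε hε1 k₀ 1 I + (3 : ℂ) • J₂ + J₃)) := ⟨_, rfl⟩
  rw [← hZ]
  set Xe : E := ((ε ^ 3 : ℝ) : ℂ) • ((σ * Complex.I / 2 : ℂ) • mulE κ (jbPow 1 zero_le_one)
    (J₁ + (3 : ℂ) • J₂ + J₃) + (3 : ℂ) • embE hs hε hε1 k₀ 1 R') - (ε : ℂ) • embE hs hε hε1 k₀ 1 R
    with hXe
  -- Half of the residual, in the form of the unitary evolution of `Xe`; the other half is its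
  -- complex conjugate.
  have hr : Z - (ansE hs hε hε1 k₀ ω₀ b t - freeE hs σ hε hε1 k₀ ω₀ b t) =
      mulE κ (phase (σ • jbC) (-t)) Xe := by
    have h3 : (3 * Complex.I / (2 * ω₀) : ℂ) = 3 * (Complex.I / (2 * ω₀)) := by ring
    have hε3 : ((ε ^ 3 : ℝ) : ℂ) = (ε : ℂ) ^ 3 := by push_cast; rfl
    have hε2 : ((ε ^ 2 : ℝ) : ℂ) = (ε : ℂ) ^ 2 := by push_cast; rfl
    rw [hZ, mulE_ansE (σ := σ), freeE, ansE_zero, ← map_sub, hRe2, map_smul (mulE κ),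
      smul_apply, ← mulE_mulE, ← map_smul (mulE κ (phase (σ • jbC) (-t))),
      ← map_sub, hXe, h3, hε3, hε2]
    exact congrArg _ (resonant_cancellation (mulE κ (jbPow 1 zero_le_one)).toLinearMap
      (embE hs hε hε1 k₀ 1).toLinearMap hRe')
  have hnorm : ‖Xe‖ ≤ (C + 3 * C + C + 3 * (K * (M' * T₀)) + K * (5 * T₀ * M)) *
      ε ^ (3 / 2 : ℝ) := by
    have n₄ := norm_embE_le_mul hs hε hε1 k₀ 1 hR'
    have n₅ := norm_embE_le_mul hs hε hε1 k₀ 1 hR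
    have hε3 : ‖((ε ^ 3 : ℝ) : ℂ)‖ = ε ^ 3 := by
      rw [Complex.norm_real, Real.norm_of_nonneg (by positivity)]
    have hε' : ‖(ε : ℂ)‖ = ε := by rw [Complex.norm_real, Real.norm_of_nonneg hε.le]
    have hn : ‖(σ * Complex.I / 2 : ℂ)‖ ≤ 1 := by
      rw [norm_div, norm_mul, Complex.norm_real, Real.norm_eq_abs, hσ, Complex.norm_I]; norm_num
    have h3n : ∀ e : E, ‖(3 : ℂ) • e‖ = 3 * ‖e‖ := fun e => by rw [norm_smul]; norm_num
    set q := ε ^ (-(1 / 2) : ℝ) with hq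
    have hq0 : 0 ≤ q := Real.rpow_nonneg hε.le _
    have hq3 : ε ^ (3 / 2 : ℝ) = ε ^ 2 * q := by
      rw [hq, ← Real.rpow_natCast, ← Real.rpow_add hε]; norm_num
    have a₁ : ‖(σ * Complex.I / 2 : ℂ) • mulE κ (jbPow 1 zero_le_one) (J₁ + (3 : ℂ) • J₂ + J₃)‖ ≤
        C / ε * q + 3 * (C / ε * q) + C / ε * q := by
      rw [norm_smul]
      refine (mul_le_of_le_one_left (norm_nonneg _) hn).trans ((norm_mulE_jbPow_le _ _ _ _).trans
        (norm_add₃_le.trans ?_))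
      rw [h3n]
      gcongr
    -- With q = ε^(-1/2): the oscillatory integrals give ε³ · ε⁻¹ q, the coefficient error ε³ · εt q
    -- with ε²t ≤ T₀, and the Taylor remainder ε · ε q. All are of order ε² q = ε^(3/2).
    calc ‖Xe‖ ≤ ε ^ 3 * (C / ε * q + 3 * (C / ε * q) + C / ε * q + 3 * (K * (ε * M' * t) * q)) +
          ε * (K * (5 * T₀ * M * ε) * q) := by
          refine (norm_sub_le _ _).trans (add_le_add ?_ ?_)
          · rw [norm_smul, hε3]
            refine mul_le_mul_of_nonneg_left ((norm_add_le _ _).trans (add_le_add a₁ ?_))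
              (by positivity)
            rw [h3n]
            exact mul_le_mul_of_nonneg_left n₄ (by norm_num)
          · rw [norm_smul, hε']
            exact mul_le_mul_of_nonneg_left n₅ hε.le
      _ = (C + 3 * C + C + 3 * (K * (M' * (ε ^ 2 * t))) + K * (5 * T₀ * M)) * (ε ^ 2 * q) := by
          field_simp
      _ ≤ _ := by rw [hq3]; gcongr
  have hfin : freeE hs σ hε hε1 k₀ ω₀ b t + conjE (freeE hs σ hε hε1 k₀ ω₀ b t) + (Z + conjE Z) -
      ansatzE hs hε hε1 k₀ ω₀ b t = mulE κ (phase (σ • jbC) (-t)) Xe +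
        conjE (mulE κ (phase (σ • jbC) (-t)) Xe) := by
    rw [← hr, ansatzE, map_sub, map_sub]; abel
  rw [hfin]
  have hn : ‖mulE κ (phase (σ • jbC) (-t)) Xe‖ ≤ ‖Xe‖ := norm_mulE_phase_le _ _ _ _
  calc _ ≤ ‖Xe‖ + ‖conjE‖ * ‖Xe‖ := (norm_add_le _ _).trans (add_le_add hn
        ((conjE.le_opNorm _).trans (mul_le_mul_of_nonneg_left hn (norm_nonneg _))))
    _ = (1 + ‖conjE‖) * ‖Xe‖ := by ring
    _ ≤ _ := by rw [mul_assoc]; gcongr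

end

/-! ### Solutions near the NLS ansatz -/

/-- Nested products rather than a product of squares: each of the two outer multiplications, by an
element near the ansatz, then contributes a factor O(ε). -/
lemma FunAlg.cube_sub_cube {X : Type*} [NormedAddCommGroup X] [NormedSpace ℂ X] (A : FunAlg X)
    (a c : X) : A.cube a - A.cube c =
      A.mul a (A.mul a (a - c)) + A.mul a (A.mul c (a - c)) + A.mul c (A.mul c (a - c)) := by
  refine A.ext fun x => ?_
  simp only [FunAlg.cube, FunAlg.σ_mul_apply, map_add, map_sub, Pi.add_apply, Pi.sub_apply]
  ring

section

variable {k₀ ω₀ σ s T₀ : ℝ} (hk₀ : 0 < k₀) (hω₀ : ω₀ ^ 2 = k₀ ^ 2 + 1)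
  (hσ : |σ| = 1) (hσω : 0 < σ * ω₀) (hs : 1 / 2 < s) (hs4 : 1 / 2 < s + 4) (hT₀ : 0 < T₀)

/-- One of the four orders of smoothing provides the integrable Fourier transform required by
`exists_norm_embE_mul_le`; the phases and the other three orders do not increase the norm. -/
lemma exists_norm_modE_mul_le (k₀ ω₀ : ℝ) {s : ℝ} (hs : 1 / 2 < s) (n : ℤ) :
    ∃ C : ℝ, 0 ≤ C ∧ ∀ (ε : ℝ) (hε : 0 < ε) (hε1 : ε ≤ 1) (hk₀ : 0 < k₀) (t : ℝ) (b : Y) (e : E),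
      ‖(algEε hk₀ hs hε hε1).mul
        (modE hs hε hε1 k₀ ω₀ n t (mulY (jbPow 4 zero_le_four) b)) e‖ ≤ C * ‖b‖ * ‖e‖ := by
  obtain ⟨C, hC, H⟩ := exists_norm_embE_mul_le k₀ hs n
  refine ⟨C, hC, fun ε hε hε1 hk₀ t b e => ?_⟩
  rw [modE, mulY_jbPow_split zero_le_one zero_le_three zero_le_four (by norm_num), mulY_mulY,
    mul_comm, ← mulY_mulY]
  refine (H ε hε hε1 hk₀ _ e).trans ?_
  gcongr
  exact (norm_mulY_phase_le _ _ _).trans (norm_mulY_jbPow_le _ _ _)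

/-- Multiplication with the NLS ansatz is small uniformly in `ε`. -/
lemma exists_norm_ansatzE_mul_le (ω₀ T₀ : ℝ) {b : ℝ → Y} (hb : Continuous b) :
    ∃ C : ℝ, 0 ≤ C ∧ ∀ (ε : ℝ) (hε : 0 < ε) (hε1 : ε ≤ 1), ∀ t ∈ Icc 0 (T₀ / ε ^ 2), ∀ e : E,
      ‖(algEε hk₀ hs hε hε1).mul (ansatzE hs hε hε1 k₀ ω₀ b t) e‖ ≤ C * ε * ‖e‖ := by
  obtain ⟨C, hC, H⟩ := exists_norm_modE_mul_le k₀ ω₀ hs 1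
  obtain ⟨C', hC', H'⟩ := exists_norm_modE_mul_le k₀ ω₀ hs (-1)
  obtain ⟨M, hM0, hM⟩ := exists_bound_Icc hb T₀
  obtain ⟨M', hM0', hM'⟩ := exists_bound_Icc (conjY.continuous.comp hb) T₀
  refine ⟨C * M + C' * M', by positivity, fun ε hε hε1 t ht e => ?_⟩
  have hmem := sq_mul_mem hε ht ⟨ht.1, le_rfl⟩
  have hε' : ‖(ε : ℂ)‖ = ε := by rw [Complex.norm_real, Real.norm_of_nonneg hε.le]
  rw [ansatzE, conjE_ansE hs hε hε1 ω₀ hk₀, ansE, ← smul_add, map_smul, map_add,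
    smul_apply, add_apply, norm_smul, hε']
  calc _ ≤ ε * (C * M * ‖e‖ + C' * M' * ‖e‖) := by
        refine mul_le_mul_of_nonneg_left ((norm_add_le _ _).trans (add_le_add ?_ ?_)) hε.le
        · exact (H ε hε hε1 hk₀ t _ e).trans (by have := hM _ hmem; gcongr)
        · exact (H' ε hε hε1 hk₀ t _ e).trans (by have := hM' _ hmem; gcongr; exact this)
    _ = _ := by ring

lemma freeE_eq {ε : ℝ} (hε : 0 < ε) (hε1 : ε ≤ 1) (b : ℝ → Y) (t : ℝ) :
    freeE hs σ hε hε1 k₀ ω₀ b t = (ε : ℂ) • embE hs hε hε1 k₀ 1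
      (mulY (phase (dispD 0 σ 0 1 (k₀ / (2 * Real.pi)) ε) (-t))
        (mulY (jbPow 4 zero_le_four) (b 0))) := by
  rw [freeE, ansE_zero, map_smul, mulE_embE hs hε hε1 fun ζ => ?_]
  rw [phase_apply, phase_apply, dispD_apply]
  congr 3
  simp

include hσ in
lemma continuous_freeE {ε : ℝ} (hε : 0 < ε) (hε1 : ε ≤ 1) (b : ℝ → Y) :
    Continuous (freeE hs σ hε hε1 k₀ ω₀ b) := by
  have h := continuous_mulY_phase (abs_dispD_le 0 hσ 0 1 (k₀ / (2 * Real.pi)) hε)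
    (by norm_num : (1 : ℝ) ≤ 4) (continuous_const (y := b 0))
  have h2 := ((embE hs hε hε1 k₀ 1).continuous.comp (h.comp continuous_neg)).const_smul (ε : ℂ)
  exact h2.congr fun t => (freeE_eq hs hε hε1 b t).symm

lemma conjE_cube {ε : ℝ} (hε : 0 < ε) (hε1 : ε ≤ 1) (x : E) :
    conjE ((algEε hk₀ hs hε hε1).cube x) = (algEε hk₀ hs hε hε1).cube (conjE x) := by
  rw [FunAlg.cube, FunAlg.cube, algEε, algE_mul_conj, algE_mul_conj]

include hω₀ hσ hσω hT₀ in
/-- Existence of solutions of the Klein-Gordon equation near the NLS ansatz. -/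
theorem exists_solution {b : ℝ → Y} (hb : IsC1 T₀ b fun T => nlsRhs hs4 ω₀ (b T)) :
    ∃ ε₀ C : ℝ, 0 < ε₀ ∧ 0 ≤ C ∧ ∀ (ε : ℝ) (hε : 0 < ε) (hε1 : ε ≤ 1), ε < ε₀ →
      ∃ e : ℝ → E, Continuous e ∧ (∀ t ∈ Icc 0 (T₀ / ε ^ 2), ‖e t‖ ≤ C * ε ^ (3 / 2 : ℝ)) ∧
      (∀ t, conjE (e t) = e t) ∧ ∀ t ∈ Icc 0 (T₀ / ε ^ 2),
        ansatzE hs hε hε1 k₀ ω₀ b t + e t =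
          freeE hs σ hε hε1 k₀ ω₀ b t + conjE (freeE hs σ hε hε1 k₀ ω₀ b t) +
          ∫ τ in (0 : ℝ)..t, waveE (k₀ / (2 * Real.pi)) (t - τ)
            ((algEε hk₀ hs hε hε1).cube (ansatzE hs hε hε1 k₀ ω₀ b τ + e τ)) := by
  set κ := k₀ / (2 * Real.pi)
  obtain ⟨C₁, hC₁, H₁⟩ := exists_residual_le hk₀ hω₀ hσ hσω hs hs4 hT₀ hb
  obtain ⟨C₂, hC₂, H₂⟩ := exists_norm_ansatzE_mul_le hk₀ hs ω₀ T₀ hb.cont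
  set L := 3 * (C₂ + boundE hs) ^ 2 + 1
  have hK := boundE_nonneg hs
  have hL : 0 < L := by positivity
  set C := 2 * Real.exp (2 * (L * T₀)) * C₁
  have hC : 0 ≤ C := by positivity
  -- The threshold gives C ε^(1/2) ≤ 1, so that errors of size C ε^(3/2) stay in the ball of radius
  -- ε on which the Lipschitz bound holds.
  refine ⟨1 / (C + 1) ^ 2, C, by positivity, hC, fun ε hε hε1 hlt => ?_⟩
  have hε2 : 0 < ε ^ 2 := by positivity
  have hsmall : C * ε ^ (3 / 2 : ℝ) ≤ ε := by
    have h1 : C * ε ^ (1 / 2 : ℝ) ≤ 1 := by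
      have h2 : ε ^ (1 / 2 : ℝ) ≤ 1 / (C + 1) := by
        rw [← Real.sqrt_eq_rpow]
        refine Real.sqrt_le_iff.2 ⟨by positivity, ?_⟩
        rw [div_pow, one_pow]; exact hlt.le
      calc C * ε ^ (1 / 2 : ℝ) ≤ C * (1 / (C + 1)) := by gcongr
        _ ≤ 1 := by rw [mul_one_div]; exact div_le_one_of_le₀ (by linarith) (by linarith)
    calc C * ε ^ (3 / 2 : ℝ) = (C * ε ^ (1 / 2 : ℝ)) * ε := by
          rw [show (3 / 2 : ℝ) = 1 / 2 + 1 by norm_num, Real.rpow_add hε, Real.rpow_one]; ring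
      _ ≤ 1 * ε := by gcongr
      _ = ε := one_mul ε
  set A := algEε hk₀ hs hε hε1
  set Φ := ansatzE hs hε hε1 k₀ ω₀ b
  have hΦ : Continuous Φ := continuous_ansatzE hs hε hε1 k₀ ω₀ hb.cont
  set fr := freeE hs σ hε hε1 k₀ ω₀ b
  have hfr : Continuous fr := continuous_freeE hσ hs hε hε1 b
  have hcube : Continuous A.cube := A.continuous_cube
  have hmul : ∀ t ∈ Icc 0 (T₀ / ε ^ 2), ∀ x z : E, ‖x‖ ≤ ε →
      ‖A.mul (Φ t + x) z‖ ≤ (C₂ + boundE hs) * ε * ‖z‖ := fun t ht x z hx => by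
    rw [map_add, add_apply]
    have h1 : ‖A.mul x z‖ ≤ boundE hs * (‖x‖ * ‖z‖) := norm_algE_mul_le _ _ _ _ x z
    calc _ ≤ C₂ * ε * ‖z‖ + boundE hs * (ε * ‖z‖) :=
          (norm_add_le _ _).trans (add_le_add (H₂ ε hε hε1 t ht z) (h1.trans (by gcongr)))
      _ = _ := by ring
  have hcj : ∀ x, conjE (A.cube x) = A.cube (conjE x) := conjE_cube hk₀ hs hε hε1
  have hint : ∀ {f : ℝ → E} (hf : Continuous f) (t : ℝ),
      IntervalIntegrable (fun τ => waveE κ (t - τ) (f τ)) volume 0 t := fun hf t =>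
    Continuous.intervalIntegrable
      (((continuous_waveE κ).comp (continuous_const.sub continuous_id)).clm_apply hf) _ _
  -- The residual. The free part has the ansatz at time zero as initial value, so the error starts
  -- from zero.
  set ρ : ℝ → E := fun t => fr t + conjE (fr t) +
    (∫ τ in (0 : ℝ)..t, waveE κ (t - τ) (A.cube (Φ τ))) - Φ t
  have hNc : Continuous fun τ => A.cube (Φ τ) := hcube.comp hΦ
  have hρ : Continuous ρ := ((hfr.add (conjE.continuous.comp hfr)).add
    (continuous_volterra (continuous_waveE κ) hNc)).sub hΦ
  have hΦJ : ∀ t, conjE (Φ t) = Φ t := conjE_ansatzE hs hε hε1 ω₀ b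
  have hρJ : ∀ t, conjE (ρ t) = ρ t := fun t => by
    simp only [ρ]
    rw [map_sub, map_add, map_add, hΦJ, conjE_conjE, add_comm (conjE (fr t)),
      ← ContinuousLinearMap.intervalIntegral_comp_comm _ (hint hNc t)]
    congr 3; ext1 τ
    rw [conjE_waveE, hcj, hΦJ]
  -- The Lipschitz constant Lε² times the time T₀/ε² is L T₀, hence the Gronwall factor does not
  -- depend on ε. The symmetry is complex conjugation, which makes the solution real.
  obtain ⟨e, he, hen, heJ, heq⟩ := exists_volterra_solution (T := T₀ / ε ^ 2) (ℓ := L * ε ^ 2) (B := ε)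
    (R := C₁ * ε ^ (3 / 2 : ℝ)) (by positivity) (by positivity) (continuous_waveE κ)
    (norm_waveE_le κ) (F := fun t x => A.cube (Φ t + x) - A.cube (Φ t))
    ((hcube.comp ((hΦ.comp continuous_fst).add continuous_snd)).sub
      (hcube.comp (hΦ.comp continuous_fst))) (fun t => by simp) (fun t ht x y hx hy => by
      rw [sub_sub_sub_cancel_right, FunAlg.cube_sub_cube, add_sub_add_left_eq_sub]
      have hp : 0 ≤ (C₂ + boundE hs) * ε := by positivity
      have hz : ∀ x y z : E, ‖x‖ ≤ ε → ‖y‖ ≤ ε → ‖A.mul (Φ t + x) (A.mul (Φ t + y) z)‖ ≤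
          (C₂ + boundE hs) * ε * ((C₂ + boundE hs) * ε * ‖z‖) := fun x y z hx hy =>
        (hmul t ht x _ hx).trans (mul_le_mul_of_nonneg_left (hmul t ht y z hy) hp)
      refine norm_add₃_le.trans ((add_le_add (add_le_add (hz x x _ hx hx) (hz x y _ hx hy))
        (hz y y _ hy hy)).trans ?_)
      have h0 : 0 ≤ ε ^ 2 * ‖x - y‖ := by positivity
      simp only [L]
      nlinarith) hρ (fun t ht => H₁ ε hε hε1 t ht) (by
      have e1 : 2 * (L * ε ^ 2) * (T₀ / ε ^ 2) = 2 * (L * T₀) := by field_simp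
      rw [e1, ← mul_assoc]; exact hsmall) (conjE_waveE κ) (fun t x => by
      rw [map_sub, hcj, hcj, map_add, hΦJ]) hρJ
  refine ⟨e, he, fun t ht => ?_, heJ, fun t ht => ?_⟩
  · refine (hen t ht).trans_eq ?_
    have e1 : 2 * (L * ε ^ 2) * (T₀ / ε ^ 2) = 2 * (L * T₀) := by field_simp
    rw [e1, ← mul_assoc]
  · have h1 := heq t ht
    simp only [map_sub] at h1
    have hNe : Continuous fun τ => A.cube (Φ τ + e τ) := hcube.comp (hΦ.add he)
    rw [intervalIntegral.integral_sub (hint hNe t) (hint hNc t)] at h1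
    rw [h1]
    simp only [ρ]
    abel

end

/-! ### Mild solutions are solutions in the sense of distributions -/

/-- A time derivative of the phase costs one bracket and so lowers the order of smoothing from p to
q = p - 1. -/
lemma hasDerivAt_mulE_phase (κ η : ℝ) {p q : ℝ} (hp : 0 ≤ p) (hq : 1 ≤ q) (hpq : p = q + 1)
    {P : ℝ → E} {P' : E} {t : ℝ} (hP : HasDerivAt P P' t) :
    HasDerivAt (fun t => mulE κ (phase (η • jbC) t * jbPow p hp) (P t))
      ((Complex.I * η) • mulE κ (phase (η • jbC) t * jbPow q (zero_le_one.trans hq)) (P t) +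
        mulE κ (phase (η • jbC) t * jbPow p hp) P') t := by
  have h1 := hasDerivAt_phase_mul (D := η • jbC) (m := jbPow p hp)
    (n := (Complex.I * η : ℂ) • jbPow q (zero_le_one.trans hq)) (K := |η| ^ 2) (fun ξ => by
      have e : ((jb ξ ^ (-q) : ℝ) : ℂ) = (jb ξ : ℂ) * ((jb ξ ^ (-p) : ℝ) : ℂ) := by
        rw [← Complex.ofReal_mul, hpq, show -q = 1 + -(q + 1) by ring, Real.rpow_add (jb_pos ξ),
          Real.rpow_one]
      simp only [BoundedContinuousFunction.smul_apply, jbPow_apply, e, smul_eq_mul,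
        ContinuousMap.smul_apply, jbC_apply]
      push_cast; ring)
    (sq_mul_norm_jbPow_le (fun ξ => by
      rw [ContinuousMap.smul_apply, jbC_apply, smul_eq_mul, abs_mul, abs_of_pos (jb_pos ξ)])
      (by linarith)) t
  have h2 := ((mulE κ).hasFDerivAt.restrictScalars ℝ).comp_hasDerivAt t h1
  have B := ((isBoundedBilinearMap_apply (𝕜 := ℂ) (E := E) (F := E)).hasFDerivAt
    (mulE κ (phase (η • jbC) t * jbPow p hp), P t)).restrictScalars ℝ
  have h3 := B.comp_hasDerivAt t (h2.prodMk hP)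
  refine h3.congr_deriv ?_
  rw [mul_smul_comm]
  change mulE κ (phase (η • jbC) t * jbPow p hp) P' +
    mulE κ ((Complex.I * η : ℂ) • (phase (η • jbC) t * jbPow q _)) (P t) = _
  rw [map_smul, smul_apply, add_comm]

/-- The mild solution with initial data determined by `a`, and inhomogeneity `N`. -/
def mildE (κ σ : ℝ) (a : E) (N : ℝ → E) (t : ℝ) : E :=
  mulE κ (phase (σ • jbC) (-t)) a + conjE (mulE κ (phase (σ • jbC) (-t)) a) +
    ∫ τ in (0 : ℝ)..t, waveE κ (t - τ) (N τ)

lemma continuous_mulE_phase_jbPow (κ η : ℝ) {N : ℝ → E} (hN : Continuous N) :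
    Continuous fun τ => mulE κ (phase (η • jbC) τ * jbPow 1 zero_le_one) (N τ) := by
  have h : Continuous fun τ => phase (η • jbC) τ * jbPow 1 zero_le_one :=
    continuous_phase_jbPow (C := |η|) (fun ξ => by
      rw [ContinuousMap.smul_apply, jbC_apply, smul_eq_mul, abs_mul, abs_of_pos (jb_pos ξ)]) le_rfl
  exact ((mulE κ).continuous.comp h).clm_apply hN

/-- The addition theorem separates t from τ in the sine. Each term becomes a phase in t acting on a
primitive, to which the product rule applies. -/
lemma mulE_jbPow_mildE (κ σ : ℝ) (a : E) {N : ℝ → E} (hN : Continuous N) {p : ℝ} (hp : 0 ≤ p)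
    (t : ℝ) : mulE κ (jbPow p hp) (mildE κ σ a N t) =
      mulE κ (phase ((-σ) • jbC) t * jbPow p hp) a +
      conjE (mulE κ (phase ((-σ) • jbC) t * jbPow p hp) a) +
      (Complex.I / 2) •
        (mulE κ (phase ((-1 : ℝ) • jbC) t * jbPow p hp)
          (∫ τ in (0 : ℝ)..t, mulE κ (phase ((1 : ℝ) • jbC) τ * jbPow 1 zero_le_one) (N τ)) -
        mulE κ (phase ((1 : ℝ) • jbC) t * jbPow p hp)
          (∫ τ in (0 : ℝ)..t, mulE κ (phase ((-1 : ℝ) • jbC) τ * jbPow 1 zero_le_one) (N τ))) := by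
  have e1 : phase ((-σ) • jbC) t = phase (σ • jbC) (-t) := by
    ext ξ; simp [phase_apply]
  have hw : Continuous fun τ => waveE κ (t - τ) (N τ) :=
    ((continuous_waveE κ).comp (continuous_const.sub continuous_id)).clm_apply hN
  have c1 := continuous_mulE_phase_jbPow κ 1 hN
  have c2 := continuous_mulE_phase_jbPow κ (-1) hN
  have d1 : Continuous fun τ => mulE κ (phase ((-1 : ℝ) • jbC) t * jbPow p hp)
    (mulE κ (phase ((1 : ℝ) • jbC) τ * jbPow 1 zero_le_one) (N τ)) := (mulE κ _).continuous.comp c1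
  have d2 : Continuous fun τ => mulE κ (phase ((1 : ℝ) • jbC) t * jbPow p hp)
    (mulE κ (phase ((-1 : ℝ) • jbC) τ * jbPow 1 zero_le_one) (N τ)) :=
    (mulE κ _).continuous.comp c2
  rw [mildE, map_add, map_add, e1, mul_comm (phase (σ • jbC) (-t)), ← mulE_mulE]
  congr 1
  · congr 1
    rw [conjE_mulE κ (jbPow p hp), starNeg_jbPow]
  · rw [← ContinuousLinearMap.intervalIntegral_comp_comm _ (hw.intervalIntegrable _ _),
      ← ContinuousLinearMap.intervalIntegral_comp_comm _ (c1.intervalIntegrable _ _),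
      ← ContinuousLinearMap.intervalIntegral_comp_comm _ (c2.intervalIntegrable _ _),
      ← intervalIntegral.integral_sub (d1.intervalIntegrable _ _) (d2.intervalIntegrable _ _),
      ← intervalIntegral.integral_smul]
    congr 1; ext1 τ
    rw [waveE_apply, mulE_mulE, mulE_mulE, mulE_mulE, ← sub_apply, ← map_sub,
      ← smul_apply, ← map_smul]
    congr 2
    ext ξ
    have e1 : Complex.exp (Complex.I * ((jb ξ * -(t - τ) : ℝ) : ℂ)) =
        Complex.exp (Complex.I * ((-1 * jb ξ * t : ℝ) : ℂ)) *
          Complex.exp (Complex.I * ((1 * jb ξ * τ : ℝ) : ℂ)) := by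
      rw [← Complex.exp_add]; congr 1; push_cast; ring
    have e2 : Complex.exp (Complex.I * ((jb ξ * (t - τ) : ℝ) : ℂ)) =
        Complex.exp (Complex.I * ((1 * jb ξ * t : ℝ) : ℂ)) *
          Complex.exp (Complex.I * ((-1 * jb ξ * τ : ℝ) : ℂ)) := by
      rw [← Complex.exp_add]; congr 1; push_cast; ring
    simp only [waveSymbol, BoundedContinuousFunction.mul_apply,
      BoundedContinuousFunction.smul_apply, BoundedContinuousFunction.sub_apply, smul_eq_mul,
      phase_apply, ContinuousMap.smul_apply, jbC_apply, e1, e2]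
    ring

/-- The smoothed mild solution is twice differentiable and solves the wave equation. -/
theorem exists_hasDerivAt_mildE (κ : ℝ) {σ : ℝ} (hσ : |σ| = 1) (a : E) {N : ℝ → E}
    (hN : Continuous N) : ∃ y : ℝ → E, ∀ t,
      HasDerivAt (fun t => mulE κ (jbPow 4 zero_le_four) (mildE κ σ a N t)) (y t) t ∧
      HasDerivAt y (mulE κ (jbPow 4 zero_le_four) (N t) -
        mulE κ (jbPow 2 zero_le_two) (mildE κ σ a N t)) t := by
  have hσ2 : (σ : ℂ) ^ 2 = 1 := by
    have : σ ^ 2 = 1 := by rw [← sq_abs, hσ]; norm_num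
    exact_mod_cast this
  let Q : ℝ → (p : ℝ) → 0 ≤ p → (ℝ → E) → ℝ → E := fun η p hp P t =>
    mulE κ (phase (η • jbC) t * jbPow p hp) (P t)
  let P : ℝ → ℝ → E := fun η t =>
    ∫ τ in (0 : ℝ)..t, mulE κ (phase (η • jbC) τ * jbPow 1 zero_le_one) (N τ)
  have hP : ∀ η t, HasDerivAt (P η) (mulE κ (phase (η • jbC) t * jbPow 1 zero_le_one) (N t)) t :=
    fun η t => ((continuous_mulE_phase_jbPow κ η hN).integral_hasStrictDerivAt 0 t).hasDerivAt
  have hQa : ∀ {p q : ℝ} (hp : 0 ≤ p) (hq : 1 ≤ q) (hpq : p = q + 1) (t : ℝ),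
      HasDerivAt (Q (-σ) p hp fun _ => a)
        ((Complex.I * ((-σ : ℝ) : ℂ)) • Q (-σ) q (zero_le_one.trans hq) (fun _ => a) t) t :=
    fun hp hq hpq t => by
      have := hasDerivAt_mulE_phase κ (-σ) hp hq hpq (hasDerivAt_const t a)
      rwa [map_zero, add_zero] at this
  have hQ : ∀ (η : ℝ) {p q r : ℝ} (hp : 0 ≤ p) (hq : 1 ≤ q) (hr : 0 ≤ r) (hpq : p = q + 1)
      (hpr : p + 1 = r) (t : ℝ), HasDerivAt (Q η p hp (P (-η)))
        ((Complex.I * η) • Q η q (zero_le_one.trans hq) (P (-η)) t + mulE κ (jbPow r hr) (N t)) t :=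
    fun η p q r hp hq hr hpq hpr t => by
      refine (hasDerivAt_mulE_phase κ η hp hq hpq (hP (-η) t)).congr_deriv ?_
      congr 1
      rw [mulE_mulE, mul_mul_mul_comm, jbPow_mul_jbPow hp zero_le_one hr hpr,
        phase_mul (η • jbC) ((-η) • jbC) t t (D'' := jbC) (t'' := 0) (fun ξ => by simp),
        phase_zero, one_mul]
  have hmild : ∀ {p : ℝ} (hp : 0 ≤ p) t, mulE κ (jbPow p hp) (mildE κ σ a N t) =
      Q (-σ) p hp (fun _ => a) t + conjE (Q (-σ) p hp (fun _ => a) t) +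
      (Complex.I / 2) • (Q (-1) p hp (P (- -1)) t - Q 1 p hp (P (-1)) t) := fun hp t => by
    rw [mulE_jbPow_mildE κ σ a hN hp t, neg_neg]
  have h5 : (0 : ℝ) ≤ 5 := by norm_num
  have h31 : (1 : ℝ) ≤ 3 := by norm_num
  have h21 : (1 : ℝ) ≤ 2 := by norm_num
  refine ⟨fun t => (Complex.I * ((-σ : ℝ) : ℂ)) • Q (-σ) 3 zero_le_three (fun _ => a) t +
    conjE ((Complex.I * ((-σ : ℝ) : ℂ)) • Q (-σ) 3 zero_le_three (fun _ => a) t) +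
    (Complex.I / 2) • ((Complex.I * ((-1 : ℝ) : ℂ)) • Q (-1) 3 zero_le_three (P (- -1)) t -
      (Complex.I * ((1 : ℝ) : ℂ)) • Q 1 3 zero_le_three (P (-1)) t), fun t => ⟨?_, ?_⟩⟩
  · simp only [hmild]
    have h1 := hQa zero_le_four h31 (by norm_num) t
    have h2 := conjE.hasFDerivAt.comp_hasDerivAt t h1
    have h3 := hQ (-1) zero_le_four h31 h5 (by norm_num) (by norm_num) t
    have h4 := hQ 1 zero_le_four h31 h5 (by norm_num) (by norm_num) t
    refine ((h1.add h2).add ((h3.sub h4).const_smul (Complex.I / 2))).congr_deriv ?_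
    -- The two inhomogeneities cancel, since the sine propagator vanishes at time zero; they appear
    -- first in the second derivative, where they add up.
    rw [add_sub_add_right_eq_sub]
  · rw [hmild]
    have h1 := (hQa zero_le_three h21 (by norm_num) t).const_smul (Complex.I * ((-σ : ℝ) : ℂ))
    have h2 := conjE.hasFDerivAt.comp_hasDerivAt t h1
    have h3 := (hQ (-1) zero_le_three h21 zero_le_four (by norm_num) (by norm_num) t).const_smul
      (Complex.I * ((-1 : ℝ) : ℂ))
    have h4 := (hQ 1 zero_le_three h21 zero_le_four (by norm_num) (by norm_num) t).const_smul
      (Complex.I * ((1 : ℝ) : ℂ))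
    refine ((h1.add h2).add ((h3.sub h4).const_smul (Complex.I / 2))).congr_deriv ?_
    have hsq : (Complex.I * ((-σ : ℝ) : ℂ)) * (Complex.I * ((-σ : ℝ) : ℂ)) = -1 := by
      push_cast
      linear_combination (σ : ℂ) ^ 2 * Complex.I_sq - hσ2
    rw [smul_smul, hsq, neg_one_smul, map_neg]
    generalize Q (-σ) 2 _ (fun _ => a) t = u
    generalize Q (-1) 2 _ (P (- -1)) t = v
    generalize Q 1 2 _ (P (-1)) t = w
    generalize mulE κ (jbPow 4 zero_le_four) (N t) = z
    generalize conjE u = u'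
    simp only [Complex.ofReal_neg, Complex.ofReal_one, mul_one, smul_add, smul_sub, smul_smul,
      mul_neg, neg_mul, neg_neg, Complex.I_mul_I]
    have hI : Complex.I / 2 * Complex.I = -1 / 2 := by
      linear_combination (1 / 2 : ℂ) * Complex.I_mul_I
    simp only [hI]
    module

/-! ### Testing against smooth functions with compact support -/

lemma hasDerivAt_fchar (x ξ : ℝ) :
    HasDerivAt (fun x => fchar x ξ) (2 * Real.pi * ξ * Complex.I * fchar x ξ) x := by
  have h : HasDerivAt (fun x : ℝ => ((2 * Real.pi * ξ * x : ℝ) : ℂ) * Complex.I)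
      (((2 * Real.pi * ξ * 1 : ℝ) : ℂ) * Complex.I) x :=
    (((hasDerivAt_id x).const_mul (2 * Real.pi * ξ)).ofReal_comp).mul_const _
  refine h.cexp.congr_deriv ?_
  rw [← fchar]; push_cast; ring

lemma contDiff_deriv_test {φ : ℝ → ℝ} (hφ : ContDiff ℝ ∞ φ) : ContDiff ℝ ∞ (deriv φ) :=
  (contDiff_infty_iff_deriv.1 hφ).2

section

variable {φ : ℝ → ℝ} (hφ : ContDiff ℝ ∞ φ) (hφc : HasCompactSupport φ)
include hφ hφc

lemma integrable_fchar_mul_test (ξ : ℝ) : Integrable fun x => fchar x ξ * (φ x : ℂ) := by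
  refine Continuous.integrable_of_hasCompactSupport ?_ ?_
  · exact (continuous_fchar_left ξ).mul (Complex.continuous_ofReal.comp hφ.continuous)
  · exact (hφc.comp_left (g := Complex.ofReal) Complex.ofReal_zero).mul_left

lemma integral_fchar_mul_deriv (ξ : ℝ) : ∫ x, fchar x ξ * ((deriv φ x : ℝ) : ℂ) =
    -(2 * Real.pi * ξ * Complex.I * ∫ x, fchar x ξ * (φ x : ℂ)) := by
  have h := integral_mul_deriv_eq_deriv_mul_of_integrable (u := fun x => fchar x ξ)
    (v := fun x => (φ x : ℂ)) (u' := fun x => 2 * Real.pi * ξ * Complex.I * fchar x ξ)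
    (v' := fun x => ((deriv φ x : ℝ) : ℂ)) (fun x _ => hasDerivAt_fchar x ξ)
    (fun x _ => ((hφ.differentiable (by simp)) x).hasDerivAt.ofReal_comp)
    (integrable_fchar_mul_test (contDiff_deriv_test hφ) hφc.deriv ξ)
    (by
      have := (integrable_fchar_mul_test hφ hφc ξ).const_mul (2 * Real.pi * ξ * Complex.I)
      refine this.congr (Eventually.of_forall fun x => ?_)
      simp only [Pi.mul_apply]; ring)
    (integrable_fchar_mul_test hφ hφc ξ)
  rw [h, ← integral_const_mul]
  congr 2; ext x; ring

lemma integral_fchar_mul_sub_deriv (ξ : ℝ) :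
    ∫ x, fchar x ξ * ((φ x - deriv (deriv φ) x : ℝ) : ℂ) =
      (jb ξ : ℂ) ^ 2 * ∫ x, fchar x ξ * (φ x : ℂ) := by
  have hφ1 := contDiff_deriv_test hφ
  have hφ2 := contDiff_deriv_test hφ1
  have e : ∀ x, fchar x ξ * ((φ x - deriv (deriv φ) x : ℝ) : ℂ) =
      fchar x ξ * (φ x : ℂ) - fchar x ξ * ((deriv (deriv φ) x : ℝ) : ℂ) := fun x => by
    push_cast; ring
  simp only [e]
  rw [integral_sub (integrable_fchar_mul_test hφ hφc ξ)
    (integrable_fchar_mul_test hφ2 hφc.deriv.deriv ξ),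
    integral_fchar_mul_deriv hφ1 hφc.deriv, integral_fchar_mul_deriv hφ hφc,
    ← Complex.ofReal_pow, jb_sq]
  push_cast
  linear_combination -(2 * Real.pi * ξ : ℂ) ^ 2 * (∫ x, fchar x ξ * (φ x : ℂ)) * Complex.I_sq

lemma integrable_test : Integrable fun x => (φ x : ℂ) := by
  simpa using (hφ.continuous.integrable_of_hasCompactSupport hφc).ofReal (𝕜 := ℂ)

/-- By Fubini both integrals are taken on the frequency side, where 1 - ∂² on the test function is
the factor ⟨ξ⟩² that undoes two orders of smoothing. -/
lemma integral_test_mul_synth {s : ℝ} (hs : 1 / 2 < s) (f : L2) :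
    ∫ x, ((φ x - deriv (deriv φ) x : ℝ) : ℂ) * synth s (mulL2 (jbPow 2 zero_le_two) f) x =
      ∫ x, (φ x : ℂ) * synth s f x := by
  have hφ2 := contDiff_deriv_test (contDiff_deriv_test hφ)
  have h1 : Integrable fun x => ((φ x - deriv (deriv φ) x : ℝ) : ℂ) :=
    integrable_test (hφ.sub hφ2) (hφc.sub hφc.deriv.deriv)
  have h2 : Integrable fun ξ => jbPow 2 zero_le_two ξ * dens s f ξ :=
    (integrable_dens hs f).bdd_mul (jbPow 2 zero_le_two).continuous.aestronglyMeasurable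
      (Eventually.of_forall fun ξ => (jbPow 2 zero_le_two).norm_coe_le_norm ξ)
  simp only [synth_mulL2]
  simp only [synth_apply]
  rw [integral_mul_integral_fchar h1 h2, integral_mul_integral_fchar (integrable_test hφ hφc)
    (integrable_dens hs f)]
  congr 1; ext ξ
  rw [integral_fchar_mul_sub_deriv hφ hφc, jbPow_apply, Real.rpow_neg (jb_pos ξ).le,
    Real.rpow_two]
  have : (jb ξ : ℂ) ≠ 0 := by exact_mod_cast (jb_pos ξ).ne'
  push_cast
  field_simp

lemma integral_test_mul_synthV_eq_tsum {s : ℝ} (hs : 0 ≤ s) (κ : ℝ) (v : V) :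
    ∫ x, (φ x : ℂ) * synthV s κ v x =
      ∑' k : ℤ, coefV s κ v k * ∫ x, fchar x (k * κ) * (φ x : ℂ) := by
  have hi := integrable_test hφ hφc
  have e : ∀ (k : ℤ) x, (φ x : ℂ) * (coefV s κ v k * fchar x (k * κ)) =
    coefV s κ v k * (fchar x (k * κ) * (φ x : ℂ)) := fun k x => by ring
  simp only [synthV, ← tsum_mul_left, e]
  rw [← integral_tsum_of_summable_integral_norm]
  · simp only [integral_const_mul]
  · exact fun k => (integrable_fchar_mul_test hφ hφc _).const_mul _
  · simp only [norm_mul, norm_fchar, one_mul, integral_const_mul]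
    exact (summable_norm_coefV hs κ v).mul_right _

lemma integral_test_mul_synthV {s : ℝ} (hs : 0 ≤ s) (κ : ℝ) (v : V) :
    ∫ x, ((φ x - deriv (deriv φ) x : ℝ) : ℂ) * synthV s κ (mulV κ (jbPow 2 zero_le_two) v) x =
      ∫ x, (φ x : ℂ) * synthV s κ v x := by
  have hφ2 := contDiff_deriv_test (contDiff_deriv_test hφ)
  rw [integral_test_mul_synthV_eq_tsum (φ := fun x => φ x - deriv (deriv φ) x)
    (hφ.sub hφ2) (hφc.sub hφc.deriv.deriv) hs,
    integral_test_mul_synthV_eq_tsum hφ hφc hs]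
  congr 1; ext k
  rw [integral_fchar_mul_sub_deriv hφ hφc, coefV, coefV, mulV_apply, jbPow_apply,
    Real.rpow_neg (jb_pos (k * κ)).le, Real.rpow_neg (jb_pos (k * κ)).le, Real.rpow_two]
  have : (jb (k * κ) : ℂ) ≠ 0 := by exact_mod_cast (jb_pos _).ne'
  push_cast
  field_simp

end

/-- The linear combination `α V + β S` of the two components of `e = (V, S)`, as a function. -/
def combE (s κ : ℝ) (α β : ℂ) (e : E) (x : ℝ) : ℂ :=
  α * synthV s κ e.1 x + β * synth s e.2 x

lemma combE_add {s : ℝ} (hs : 1 / 2 < s) (κ : ℝ) (α β : ℂ) (e e' : E) (x : ℝ) :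
    combE s κ α β (e + e') x = combE s κ α β e x + combE s κ α β e' x := by
  have hs0 : 0 ≤ s := by linarith
  simp only [combE, Prod.fst_add, Prod.snd_add, synthV_add hs0, synth_add hs, Pi.add_apply]
  ring

lemma combE_smul (s κ : ℝ) (α β c : ℂ) (e : E) (x : ℝ) :
    combE s κ α β (c • e) x = c * combE s κ α β e x := by
  simp only [combE, Prod.smul_fst, Prod.smul_snd, synthV_smul, synth_smul, Pi.smul_apply,
    smul_eq_mul]
  ring

lemma continuous_combE {s : ℝ} (hs : 1 / 2 < s) (κ : ℝ) (α β : ℂ) (e : E) :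
    Continuous (combE s κ α β e) :=
  (continuous_const.mul (continuous_synthV (by linarith) κ _)).add
    (continuous_const.mul (continuous_synth hs _))

lemma exists_norm_combE_le {s : ℝ} (hs : 1 / 2 < s) (κ : ℝ) (α β : ℂ) :
    ∃ C, ∀ e x, ‖combE s κ α β e x‖ ≤ C * ‖e‖ := by
  refine ⟨‖α‖ + ‖β‖ * Real.sqrt (∫ ξ, jb ξ ^ (-(2 * s))), fun e x => ?_⟩
  rw [combE, add_mul]
  refine (norm_add_le _ _).trans (add_le_add ?_ ?_)
  · rw [norm_mul]
    exact mul_le_mul_of_nonneg_left ((norm_synthV_le (by linarith) κ _ x).trans (norm_fst_le e))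
      (norm_nonneg _)
  · rw [norm_mul, mul_assoc]
    exact mul_le_mul_of_nonneg_left ((norm_synth_le hs _ x).trans
      (mul_le_mul_of_nonneg_left (norm_snd_le e) (Real.sqrt_nonneg _))) (norm_nonneg _)

/-- The functional `e ↦ ∫ φ (α V + β S)`. -/
lemma exists_pairing {s : ℝ} (hs : 1 / 2 < s) (κ : ℝ) (α β : ℂ) {φ : ℝ → ℝ} (hφ : Continuous φ)
    (hφc : HasCompactSupport φ) :
    ∃ Λ : E →L[ℂ] ℂ, ∀ e, Λ e = ∫ x, (φ x : ℂ) * combE s κ α β e x := by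
  obtain ⟨C, hC⟩ := exists_norm_combE_le hs κ α β
  have hφi : Integrable fun x => (φ x : ℂ) := by
    simpa using (hφ.integrable_of_hasCompactSupport hφc).ofReal (𝕜 := ℂ)
  have hi : ∀ e, Integrable fun x => (φ x : ℂ) * combE s κ α β e x := fun e =>
    hφi.mul_bdd (c := C * ‖e‖) (continuous_combE hs κ α β e).aestronglyMeasurable
      (Eventually.of_forall fun x => hC e x)
  refine ⟨LinearMap.mkContinuous
    { toFun := fun e => ∫ x, (φ x : ℂ) * combE s κ α β e x
      map_add' := fun e e' => ?_
      map_smul' := fun c e => ?_ } ((∫ x, ‖(φ x : ℂ)‖) * C) fun e => ?_, fun e => rfl⟩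
  · simp only [combE_add hs, mul_add]
    exact integral_add (hi e) (hi e')
  · simp only [combE_smul, RingHom.id_apply, smul_eq_mul]
    rw [← integral_const_mul]
    congr 1; ext x; ring
  · simp only [LinearMap.coe_mk, AddHom.coe_mk]
    refine (norm_integral_le_integral_norm _).trans ?_
    rw [mul_assoc, ← integral_mul_const]
    refine integral_mono (hi e).norm (hφi.norm.mul_const _) fun x => ?_
    simp only [norm_mul]
    exact mul_le_mul_of_nonneg_left (hC e x) (norm_nonneg _)

lemma integrable_test_mul_combE {s : ℝ} (hs : 1 / 2 < s) (κ : ℝ) (α β : ℂ) (e : E) {φ : ℝ → ℝ}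
    (hφ : Continuous φ) (hφc : HasCompactSupport φ) :
    Integrable fun x => (φ x : ℂ) * combE s κ α β e x := by
  refine Continuous.integrable_of_hasCompactSupport ?_ ?_
  · exact (Complex.continuous_ofReal.comp hφ).mul (continuous_combE hs κ α β e)
  · exact (hφc.comp_left (g := Complex.ofReal) Complex.ofReal_zero).mul_right

lemma integral_test_mul_combE {s : ℝ} (hs : 1 / 2 < s) (κ : ℝ) (α β : ℂ) (e : E) {φ : ℝ → ℝ}
    (hφ : ContDiff ℝ ∞ φ) (hφc : HasCompactSupport φ) :
    ∫ x, ((φ x - deriv (deriv φ) x : ℝ) : ℂ) *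
        combE s κ α β (mulE κ (jbPow 2 zero_le_two) e) x =
      ∫ x, (φ x : ℂ) * combE s κ α β e x := by
  have hφ2 := contDiff_deriv_test (contDiff_deriv_test hφ)
  have key : ∀ (ψ : ℝ → ℝ) (_ : Continuous ψ) (_ : HasCompactSupport ψ) (e : E),
      ∫ x, (ψ x : ℂ) * combE s κ α β e x =
        α * (∫ x, (ψ x : ℂ) * synthV s κ e.1 x) + β * ∫ x, (ψ x : ℂ) * synth s e.2 x := by
    intro ψ h1 h2 e
    have i1 : Integrable fun x => (ψ x : ℂ) * synthV s κ e.1 x := by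
      simpa [combE] using integrable_test_mul_combE hs κ 1 0 e h1 h2
    have i2 : Integrable fun x => (ψ x : ℂ) * synth s e.2 x := by
      simpa [combE] using integrable_test_mul_combE hs κ 0 1 e h1 h2
    rw [← integral_const_mul, ← integral_const_mul, ← integral_add (i1.const_mul _)
      (i2.const_mul _)]
    congr 1; ext x; rw [combE]; ring
  rw [key (fun x => φ x - deriv (deriv φ) x) (hφ.continuous.sub hφ2.continuous)
    (hφc.sub hφc.deriv.deriv), key φ hφ.continuous hφc, mulE_apply]
  simp only
  rw [integral_test_mul_synthV hφ hφc (by linarith), integral_test_mul_synth hφ hφc hs]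

/-- Mild solutions solve the wave equation in the sense of distributions. -/
theorem solvesWave_mildE {s : ℝ} (hs : 1 / 2 < s) (κ : ℝ) {σ : ℝ} (hσ : |σ| = 1) (a : E)
    {N : ℝ → E} (hN : Continuous N) (α β : ℂ) {T : ℝ} {u : ℝ → E}
    (hu : ∀ t ∈ Icc 0 T, u t = mildE κ σ a N t) :
    SolvesWave T (fun t x => (combE s κ α β (u t) x).re)
      (fun t x => -(combE s κ α β (u t) x).re + (combE s κ α β (N t) x).re) := by
  intro φ hφ hφc
  obtain ⟨y, hy⟩ := exists_hasDerivAt_mildE κ hσ a hN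
  have hre : ∀ (ψ : ℝ → ℝ) (_ : Continuous ψ) (_ : HasCompactSupport ψ) (e : E),
      ∫ x, (combE s κ α β e x).re * ψ x = (∫ x, (ψ x : ℂ) * combE s κ α β e x).re := by
    intro ψ h1 h2 e
    refine Eq.trans ?_ (integral_re (integrable_test_mul_combE hs κ α β e h1 h2))
    congr 1; ext x
    simp [mul_comm]
  have hφ2 := contDiff_deriv_test (contDiff_deriv_test hφ)
  have hψ : ContDiff ℝ ∞ fun x => φ x - deriv (deriv φ) x := hφ.sub hφ2
  have hψc : HasCompactSupport fun x => φ x - deriv (deriv φ) x := hφc.sub hφc.deriv.deriv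
  have hψ2 := contDiff_deriv_test (contDiff_deriv_test hψ)
  -- Pairing with (1 - ∂²)²φ undoes four orders of smoothing. The smoothed solution is
  -- differentiable in `E`, and so the pairing of the unsmoothed one with φ is differentiable.
  obtain ⟨Λ, hΛ⟩ := exists_pairing hs κ α β (hψ.continuous.sub hψ2.continuous)
    (hψc.sub hψc.deriv.deriv)
  have hL2 : ∀ e, Λ (mulE κ (jbPow 2 zero_le_two) e) =
      ∫ x, ((φ x - deriv (deriv φ) x : ℝ) : ℂ) * combE s κ α β e x := fun e => by
    rw [hΛ, ← integral_test_mul_combE hs κ α β e hψ hψc]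
    rfl
  have hL4 : ∀ e, Λ (mulE κ (jbPow 4 zero_le_four) e) = ∫ x, (φ x : ℂ) * combE s κ α β e x :=
    fun e => by
    rw [← jbPow_mul_jbPow zero_le_two zero_le_two zero_le_four (by norm_num), ← mulE_mulE, hL2,
      integral_test_mul_combE hs κ α β e hφ hφc]
  have hΛd : ∀ {f : ℝ → E} {f' : E} {t : ℝ}, HasDerivAt f f' t →
      HasDerivAt (fun t => (Λ (f t)).re) (Λ f').re t := fun h =>
    (Complex.reCLM.hasFDerivAt.comp_hasDerivAt _
      ((Λ.hasFDerivAt.restrictScalars ℝ).comp_hasDerivAt _ h))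
  refine ⟨fun t => (Λ (y t)).re, fun t ht => ⟨?_, ?_⟩⟩
  · refine (hΛd (hy t).1).hasDerivWithinAt.congr_of_mem (fun τ hτ => ?_) ht
    rw [hre φ hφ.continuous hφc, hu τ hτ, hL4]
  · refine (hΛd (hy t).2).hasDerivWithinAt.congr_deriv ?_
    rw [map_sub, hL4, hL2, ← hu t ht, Complex.sub_re, ← hre φ hφ.continuous hφc,
      ← hre _ hψ.continuous hψc]
    have i1 : ∀ e (ψ : ℝ → ℝ) (_ : Continuous ψ) (_ : HasCompactSupport ψ),
      Integrable fun x => (combE s κ α β e x).re * ψ x := fun e ψ h1 h2 =>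
      Continuous.integrable_of_hasCompactSupport
        ((Complex.continuous_re.comp (continuous_combE hs κ α β e)).mul h1) h2.mul_left
    rw [← integral_sub (i1 _ _ hφ.continuous hφc) (i1 _ _ hψ.continuous hψc)]
    congr 1; ext x
    rw [iteratedDeriv_succ, iteratedDeriv_one]
    ring

/-! ### Validity of the NLS approximation -/

section

variable {k₀ s ε : ℝ} (hk₀ : 0 < k₀) (hs : 1 / 2 < s) (hε : 0 < ε) (hε1 : ε ≤ 1)

lemma combE_fst (e : E) (x : ℝ) :
    combE s (k₀ / (2 * Real.pi)) ((ε ^ (1 / 2 : ℝ) : ℝ) : ℂ) 0 e x =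
      ((algEε hk₀ hs hε hε1).σ e x).1 := by
  rw [algEε, algE_σ, combE, zero_mul, add_zero]

lemma combE_snd (e : E) (x : ℝ) :
    combE s (k₀ / (2 * Real.pi)) ((ε ^ (1 / 2 : ℝ) : ℝ) : ℂ) 1 e x =
      ((algEε hk₀ hs hε hε1).σ e x).2 := by
  rw [algEε, algE_σ, combE, one_mul]

lemma combE_sub (e : E) (x : ℝ) :
    combE s (k₀ / (2 * Real.pi)) 0 1 e x =
      ((algEε hk₀ hs hε hε1).σ e x).2 - ((algEε hk₀ hs hε hε1).σ e x).1 := by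
  rw [algEε, algE_σ, combE]
  simp

lemma algEε_σ_real {e : E} (he : conjE e = e) (x : ℝ) :
    ((((algEε hk₀ hs hε hε1).σ e x).1.re : ℝ) : ℂ) = ((algEε hk₀ hs hε hε1).σ e x).1 ∧
    ((((algEε hk₀ hs hε hε1).σ e x).2.re : ℝ) : ℂ) = ((algEε hk₀ hs hε hε1).σ e x).2 := by
  have h := algEε_σ_conj hk₀ hs hε hε1 e x
  rw [he] at h
  exact ⟨Complex.conj_eq_iff_re.1 (congrArg Prod.fst h).symm,
    Complex.conj_eq_iff_re.1 (congrArg Prod.snd h).symm⟩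

lemma algEε_σ_cube (e : E) (x : ℝ) :
    (algEε hk₀ hs hε hε1).σ ((algEε hk₀ hs hε hε1).cube e) x =
      (((algEε hk₀ hs hε hε1).σ e x).1 ^ 3, ((algEε hk₀ hs hε hε1).σ e x).2 ^ 3) := by
  rw [FunAlg.cube, FunAlg.σ_mul_apply, FunAlg.σ_mul_apply]
  ext
  · simp only [Prod.fst_mul]; ring
  · simp only [Prod.snd_mul]; ring

lemma algEε_σ_ansatzE (ω₀ : ℝ) {b : ℝ → Y} {Av : ℝ → ℂ} {Aw : ℝ → ℝ → ℂ} {t : ℝ}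
    (hb : (b (ε ^ 2 * t)).1 = Av (ε ^ 2 * t) ∧
      synth (s + 4) (b (ε ^ 2 * t)).2 = Aw (ε ^ 2 * t)) (x : ℝ) :
    (algEε hk₀ hs hε hε1).σ (ansatzE hs hε hε1 k₀ ω₀ b t) x =
      (((nlsAnsatz k₀ ω₀ ε (fun T _ => Av T) t x : ℝ) : ℂ),
        ((nlsAnsatz k₀ ω₀ ε (fun T _ => Av T) t x : ℝ) : ℂ) +
          ((nlsAnsatz k₀ ω₀ ε Aw t x : ℝ) : ℂ)) := by
  have hs4 : 1 / 2 < s + 4 := by linarith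
  have hc : fchar x (((1 : ℤ) : ℝ) * (k₀ / (2 * Real.pi))) *
      Complex.exp (-(Complex.I * (1 : ℤ) * ω₀ * t)) =
      Complex.exp (Complex.I * (k₀ * x - ω₀ * t)) := by
    have hπ : (Real.pi : ℂ) ≠ 0 := by exact_mod_cast Real.pi_ne_zero
    rw [fchar, ← Complex.exp_add]
    congr 1
    push_cast
    field_simp
    ring
  rw [ansatzE, map_add, Pi.add_apply, algEε_σ_conj, ansE, map_smul, Pi.smul_apply,
    algEε_σ_modE hs hε hε1 ω₀ hk₀, hc, algY_σ_jbPow hs _ hs4, algY_σ, hb.1, hb.2]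
  ext
  · simp only [nlsAnsatz, Prod.fst_add, Prod.smul_fst, Prod.fst_star, smul_eq_mul, Complex.star_def,
      Complex.add_conj]
    congr 3; ring
  · simp only [nlsAnsatz, Prod.snd_add, Prod.smul_snd, Prod.snd_star, smul_eq_mul, Complex.star_def,
      Complex.add_conj]
    rw [← Complex.ofReal_add, ← mul_add, ← Complex.add_re]
    congr 3; ring

end

lemma continuousCurve_of_bound {N : (ℝ → ℂ) → ℝ≥0∞} {T C : ℝ} {P : E → ℝ → ℂ}
    (hP : ∀ e e', P (e - e') = fun x => P e x - P e' x)
    (hN : ∀ e, N (P e) ≤ ENNReal.ofReal (C * ‖e‖)) {u : ℝ → E} (hu : Continuous u)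
    {f : ℝ → ℝ → ℂ} (hf : ∀ t, f t = P (u t)) : ContinuousCurve N T f := by
  refine ⟨fun t _ => ?_, fun t₀ _ => ?_⟩
  · rw [hf]
    exact (hN _).trans_lt ENNReal.ofReal_lt_top
  · have h1 : Tendsto (fun t => ENNReal.ofReal (C * ‖u t - u t₀‖)) (𝓝[Icc 0 T] t₀) (𝓝 0) := by
      have : Continuous fun t => ENNReal.ofReal (C * ‖u t - u t₀‖) :=
        ENNReal.continuous_ofReal.comp (continuous_const.mul (hu.sub continuous_const).norm)
      have h := this.tendsto t₀
      rw [sub_self, norm_zero, mul_zero, ENNReal.ofReal_zero] at h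
      exact h.mono_left nhdsWithin_le_nhds
    refine tendsto_of_tendsto_of_tendsto_of_le_of_le tendsto_const_nhds h1 (fun t => zero_le)
      fun t => ?_
    simp only [hf]
    rw [← hP]
    exact hN _

/-- The solution in `E` is read off through the two components of the algebra: the first is v, the
second is u = v + w, and their difference is w. Reality comes from invariance under conjugation. -/
theorem nlsApproximationValid {k₀ ω₀ s T₀ : ℝ} (hk₀ : 0 < k₀) (hω₀ : ω₀ ^ 2 = k₀ ^ 2 + 1)
    (hs : 1 / 2 < s) (hT₀ : 0 < T₀) {Av : ℝ → ℂ} {Aw : ℝ → ℝ → ℂ}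
    (h : IsSplitNLSSolution k₀ ω₀ (s + 4) T₀ Av Aw) :
    NLSApproximationValid k₀ ω₀ s T₀ Av Aw := by
  have hs4 : 1 / 2 < s + 4 := by linarith
  have hω : ω₀ ≠ 0 := by rintro rfl; nlinarith [sq_nonneg k₀]
  obtain ⟨σ, hσ, hσω⟩ : ∃ σ : ℝ, |σ| = 1 ∧ 0 < σ * ω₀ := by
    rcases lt_or_gt_of_ne hω with h | h
    · exact ⟨-1, by norm_num, by linarith⟩
    · exact ⟨1, by norm_num, by linarith⟩
  obtain ⟨b, hb, hbA, hbd⟩ := h.exists_curve hω₀ hs hT₀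
  have hC1 : IsC1 T₀ b fun T => nlsRhs hs4 ω₀ (b T) :=
    ⟨hb, (continuous_nlsRhs hs4 ω₀).comp hb, fun T hT => by
      rw [mulY_nlsRhs hs]; exact hbd T hT⟩
  obtain ⟨ε₀, C, hε₀, hC, H⟩ := exists_solution hk₀ hω₀ hσ hσω hs hs4 hT₀ hC1
  obtain ⟨K, hK, hper⟩ := exists_hsPerNorm_synthV_le hk₀ (by linarith : 0 ≤ s)
  -- The summand 1 only serves to make the constant positive.
  refine ⟨min ε₀ 1, lt_min hε₀ one_pos, (K + 1) * C + 1, by positivity, fun ε hεm => ?_⟩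
  have hε : 0 < ε := hεm.1
  have hε1 : ε ≤ 1 := (hεm.2.trans_le (min_le_right _ _)).le
  obtain ⟨e, he, hen, heJ, heq⟩ := H ε hε hε1 (hεm.2.trans_le (min_le_left _ _))
  obtain ⟨A, hA⟩ : ∃ A, A = algEε hk₀ hs hε hε1 := ⟨_, rfl⟩
  obtain ⟨Φ, hΦ⟩ : ∃ Φ, Φ = ansatzE hs hε hε1 k₀ ω₀ b := ⟨_, rfl⟩
  have hΦc : Continuous Φ := hΦ ▸ continuous_ansatzE hs hε hε1 k₀ ω₀ hb
  have hΦJ : ∀ t, conjE (Φ t) = Φ t := fun t => hΦ ▸ conjE_ansatzE hs hε hε1 ω₀ b t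
  have huc : Continuous fun t => Φ t + e t := hΦc.add he
  have huJ : ∀ t, conjE (Φ t + e t) = Φ t + e t := fun t => by rw [map_add, hΦJ, heJ]
  set κ := k₀ / (2 * Real.pi) with hκ
  set δ := ε ^ (1 / 2 : ℝ)
  have hδ0 : 0 < δ := rpow_half_pos hε
  have hδ1 : δ ≤ 1 := rpow_half_le_one hε hε1
  have hN : Continuous fun t => A.cube (Φ t + e t) := A.continuous_cube.comp huc
  have hu : ∀ t ∈ Icc 0 (T₀ / ε ^ 2), Φ t + e t =
      mildE κ σ (ansE hs hε hε1 k₀ ω₀ b 0) (fun t => A.cube (Φ t + e t)) t := fun t ht => by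
    rw [hΦ, hA]; exact heq t ht
  have c1 : ∀ e x, combE s κ (δ : ℂ) 0 e x = (A.σ e x).1 := fun e x =>
    hA ▸ combE_fst hk₀ hs hε hε1 e x
  have c2 : ∀ e x, combE s κ (δ : ℂ) 1 e x = (A.σ e x).2 := fun e x =>
    hA ▸ combE_snd hk₀ hs hε hε1 e x
  have c3 : ∀ e x, combE s κ 0 1 e x = (A.σ e x).2 - (A.σ e x).1 := fun e x =>
    hA ▸ combE_sub hk₀ hs hε hε1 e x
  have hreal : ∀ e, conjE e = e → ∀ x, (((A.σ e x).1.re : ℝ) : ℂ) = (A.σ e x).1 ∧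
      (((A.σ e x).2.re : ℝ) : ℂ) = (A.σ e x).2 := fun e he x =>
    hA ▸ algEε_σ_real hk₀ hs hε hε1 he x
  have hcube : ∀ e x, A.σ (A.cube e) x = ((A.σ e x).1 ^ 3, (A.σ e x).2 ^ 3) := fun e x =>
    hA ▸ algEε_σ_cube hk₀ hs hε hε1 e x
  have P1 : ∀ e e', combE s κ (δ : ℂ) 0 (e - e') =
      fun x => combE s κ (δ : ℂ) 0 e x - combE s κ (δ : ℂ) 0 e' x := fun e e' => by
    ext x; simp [c1]
  have P2 : ∀ e e', combE s κ 0 1 (e - e') =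
      fun x => combE s κ 0 1 e x - combE s κ 0 1 e' x := fun e e' => by
    ext x; simp [c3]; ring
  have N1 : ∀ e, hsPerNorm k₀ s (combE s κ (δ : ℂ) 0 e) ≤ ENNReal.ofReal (K * ‖e‖) := fun e => by
    have e1 : combE s κ (δ : ℂ) 0 e = synthV s κ ((δ : ℂ) • e.1) := by
      ext x; rw [synthV_smul, combE, zero_mul, add_zero]; rfl
    rw [e1]
    refine (hper _).trans (ENNReal.ofReal_le_ofReal (mul_le_mul_of_nonneg_left ?_ hK))
    rw [norm_smul, Complex.norm_real, Real.norm_of_nonneg hδ0.le]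
    exact (mul_le_of_le_one_left (norm_nonneg _) hδ1).trans (norm_fst_le e)
  have N2 : ∀ e, hsNorm s (combE s κ 0 1 e) ≤ ENNReal.ofReal (1 * ‖e‖) := fun e => by
    have e1 : combE s κ 0 1 e = synth s e.2 := by
      ext x; simp [combE]
    rw [e1, hsNorm_synth hs, ← ofReal_norm, one_mul]
    exact ENNReal.ofReal_le_ofReal (norm_snd_le e)
  have r1 : ∀ e, conjE e = e → ∀ x, (((combE s κ (δ : ℂ) 0 e x).re : ℝ) : ℂ) =
      combE s κ (δ : ℂ) 0 e x := fun e he x => by rw [c1, (hreal e he x).1]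
  have r2 : ∀ e, conjE e = e → ∀ x, (((combE s κ 0 1 e x).re : ℝ) : ℂ) =
      combE s κ 0 1 e x := fun e he x => by
    rw [c3, Complex.sub_re, Complex.ofReal_sub, (hreal e he x).1, (hreal e he x).2]
  refine ⟨fun t x => (combE s κ (δ : ℂ) 0 (Φ t + e t) x).re,
    fun t x => (combE s κ 0 1 (Φ t + e t) x).re,
    continuousCurve_of_bound P1 N1 huc fun t => funext fun x => r1 _ (huJ t) x,
    continuousCurve_of_bound P2 N2 huc fun t => funext fun x => r2 _ (huJ t) x, ⟨?_, ?_, ?_⟩,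
    fun t ht => ?_⟩
  · convert solvesWave_mildE hs κ hσ _ hN (δ : ℂ) 0 hu using 4 with t x
    rw [c1, c1, hcube, ← (hreal _ (huJ t) x).1, ← Complex.ofReal_pow, Complex.ofReal_re,
      Complex.ofReal_re]
  -- Here the inhomogeneity is u³ - v³, which expands to the coupling terms of the equation for w.
  · convert solvesWave_mildE hs κ hσ _ hN 0 1 hu using 3 with t x
    rw [c1, c3, c3, hcube, ← (hreal _ (huJ t) x).1, ← (hreal _ (huJ t) x).2, ← Complex.ofReal_pow,
      ← Complex.ofReal_pow, ← Complex.ofReal_sub, ← Complex.ofReal_sub, Complex.ofReal_re,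
      Complex.ofReal_re, Complex.ofReal_re]
    ring
  · convert solvesWave_mildE hs κ hσ _ hN (δ : ℂ) 1 hu using 3 with t x t x
    · rw [c1, c3, c2, ← Complex.add_re, add_sub_cancel]
    · rw [c1, c2, c3, c2, hcube, ← Complex.add_re, add_sub_cancel, ← (hreal _ (huJ t) x).2,
        ← Complex.ofReal_pow, Complex.ofReal_re, Complex.ofReal_re]
  · have ht' : ε ^ 2 * t ∈ Icc 0 T₀ := by
      refine ⟨mul_nonneg (by positivity) ht.1, ?_⟩
      have := (le_div_iff₀ (by positivity : 0 < ε ^ 2)).1 ht.2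
      linarith
    have hans : ∀ x, A.σ (Φ t) x = _ := fun x =>
      hA ▸ hΦ ▸ algEε_σ_ansatzE hk₀ hs hε hε1 ω₀ (hbA _ ht') x
    have e1 : (fun x => (((combE s κ (δ : ℂ) 0 (Φ t + e t) x).re -
        nlsAnsatz k₀ ω₀ ε (fun T _ => Av T) t x : ℝ) : ℂ)) = combE s κ (δ : ℂ) 0 (e t) := by
      ext x
      rw [Complex.ofReal_sub, r1 _ (huJ t), combE_add hs, c1 (Φ t), hans]
      simp
    have e2 : (fun x => (((combE s κ 0 1 (Φ t + e t) x).re -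
        nlsAnsatz k₀ ω₀ ε Aw t x : ℝ) : ℂ)) = combE s κ 0 1 (e t) := by
      ext x
      rw [Complex.ofReal_sub, r2 _ (huJ t), combE_add hs, c3 (Φ t), hans]
      simp
    rw [e1, e2]
    refine (add_le_add (N1 _) (N2 _)).trans ?_
    rw [← ENNReal.ofReal_add (by positivity) (by positivity)]
    refine ENNReal.ofReal_le_ofReal ?_
    have hp : 0 ≤ ε ^ (3 / 2 : ℝ) := Real.rpow_nonneg hε.le _
    have := hen t ht
    calc K * ‖e t‖ + 1 * ‖e t‖ = (K + 1) * ‖e t‖ := by ring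
      _ ≤ (K + 1) * (C * ε ^ (3 / 2 : ℝ)) := by gcongr
      _ ≤ _ := by nlinarith

/-! ### Sobolev norms in terms of derivatives -/

lemma integral_mul_fourier_L2 (ψ : SchwartzMap ℝ ℂ) (f : L2) :
    ∫ x, ψ x * (𝓕 f : L2) x = ∫ x, 𝓕 (ψ : ℝ → ℂ) x * f x := by
  have e1 := congrArg (fun T => T ψ) (Lp.fourier_toTemperedDistribution_eq f)
  simp only [TemperedDistribution.fourier_apply, Lp.toTemperedDistribution_apply,
    smul_eq_mul] at e1
  rw [← e1, SchwartzMap.fourier_coe]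

lemma integrable_fourier_mul (ψ : SchwartzMap ℝ ℂ) {u : ℝ → ℂ} (hu : MemLp u 2) :
    Integrable (𝓕 (ψ : ℝ → ℂ) * u) := by
  rw [← SchwartzMap.fourier_coe]
  exact ((𝓕 ψ).memLp 2).integrable_mul hu

lemma hasDerivAt_fourier_schwartz {ψ χ : SchwartzMap ℝ ℂ}
    (hχ : ∀ x : ℝ, χ x = (-2 * Real.pi * Complex.I * x) • ψ x) (x : ℝ) :
    HasDerivAt (𝓕 (ψ : ℝ → ℂ)) (𝓕 (χ : ℝ → ℂ) x) x := by
  have h1 : Integrable fun x : ℝ => x • ψ x := by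
    refine (χ.integrable.const_mul (-2 * Real.pi * Complex.I)⁻¹).congr
      (Eventually.of_forall fun x => ?_)
    have hπ : (Real.pi : ℂ) ≠ 0 := by exact_mod_cast Real.pi_ne_zero
    have hI := Complex.I_ne_zero
    simp only [hχ, smul_eq_mul, Complex.real_smul]
    field_simp
  have h2 := Real.hasDerivAt_fourier ψ.integrable h1 x
  rwa [← funext hχ] at h2

lemma integral_fourier_mul_deriv {ψ χ : SchwartzMap ℝ ℂ}
    (hχ : ∀ x : ℝ, χ x = (-2 * Real.pi * Complex.I * x) • ψ x) {f f' : ℝ → ℂ}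
    (hd : ∀ x, HasDerivAt f (f' x) x) (hf : MemLp f 2) (hf' : MemLp f' 2) :
    ∫ x, 𝓕 (ψ : ℝ → ℂ) x * f' x = -∫ x, 𝓕 (χ : ℝ → ℂ) x * f x :=
  integral_mul_deriv_eq_deriv_mul_of_integrable (u := 𝓕 (ψ : ℝ → ℂ)) (v := f)
    (fun x _ => hasDerivAt_fourier_schwartz hχ x) (fun x _ => hd x) (integrable_fourier_mul ψ hf')
    (integrable_fourier_mul χ hf) (integrable_fourier_mul ψ hf)

lemma integral_mul_fourier_toLp (ψ : SchwartzMap ℝ ℂ) {f : ℝ → ℂ} (hf : MemLp f 2) :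
    ∫ x, ψ x * (𝓕 (hf.toLp f) : L2) x = ∫ x, 𝓕 (ψ : ℝ → ℂ) x * f x := by
  rw [integral_mul_fourier_L2]
  refine integral_congr_ae ?_
  filter_upwards [hf.coeFn_toLp] with x hx
  rw [hx]

lemma exists_schwartzMap_eq {g : ℝ → ℂ} (hg : ContDiff ℝ ∞ g) (hc : HasCompactSupport g) :
    ∃ ψ : SchwartzMap ℝ ℂ, ∀ x, ψ x = g x :=
  ⟨hc.toSchwartzMap hg, fun _ => rfl⟩

/-- The Fourier transform turns derivatives into multiplication, for functions in `L²`. -/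
lemma fourier_toLp_deriv {f f' : ℝ → ℂ} (hd : ∀ x, HasDerivAt f (f' x) x) (hf : MemLp f 2)
    (hf' : MemLp f' 2) : (𝓕 (hf'.toLp f') : L2) =ᵐ[volume]
      fun ξ => (2 * Real.pi * Complex.I * ξ) * (𝓕 (hf.toLp f) : L2) ξ := by
  have hloc : LocallyIntegrable (fun ξ : ℝ => (2 * Real.pi * Complex.I * ξ) *
      (𝓕 (hf.toLp f) : L2) ξ) volume := by
    have h := ((Lp.memLp (𝓕 (hf.toLp f) : L2)).locallyIntegrable (by norm_num))
    rw [← locallyIntegrableOn_univ] at h ⊢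
    exact h.continuousOn_mul (g := fun ξ : ℝ => (2 * Real.pi * Complex.I * ξ : ℂ))
      (by fun_prop) isOpen_univ.isLocallyClosed
  refine ae_eq_of_integral_contDiff_smul_eq
    ((Lp.memLp _).locallyIntegrable (by norm_num)) hloc fun φ hφ hφc => ?_
  have hφ' : HasCompactSupport fun x => (φ x : ℂ) :=
    hφc.comp_left (g := fun y : ℝ => (y : ℂ)) (by simp)
  have hφ1 : ContDiff ℝ ∞ fun x => (φ x : ℂ) := Complex.ofRealCLM.contDiff.comp hφ
  -- The derivative of the transform of φ is the transform of -2πix φ. Integration by parts on the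
  -- physical side therefore becomes multiplication by 2πix against φ.
  have hχc : HasCompactSupport fun x : ℝ => (-2 * Real.pi * Complex.I * x) * (φ x : ℂ) :=
    hφ'.mul_left
  have hχ1 : ContDiff ℝ ∞ fun x : ℝ => (-2 * Real.pi * Complex.I * x) * (φ x : ℂ) :=
    (contDiff_const.mul Complex.ofRealCLM.contDiff).mul hφ1
  obtain ⟨ψ, hψ⟩ := exists_schwartzMap_eq hφ1 hφ'
  obtain ⟨χ, hχ'⟩ := exists_schwartzMap_eq hχ1 hχc
  have hχ : ∀ x : ℝ, χ x = (-2 * Real.pi * Complex.I * x) • ψ x := fun x => by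
    rw [hχ', hψ, smul_eq_mul]
  have key := integral_fourier_mul_deriv hχ hd hf hf'
  rw [← integral_mul_fourier_toLp ψ hf', ← integral_mul_fourier_toLp χ hf, ← integral_neg] at key
  refine Eq.trans ?_ (key.trans ?_)
  · simp only [hψ, Complex.real_smul]
  · congr 1; ext x
    rw [hχ, hψ, smul_eq_mul, Complex.real_smul]; ring

lemma fourier_toLp_iteratedDeriv {f : ℝ → ℂ} (hf : ContDiff ℝ ∞ f) (hf0 : MemLp f 2)
    (hL : ∀ n, MemLp (iteratedDeriv n f) 2) (n : ℕ) :
    (𝓕 ((hL n).toLp (iteratedDeriv n f)) : L2) =ᵐ[volume]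
      fun ξ => (2 * Real.pi * Complex.I * ξ) ^ n * (𝓕 (hf0.toLp f) : L2) ξ := by
  induction n with
  | zero => simp
  | succ n ih =>
    have hd : ∀ x, HasDerivAt (iteratedDeriv n f) (iteratedDeriv (n + 1) f x) x := fun x => by
      rw [iteratedDeriv_succ]
      exact (hf.differentiable_iteratedDeriv n (by exact_mod_cast WithTop.coe_lt_top _) x).hasDerivAt
    filter_upwards [ih, fourier_toLp_deriv hd (hL n) (hL (n + 1))] with ξ h1 h2
    rw [h2, h1]; ring

lemma eLpNorm_fourier_toLp {f : ℝ → ℂ} (hf : MemLp f 2) :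
    eLpNorm (𝓕 (hf.toLp f) : L2) 2 = eLpNorm f 2 := by
  rw [← Lp.enorm_def, ← ofReal_norm, Lp.norm_fourier_eq, ofReal_norm,
    Lp.enorm_toLp]

lemma jb_rpow_le {r : ℝ} {m : ℕ} (hr : r ≤ m) (ξ : ℝ) :
    jb ξ ^ r ≤ 2 ^ m * (1 + |2 * Real.pi * ξ| ^ m) := by
  have h1 : jb ξ ≤ 2 * max 1 |2 * Real.pi * ξ| := by
    have h2 := jb_sq ξ
    have h3 := le_max_left 1 |2 * Real.pi * ξ|
    have h4 := le_max_right 1 |2 * Real.pi * ξ|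
    have h5 := abs_nonneg (2 * Real.pi * ξ)
    rw [← sq_abs (2 * Real.pi * ξ)] at h2
    refine abs_le_of_sq_le_sq' ?_ (by positivity) |>.2
    nlinarith
  calc jb ξ ^ r ≤ jb ξ ^ (m : ℝ) := Real.rpow_le_rpow_of_exponent_le (one_le_jb ξ) hr
    _ = jb ξ ^ m := Real.rpow_natCast _ _
    _ ≤ (2 * max 1 |2 * Real.pi * ξ|) ^ m := pow_le_pow_left₀ (jb_pos ξ).le h1 m
    _ = 2 ^ m * max 1 |2 * Real.pi * ξ| ^ m := mul_pow _ _ _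
    _ ≤ _ := by
      gcongr
      rcases max_cases 1 |2 * Real.pi * ξ| with h | h
      · rw [h.1, one_pow]
        linarith [pow_nonneg (abs_nonneg (2 * Real.pi * ξ)) m]
      · rw [h.1]; linarith

lemma norm_two_pi_I_mul (ξ : ℝ) : ‖(2 * Real.pi * Complex.I * ξ : ℂ)‖ = |2 * Real.pi * ξ| := by
  rw [show (2 * Real.pi * Complex.I * ξ : ℂ) = ((2 * Real.pi * ξ : ℝ) : ℂ) * Complex.I by
    push_cast; ring, norm_mul, Complex.norm_I, mul_one, Complex.norm_real, Real.norm_eq_abs]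

lemma eLpNorm_jb_rpow_mul_le {r : ℝ} {m : ℕ} (hr : r ≤ m) {F G : ℝ → ℂ}
    (hF : AEStronglyMeasurable F) (hG : AEStronglyMeasurable G)
    (h : G =ᵐ[volume] fun ξ => (2 * Real.pi * Complex.I * ξ) ^ m * F ξ) :
    eLpNorm (fun ξ : ℝ => (((1 + (2 * Real.pi * ξ) ^ 2) ^ (r / 2) : ℝ) : ℂ) * F ξ) 2 ≤
      2 ^ m * (eLpNorm F 2 + eLpNorm G 2) := by
  have h1 : eLpNorm (fun ξ : ℝ => (((1 + (2 * Real.pi * ξ) ^ 2) ^ (r / 2) : ℝ) : ℂ) * F ξ) 2 ≤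
      ENNReal.ofReal (2 ^ m) * eLpNorm (fun ξ => ‖F ξ‖ + ‖G ξ‖) 2 := by
    refine eLpNorm_le_mul_eLpNorm_of_ae_le_mul ?_ 2
    filter_upwards [h] with ξ h
    have hn : ‖G ξ‖ = |2 * Real.pi * ξ| ^ m * ‖F ξ‖ := by
      rw [h, norm_mul, norm_pow, norm_two_pi_I_mul]
    rw [Real.norm_of_nonneg (add_nonneg (norm_nonneg _) (norm_nonneg _)), hn, jb_rpow_eq, norm_mul,
      Complex.norm_real, Real.norm_of_nonneg (Real.rpow_nonneg (jb_pos ξ).le _)]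
    refine (mul_le_mul_of_nonneg_right (jb_rpow_le hr ξ) (norm_nonneg _)).trans_eq ?_
    ring
  have h3 : ENNReal.ofReal (2 ^ m) = 2 ^ m := by
    rw [ENNReal.ofReal_pow (by norm_num), ENNReal.ofReal_ofNat]
  have h4 := eLpNorm_add_le (p := 2) hF.norm hG.norm (by norm_num)
  rw [eLpNorm_norm, eLpNorm_norm] at h4
  rw [h3] at h1
  refine h1.trans ?_
  gcongr
  exact h4

/-- A smooth function whose derivatives belong to `L²` belongs to all Sobolev spaces. -/
lemma hsNorm_le_eLpNorm {r : ℝ} {m : ℕ} (hr : r ≤ m) {f : ℝ → ℂ} (hf : ContDiff ℝ ∞ f)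
    (hL : ∀ n, MemLp (iteratedDeriv n f) 2) :
    hsNorm r f ≤ 2 ^ m * (eLpNorm (iteratedDeriv 0 f) 2 + eLpNorm (iteratedDeriv m f) 2) := by
  have hf0 : MemLp f 2 := by simpa only [iteratedDeriv_zero] using hL 0
  have h1 := fourier_toLp_iteratedDeriv hf hf0 hL m
  have n1 := eLpNorm_fourier_toLp hf0
  have n2 := eLpNorm_fourier_toLp (hL m)
  rw [hsNorm, dif_pos hf0, iteratedDeriv_zero, ← n1, ← n2]
  clear n1 n2
  obtain ⟨F, hF⟩ : ∃ F : L2, F = 𝓕 (hf0.toLp f) := ⟨_, rfl⟩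
  obtain ⟨G, hG⟩ : ∃ G : L2, G = 𝓕 ((hL m).toLp (iteratedDeriv m f)) := ⟨_, rfl⟩
  rw [← hF, ← hG] at h1
  rw [← hF, ← hG]
  exact eLpNorm_jb_rpow_mul_le hr (Lp.aestronglyMeasurable F) (Lp.aestronglyMeasurable G) h1

/-- Dominated convergence in `L²`. -/
lemma tendsto_eLpNorm_sub {F : ℝ → ℝ → ℂ} {S : Set ℝ} {t₀ : ℝ} (ht₀ : t₀ ∈ S) {g : ℝ → ℝ}
    (hg : MemLp g 2) (hF : ∀ t ∈ S, AEStronglyMeasurable (F t) volume)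
    (hb : ∀ t ∈ S, ∀ x, ‖F t x‖ ≤ g x)
    (hc : ∀ x, ContinuousOn (fun t => F t x) S) :
    Tendsto (fun t => eLpNorm (fun x => F t x - F t₀ x) 2) (𝓝[S] t₀) (𝓝 0) := by
  have h2 : (2 : ℝ≥0∞) ≠ 0 := by norm_num
  have h2' : (2 : ℝ≥0∞) ≠ ⊤ := by norm_num
  simp only [eLpNorm_eq_lintegral_rpow_enorm_toReal h2 h2']
  have key : Tendsto (fun t => ∫⁻ x, ‖F t x - F t₀ x‖ₑ ^ (2 : ℝ≥0∞).toReal) (𝓝[S] t₀)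
      (𝓝 (∫⁻ x : ℝ, 0)) := by
    refine tendsto_lintegral_filter_of_dominated_convergence'
      (fun x => ‖(2 : ℝ) • g x‖ₑ ^ (2 : ℝ≥0∞).toReal) ?_ ?_ ?_ ?_
    · filter_upwards [self_mem_nhdsWithin] with t ht
      exact ((hF t ht).sub (hF t₀ ht₀)).enorm.pow_const _
    · filter_upwards [self_mem_nhdsWithin] with t ht
      refine Eventually.of_forall fun x => ?_
      refine ENNReal.rpow_le_rpow ?_ (by simp)
      refine enorm_le_iff_norm_le.2 ?_
      have h0 := (norm_nonneg _).trans (hb t ht x)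
      rw [Real.norm_of_nonneg (by positivity), smul_eq_mul, two_mul]
      exact (norm_sub_le _ _).trans (add_le_add (hb t ht x) (hb t₀ ht₀ x))
    · have h := (hg.const_smul (2 : ℝ)).2
      exact (lintegral_rpow_enorm_lt_top_of_eLpNorm_lt_top h2 h2' h).ne
    · refine Eventually.of_forall fun x => ?_
      have h := ((hc x t₀ ht₀).sub_const (F t₀ x)).enorm.ennrpow_const (2 : ℝ≥0∞).toReal
      simpa [ContinuousWithinAt] using h
  rw [lintegral_zero] at key
  have := key.ennrpow_const (1 / (2 : ℝ≥0∞).toReal)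
  simpa using this

/-- A smooth function with decaying derivatives that are continuous in time is a continuous curve in
all Sobolev spaces. -/
theorem continuousCurve_hsNorm (r : ℝ) {T : ℝ} {f : ℝ → ℝ → ℂ}
    (hf : ∀ t ∈ Icc 0 T, ContDiff ℝ ∞ (f t)) {g : ℕ → ℝ → ℝ} (hg : ∀ n, MemLp (g n) 2)
    (hb : ∀ n, ∀ t ∈ Icc 0 T, ∀ x, ‖iteratedDeriv n (f t) x‖ ≤ g n x)
    (hc : ∀ n x, ContinuousOn (fun t => iteratedDeriv n (f t) x) (Icc 0 T)) :
    ContinuousCurve (hsNorm r) T f := by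
  obtain ⟨m, hm⟩ := exists_nat_ge r
  have hmeas : ∀ n, ∀ t ∈ Icc 0 T, AEStronglyMeasurable (iteratedDeriv n (f t)) volume :=
    fun n t ht => ((hf t ht).continuous_iteratedDeriv n
      (by exact_mod_cast le_top)).aestronglyMeasurable
  have hL : ∀ n, ∀ t ∈ Icc 0 T, MemLp (iteratedDeriv n (f t)) 2 := fun n t ht =>
    (hg n).mono (hmeas n t ht) (Eventually.of_forall fun x =>
      (hb n t ht x).trans (Real.le_norm_self _))
  refine ⟨fun t ht => ?_, fun t₀ ht₀ => ?_⟩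
  · refine (hsNorm_le_eLpNorm hm (hf t ht) fun n => hL n t ht).trans_lt ?_
    exact ENNReal.mul_lt_top (by simp) (ENNReal.add_lt_top.2 ⟨(hL 0 t ht).2, (hL m t ht).2⟩)
  · have hit : ∀ n, ∀ t ∈ Icc 0 T, iteratedDeriv n (fun x => f t x - f t₀ x) =
        fun x => iteratedDeriv n (f t) x - iteratedDeriv n (f t₀) x := fun n t ht => by
      ext x
      exact iteratedDeriv_sub ((hf t ht).of_le (by exact_mod_cast le_top)).contDiffAt
        ((hf t₀ ht₀).of_le (by exact_mod_cast le_top)).contDiffAt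
    have h1 := fun n => tendsto_eLpNorm_sub ht₀ (hg n) (hmeas n) (hb n) (hc n)
    have h2 : Tendsto (fun t => (2 : ℝ≥0∞) ^ m *
        (eLpNorm (fun x => iteratedDeriv 0 (f t) x - iteratedDeriv 0 (f t₀) x) 2 +
          eLpNorm (fun x => iteratedDeriv m (f t) x - iteratedDeriv m (f t₀) x) 2))
        (𝓝[Icc 0 T] t₀) (𝓝 0) := by
      have := ENNReal.Tendsto.const_mul (a := (2 : ℝ≥0∞) ^ m) ((h1 0).add (h1 m))
        (Or.inr (by simp))
      simpa using this
    refine tendsto_of_tendsto_of_tendsto_of_le_of_le' tendsto_const_nhds h2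
      (Eventually.of_forall fun t => zero_le) ?_
    filter_upwards [self_mem_nhdsWithin] with t ht
    rw [← hit 0 t ht, ← hit m t ht]
    refine hsNorm_le_eLpNorm hm ((hf t ht).sub (hf t₀ ht₀)) fun n => ?_
    rw [hit n t ht]
    exact (hL n t ht).sub (hL n t₀ ht₀)

/-! ### Families of smooth functions with derivatives of a given order of growth -/

/-- The functions `F τ` are smooth, and their derivatives are continuous in `τ` and bounded by
multiples of `w ^ p`, locally uniformly in `τ`. -/
structure IsSymbol (w : ℝ → ℝ) (p : ℤ) (F : ℝ → ℝ → ℂ) : Prop where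
  contDiff : ∀ τ, ContDiff ℝ ∞ (F τ)
  cont : ∀ n x, Continuous fun τ => iteratedDeriv n (F τ) x
  bound : ∀ (n : ℕ) (K : ℝ), ∃ C, 0 ≤ C ∧ ∀ τ, |τ| ≤ K → ∀ x,
    ‖iteratedDeriv n (F τ) x‖ ≤ C * w x ^ p

namespace IsSymbol

variable {w : ℝ → ℝ} {p q : ℤ} {F G : ℝ → ℝ → ℂ}

lemma contDiffAt (h : IsSymbol w p F) (τ : ℝ) (n : ℕ) (x : ℝ) : ContDiffAt ℝ n (F τ) x :=
  ((h.contDiff τ).of_le (by exact_mod_cast le_top)).contDiffAt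

lemma add (hF : IsSymbol w p F) (hG : IsSymbol w p G) :
    IsSymbol w p fun τ x => F τ x + G τ x := by
  have e : ∀ n τ x, iteratedDeriv n (fun x => F τ x + G τ x) x =
      iteratedDeriv n (F τ) x + iteratedDeriv n (G τ) x := fun n τ x =>
    iteratedDeriv_add (hF.contDiffAt τ n x) (hG.contDiffAt τ n x)
  refine ⟨fun τ => (hF.contDiff τ).add (hG.contDiff τ), fun n x => ?_, fun n K => ?_⟩
  · simp only [e]
    exact (hF.cont n x).add (hG.cont n x)
  · obtain ⟨C, hC, h1⟩ := hF.bound n K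
    obtain ⟨C', hC', h2⟩ := hG.bound n K
    refine ⟨C + C', add_nonneg hC hC', fun τ hτ x => ?_⟩
    rw [e, add_mul]
    exact (norm_add_le _ _).trans (add_le_add (h1 τ hτ x) (h2 τ hτ x))

lemma mul (hw : ∀ x, 1 ≤ w x) (hF : IsSymbol w p F) (hG : IsSymbol w q G) :
    IsSymbol w (p + q) fun τ x => F τ x * G τ x := by
  have e : ∀ n τ x, iteratedDeriv n (fun x => F τ x * G τ x) x = ∑ i ∈ Finset.range (n + 1),
      n.choose i * iteratedDeriv i (F τ) x * iteratedDeriv (n - i) (G τ) x := fun n τ x =>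
    iteratedDeriv_mul (hF.contDiffAt τ n x) (hG.contDiffAt τ n x)
  refine ⟨fun τ => (hF.contDiff τ).mul (hG.contDiff τ), fun n x => ?_, fun n K => ?_⟩
  · simp only [e]
    exact continuous_finsetSum _ fun i _ => (continuous_const.mul (hF.cont i x)).mul (hG.cont _ x)
  · choose C hC h1 using fun i => hF.bound i K
    choose C' hC' h2 using fun i => hG.bound i K
    refine ⟨∑ i ∈ Finset.range (n + 1), n.choose i * C i * C' (n - i),
      Finset.sum_nonneg fun i _ => mul_nonneg (mul_nonneg (by positivity) (hC i)) (hC' _),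
      fun τ hτ x => ?_⟩
    have hwx : 0 < w x := one_pos.trans_le (hw x)
    rw [e, Finset.sum_mul]
    refine norm_sum_le_of_le _ fun i _ => ?_
    rw [norm_mul, norm_mul, Complex.norm_natCast, zpow_add₀ hwx.ne']
    calc _ ≤ n.choose i * (C i * w x ^ p) * (C' (n - i) * w x ^ q) := by
          have := hC i
          gcongr
          · exact h1 i τ hτ x
          · exact h2 _ τ hτ x
      _ = _ := by ring

lemma mono (hw : ∀ x, 1 ≤ w x) (hF : IsSymbol w p F) (hpq : p ≤ q) : IsSymbol w q F := by
  refine ⟨hF.contDiff, hF.cont, fun n K => ?_⟩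
  obtain ⟨C, hC, h⟩ := hF.bound n K
  exact ⟨C, hC, fun τ hτ x => (h τ hτ x).trans
    (mul_le_mul_of_nonneg_left (zpow_le_zpow_right₀ (hw x) hpq) hC)⟩

lemma zero : IsSymbol w p fun _ _ => 0 := by
  refine ⟨fun τ => contDiff_const, fun n x => continuous_const, fun n K => ⟨0, le_rfl, ?_⟩⟩
  intro τ _ x
  rw [iteratedDeriv_const]
  split_ifs <;> simp

/-- Functions of `τ` have order zero. -/
lemma of_continuous {c : ℝ → ℂ} (hc : Continuous c) : IsSymbol w 0 fun τ _ => c τ := by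
  refine ⟨fun τ => contDiff_const, fun n x => ?_, fun n K => ?_⟩
  · simp only [iteratedDeriv_const]
    split_ifs
    · exact hc
    · exact continuous_const
  · obtain ⟨C, hC⟩ := isCompact_Icc.exists_bound_of_continuousOn (s := Icc (-K) K) hc.continuousOn
    refine ⟨max C 0, le_max_right _ _, fun τ hτ x => ?_⟩
    rw [iteratedDeriv_const, zpow_zero, mul_one]
    split_ifs
    · exact (hC τ (abs_le.1 hτ)).trans (le_max_left _ _)
    · simp

lemma sum {ι : Type*} (s : Finset ι) {F : ι → ℝ → ℝ → ℂ} (h : ∀ i ∈ s, IsSymbol w p (F i)) :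
    IsSymbol w p fun τ x => ∑ i ∈ s, F i τ x := by
  classical
  induction s using Finset.induction_on with
  | empty => simpa using zero
  | insert i s hi ih =>
    simp only [Finset.sum_insert hi]
    exact (h i (Finset.mem_insert_self i s)).add (ih fun j hj => h j (Finset.mem_insert_of_mem hj))

/-- The inverse of a family that is bounded from below. -/
lemma inv (hw : ∀ x, 1 ≤ w x) (hF : IsSymbol w p F)
    (hlow : ∀ K : ℝ, ∃ c, 0 < c ∧ ∀ τ, |τ| ≤ K → ∀ x, c * w x ^ p ≤ ‖F τ x‖) :
    IsSymbol w (-p) fun τ x => (F τ x)⁻¹ := by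
  have hne : ∀ τ x, F τ x ≠ 0 := fun τ x h => by
    obtain ⟨c, hc, h1⟩ := hlow |τ|
    have := h1 τ le_rfl x
    rw [h, norm_zero] at this
    have hwx : 0 < w x := one_pos.trans_le (hw x)
    have : 0 < c * w x ^ p := by positivity
    linarith
  have hd : ∀ τ, ContDiff ℝ ∞ fun x => (F τ x)⁻¹ := fun τ => (hF.contDiff τ).inv (hne τ)
  -- Leibniz' rule for F · F⁻¹ = 1, solved for the term in which only the inverse is differentiated.
  -- It expresses the derivative of order n by those of lower order and drives both inductions.
  have e : ∀ n τ x, iteratedDeriv n (fun x => (F τ x)⁻¹) x = (F τ x)⁻¹ * ((if n = 0 then 1 else 0) -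
      ∑ i ∈ Finset.range n, n.choose (i + 1) * iteratedDeriv (i + 1) (F τ) x *
        iteratedDeriv (n - (i + 1)) (fun x => (F τ x)⁻¹) x) := fun n τ x => by
    have h1 := iteratedDeriv_mul (n := n) (x := x) (hF.contDiffAt τ n x)
      (((hd τ).of_le (by exact_mod_cast le_top)).contDiffAt : ContDiffAt ℝ n _ x)
    have h2 : (F τ * fun x => (F τ x)⁻¹) = fun _ => 1 := by
      ext x; exact mul_inv_cancel₀ (hne τ x)
    rw [h2, iteratedDeriv_const, Finset.sum_range_succ', Nat.choose_zero_right, Nat.cast_one,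
      one_mul, iteratedDeriv_zero, Nat.sub_zero] at h1
    rw [eq_inv_mul_iff_mul_eq₀ (hne τ x), h1]
    ring
  refine ⟨hd, fun n x => ?_, fun n K => ?_⟩
  · induction n using Nat.strong_induction_on with
    | _ n ih =>
      simp only [e n]
      refine Continuous.mul ?_ (continuous_const.sub (continuous_finsetSum _ fun i hi =>
        (continuous_const.mul (hF.cont _ x)).mul (ih _ ?_)))
      · have := hF.cont 0 x
        simp only [iteratedDeriv_zero] at this
        exact this.inv₀ fun τ => hne τ x
      · have := Finset.mem_range.1 hi
        omega
  · obtain ⟨c, hc, hlow⟩ := hlow K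
    induction n using Nat.strong_induction_on with
    | _ n ih =>
      choose C hC h1 using fun i => hF.bound i K
      choose! C' hC' h2 using ih
      have hm : ∀ i ∈ Finset.range n, n - (i + 1) < n := fun i hi => by
        have := Finset.mem_range.1 hi
        omega
      have hS : 0 ≤ ∑ i ∈ Finset.range n, n.choose (i + 1) * C (i + 1) * C' (n - (i + 1)) :=
        Finset.sum_nonneg fun i hi =>
          mul_nonneg (mul_nonneg (by positivity) (hC _)) (hC' _ (hm i hi))
      refine ⟨c⁻¹ * (1 + ∑ i ∈ Finset.range n, n.choose (i + 1) * C (i + 1) * C' (n - (i + 1))),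
        by positivity, fun τ hτ x => ?_⟩
      have hwx : 0 < w x := one_pos.trans_le (hw x)
      rw [e, norm_mul, norm_inv]
      have b1 : ‖F τ x‖⁻¹ ≤ c⁻¹ * w x ^ (-p) := by
        rw [zpow_neg, ← mul_inv]
        exact inv_anti₀ (by positivity) (hlow τ hτ x)
      have b2 : ‖(if n = 0 then 1 else 0 : ℂ) - ∑ i ∈ Finset.range n,
          n.choose (i + 1) * iteratedDeriv (i + 1) (F τ) x *
          iteratedDeriv (n - (i + 1)) (fun x => (F τ x)⁻¹) x‖ ≤
          1 + ∑ i ∈ Finset.range n, n.choose (i + 1) * C (i + 1) * C' (n - (i + 1)) := by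
        refine (norm_sub_le _ _).trans (add_le_add (by split_ifs <;> simp) ?_)
        refine norm_sum_le_of_le _ fun i hi => ?_
        rw [norm_mul, norm_mul, Complex.norm_natCast]
        have := hC (i + 1)
        calc _ ≤ n.choose (i + 1) * (C (i + 1) * w x ^ p) *
              (C' (n - (i + 1)) * w x ^ (-p)) := by
              gcongr
              · exact h1 _ τ hτ x
              · exact h2 _ (hm i hi) τ hτ x
          _ = n.choose (i + 1) * C (i + 1) * C' (n - (i + 1)) * (w x ^ p * w x ^ (-p)) := by ring
          _ = _ := by rw [← zpow_add₀ hwx.ne', add_neg_cancel, zpow_zero, mul_one]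
      calc _ ≤ c⁻¹ * w x ^ (-p) * (1 + ∑ i ∈ Finset.range n,
            n.choose (i + 1) * C (i + 1) * C' (n - (i + 1))) := by gcongr
        _ = _ := by ring

/-- Rescaled families of negative order are continuous curves in all Sobolev spaces. -/
theorem continuousCurve_rescale {A : ℝ} (hw : ∀ x, 1 ≤ w x) (hA : ∀ x, 1 + |x| ≤ A * w x)
    (hF : IsSymbol w (-1) F) (r ω₀ T₀ τ₀ : ℝ) {β : ℝ} (hβ : 0 < β) :
    ContinuousCurve (hsNorm r) T₀ (rescale ω₀ β τ₀ F) := by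
  set c : ℂ := ((Real.sqrt (2 / 3) * (β / |ω₀|) : ℝ) : ℂ)
  set γ := β ^ 2 / ω₀ ^ 3
  have hFn : ∀ (n : ℕ) τ, ContDiff ℝ n (F τ) := fun n τ =>
    (hF.contDiff τ).of_le (by exact_mod_cast le_top)
  have e : ∀ n T x, iteratedDeriv n (rescale ω₀ β τ₀ F T) x =
      c * (β ^ n • iteratedDeriv n (F (τ₀ + γ * T)) (β * x)) := fun n T x => by
    have h1 : rescale ω₀ β τ₀ F T = fun X => c * F (τ₀ + γ * T) (β * X) := rfl
    rw [h1, iteratedDeriv_const_mul_field, iteratedDeriv_comp_const_smul (hFn n _)]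
  have hγ : ∀ T ∈ Icc 0 T₀, |τ₀ + γ * T| ≤ |τ₀| + |γ| * T₀ := fun T hT => by
    refine (abs_add_le _ _).trans ?_
    rw [abs_mul, abs_of_nonneg hT.1]
    gcongr
    exact hT.2
  choose C hC hb using fun n => hF.bound n (|τ₀| + |γ| * T₀)
  -- One order of decay suffices in one dimension: 1/(1+|βx|) is dominated by a multiple of ⟨x⟩⁻¹,
  -- which is square integrable.
  have hmem : MemLp (fun x : ℝ => (1 + |β * x|)⁻¹) 2 := by
    have h1 := (memLp_jb_rpow (s := 1) (by norm_num)).const_mul ((1 + 2 * Real.pi) * (1 + β⁻¹))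
    refine h1.mono ?_ (Eventually.of_forall fun x => ?_)
    · refine Continuous.aestronglyMeasurable (Continuous.inv₀ (by fun_prop) fun x => ?_)
      positivity
    · have hj : jb x ≤ (1 + 2 * Real.pi) * (1 + |x|) := by
        refine (Real.sqrt_le_sqrt (y := (1 + 2 * Real.pi * |x|) ^ 2) ?_).trans ?_
        · have := Real.pi_pos
          have := abs_nonneg x
          rw [mul_pow, ← sq_abs x]
          nlinarith [mul_nonneg (mul_nonneg zero_le_two Real.pi_pos.le) (abs_nonneg x)]
        · rw [Real.sqrt_sq (by positivity)]
          nlinarith [Real.pi_pos, abs_nonneg x, mul_nonneg Real.pi_pos.le (abs_nonneg x)]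
      have h2 : 1 + |x| ≤ (1 + β⁻¹) * (1 + |β * x|) := by
        rw [abs_mul, abs_of_pos hβ]
        have h3 : β⁻¹ * (β * |x|) = |x| := by field_simp
        have h4 : 0 ≤ β⁻¹ := by positivity
        have h5 : 0 ≤ β * |x| := by positivity
        nlinarith
      rw [Real.norm_of_nonneg (by positivity), norm_mul,
        Real.norm_of_nonneg (by positivity), Real.norm_of_nonneg (Real.rpow_nonneg (jb_pos x).le _),
        Real.rpow_neg_one, inv_le_iff_one_le_mul₀ (by positivity), mul_assoc, mul_assoc]
      rw [← div_eq_inv_mul, ← mul_div_assoc, ← mul_div_assoc, le_div_iff₀ (jb_pos x), one_mul]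
      calc jb x ≤ (1 + 2 * Real.pi) * (1 + |x|) := hj
        _ ≤ (1 + 2 * Real.pi) * ((1 + β⁻¹) * (1 + |β * x|)) := by gcongr
  refine continuousCurve_hsNorm r (g := fun n x => ‖c‖ * β ^ n * C n * A * (1 + |β * x|)⁻¹)
    (fun T _ => ?_) (fun n => hmem.const_mul _) (fun n T hT x => ?_) fun n x => ?_
  · exact contDiff_const.mul ((hF.contDiff _).comp (contDiff_const.mul contDiff_id))
  · have hw1 : w (β * x) ^ (-1 : ℤ) ≤ A * (1 + |β * x|)⁻¹ := by
      have := one_pos.trans_le (hw (β * x))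
      rw [zpow_neg_one, inv_le_iff_one_le_mul₀ this, mul_right_comm, ← div_eq_mul_inv,
        one_le_div (by positivity)]
      exact hA _
    rw [e, norm_mul, norm_smul, norm_pow, Real.norm_of_nonneg hβ.le]
    calc _ ≤ ‖c‖ * (β ^ n * (C n * (A * (1 + |β * x|)⁻¹))) := by
          have := hC n
          gcongr
          exact (hb n _ (hγ T hT) _).trans (by gcongr)
      _ = _ := by ring
  · simp only [e]
    have h1 : Continuous fun T => iteratedDeriv n (F (τ₀ + γ * T)) (β * x) :=
      (hF.cont n (β * x)).comp (continuous_const.add (continuous_const.mul continuous_id))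
    exact (continuous_const.mul (h1.const_smul (β ^ n))).continuousOn

end IsSymbol

/-! ### Rational families -/

lemma one_le_one_add_abs (x : ℝ) : 1 ≤ 1 + |x| := by linarith [abs_nonneg x]

lemma IsSymbol.ofReal_coe : IsSymbol (fun x => 1 + |x|) 1 fun _ x => (x : ℂ) := by
  have e : ∀ n x, iteratedDeriv n (fun x : ℝ => (x : ℂ)) x =
      if n = 0 then (x : ℂ) else if n = 1 then 1 else 0 := fun n x => by
    rcases n with _ | n
    · simp
    · have h : deriv (fun x : ℝ => (x : ℂ)) = fun _ => 1 := funext fun x =>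
        ((hasDerivAt_id x).ofReal_comp).deriv.trans (by simp)
      rw [iteratedDeriv_succ', h, iteratedDeriv_const]
      simp
  refine ⟨fun _ => Complex.ofRealCLM.contDiff, fun n x => continuous_const, fun n K =>
    ⟨1, zero_le_one, fun τ _ x => ?_⟩⟩
  rw [e, zpow_one, one_mul]
  have := abs_nonneg x
  split_ifs
  · rw [Complex.norm_real, Real.norm_eq_abs]; linarith
  · rw [norm_one]; linarith
  · rw [norm_zero]; linarith

lemma IsSymbol.ofReal_pow (i : ℕ) : IsSymbol (fun x => 1 + |x|) i fun _ x => (x : ℂ) ^ i := by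
  induction i with
  | zero => simpa using IsSymbol.of_continuous (w := fun x => 1 + |x|) (continuous_const (y := 1))
  | succ i ih =>
    have := ih.mul one_le_one_add_abs IsSymbol.ofReal_coe
    simpa [pow_succ] using this

lemma IsSymbol.sum_range {d : ℕ} {c : ℕ → ℝ → ℂ} (hc : ∀ i, Continuous (c i)) :
    IsSymbol (fun x => 1 + |x|) d fun τ x => ∑ i ∈ Finset.range (d + 1), c i τ * (x : ℂ) ^ i := by
  refine IsSymbol.sum _ fun i hi => ?_
  have h := (IsSymbol.of_continuous (w := fun x => 1 + |x|) (hc i)).mul one_le_one_add_abs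
    (IsSymbol.ofReal_pow i)
  rw [zero_add] at h
  refine h.mono one_le_one_add_abs ?_
  exact_mod_cast Nat.lt_succ_iff.1 (Finset.mem_range.1 hi)

lemma evalEval_eq_sum_range {R : Type*} [CommRing R] (P : Polynomial (Polynomial R)) (x y : R) :
    P.evalEval x y = ∑ i ∈ Finset.range (P.natDegree + 1), (P.coeff i).eval x * y ^ i := by
  rw [Polynomial.evalEval, Polynomial.eval_eq_sum_range (p := P), Polynomial.eval_finsetSum]
  simp

lemma isSymbol_evalEval (P : Polynomial (Polynomial ℂ)) :
    IsSymbol (fun x => 1 + |x|) P.natDegree fun τ x => P.evalEval (τ : ℂ) (x : ℂ) := by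
  simp only [evalEval_eq_sum_range]
  exact IsSymbol.sum_range fun i => (P.coeff i).continuous.comp Complex.continuous_ofReal

lemma isSymbol_evalEval_ofReal (D : Polynomial (Polynomial ℝ)) :
    IsSymbol (fun x => 1 + |x|) D.natDegree fun τ x => ((D.evalEval τ x : ℝ) : ℂ) := by
  simp only [evalEval_eq_sum_range, Complex.ofReal_sum, Complex.ofReal_mul, Complex.ofReal_pow]
  exact IsSymbol.sum_range fun i => Complex.continuous_ofReal.comp (D.coeff i).continuous

lemma isSymbol_evalEval_of_degree_lt {P : Polynomial (Polynomial ℂ)}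
    {D : Polynomial (Polynomial ℝ)} (h : P.degree < D.degree) :
    IsSymbol (fun x => 1 + |x|) (D.natDegree + -1) fun τ x => P.evalEval (τ : ℂ) (x : ℂ) := by
  rcases eq_or_ne P 0 with rfl | hP
  · simpa using IsSymbol.zero
  · refine (isSymbol_evalEval P).mono one_le_one_add_abs ?_
    have := Polynomial.natDegree_lt_natDegree hP h
    omega

/-- A polynomial without zeros whose leading coefficient has no zeros is bounded from below. -/
lemma exists_le_evalEval {D : Polynomial (Polynomial ℝ)} (hpos : ∀ τ x, 0 < D.evalEval τ x)
    (hlead : ∀ τ, D.leadingCoeff.eval τ ≠ 0) (K : ℝ) :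
    ∃ c, 0 < c ∧ ∀ τ, |τ| ≤ K → ∀ x, c * (1 + |x|) ^ (D.natDegree : ℤ) ≤ D.evalEval τ x := by
  set d := D.natDegree
  -- The homogenization of D in x, whose zeros are excluded on a compact set of parameters and
  -- directions. Compactness then yields a uniform lower bound.
  let g : ℝ × ℝ × ℝ → ℝ := fun y =>
    ∑ i ∈ Finset.range (d + 1), (D.coeff i).eval y.1 * y.2.1 ^ i * y.2.2 ^ (d - i)
  have hg : Continuous g := continuous_finsetSum _ fun i _ =>
    (((D.coeff i).continuous.comp continuous_fst).mul (by fun_prop)).mul (by fun_prop)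
  have hhom : ∀ τ x t : ℝ, t ≠ 0 → D.evalEval τ x = t ^ d * g (τ, x / t, 1 / t) := fun τ x t ht => by
    rw [evalEval_eq_sum_range, Finset.mul_sum]
    refine Finset.sum_congr rfl fun i hi => ?_
    have hi : i ≤ d := Nat.lt_succ_iff.1 (Finset.mem_range.1 hi)
    have h1 : t ^ d = t ^ i * t ^ (d - i) := by rw [← pow_add, Nat.add_sub_cancel' hi]
    rw [h1, div_pow, div_pow, one_pow]
    field_simp
  let S : Set (ℝ × ℝ × ℝ) := Icc (-K) K ×ˢ Metric.sphere 0 1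
  have hS : IsCompact S := isCompact_Icc.prod (isCompact_sphere 0 1)
  have hne : ∀ y ∈ S, 0 < |g y| := by
    rintro ⟨τ, p, q⟩ ⟨-, hpq⟩
    refine abs_pos.2 ?_
    rcases eq_or_ne q 0 with rfl | hq
    -- The direction q = 0 corresponds to x = ±∞; there only the leading coefficient survives.
    -- Elsewhere positivity of D is used.
    · have hp : p ≠ 0 := by
        rintro rfl
        simp at hpq
      have h1 : g (τ, p, 0) = (D.coeff d).eval τ * p ^ d := by
        simp only [g]
        rw [Finset.sum_eq_single d]
        · simp
        · intro i hi hid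
          have : d - i ≠ 0 := by
            have := Finset.mem_range.1 hi
            omega
          simp [this]
        · simp
      rw [h1]
      exact mul_ne_zero (hlead τ) (pow_ne_zero _ hp)
    · have h1 := hhom τ (p / q) (1 / q) (by positivity)
      have h2 := hpos τ (p / q)
      rw [h1, show p / q / (1 / q) = p by field_simp, one_div_one_div] at h2
      exact right_ne_zero_of_mul h2.ne'
  rcases S.eq_empty_or_nonempty with hSe | hSn
  · refine ⟨1, one_pos, fun τ hτ => ?_⟩
    exfalso
    have : (τ, (1 : ℝ), (0 : ℝ)) ∈ S := ⟨abs_le.1 hτ, by simp⟩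
    rw [hSe] at this
    exact this
  obtain ⟨y, hy, hmin⟩ := hS.exists_isMinOn hSn hg.abs.continuousOn
  refine ⟨|g y| / 2 ^ d, by have := hne y hy; positivity, fun τ hτ x => ?_⟩
  -- The sphere is that of the maximum norm on pairs, to which (x, 1) is scaled.
  set t := max 1 |x|
  have ht : 0 < t := one_pos.trans_le (le_max_left _ _)
  have hmem : (τ, x / t, 1 / t) ∈ S := by
    refine ⟨abs_le.1 hτ, ?_⟩
    rw [mem_sphere_zero_iff_norm, Prod.norm_def]
    simp only [norm_div, norm_one, Real.norm_of_nonneg ht.le, Real.norm_eq_abs]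
    rw [max_div_div_right ht.le, max_comm]
    exact div_self ht.ne'
  have h1 : |g y| ≤ |g (τ, x / t, 1 / t)| := hmin hmem
  have h2 : D.evalEval τ x = t ^ d * |g (τ, x / t, 1 / t)| := by
    rw [← abs_of_pos (hpos τ x), hhom τ x t ht.ne', abs_mul, abs_of_pos (pow_pos ht d)]
  have h3 : 1 + |x| ≤ 2 * t := by
    have := le_max_left 1 |x|
    have := le_max_right 1 |x|
    linarith
  rw [h2, zpow_natCast]
  calc |g y| / 2 ^ d * (1 + |x|) ^ d ≤ |g y| / 2 ^ d * (2 * t) ^ d := by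
        have := abs_nonneg x
        gcongr
    _ = t ^ d * |g y| := by rw [mul_pow]; field_simp
    _ ≤ _ := by gcongr

/-- The denominator is comparable to (1+|x|)^deg, so its inverse is a symbol of the opposite order,
and the gap of at least one in the degrees leaves order -1. -/
lemma isSymbol_rationalProfile {j : ℕ} {G H : Polynomial (Polynomial ℂ)}
    {D : Polynomial (Polynomial ℝ)} (hpos : ∀ τ x, 0 < D.evalEval τ x)
    (hlead : ∀ τ, D.leadingCoeff.eval τ ≠ 0) (hG : G.degree < D.degree) (hH : H.degree < D.degree) :
    IsSymbol (fun x => 1 + |x|) (-1) fun τ x =>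
      rationalProfile j G H D τ x - (-1) ^ j * Complex.exp (Complex.I * τ) := by
  have hw := one_le_one_add_abs
  have h1 : IsSymbol (fun x => 1 + |x|) (-D.natDegree) fun τ x => ((D.evalEval τ x : ℝ) : ℂ)⁻¹ := by
    refine (isSymbol_evalEval_ofReal D).inv hw fun K => ?_
    obtain ⟨c, hc, h⟩ := exists_le_evalEval hpos hlead K
    refine ⟨c, hc, fun τ hτ x => ?_⟩
    rw [Complex.norm_real, Real.norm_of_nonneg (hpos τ x).le]
    exact h τ hτ x
  have h2 := ((IsSymbol.of_continuous (w := fun x => 1 + |x|)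
    (continuous_const (y := Complex.I))).mul hw (isSymbol_evalEval_of_degree_lt hH))
  rw [zero_add] at h2
  have h3 := (((isSymbol_evalEval_of_degree_lt hG).add h2).mul hw h1)
  have h4 := (IsSymbol.of_continuous (w := fun x => 1 + |x|)
    (show Continuous fun τ : ℝ => Complex.exp (Complex.I * τ) by fun_prop)).mul hw h3
  convert h4 using 1
  · ring
  · ext τ x
    rw [rationalProfile]
    ring

/-! ### Rescaling of solutions of the NLS equation -/

/-- Since c_g² - 1 = -1/ω₀², the scaling of X by β dictates the time scale β²/ω₀³, and balance with
the cubic term dictates the amplitude c through 3c²ω₀² = 2β². -/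
lemma solvesNLS_rescale {k₀ ω₀ β : ℝ} (hω₀ : ω₀ ^ 2 = k₀ ^ 2 + 1) (T₀ τ₀ : ℝ) {ψ : ℝ → ℝ → ℂ}
    (h : SolvesNLS 1 (-(1 / 2)) (-1) univ ψ) :
    SolvesNLS (2 * ω₀) ((k₀ / ω₀) ^ 2 - 1) (-3) (Icc 0 T₀) (rescale ω₀ β τ₀ ψ) := by
  have hω : ω₀ ≠ 0 := by rintro rfl; nlinarith [sq_nonneg k₀]
  set c : ℝ := Real.sqrt (2 / 3) * (β / |ω₀|) with hc
  have hc2 : 3 * c ^ 2 * ω₀ ^ 2 = 2 * β ^ 2 := by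
    rw [hc, mul_pow, div_pow, sq_abs, Real.sq_sqrt (by norm_num)]
    field_simp
  have hr : ∀ T, rescale ω₀ β τ₀ ψ T = fun X => (c : ℂ) * ψ (τ₀ + β ^ 2 / ω₀ ^ 3 * T) (β * X) :=
    fun T => rfl
  intro T _
  obtain ⟨h1, h2⟩ := h (τ₀ + β ^ 2 / ω₀ ^ 3 * T) (mem_univ _)
  refine ⟨?_, fun X => ?_⟩
  · rw [hr]
    exact contDiff_const.mul (h1.comp (contDiff_const.mul contDiff_id))
  · obtain ⟨A', hA, heq⟩ := h2 (β * X)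
    rw [hasDerivWithinAt_univ] at hA
    have h3 : HasDerivAt (fun T : ℝ => τ₀ + β ^ 2 / ω₀ ^ 3 * T) (β ^ 2 / ω₀ ^ 3) T := by
      simpa using ((hasDerivAt_id T).const_mul (β ^ 2 / ω₀ ^ 3)).const_add τ₀
    have h4 := (hA.scomp T h3).const_mul (c : ℂ)
    refine ⟨_, h4.hasDerivWithinAt, ?_⟩
    rw [hr, iteratedDeriv_const_mul_field, iteratedDeriv_comp_const_smul h1, norm_mul,
      Complex.norm_real, Real.norm_eq_abs, mul_pow, sq_abs]
    simp only [Complex.real_smul]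
    generalize iteratedDeriv 2 (ψ (τ₀ + β ^ 2 / ω₀ ^ 3 * T)) (β * X) = B at *
    generalize ψ (τ₀ + β ^ 2 / ω₀ ^ 3 * T) (β * X) = P at *
    have hωc : (ω₀ : ℂ) ≠ 0 := by exact_mod_cast hω
    have hc2' : 3 * (c : ℂ) ^ 2 * (ω₀ : ℂ) ^ 2 = 2 * (β : ℂ) ^ 2 := by exact_mod_cast hc2
    have hω₀' : (ω₀ : ℂ) ^ 2 = (k₀ : ℂ) ^ 2 + 1 := by exact_mod_cast hω₀
    push_cast at heq ⊢
    have e1 : Complex.I * A' = -(1 / 2) * B - P * (‖P‖ : ℂ) ^ 2 := by linear_combination heq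
    have e2 : ((k₀ : ℂ) / ω₀) ^ 2 - 1 = -1 / (ω₀ : ℂ) ^ 2 := by
      field_simp
      linear_combination -hω₀'
    have e3 : (β : ℂ) ^ 2 = 3 / 2 * (c : ℂ) ^ 2 * (ω₀ : ℂ) ^ 2 := by linear_combination -hc2' / 2
    rw [e2]
    calc _ = 2 * (c * β ^ 2 / (ω₀ : ℂ) ^ 2) * (Complex.I * A') := by field_simp
      _ = _ := by
        rw [e1, e3]
        field_simp
        ring

/-- Solutions of the normalized equation with a decaying deviation from the background. -/
theorem rescalingsAreSplitNLSSolutions {k₀ ω₀ : ℝ} (hω₀ : ω₀ ^ 2 = k₀ ^ 2 + 1) (r T₀ : ℝ)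
    {b : ℝ → ℂ} (hb : Continuous b) {ψ : ℝ → ℝ → ℂ} (h : SolvesNLS 1 (-(1 / 2)) (-1) univ ψ)
    {w : ℝ → ℝ} {A : ℝ} (hw : ∀ x, 1 ≤ w x) (hA : ∀ x, 1 + |x| ≤ A * w x)
    (hF : IsSymbol w (-1) fun τ x => ψ τ x - b τ) :
    RescalingsAreSplitNLSSolutions k₀ ω₀ r T₀ b ψ := by
  refine fun β τ₀ hβ => ⟨?_, hF.continuousCurve_rescale hw hA r ω₀ T₀ τ₀ hβ, ?_⟩
  · refine Continuous.continuousOn ?_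
    exact continuous_const.mul (hb.comp (continuous_const.add (continuous_const.mul continuous_id)))
  · convert solvesNLS_rescale hω₀ T₀ τ₀ h (β := β) using 1
    ext T X
    simp only [rescale]
    ring

theorem IsHigherOrderPeregrine.rescalings {k₀ ω₀ : ℝ} (hω₀ : ω₀ ^ 2 = k₀ ^ 2 + 1) (r T₀ : ℝ) {j : ℕ}
    {G H : Polynomial (Polynomial ℂ)} {D : Polynomial (Polynomial ℝ)}
    (h : IsHigherOrderPeregrine j G H D) :
    RescalingsAreSplitNLSSolutions k₀ ω₀ r T₀
      (fun τ => (-1) ^ j * Complex.exp (Complex.I * τ)) (rationalProfile j G H D) :=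
  rescalingsAreSplitNLSSolutions hω₀ r T₀ (by fun_prop) h.solves one_le_one_add_abs
    (fun x => (one_mul (1 + |x|)).ge)
    (isSymbol_rationalProfile h.pos h.leadingCoeff_ne h.degree_G h.degree_H)

/-! ### The Peregrine solution and the Kuznetsov-Ma soliton -/

/-- With a numerator that does not depend on x and a real denominator, the factor e^{iτ} drops out
and multiplication by D³ leaves an identity between A, D and their derivatives. The Peregrine and
Kuznetsov–Ma solutions both have this form. -/
lemma solvesNLS_one_add_div {A A' : ℝ → ℂ} {D Dt D₁ D₂ : ℝ → ℝ → ℝ}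
    (hA : ∀ τ, HasDerivAt A (A' τ) τ) (hDt : ∀ τ x, HasDerivAt (fun τ => D τ x) (Dt τ x) τ)
    (hD₁ : ∀ τ x, HasDerivAt (D τ) (D₁ τ x) x) (hD₂ : ∀ τ x, HasDerivAt (D₁ τ) (D₂ τ x) x)
    (hsm : ∀ τ, ContDiff ℝ 2 (D τ)) (hD : ∀ τ x, D τ x ≠ 0)
    (heq : ∀ τ x, Complex.I * (A' τ * D τ x - A τ * Dt τ x) * D τ x - (D τ x + A τ) * D τ x ^ 2 +
      (2 * A τ * D₁ τ x ^ 2 - A τ * D τ x * D₂ τ x) / 2 +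
      (D τ x + A τ) ^ 2 * (D τ x + conj (A τ)) = 0) :
    SolvesNLS 1 (-(1 / 2)) (-1) univ
      fun τ x => Complex.exp (Complex.I * τ) * (1 + A τ / (D τ x : ℂ)) := by
  have hDc : ∀ τ x, (D τ x : ℂ) ≠ 0 := fun τ x => by exact_mod_cast hD τ x
  intro τ _
  have hsm' : ContDiff ℝ 2 fun x => A τ / (D τ x : ℂ) := by
    simp only [div_eq_mul_inv]
    exact contDiff_const.mul ((Complex.ofRealCLM.contDiff.comp (hsm τ)).inv (hDc τ))
  refine ⟨contDiff_const.mul (contDiff_const.add hsm'), fun x => ?_⟩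
  have d1 : ∀ x, HasDerivAt (fun x => Complex.exp (Complex.I * τ) * (1 + A τ / (D τ x : ℂ)))
      (Complex.exp (Complex.I * τ) * (-(A τ * D₁ τ x) / (D τ x : ℂ) ^ 2)) x := fun x => by
    have := ((((hasDerivAt_const x (A τ)).div (hD₁ τ x).ofReal_comp (hDc τ x)).const_add
      1).const_mul (Complex.exp (Complex.I * τ)))
    refine this.congr_deriv ?_
    rw [zero_mul, zero_sub]
  have d2 : ∀ x, HasDerivAt (fun x => Complex.exp (Complex.I * τ) *
      (-(A τ * D₁ τ x) / (D τ x : ℂ) ^ 2))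
      (Complex.exp (Complex.I * τ) * ((2 * A τ * D₁ τ x ^ 2 - A τ * D τ x * D₂ τ x) /
        (D τ x : ℂ) ^ 3)) x := fun x => by
    have h1 := ((hD₂ τ x).ofReal_comp.const_mul (A τ)).neg
    have h2 := (hD₁ τ x).ofReal_comp.pow 2
    have := ((h1.div h2 (pow_ne_zero 2 (hDc τ x))).const_mul (Complex.exp (Complex.I * τ)))
    refine this.congr_deriv ?_
    have := hDc τ x
    simp only [Pi.neg_apply, Pi.pow_apply]
    field_simp
    push_cast
    ring
  have dt : HasDerivAt (fun τ : ℝ => Complex.exp (Complex.I * τ) * (1 + A τ / (D τ x : ℂ)))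
      (Complex.exp (Complex.I * τ) * Complex.I * (1 + A τ / (D τ x : ℂ)) +
        Complex.exp (Complex.I * τ) * ((A' τ * D τ x - A τ * Dt τ x) / (D τ x : ℂ) ^ 2)) τ := by
    have h1 : HasDerivAt (fun τ : ℝ => Complex.exp (Complex.I * τ))
        (Complex.exp (Complex.I * τ) * Complex.I) τ := by
      simpa using (((hasDerivAt_id τ).ofReal_comp).const_mul Complex.I).cexp
    exact h1.mul (((hA τ).div (hDt τ x).ofReal_comp (hDc τ x)).const_add 1)
  refine ⟨_, dt.hasDerivWithinAt, ?_⟩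
  have e2 : iteratedDeriv 2 (fun x => Complex.exp (Complex.I * τ) * (1 + A τ / (D τ x : ℂ))) x =
      Complex.exp (Complex.I * τ) * ((2 * A τ * D₁ τ x ^ 2 - A τ * D τ x * D₂ τ x) /
        (D τ x : ℂ) ^ 3) := by
    rw [iteratedDeriv_succ, iteratedDeriv_one, funext fun x => (d1 x).deriv, (d2 x).deriv]
  have e3 : ((‖Complex.exp (Complex.I * τ) * (1 + A τ / (D τ x : ℂ))‖ ^ 2 : ℝ) : ℂ) =
      (1 + A τ / (D τ x : ℂ)) * (1 + conj (A τ) / (D τ x : ℂ)) := by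
    rw [norm_mul, mul_comm Complex.I, Complex.norm_exp_ofReal_mul_I, one_mul, Complex.ofReal_pow,
      ← Complex.mul_conj']
    simp
  rw [e2, e3]
  have h := heq τ x
  have hne := hDc τ x
  generalize conj (A τ) = B at *
  push_cast
  field_simp
  linear_combination 2 * h + 2 * (D τ x : ℂ) ^ 2 * (D τ x + A τ) * Complex.I_sq

lemma solvesNLS_peregrine : SolvesNLS 1 (-(1 / 2)) (-1) univ peregrine := by
  have h := solvesNLS_one_add_div (A := fun τ => -4 * (1 + 2 * Complex.I * τ))
    (A' := fun _ => -4 * (2 * Complex.I)) (D := fun τ x => 1 + 4 * x ^ 2 + 4 * τ ^ 2)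
    (Dt := fun τ _ => 8 * τ) (D₁ := fun _ x => 8 * x) (D₂ := fun _ _ => 8)
    (fun τ => by
      have := (((hasDerivAt_id τ).ofReal_comp.const_mul (2 * Complex.I)).const_add 1).const_mul
        (-4 : ℂ)
      simpa using this)
    (fun τ x => by
      have := (((hasDerivAt_id τ).pow 2).const_mul 4).const_add (1 + 4 * x ^ 2)
      refine this.congr_deriv ?_
      simp; ring)
    (fun τ x => by
      have := ((((hasDerivAt_id x).pow 2).const_mul 4).const_add 1).add_const (4 * τ ^ 2)
      refine this.congr_deriv ?_
      simp; ring)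
    (fun τ x => by simpa using (hasDerivAt_id x).const_mul 8)
    (fun τ => by fun_prop) (fun τ x => by positivity)
    (fun τ x => by
      simp only [map_mul, map_add, map_one, map_neg, Complex.conj_ofReal, Complex.conj_I,
        map_ofNat]
      push_cast
      have hI := Complex.I_sq
      grind)
  convert h using 1
  ext τ x
  rw [peregrine]
  push_cast
  ring

/-- The rational profile with j = 0, G = -4, H = -8τ and D = 1 + 4ξ² + 4τ². -/
lemma isSymbol_peregrine : IsSymbol (fun x => 1 + |x|) (-1) fun τ x =>
    peregrine τ x - Complex.exp (Complex.I * τ) := by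
  let D : Polynomial (Polynomial ℝ) :=
    Polynomial.C (Polynomial.C 4) * Polynomial.X ^ 2 +
      Polynomial.C (1 + Polynomial.C 4 * Polynomial.X ^ 2)
  have hev : ∀ τ x, D.evalEval τ x = 1 + 4 * x ^ 2 + 4 * τ ^ 2 := fun τ x => by
    simp [D, Polynomial.evalEval]; ring
  have h4 : (Polynomial.C 4 : Polynomial ℝ) ≠ 0 := by simp
  have hdeg : D.degree = 2 := by
    have := Polynomial.degree_quadratic (a := (Polynomial.C 4 : Polynomial ℝ)) (b := 0)
      (c := 1 + Polynomial.C 4 * Polynomial.X ^ 2) h4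
    simpa [D] using this
  have hlead : D.leadingCoeff = Polynomial.C 4 := by
    have := Polynomial.leadingCoeff_quadratic (a := (Polynomial.C 4 : Polynomial ℝ)) (b := 0)
      (c := 1 + Polynomial.C 4 * Polynomial.X ^ 2) h4
    simpa [D] using this
  have hC : ∀ q : Polynomial ℂ, (Polynomial.C q).degree < D.degree := fun q => by
    rw [hdeg]
    exact Polynomial.degree_C_le.trans_lt (by norm_num)
  have h := isSymbol_rationalProfile (j := 0) (G := Polynomial.C (Polynomial.C (-4)))
    (H := Polynomial.C (Polynomial.C (-8) * Polynomial.X)) (D := D)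
    (fun τ x => by rw [hev]; positivity) (fun τ => by rw [hlead]; simp) (hC _) (hC _)
  convert h using 3 with τ x
  · rw [peregrine, rationalProfile, hev, Polynomial.evalEval_C, Polynomial.evalEval_C]
    simp only [Polynomial.eval_C, Polynomial.eval_mul, Polynomial.eval_X]
    push_cast
    ring

/-! ### Hyperbolic weights and the Kuznetsov–Ma soliton -/

lemma isSymbol_cexp (m : ℝ) : IsSymbol (fun x => Real.cosh (m * x)) 1 fun _ x =>
    Complex.exp ((m * x : ℝ) : ℂ) := by
  have hd : ∀ x : ℝ, HasDerivAt (fun x : ℝ => Complex.exp ((m * x : ℝ) : ℂ))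
      (m * Complex.exp ((m * x : ℝ) : ℂ)) x := fun x => by
    have := (((hasDerivAt_id x).const_mul m).ofReal_comp).cexp
    refine this.congr_deriv ?_
    rw [mul_one, mul_comm]
    rfl
  have e : ∀ n, iteratedDeriv n (fun x : ℝ => Complex.exp ((m * x : ℝ) : ℂ)) =
      fun x => (m : ℂ) ^ n * Complex.exp ((m * x : ℝ) : ℂ) := fun n => by
    induction n with
    | zero => simp
    | succ n ih =>
      ext x
      rw [iteratedDeriv_succ, ih, ((hd x).const_mul _).deriv]
      ring
  refine ⟨fun _ => Complex.contDiff_exp.comp (Complex.ofRealCLM.contDiff.comp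
    (contDiff_const.mul contDiff_id)) |>.of_le le_top, fun n x => continuous_const, fun n K =>
    ⟨2 * |m| ^ n, by positivity, fun τ _ x => ?_⟩⟩
  rw [e, norm_mul, norm_pow, Complex.norm_real, Real.norm_eq_abs, zpow_one, Complex.norm_exp,
    Complex.ofReal_re, Real.cosh_eq]
  have h1 := (Real.exp_pos (m * x)).le
  have h2 := (Real.exp_pos (-(m * x))).le
  have h3 : 0 ≤ |m| ^ n := by positivity
  nlinarith [mul_nonneg h3 h2]

lemma isSymbol_cosh (m : ℝ) : IsSymbol (fun x => Real.cosh (m * x)) 1 fun _ x =>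
    ((Real.cosh (m * x) : ℝ) : ℂ) := by
  have hw : ∀ x, 1 ≤ Real.cosh (m * x) := fun x => Real.one_le_cosh _
  have h1 := isSymbol_cexp m
  have h2 := isSymbol_cexp (-m)
  have e : (fun x => Real.cosh (-m * x)) = fun x => Real.cosh (m * x) := by
    ext x; rw [neg_mul, Real.cosh_neg]
  rw [e] at h2
  have h3 := (IsSymbol.of_continuous (w := fun x => Real.cosh (m * x))
    (continuous_const (y := (1 / 2 : ℂ)))).mul hw (h1.add h2)
  rw [zero_add] at h3
  convert h3 using 3 with τ x
  rw [Real.cosh_eq]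
  push_cast
  rw [neg_mul]
  ring

/-- Decay measured by the hyperbolic weight is stronger than the order -1 in 1+|x| that Sobolev
membership requires. -/
lemma one_add_abs_le_cosh {m : ℝ} (hm : 0 < m) (x : ℝ) :
    1 + |x| ≤ 2 * (1 + m⁻¹) * Real.cosh (m * x) := by
  have h1 : 1 + m * |x| ≤ 2 * Real.cosh (m * x) := by
    rw [← Real.cosh_abs, abs_mul, abs_of_pos hm, Real.cosh_eq]
    have := Real.add_one_le_exp (m * |x|)
    have := Real.exp_pos (-(m * |x|))
    linarith
  have h2 : m⁻¹ * (m * |x|) = |x| := by field_simp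
  have h3 : 0 ≤ m⁻¹ := by positivity
  have h4 : 0 ≤ m * |x| := by positivity
  calc 1 + |x| ≤ (1 + m⁻¹) * (1 + m * |x|) := by nlinarith
    _ ≤ (1 + m⁻¹) * (2 * Real.cosh (m * x)) := by gcongr
    _ = _ := by ring

section

variable {a : ℝ} (ha : 1 / 2 < a)

/-- Imaginary arguments exchange circular and hyperbolic functions: the soliton is periodic in τ and
localized in x, and its denominator is real. -/
lemma kuznetsovMa_eq (a τ x : ℝ) : kuznetsovMa a τ x = Complex.exp (Complex.I * τ) * (1 +
    (((2 * (1 - 2 * a) * Real.cos (√(8 * a * (2 * a - 1)) * τ) : ℝ) : ℂ) -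
      Complex.I * ((√(8 * a * (2 * a - 1)) * Real.sin (√(8 * a * (2 * a - 1)) * τ) : ℝ) : ℂ)) /
    ((√(2 * a) * Real.cosh (2 * √(2 * a - 1) * x) - Real.cos (√(8 * a * (2 * a - 1)) * τ) : ℝ) :
      ℂ)) := by
  have h1 : Complex.I * (√(8 * a * (2 * a - 1)) : ℝ) * τ =
      ((√(8 * a * (2 * a - 1)) : ℝ) * τ) * Complex.I := by ring
  have h2 : 2 * Complex.I * (√(2 * a - 1) : ℝ) * x = (2 * (√(2 * a - 1) : ℝ) * x) * Complex.I := by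
    ring
  simp only [kuznetsovMa]
  rw [h1, h2, Complex.cosh_mul_I, Complex.sinh_mul_I, Complex.cos_mul_I]
  push_cast
  congr 3
  linear_combination ((√(8 * a * (2 * a - 1)) : ℝ) : ℂ) *
    Complex.sin ((√(8 * a * (2 * a - 1)) : ℝ) * τ) * Complex.I * Complex.I_sq

/-- From cos ≤ 1 ≤ cosh. For a > 1/2 the factor √(2a) - 1 is positive, so the denominator has no
zeros and grows like the weight. -/
lemma kuznetsovMa_denom_ge (a θ y : ℝ) :
    (√(2 * a) - 1) * Real.cosh y ≤ √(2 * a) * Real.cosh y - Real.cos θ := by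
  have := Real.one_le_cosh y
  have := Real.cos_le_one θ
  linarith

include ha

lemma one_lt_sqrt_two_mul : 1 < √(2 * a) := by
  rw [Real.lt_sqrt zero_le_one]; linarith

lemma kuznetsovMa_denom_pos (θ y : ℝ) : 0 < √(2 * a) * Real.cosh y - Real.cos θ :=
  (mul_pos (sub_pos.2 (one_lt_sqrt_two_mul ha)) (Real.cosh_pos y)).trans_le
    (kuznetsovMa_denom_ge a θ y)

lemma solvesNLS_kuznetsovMa : SolvesNLS 1 (-(1 / 2)) (-1) univ (kuznetsovMa a) := by
  obtain ⟨p, hp⟩ : ∃ p, p = √(2 * a) := ⟨_, rfl⟩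
  obtain ⟨μ, hμ⟩ : ∃ μ, μ = √(2 * a - 1) := ⟨_, rfl⟩
  obtain ⟨ρ, hρ⟩ : ∃ ρ, ρ = √(8 * a * (2 * a - 1)) := ⟨_, rfl⟩
  have hp2 : p ^ 2 = 2 * a := by rw [hp, Real.sq_sqrt (by linarith)]
  have hμ2 : μ ^ 2 = 2 * a - 1 := by rw [hμ, Real.sq_sqrt (by linarith)]
  have hρ2 : ρ ^ 2 = 8 * a * (2 * a - 1) := by
    rw [hρ, Real.sq_sqrt (mul_nonneg (by linarith) (by linarith))]
  have hc : ∀ ρ τ : ℝ, HasDerivAt (fun τ => Real.cos (ρ * τ)) (-(ρ * Real.sin (ρ * τ))) τ :=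
    fun ρ τ => by
      have := ((hasDerivAt_id τ).const_mul ρ).cos
      refine this.congr_deriv ?_
      simp; ring
  have hs : ∀ ρ τ : ℝ, HasDerivAt (fun τ => Real.sin (ρ * τ)) (ρ * Real.cos (ρ * τ)) τ :=
    fun ρ τ => by
      have := ((hasDerivAt_id τ).const_mul ρ).sin
      refine this.congr_deriv ?_
      simp; ring
  have hch : ∀ m x : ℝ, HasDerivAt (fun x => Real.cosh (m * x)) (m * Real.sinh (m * x)) x :=
    fun m x => by
      have := ((hasDerivAt_id x).const_mul m).cosh
      refine this.congr_deriv ?_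
      simp; ring
  have hsh : ∀ m x : ℝ, HasDerivAt (fun x => Real.sinh (m * x)) (m * Real.cosh (m * x)) x :=
    fun m x => by
      have := ((hasDerivAt_id x).const_mul m).sinh
      refine this.congr_deriv ?_
      simp; ring
  have h := solvesNLS_one_add_div
    (A := fun τ => ((2 * (1 - 2 * a) * Real.cos (ρ * τ) : ℝ) : ℂ) -
      Complex.I * ((ρ * Real.sin (ρ * τ) : ℝ) : ℂ))
    (A' := fun τ => ((2 * (1 - 2 * a) * -(ρ * Real.sin (ρ * τ)) : ℝ) : ℂ) -
      Complex.I * ((ρ * (ρ * Real.cos (ρ * τ)) : ℝ) : ℂ))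
    (D := fun τ x => p * Real.cosh (2 * μ * x) - Real.cos (ρ * τ))
    (Dt := fun τ _ => -(-(ρ * Real.sin (ρ * τ))))
    (D₁ := fun _ x => p * (2 * μ * Real.sinh (2 * μ * x)))
    (D₂ := fun _ x => p * (2 * μ * (2 * μ * Real.cosh (2 * μ * x))))
    (fun τ => (((hc ρ τ).const_mul _).ofReal_comp).sub
      ((((hs ρ τ).const_mul ρ).ofReal_comp).const_mul Complex.I))
    (fun τ x => (hc ρ τ).const_sub _)
    (fun τ x => ((hch (2 * μ) x).const_mul p).sub_const _)
    (fun τ x => ((hsh (2 * μ) x).const_mul (2 * μ)).const_mul p)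
    (fun τ => ((contDiff_const.mul (Real.contDiff_cosh.comp
      (contDiff_const.mul contDiff_id))).sub contDiff_const).of_le le_top)
    (fun τ x => by rw [hp]; exact (kuznetsovMa_denom_pos ha _ _).ne')
    -- After the derivatives are inserted, a polynomial identity remains in sin, cos, sinh, cosh,
    -- modulo the two Pythagorean relations and the values of p², μ² and ρ².
    (fun τ x => by
      have h1 := Real.sin_sq_add_cos_sq (ρ * τ)
      have h2 := Real.cosh_sq (2 * μ * x)
      simp only [map_mul, map_sub, Complex.conj_ofReal, Complex.conj_I]
      generalize Real.sin (ρ * τ) = S at *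
      generalize Real.cos (ρ * τ) = C at *
      generalize Real.cosh (2 * μ * x) = c at *
      generalize Real.sinh (2 * μ * x) = s at *
      have g1 : (S : ℂ) ^ 2 = 1 - (C : ℂ) ^ 2 := by
        have : S ^ 2 = 1 - C ^ 2 := by linarith
        exact_mod_cast this
      have g2 : (s : ℂ) ^ 2 = (c : ℂ) ^ 2 - 1 := by
        have : s ^ 2 = c ^ 2 - 1 := by linarith
        exact_mod_cast this
      have g3 : (p : ℂ) ^ 2 = 2 * a := by exact_mod_cast hp2
      have g4 : (μ : ℂ) ^ 2 = 2 * a - 1 := by exact_mod_cast hμ2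
      have g5 : (ρ : ℂ) ^ 2 = 8 * a * (2 * a - 1) := by exact_mod_cast hρ2
      have hI := Complex.I_sq
      push_cast
      clear hp hμ hρ hp2 hμ2 hρ2 hc hs hch hsh h1 h2
      grind)
  convert h using 1
  ext τ x
  rw [kuznetsovMa_eq, ← hp, ← hμ, ← hρ]

/-- The weight is the hyperbolic cosine of the denominator itself: the denominator has order one
with respect to it, and the numerator depends on τ alone. -/
lemma isSymbol_kuznetsovMa : IsSymbol (fun x => Real.cosh (2 * √(2 * a - 1) * x)) (-1) fun τ x =>
    kuznetsovMa a τ x - Complex.exp (Complex.I * τ) := by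
  set m := 2 * √(2 * a - 1)
  have hw : ∀ x, 1 ≤ Real.cosh (m * x) := fun x => Real.one_le_cosh _
  have hcos : Continuous fun τ : ℝ => -((Real.cos (√(8 * a * (2 * a - 1)) * τ) : ℝ) : ℂ) := by
    fun_prop
  have h1 := ((IsSymbol.of_continuous (w := fun x => Real.cosh (m * x))
    (continuous_const (y := ((√(2 * a) : ℝ) : ℂ)))).mul hw (isSymbol_cosh m))
  rw [zero_add] at h1
  have h2 := (h1.add ((IsSymbol.of_continuous hcos).mono hw zero_le_one)).inv hw fun K =>
    ⟨√(2 * a) - 1, sub_pos.2 (one_lt_sqrt_two_mul ha), fun τ _ x => by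
      rw [← Complex.ofReal_mul, ← Complex.ofReal_neg, ← Complex.ofReal_add, Complex.norm_real,
        zpow_one, ← sub_eq_add_neg]
      exact (kuznetsovMa_denom_ge a _ _).trans (Real.le_norm_self _)⟩
  have h3 := (IsSymbol.of_continuous (w := fun x => Real.cosh (m * x))
    (show Continuous fun τ : ℝ => Complex.exp (Complex.I * τ) *
      (((2 * (1 - 2 * a) * Real.cos (√(8 * a * (2 * a - 1)) * τ) : ℝ) : ℂ) -
      Complex.I * ((√(8 * a * (2 * a - 1)) * Real.sin (√(8 * a * (2 * a - 1)) * τ) : ℝ) : ℂ))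
      by fun_prop)).mul hw h2
  rw [zero_add] at h3
  convert h3 using 3 with τ x
  rw [kuznetsovMa_eq, show 2 * √(2 * a - 1) * x = m * x from rfl]
  push_cast
  ring

end

end

theorem theorem1 (k₀ ω₀ s T₀ : ℝ) (hk₀ : 0 < k₀) (hω₀ : ω₀ ^ 2 = k₀ ^ 2 + 1)
    (hs : 1 / 2 < s) (hT₀ : 0 < T₀) :
    (∀ (Av : ℝ → ℂ) (Aw : ℝ → ℝ → ℂ),
      IsSplitNLSSolution k₀ ω₀ (s + 4) T₀ Av Aw →
        NLSApproximationValid k₀ ω₀ s T₀ Av Aw) ∧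
    RescalingsAreSplitNLSSolutions k₀ ω₀ (s + 4) T₀
      (fun τ => Complex.exp (Complex.I * τ)) peregrine ∧
    (∀ a : ℝ, 1 / 2 < a →
      RescalingsAreSplitNLSSolutions k₀ ω₀ (s + 4) T₀
        (fun τ => Complex.exp (Complex.I * τ)) (kuznetsovMa a)) ∧
    (∀ (j : ℕ) (G H : Polynomial (Polynomial ℂ)) (D : Polynomial (Polynomial ℝ)),
      IsHigherOrderPeregrine j G H D →
        RescalingsAreSplitNLSSolutions k₀ ω₀ (s + 4) T₀
          (fun τ => (-1) ^ j * Complex.exp (Complex.I * τ)) (rationalProfile j G H D)) := by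
  refine ⟨fun Av Aw h => nlsApproximationValid hk₀ hω₀ hs hT₀ h, ?_, fun a ha => ?_,
    fun j G H D h => h.rescalings hω₀ (s + 4) T₀⟩
  · exact rescalingsAreSplitNLSSolutions hω₀ (s + 4) T₀ (by fun_prop) solvesNLS_peregrine
      one_le_one_add_abs (fun x => (one_mul (1 + |x|)).ge) isSymbol_peregrine
  · have hm : 0 < 2 * √(2 * a - 1) := mul_pos two_pos (Real.sqrt_pos.2 (by linarith))
    exact rescalingsAreSplitNLSSolutions hω₀ (s + 4) T₀ (by fun_prop) (solvesNLS_kuznetsovMa ha)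
      (fun x => Real.one_le_cosh _) (one_add_abs_le_cosh hm) (isSymbol_kuznetsovMa ha)
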